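/- Let $k,j_1,j_2\in\mathbb C$ with $k\neq-\tfrac32$, put $\tilde k=-3-k$, and let $\alpha_+,\tilde\alpha_+\in\mathbb C$ satisfy $\alpha_+^2=2k+3$, $\tilde\alpha_+^2=2\tilde k+3$ (so $\tilde\alpha_+=\pm i\alpha_+$). All fields have integer modes. **Modules.** Let $\beta,\gamma$ (bosonic, weights $1,0$), $\psi^+,\psi$ (fermionic, weights $1,0$) and $\phi$ be free fields with $[\beta_m,\gamma_n]=\{\psi^+_m,\psi_n\}=\delta_{m+n,0}$, $i\partial\phi=\sum_n\phi_nz^{-n-1}$, $[\phi_m,\phi_n]=m\delta_{m+n,0}$. The Wakimoto module $W(j_1,k)$ over $\widehat{osp(1,2)}$ is the Fock space whose vacuum is annihilated by $\beta_n,\psi^+_n$ ($n\ge0$) and $\gamma_n,\psi_n,\phi_n$ ($n>0$), with $\phi_0=2j_1/\alpha_+$, and with currents $$J^+=-\beta,\quad j^+=\psi^+-\beta\psi,\quad J^3=-\beta\gamma+\tfrac{i\alpha_+}2\partial\phi-\tfrac12\psi\psi^+,$$ $$j^-=\gamma(\psi^+-\beta\psi)+i\alpha_+\psi\partial\phi+(2k+1)\partial\psi,$$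 $$J^-=\beta\gamma^2-i\alpha_+\gamma\partial\phi+\gamma\psi\psi^+-k\partial\gamma+(k+1)\psi\partial\psi .$$ The dual Wakimoto module $W^*(j_2,\tilde k)$ is the Fock space of a second such set of fields $\tilde\beta,\tilde\gamma,\tilde\psi^+,\tilde\psi,\tilde\phi$, whose vacuum is annihilated by $\tilde\gamma_n,\tilde\psi_n$ ($n\ge0$) and $\tilde\beta_n,\tilde\psi^+_n,\tilde\phi_n$ ($n>0$), with $\tilde\phi_0=-(2j_2+1)/\tilde\alpha_+$ (equivalently $\tilde J^3_0=j_2$ on the vacuum), and with currents $$\tilde J^-=\tilde\beta,\quad \tilde j^-=\tilde\psi^+-\tilde\beta\tilde\psi,\quad \tilde J^3=\tilde\beta\tilde\gamma-\tfrac{i\tilde\alpha_+}2\partial\tilde\phi+\tfrac12\tilde\psi\tilde\psi^+,$$ $$\tilde j^+=-\tilde\gamma(\tilde\psi^+-\tilde\beta\tilde\psi)-i\tilde\alpha_+\tilde\psi\partial\tilde\phi-(2\tilde k+1)\partial\tilde\psi,$$ $$\tilde J^+=-\tilde\beta\tilde\gamma^2+i\tilde\alpha_+\tilde\gamma\partial\tilde\phi-\tilde\gamma\tilde\psi\tilde\psi^++\tilde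 k\partial\tilde\gamma-(\tilde k+1)\tilde\psi\partial\tilde\psi .$$ Products are normally ordered with $\beta_n,\psi^+_n$ ($n\ge0$) and $\gamma_n,\psi_n$ ($n>0$) as annihilators, in both modules. **Ghosts.** For each basis element $\alpha\in\{+,\tfrac12,3,-\tfrac12,-\}$ of $osp(1,2)$ (with $J^{\pm1/2}=j^\pm$) there is a pair $b_\alpha,c^\alpha$ of weights $1,0$, fermionic for $\alpha$ even and bosonic for $\alpha$ odd, with $[b_{\alpha,m},c^\beta_n\}=\delta_\alpha^\beta\delta_{m+n,0}$. The vacuum $|gh\rangle_0$ is annihilated by $b_{\alpha,n}$ ($n\ge0$) and $c^\alpha_n$ ($n>0$); the vacuum $|gh\rangle_{0,1/2}$ is annihilated by all positive modes, by $c^+_0,c^{1/2}_0$ and by $b_{3,0},b_{-1/2,0},b_{-,0}$. The ghost number is the eigenvalue of the zero mode of $\sum_\alpha{:}c^\alpha b_\alpha{:}$, with $b_{\alpha,n}$ ($n\ge 0$) and $c^\alpha_n$ ($n>0$) as annihilators; each $c$ counts $1$, each $b$ counts $-1$, and both vacua have ghost number $0$. **Complex.** With $J_{gh}^\alpha=f^{\alpha\beta}{}_\gamma{:}c^\gamma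 b_\beta{:}$, where $[J^\alpha,J^\beta\}=f^{\alpha\beta}{}_\gamma J^\gamma$ for the zero modes, and $h_{33}=1$, $h_{+-}=h_{-+}=\tfrac12$, $h_{-\frac12,\frac12}=-h_{\frac12,-\frac12}=\tfrac14$, let $Q=\oint{:}(J^\alpha+\tilde J^\alpha+\tfrac12J^\alpha_{gh})c^\beta{:}\,h_{\alpha\beta}$, and let $$\hat Q_0=\sum_n\Big(-\tfrac12c^-_n\beta_{-n}+\tfrac12c^+_n\tilde\beta_{-n}+\tfrac14c^{1/2}_n\tilde\psi^+_{-n}-\tfrac14c^{-1/2}_n\psi^+_{-n}\Big)+\tfrac12\sum_{n\ne0}c^3_n(\alpha_+\phi_{-n}-\tilde\alpha_+\tilde\phi_{-n})$$ be its part quadratic in the free fields. Let $L_0$ be the zero mode of $T=\beta\partial\gamma-\psi^+\partial\psi-\tfrac12(\partial\phi)^2-\tfrac{i}{2\alpha_+}\partial^2\phi$, plus the same expression in the tilded fields with $\tilde\alpha_+$, plus $\partial c^\alpha b_\alpha$. The relative complex consists of the $w$ in $W(j_1,k)\otimes W^*(j_2,\tilde k)\otimes gh$ with $J_0^{tot,3}w=L_0w=b_{3,0}w=0$,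 where $J^{tot,3}=J^3+\tilde J^3+J_{gh}^3$; it is graded by the ghost number. Let $H^{\infty/2+n}_{rel}$ be its cohomology for $Q$, and let $|j_1,j_2\rangle$ be the tensor product of the two Fock vacua and the ghost vacuum. **Theorem.** (i) For the ghost vacuum $|gh\rangle_0$ and every $n\in\mathbb Z$, the space $H^{\infty/2+n+1}_{rel}(W(j_1,k)\otimes W^*(j_2,-3-k))$ is one-dimensional if $n=0$ and $j_1+j_2+\tfrac12=0$, and it is zero otherwise. If $j_1+j_2+\tfrac12=0$, then $\tilde\psi^+_0c^+_0|j_1,j_2\rangle$ is a $\hat Q_0$-cocycle whose class is a basis of the degree-one cohomology of the relative complex for $\hat Q_0$, and the cocycle $$\tilde\psi^+_0c^+_0|j_1,j_2\rangle+2j_1\,\psi_0c^+_0|j_1,j_2\rangle+\tfrac12c^{1/2}_0|j_1,j_2\rangle$$ with this leading term represents a basis of $H^{\infty/2+1}_{rel}$. (ii) For the ghost vacuum $|gh\rangle_{0,1/2}$ and every $n\in\mathbb Z$, the space $H^{\infty/2+n}_{rel}(W(j_1,k)\otimes W^*(j_2,-3-k))$ is one-dimensional if $n=0$ and $j_1+j_2+\tfrac12=0$,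 and it is zero otherwise. If $j_1+j_2+\tfrac12=0$, then $|j_1,j_2\rangle$ is a cocycle for $\hat Q_0$ and for $Q$, and its class is a basis of the degree-zero cohomology of the relative complex for either of them. -/

import Mathlib

/-! The relative BRST complex of the tensor product of a Wakimoto module, a dual Wakimoto module
and the ghost system for the affine Lie superalgebra of `osp(1,2)`, with integer modes. -/

noncomputable section

namespace AffineOsp

open scoped TensorProduct

/-! ### Fields on a vector space and normally ordered products -/

section Fields

variable (V : Type*) [AddCommGroup V] [Module ℂ V]

/-- Fields on `V`: families of modes `A n`, `n ∈ ℤ`, of operators on `V` such that every vector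
is annihilated by `A n` for all sufficiently large `n`. A field of conformal weight `h` stands for
the series `A(z) = ∑ A n z ^ (- n - h)`. -/
def fields : Submodule ℂ (ℤ → Module.End ℂ V) where
  carrier := {A | ∀ v, ∃ N : ℤ, ∀ n, N ≤ n → A n v = 0}
  zero_mem' := fun _ => ⟨0, fun _ _ => rfl⟩
  add_mem' := by
    intro A B hA hB v
    obtain ⟨N, hN⟩ := hA v
    obtain ⟨M, hM⟩ := hB v
    refine ⟨max N M, fun n hn => ?_⟩
    simp [hN n (le_trans (le_max_left _ _) hn), hM n (le_trans (le_max_right _ _) hn)]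
  smul_mem' := by
    intro c A hA v
    obtain ⟨N, hN⟩ := hA v
    exact ⟨N, fun n hn => by simp [hN n hn]⟩

variable {V}

/-- The `n`-th mode of a field. -/
def mode (A : fields V) (n : ℤ) : Module.End ℂ V := A.1 n

lemma mode_eventually_zero (A : fields V) (v : V) : ∃ N : ℤ, ∀ n, N ≤ n → mode A n v = 0 := A.2 v

/-- The derivative `∂A` of a field `A` of weight `h`. -/
def deriv (h : ℤ) (A : fields V) : fields V :=
  ⟨fun n => (-((n : ℂ) + h)) • mode A n, fun v => by
    obtain ⟨N, hN⟩ := A.2 v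
    exact ⟨N, fun n hn => by simp [mode, hN n hn]⟩⟩

/-- The summand `:A m B (n-m):` of the normally ordered product, applied to `v`: the modes `A m`
with `m ≤ -h` are creation modes and stand on the left, the other ones stand on the right. The
number `e` is the sign of the exchange of `A` and `B`. -/
def nopTerm (h : ℤ) (e : ℂ) (A B : fields V) (n m : ℤ) (v : V) : V :=
  if m ≤ -h then mode A m (mode B (n - m) v) else e • mode B (n - m) (mode A m v)

lemma nopTerm_finite (h : ℤ) (e : ℂ) (A B : fields V) (n : ℤ) (v : V) :
    (Function.support fun m => nopTerm h e A B n m v).Finite := by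
  obtain ⟨N, hN⟩ := mode_eventually_zero A v
  obtain ⟨M, hM⟩ := mode_eventually_zero B v
  refine (Set.finite_Icc (min (n - M) (-h)) (max N (-h))).subset fun m hm => ?_
  by_contra hc
  apply hm
  simp only [Set.mem_Icc, not_and_or, not_le] at hc
  simp only [nopTerm]
  split_ifs with hmh
  · rw [hM (n - m) (by omega), map_zero]
  · rw [hN m (by omega), map_zero, smul_zero]

/-- The `n`-th mode of the normally ordered product: the sum of the `:A m B (n-m):` over all
integers `m`, of which only finitely many do not vanish on a given vector. -/
def nopMode (h : ℤ) (e : ℂ) (A B : fields V) (n : ℤ) : Module.End ℂ V where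
  toFun v := ∑ᶠ m : ℤ, nopTerm h e A B n m v
  map_add' v w := by
    rw [← finsum_add_distrib (nopTerm_finite h e A B n v) (nopTerm_finite h e A B n w)]
    refine finsum_congr fun m => ?_
    simp only [nopTerm]
    split_ifs
    · rw [map_add, map_add]
    · rw [map_add, map_add, smul_add]
  map_smul' c v := by
    rw [RingHom.id_apply, smul_finsum]
    refine finsum_congr fun m => ?_
    simp only [nopTerm]
    split_ifs
    · rw [map_smul, map_smul]
    · rw [map_smul, map_smul, smul_comm]

lemma nopMode_mem (h : ℤ) (e : ℂ) (A B : fields V) : nopMode h e A B ∈ fields V := by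
  intro v
  obtain ⟨N, hN⟩ := mode_eventually_zero A v
  obtain ⟨M, hM⟩ := mode_eventually_zero B v
  choose L hL using fun m : ℤ => mode_eventually_zero B (mode A m v)
  obtain ⟨K, hK⟩ : ∃ K : ℤ, ∀ m ∈ Finset.Icc (-h) N, L m + m ≤ K := by
    obtain ⟨K, hK⟩ := ((Finset.Icc (-h) N).image fun m => L m + m).bddAbove
    exact ⟨K, fun m hm => hK (Finset.mem_coe.2 (Finset.mem_image_of_mem _ hm))⟩
  refine ⟨max (M - h) K, fun n hn => ?_⟩
  change ∑ᶠ m : ℤ, nopTerm h e A B n m v = 0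
  rw [max_le_iff] at hn
  refine finsum_eq_zero_of_forall_eq_zero fun m => ?_
  simp only [nopTerm]
  split_ifs with hmh
  · rw [hM (n - m) (by omega), map_zero]
  · by_cases hmN : N ≤ m
    · rw [hN m hmN, map_zero, smul_zero]
    · have := hK m (Finset.mem_Icc.2 ⟨by omega, by omega⟩)
      rw [hL m (n - m) (by omega), smul_zero]

/-- The normally ordered product `:AB:` of a field `A` of weight `h` and a field `B`, at least one
of which is bosonic. -/
def nop (h : ℤ) (A B : fields V) : fields V := ⟨nopMode h 1 A B, nopMode_mem h 1 A B⟩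

/-- The normally ordered product `:AB:` of two fermionic fields, `A` being of weight `h`. -/
def nopF (h : ℤ) (A B : fields V) : fields V := ⟨nopMode h (-1) A B, nopMode_mem h (-1) A B⟩

end Fields

/-! ### The Lie superalgebra `osp(1,2)` -/

/-- Labels of the basis `J^+, j^+, J^3, j^-, J^-` of `osp(1,2)`; the ghosts carry the same labels
`+, 1/2, 3, -1/2, -`. -/
inductive Gen
  | plus | half | three | mhalf | minus
  deriving DecidableEq

open Gen

instance : Fintype Gen := ⟨{plus, half, three, mhalf, minus}, fun x => by cases x <;> decide⟩

/-- The structure constants: `[J^x, J^y} = ∑ z, f x y z J^z`. -/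
def f : Gen → Gen → Gen → ℂ
  | plus, minus, three => 2
  | minus, plus, three => -2
  | three, plus, plus => 1
  | plus, three, plus => -1
  | three, minus, minus => -1
  | minus, three, minus => 1
  | three, half, half => 1 / 2
  | half, three, half => -(1 / 2)
  | three, mhalf, mhalf => -(1 / 2)
  | mhalf, three, mhalf => 1 / 2
  | plus, mhalf, half => -1
  | mhalf, plus, half => 1
  | minus, half, mhalf => -1
  | half, minus, mhalf => 1
  | half, mhalf, three => 2
  | mhalf, half, three => 2
  | half, half, plus => 2
  | mhalf, mhalf, minus => -2
  | _, _, _ => 0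

/-- The inverse of the invariant form, as it enters the Sugawara tensor
`(J^3 J^3 + J^+ J^- / 2 + J^- J^+ / 2 - j^+ j^- / 4 + j^- j^+ / 4) / (k + 3/2)`. -/
def hInv : Gen → Gen → ℂ
  | three, three => 1
  | plus, minus => 1 / 2
  | minus, plus => 1 / 2
  | half, mhalf => -(1 / 4)
  | mhalf, half => 1 / 4
  | _, _ => 0

/-- Whether a generator is odd. -/
def isOdd : Gen → Bool
  | half => true
  | mhalf => true
  | _ => false

/-! ### The Wakimoto realizations in free fields

In both of them `phi` stands for the current `i ∂φ`, so that `[phi_m, phi_n] = m δ_{m+n,0}`, and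
`[beta_m, gamma_n] = δ_{m+n,0}`, `{psiP_m, psi_n} = δ_{m+n,0}`. The weights of
`beta, gamma, psiP, psi, phi` are `1, 0, 1, 0, 1`. -/

section Realizations

variable {V : Type*} [AddCommGroup V] [Module ℂ V]

/-- The currents of level `k` on the Wakimoto module, with `a ^ 2 = 2 k + 3`. -/
def wakimotoCurrent (k a : ℂ) (beta gamma psiP psi phi : fields V) : Gen → fields V
  | plus => -beta
  | half => psiP - nop 1 beta psi
  | three => -nop 1 beta gamma + (a / 2) • phi - (1 / 2 : ℂ) • nopF 0 psi psiP
  | mhalf => nop 0 gamma (psiP - nop 1 beta psi) + a • nop 0 psi phi + (2 * k + 1) • deriv 0 psi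
  | minus => nop 1 beta (nop 0 gamma gamma) - a • nop 0 gamma phi + nop 0 gamma (nopF 0 psi psiP)
      - k • deriv 0 gamma + (k + 1) • nopF 0 psi (deriv 0 psi)

/-- The currents of level `k` on the dual Wakimoto module, with `a ^ 2 = 2 k + 3`. -/
def dualWakimotoCurrent (k a : ℂ) (beta gamma psiP psi phi : fields V) : Gen → fields V
  | plus => -nop 1 beta (nop 0 gamma gamma) + a • nop 0 gamma phi
      - nop 0 gamma (nopF 0 psi psiP) + k • deriv 0 gamma - (k + 1) • nopF 0 psi (deriv 0 psi)
  | half => -nop 0 gamma (psiP - nop 1 beta psi) - a • nop 0 psi phi - (2 * k + 1) • deriv 0 psi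
  | three => nop 1 beta gamma - (a / 2) • phi + (1 / 2 : ℂ) • nopF 0 psi psiP
  | mhalf => psiP - nop 1 beta psi
  | minus => beta

/-- The stress-energy tensor (of weight `2`) of either realization:
`β ∂γ - ψ⁺ ∂ψ - (∂φ)² / 2 - i ∂²φ / (2 a)`. -/
def stressTensor (a : ℂ) (beta gamma psiP psi phi : fields V) : fields V :=
  nop 1 beta (deriv 0 gamma) - nopF 1 psiP (deriv 0 psi)
    + (1 / 2 : ℂ) • nop 1 phi phi - (1 / (2 * a)) • deriv 1 phi

end Realizations

/-! ### The Fock space -/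

/-- The conjugate pairs of bosonic fields: matter `(β, γ)`, Liouville `(β̃, γ̃)` and the ghosts
`(b_{1/2}, c^{1/2})`, `(b_{-1/2}, c^{-1/2})`. -/
inductive BosPair
  | matter | liouville | ghostHalf | ghostMHalf

/-- The conjugate pairs of fermionic fields: matter `(ψ⁺, ψ)`, Liouville `(ψ̃⁺, ψ̃)` and the
ghosts `(b_+, c^+)`, `(b_3, c^3)`, `(b_-, c^-)`. -/
inductive FerPair
  | matter | liouville | ghostPlus | ghostThree | ghostMinus

/-- The free bosons: `φ` and `φ̃`. -/
inductive Heis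
  | matter | liouville

/-- Indices of the bosonic oscillators. A pair of fields `(x, y)` with
`[x_m, y_n] = δ_{m+n,0}` contributes one oscillator for every integer `n`, namely the pair of
modes `(x_n, y_{-n})`; a free boson contributes one oscillator, numbered by `n`, for every mode
`φ_{-(n+1)}`, `n ≥ 0`. -/
abbrev BosIdx : Type := (BosPair × ℤ) ⊕ (Heis × ℕ)

/-- Indices of the fermionic oscillators, one for every pair of modes `(x_n, y_{-n})`. -/
abbrev FerIdx : Type := FerPair × ℤ

/-- The Fock space of all matter, Liouville and ghost oscillators: polynomials in the bosonic
creation operators tensor exterior algebra in the fermionic ones. It is the underlying space of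
the (graded) tensor product `W ⊗ W* ⊗ gh`. -/
def Fock : Type :=
  MvPolynomial BosIdx ℂ ⊗[ℂ] ExteriorAlgebra ℂ (FerIdx →₀ ℂ)

instance : AddCommGroup Fock :=
  inferInstanceAs (AddCommGroup (MvPolynomial BosIdx ℂ ⊗[ℂ] ExteriorAlgebra ℂ (FerIdx →₀ ℂ)))

instance : Module ℂ Fock :=
  inferInstanceAs (Module ℂ (MvPolynomial BosIdx ℂ ⊗[ℂ] ExteriorAlgebra ℂ (FerIdx →₀ ℂ)))

/-- The vector `p ⊗ q` of the Fock space. -/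
def Fock.tmul (p : MvPolynomial BosIdx ℂ) (q : ExteriorAlgebra ℂ (FerIdx →₀ ℂ)) : Fock :=
  TensorProduct.tmul ℂ p q

lemma Fock.induction {P : Fock → Prop} (zero : P 0) (tmul : ∀ p q, P (Fock.tmul p q))
    (add : ∀ v w, P v → P w → P (v + w)) (v : Fock) : P v :=
  TensorProduct.induction_on v zero tmul add

/-- The Fock vacuum. -/
def vac : Fock := Fock.tmul 1 1

/-- Bosonic creation operator. -/
def bCre (i : BosIdx) : Module.End ℂ Fock :=
  LinearMap.rTensor _ (LinearMap.mulLeft ℂ (MvPolynomial.X i))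

/-- Bosonic annihilation operator. -/
def bAnn (i : BosIdx) : Module.End ℂ Fock :=
  LinearMap.rTensor _ (MvPolynomial.pderiv (R := ℂ) i).toLinearMap

/-- Fermionic creation operator. -/
def fCre (i : FerIdx) : Module.End ℂ Fock :=
  LinearMap.lTensor _ (LinearMap.mulLeft ℂ (ExteriorAlgebra.ι ℂ (Finsupp.single i (1 : ℂ))))

/-- Fermionic annihilation operator: contraction with the dual basis vector. -/
def fAnn (i : FerIdx) : Module.End ℂ Fock :=
  LinearMap.lTensor _ (CliffordAlgebra.contractLeft (Q := (0 : QuadraticForm ℂ (FerIdx →₀ ℂ)))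
    (Finsupp.lapply i))

lemma bAnn_tmul (i : BosIdx) (p : MvPolynomial BosIdx ℂ)
    (q : ExteriorAlgebra ℂ (FerIdx →₀ ℂ)) :
    bAnn i (Fock.tmul p q) = Fock.tmul (MvPolynomial.pderiv i p) q := rfl

lemma fAnn_tmul (i : FerIdx) (p : MvPolynomial BosIdx ℂ)
    (q : ExteriorAlgebra ℂ (FerIdx →₀ ℂ)) :
    fAnn i (Fock.tmul p q) = Fock.tmul p
      (CliffordAlgebra.contractLeft (Q := (0 : QuadraticForm ℂ (FerIdx →₀ ℂ)))
        (Finsupp.lapply i) q) := rfl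

lemma bAnn_finite (v : Fock) : {i | bAnn i v ≠ 0}.Finite := by
  induction v using Fock.induction with
  | zero => simp only [map_zero, ne_eq, not_true_eq_false, Set.ofPred_false, Set.finite_empty]
  | tmul p q =>
    refine p.vars.finite_toSet.subset fun i hi => ?_
    by_contra hc
    apply hi
    rw [bAnn_tmul, MvPolynomial.pderiv_eq_zero_of_notMem_vars (by simpa using hc)]
    exact TensorProduct.zero_tmul _ _
  | add v w hv hw =>
    refine (hv.union hw).subset fun i hi => ?_
    by_contra hc
    simp only [Set.mem_union, Set.mem_ofPred_eq, not_or, not_not] at hc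
    exact hi (by rw [map_add, hc.1, hc.2, add_zero])

lemma contract_finite (q : ExteriorAlgebra ℂ (FerIdx →₀ ℂ)) :
    {i : FerIdx | CliffordAlgebra.contractLeft (Q := (0 : QuadraticForm ℂ (FerIdx →₀ ℂ)))
      (Finsupp.lapply i) q ≠ 0}.Finite := by
  induction q using CliffordAlgebra.left_induction with
  | algebraMap r => simp [CliffordAlgebra.contractLeft_algebraMap]
  | add v w hv hw =>
    refine (hv.union hw).subset fun i hi => ?_
    by_contra hc
    simp only [Set.mem_union, Set.mem_ofPred_eq, not_or, not_not] at hc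
    exact hi (by rw [map_add, hc.1, hc.2, add_zero])
  | ι_mul x m hx =>
    refine (m.support.finite_toSet.union hx).subset fun i hi => ?_
    by_contra hc
    simp only [Set.mem_union, Set.mem_ofPred_eq, not_or, not_not, Finset.mem_coe,
      Finsupp.mem_support_iff] at hc
    exact hi (by rw [CliffordAlgebra.contractLeft_ι_mul, hc.2]; simp [hc.1])

lemma fAnn_finite (v : Fock) : {i | fAnn i v ≠ 0}.Finite := by
  induction v using Fock.induction with
  | zero => simp only [map_zero, ne_eq, not_true_eq_false, Set.ofPred_false, Set.finite_empty]
  | tmul p q =>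
    refine (contract_finite q).subset fun i hi hc => hi ?_
    rw [fAnn_tmul, hc]
    exact TensorProduct.tmul_zero _ _
  | add v w hv hw =>
    refine (hv.union hw).subset fun i hi => ?_
    by_contra hc
    simp only [Set.mem_union, Set.mem_ofPred_eq, not_or, not_not] at hc
    exact hi (by rw [map_add, hc.1, hc.2, add_zero])

/-- A finite set of indices is missed by `g n` for all large `n`, if `g` is injective. -/
lemma eventually_not_mem {I : Type*} {s : Set I} (hs : s.Finite) (g : ℤ → I)
    (hg : Function.Injective g) : ∃ N : ℤ, ∀ n, N ≤ n → g n ∉ s := by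
  obtain ⟨K, hK⟩ := (hs.preimage hg.injOn : (g ⁻¹' s).Finite).bddAbove
  exact ⟨K + 1, fun n hn hmem => by have := hK hmem; omega⟩

/-- First field `x` of a bosonic pair `(x, y)`, for the vacuum that is annihilated by `x_n` for
`n ≥ t` and by `y_n` for `n > -t`. -/
def bosFst (s : BosPair) (t : ℤ) : fields Fock :=
  ⟨fun n => if t ≤ n then bAnn (.inl (s, n)) else bCre (.inl (s, n)), fun v => by
    obtain ⟨N, hN⟩ := eventually_not_mem (bAnn_finite v) (fun n : ℤ => .inl (s, n))
      (fun a b h => by simpa using h)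
    refine ⟨max N t, fun n hn => ?_⟩
    rw [max_le_iff] at hn
    simpa [hn.2] using hN n hn.1⟩

/-- Second field `y` of a bosonic pair. -/
def bosSnd (s : BosPair) (t : ℤ) : fields Fock :=
  ⟨fun n => if t ≤ -n then bCre (.inl (s, -n)) else -bAnn (.inl (s, -n)), fun v => by
    obtain ⟨N, hN⟩ := eventually_not_mem (bAnn_finite v) (fun n : ℤ => .inl (s, -n))
      (fun a b h => by simpa using h)
    refine ⟨max N (1 - t), fun n hn => ?_⟩
    rw [max_le_iff] at hn
    simpa [show ¬ t ≤ -n by omega] using hN n hn.1⟩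

/-- First field `x` of a fermionic pair `(x, y)`, for the vacuum that is annihilated by `x_n` for
`n ≥ t` and by `y_n` for `n > -t`. -/
def ferFst (s : FerPair) (t : ℤ) : fields Fock :=
  ⟨fun n => if t ≤ n then fAnn (s, n) else fCre (s, n), fun v => by
    obtain ⟨N, hN⟩ := eventually_not_mem (fAnn_finite v) (fun n : ℤ => (s, n))
      (fun a b h => by simpa using h)
    refine ⟨max N t, fun n hn => ?_⟩
    rw [max_le_iff] at hn
    simpa [hn.2] using hN n hn.1⟩

/-- Second field `y` of a fermionic pair. -/
def ferSnd (s : FerPair) (t : ℤ) : fields Fock :=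
  ⟨fun n => if t ≤ -n then fCre (s, -n) else fAnn (s, -n), fun v => by
    obtain ⟨N, hN⟩ := eventually_not_mem (fAnn_finite v) (fun n : ℤ => (s, -n))
      (fun a b h => by simpa using h)
    refine ⟨max N (1 - t), fun n hn => ?_⟩
    rw [max_le_iff] at hn
    simpa [show ¬ t ≤ -n by omega] using hN n hn.1⟩

/-- The current `i ∂φ` of a free boson, with zero mode `φ_0 = p`. -/
def boson (s : Heis) (p : ℂ) : fields Fock :=
  ⟨fun n => if n = 0 then p • LinearMap.id
      else if 0 < n then (n : ℂ) • bAnn (.inr (s, (n - 1).toNat))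
      else bCre (.inr (s, (-n - 1).toNat)), fun v => by
    obtain ⟨N, hN⟩ := eventually_not_mem (bAnn_finite v)
      (fun n : ℤ => if 0 < n then .inr (s, (n - 1).toNat) else .inl (.matter, n)) (fun a b h => by
        dsimp only at h
        split_ifs at h <;> simp at h <;> omega)
    refine ⟨max N 1, fun n hn => ?_⟩
    rw [max_le_iff] at hn
    have h1 : 0 < n := by omega
    have h2 := hN n hn.1
    simp only [h1, if_true, Set.mem_ofPred_eq, not_not] at h2
    simp only [h1, h1.ne', if_true, if_false, LinearMap.smul_apply, h2, smul_zero]⟩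

/-! ### The complex -/

/-- The two ghost vacua: `zero` is annihilated by `b_{x,n}` (`n ≥ 0`) and `c^x_n` (`n > 0`);
`zeroHalf` is annihilated by all positive modes, by `c^+_0`, `c^{1/2}_0` and by
`b_{3,0}`, `b_{-1/2,0}`, `b_{-,0}`. -/
inductive GhostVac
  | zero | zeroHalf

/-- The mode from which on `b_x` annihilates the ghost vacuum. -/
def GhostVac.level : GhostVac → Gen → ℤ
  | .zeroHalf, plus => 1
  | .zeroHalf, half => 1
  | _, _ => 0

/-- The data of the complex: the level `k`, the numbers `a = α_+` and `a' = α̃_+`, the isospins of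
the two highest weight vectors, and the ghost vacuum. -/
structure Datum where
  k : ℂ
  a : ℂ
  a' : ℂ
  j₁ : ℂ
  j₂ : ℂ
  gh : GhostVac

namespace Datum

variable (D : Datum)

/-! Matter fields. The vacuum is annihilated by `β_n, ψ⁺_n` (`n ≥ 0`) and `γ_n, ψ_n` (`n > 0`), and
`φ_0 = 2 j₁ / a`, so that `J^3_0 = j₁` on the vacuum. -/

def beta (_ : Datum) : fields Fock := bosFst .matter 0
def gamma (_ : Datum) : fields Fock := bosSnd .matter 0
def psiP (_ : Datum) : fields Fock := ferFst .matter 0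
def psi (_ : Datum) : fields Fock := ferSnd .matter 0
def phi : fields Fock := boson .matter (2 * D.j₁ / D.a)

/-! Liouville fields. The vacuum is annihilated by `γ̃_n, ψ̃_n` (`n ≥ 0`) and `β̃_n, ψ̃⁺_n`
(`n > 0`), and `φ̃_0 = - (2 j₂ + 1) / a'`. As the zero modes in `J̃^3` are ordered with respect to
the other vacuum, this means that `J̃^3_0 = j₂` on the vacuum. -/

def betaT (_ : Datum) : fields Fock := bosFst .liouville 1
def gammaT (_ : Datum) : fields Fock := bosSnd .liouville 1
def psiPT (_ : Datum) : fields Fock := ferFst .liouville 1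
def psiT (_ : Datum) : fields Fock := ferSnd .liouville 1
def phiT : fields Fock := boson .liouville (-(2 * D.j₂ + 1) / D.a')

/-- The ghost `b_x` (of weight `1`); it is fermionic for even `x` and bosonic for odd `x`. -/
def b : Gen → fields Fock
  | plus => ferFst .ghostPlus (D.gh.level plus)
  | three => ferFst .ghostThree (D.gh.level three)
  | minus => ferFst .ghostMinus (D.gh.level minus)
  | half => bosFst .ghostHalf (D.gh.level half)
  | mhalf => bosFst .ghostMHalf (D.gh.level mhalf)

/-- The ghost `c^x` (of weight `0`). -/
def c : Gen → fields Fock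
  | plus => ferSnd .ghostPlus (D.gh.level plus)
  | three => ferSnd .ghostThree (D.gh.level three)
  | minus => ferSnd .ghostMinus (D.gh.level minus)
  | half => bosSnd .ghostHalf (D.gh.level half)
  | mhalf => bosSnd .ghostMHalf (D.gh.level mhalf)

/-- The currents of level `k` of the Wakimoto module `W(j₁, k)`. -/
def J : Gen → fields Fock :=
  wakimotoCurrent D.k D.a D.beta D.gamma D.psiP D.psi D.phi

/-- The currents of level `-3-k` of the dual Wakimoto module `W*(j₂, -3-k)`. -/
def JT : Gen → fields Fock :=
  dualWakimotoCurrent (-3 - D.k) D.a' D.betaT D.gammaT D.psiPT D.psiT D.phiT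

/-- The product `:∂^i c^x b_y:`, where `cx` is `c^x` or its derivative and `h` is its weight. -/
def ghostProd (h : ℤ) (x : Gen) (cx : fields Fock) (y : Gen) : fields Fock :=
  if isOdd x = false ∧ isOdd y = false then nopF h cx (D.b y) else nop h cx (D.b y)

/-- The ghost currents `∑ f x y z :c^z b_y:` of level `3`. -/
def Jgh (x : Gen) : fields Fock := ∑ y, ∑ z, f x y z • D.ghostProd 0 z (D.c z) y

/-- The BRST current `(J^x + J̃^x + J_gh^x / 2) c^y h_{xy}`. -/
def brstCurrent : fields Fock :=
  ∑ x, ∑ y, hInv x y • nop 0 (D.c y) (D.J x + D.JT x + (1 / 2 : ℂ) • D.Jgh x)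

/-- The BRST operator: the contour integral of the BRST current. -/
def Q : Module.End ℂ Fock := mode D.brstCurrent 0

/-- The part `Q̂_0` of `Q` that is quadratic in the free fields:
`∑ - c^-_n β_{-n} / 2 + c^+_n β̃_{-n} / 2 + c^{1/2}_n ψ̃⁺_{-n} / 4 - c^{-1/2}_n ψ⁺_{-n} / 4` plus
`∑_{n ≠ 0} c^3_n (a φ_{-n} - a' φ̃_{-n}) / 2`. -/
def Q₀ : Module.End ℂ Fock := mode
  (-(1 / 2 : ℂ) • nop 0 (D.c minus) D.beta + (1 / 2 : ℂ) • nop 0 (D.c plus) D.betaT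
    + (1 / 4 : ℂ) • nop 0 (D.c half) D.psiPT - (1 / 4 : ℂ) • nop 0 (D.c mhalf) D.psiP
    + (1 / 2 : ℂ) • nop 0 (D.c three) (D.a • boson .matter 0 - D.a' • boson .liouville 0)) 0

/-- The total isospin `J^{tot,3}_0`. -/
def totalIsospin : Module.End ℂ Fock := mode (D.J three + D.JT three + D.Jgh three) 0

/-- The total energy `L_0`. -/
def L₀ : Module.End ℂ Fock := mode
  (stressTensor D.a D.beta D.gamma D.psiP D.psi D.phi
    + stressTensor D.a' D.betaT D.gammaT D.psiPT D.psiT D.phiT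
    + ∑ x, D.ghostProd 1 x (deriv 0 (D.c x)) x) 0

/-- The ghost number operator: the zero mode of `c^x b_x`. It counts `1` for every `c` and `-1` for
every `b`, and vanishes on both ghost vacua. -/
def ghostNumber : Module.End ℂ Fock := mode (∑ x, D.ghostProd 0 x (D.c x) x) 0

/-- The part of ghost number `n` of the relative complex
`{w | J^{tot,3}_0 w = L_0 w = b_{3,0} w = 0}`. -/
def relComplex (n : ℤ) : Submodule ℂ Fock :=
  LinearMap.ker D.totalIsospin ⊓ LinearMap.ker D.L₀ ⊓ LinearMap.ker (mode (D.b three) 0)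
    ⊓ LinearMap.ker (D.ghostNumber - (n : ℂ) • LinearMap.id)

/-- Relative cocycles of degree `n` for a differential `d`. -/
def cocycles (d : Module.End ℂ Fock) (n : ℤ) : Submodule ℂ Fock :=
  D.relComplex n ⊓ LinearMap.ker d

/-- Relative coboundaries of degree `n` for a differential `d`. -/
def coboundaries (d : Module.End ℂ Fock) (n : ℤ) : Submodule ℂ Fock :=
  (D.relComplex (n - 1)).map d

/-- The relative cohomology of degree `n` for a differential `d`. For `d = Q` this is
`H_rel^{∞/2+n}(W(j₁, k) ⊗ W*(j₂, -3-k))`. -/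
abbrev cohomology (d : Module.End ℂ Fock) (n : ℤ) : Type :=
  D.cocycles d n ⧸ (D.coboundaries d n).submoduleOf (D.cocycles d n)

/-- `w` is a cocycle, and its class is not zero and spans the cohomology of degree `n`. -/
def Generates (d : Module.End ℂ Fock) (n : ℤ) (w : Fock) : Prop :=
  ∃ hw : w ∈ D.cocycles d n,
    (Submodule.Quotient.mk ⟨w, hw⟩ : D.cohomology d n) ≠ 0 ∧
      Submodule.span ℂ {(Submodule.Quotient.mk ⟨w, hw⟩ : D.cohomology d n)} = ⊤

end Datum

end AffineOsp

end

noncomputable section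

namespace AffineOsp

/-! ### Calculus of normally ordered products -/

section Calculus

variable {V : Type*} [AddCommGroup V] [Module ℂ V]

/-! The operator `Q` is a perturbation of a differential of Koszul type. Its quadratic part `Q₀`
couples the ghosts c⁻, c^{-1/2}, c⁺, c^{1/2} to β, ψ⁺, β̃, ψ̃⁺, and the nonzero modes of c³ to a
combination of the two bosons that is null because α₊² + α̃₊² = 0. Such quartets carry no cohomology
beyond one vacuum vector: there is a homotopy `K` for which Q₀K + KQ₀ is diagonalizable and counts
the creation modes over a suitable vacuum vector h, apart from the mode c³_0, which the condition
b_{3,0}w = 0 removes (`lapWeights`, `mem_span_of_lap`). The harmonic vectors of the relative complex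
are therefore multiples of h.

The vector h is dictated by polarizations. A quartet consists of a bosonic and a fermionic pair,
whose modes have to be divided into creation and annihilation modes at the same place. For bosons
the division is fixed by the Fock space; for fermions it can be moved by filling a level
(`fill_fst`, `fill_snd`). The vacuum built on |gh⟩_{0,1/2} fits as it stands. Over |gh⟩_0 the modes
c⁺_0 and ψ̃⁺_0 have to be filled, which explains the shift of the degree by one. In both cases h has
isospin j₁ + j₂ + 1/2 and its energy is a multiple of this number, so h lies in the relative complex
exactly if the number vanishes.

For the passage from Q₀ to Q the Fock space is filtered by the eigenvalues of `degOp`. Both Q₀ and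
`K` preserve the degree, while Q - Q₀ raises it (`Q_sub_Q₀`). In the relative complex of a fixed
ghost number the degree is bounded above (`bounded`), so successive approximation stops after
finitely many steps; `exists_of_cocycle` and `ne_coboundary` carry this out without a spectral
sequence. What remains is a cocycle of Q with leading term h. It lives on the lowest energy level,
where only zero modes act (`Q_lowest`), and checking it is a finite calculation.

All this needs Q² = 0. The two sets of matter currents satisfy the affine relations at levels k and
-3-k and the ghost currents at level 3, so the total currents have level zero. The bracket of Q with
an antighost is a total current. The bracket of Q with a total current commutes up to signs with all
antighosts and raises the ghost number, and `eq_zero_of_comm_b` shows that such an operator is zero.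
The same argument then applies to Q², which never has to be expanded. The affine relations rest on
the Wick formula (`mul_mode_nopE`, `LB.nop`), quasi-associativity (`nopE_assoc`) and the Jacobi
identity (`LB.jacobi`). -/

lemma fields_ext {A B : fields V} (h : ∀ n, mode A n = mode B n) : A = B :=
  Subtype.ext (funext h)

@[simp] lemma mode_add (A B : fields V) (n : ℤ) : mode (A + B) n = mode A n + mode B n := rfl
@[simp] lemma mode_sub (A B : fields V) (n : ℤ) : mode (A - B) n = mode A n - mode B n := rfl
@[simp] lemma mode_neg (A : fields V) (n : ℤ) : mode (-A) n = -mode A n := rfl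
@[simp] lemma mode_zero (n : ℤ) : mode (0 : fields V) n = 0 := rfl
@[simp] lemma mode_smul (c : ℂ) (A : fields V) (n : ℤ) : mode (c • A) n = c • mode A n := rfl

lemma mode_sum {ι : Type*} (s : Finset ι) (A : ι → fields V) (n : ℤ) :
    mode (∑ i ∈ s, A i) n = ∑ i ∈ s, mode (A i) n := by
  induction s using Finset.cons_induction with
  | empty => rfl
  | cons a s ha ih => rw [Finset.sum_cons, Finset.sum_cons, mode_add, ih]

@[simp] lemma mode_deriv (h : ℤ) (A : fields V) (n : ℤ) :
    mode (deriv h A) n = (-((n : ℂ) + h)) • mode A n := rfl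

/-- The normally ordered product with an arbitrary sign of exchange. -/
def nopE (h : ℤ) (e : ℂ) (A B : fields V) : fields V := ⟨nopMode h e A B, nopMode_mem h e A B⟩

lemma nop_eq (h : ℤ) (A B : fields V) : nop h A B = nopE h 1 A B := rfl
lemma nopF_eq (h : ℤ) (A B : fields V) : nopF h A B = nopE h (-1) A B := rfl

lemma mode_nopE_apply (h : ℤ) (e : ℂ) (A B : fields V) (n : ℤ) (v : V) :
    mode (nopE h e A B) n v = ∑ᶠ m : ℤ, nopTerm h e A B n m v := rfl

lemma nopTerm_hasFiniteSupport (h : ℤ) (e : ℂ) (A B : fields V) (n : ℤ) (v : V) :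
    (fun m => nopTerm h e A B n m v).HasFiniteSupport := nopTerm_finite h e A B n v

@[simp] lemma nopE_add_left (h : ℤ) (e : ℂ) (A A' B : fields V) :
    nopE h e (A + A') B = nopE h e A B + nopE h e A' B := by
  refine fields_ext fun n => LinearMap.ext fun v => ?_
  rw [mode_add, LinearMap.add_apply]
  simp only [mode_nopE_apply]
  rw [← finsum_add_distrib (nopTerm_hasFiniteSupport ..) (nopTerm_hasFiniteSupport ..)]
  refine finsum_congr fun m => ?_
  simp only [nopTerm, mode_add, LinearMap.add_apply, map_add, smul_add]
  split_ifs <;> rfl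

@[simp] lemma nopE_add_right (h : ℤ) (e : ℂ) (A B B' : fields V) :
    nopE h e A (B + B') = nopE h e A B + nopE h e A B' := by
  refine fields_ext fun n => LinearMap.ext fun v => ?_
  rw [mode_add, LinearMap.add_apply]
  simp only [mode_nopE_apply]
  rw [← finsum_add_distrib (nopTerm_hasFiniteSupport ..) (nopTerm_hasFiniteSupport ..)]
  refine finsum_congr fun m => ?_
  simp only [nopTerm, mode_add, LinearMap.add_apply, map_add, smul_add]
  split_ifs <;> rfl

@[simp] lemma nopE_smul_left (h : ℤ) (e c : ℂ) (A B : fields V) :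
    nopE h e (c • A) B = c • nopE h e A B := by
  refine fields_ext fun n => LinearMap.ext fun v => ?_
  rw [mode_smul, LinearMap.smul_apply]
  simp only [mode_nopE_apply]
  rw [smul_finsum]
  refine finsum_congr fun m => ?_
  simp only [nopTerm, mode_smul, LinearMap.smul_apply, map_smul]
  split_ifs
  · rfl
  · rw [smul_comm]

@[simp] lemma nopE_smul_right (h : ℤ) (e c : ℂ) (A B : fields V) :
    nopE h e A (c • B) = c • nopE h e A B := by
  refine fields_ext fun n => LinearMap.ext fun v => ?_
  rw [mode_smul, LinearMap.smul_apply]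
  simp only [mode_nopE_apply]
  rw [smul_finsum]
  refine finsum_congr fun m => ?_
  simp only [nopTerm, mode_smul, LinearMap.smul_apply, map_smul]
  split_ifs
  · rfl
  · rw [smul_comm]

@[simp] lemma nopE_zero_left (h : ℤ) (e : ℂ) (B : fields V) : nopE h e 0 B = 0 := by
  rw [← zero_smul ℂ (0 : fields V), nopE_smul_left, zero_smul, zero_smul]

@[simp] lemma nopE_zero_right (h : ℤ) (e : ℂ) (A : fields V) : nopE h e A 0 = 0 := by
  rw [← zero_smul ℂ (0 : fields V), nopE_smul_right, zero_smul, zero_smul]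

@[simp] lemma nopE_neg_left (h : ℤ) (e : ℂ) (A B : fields V) : nopE h e (-A) B = -nopE h e A B := by
  rw [eq_neg_iff_add_eq_zero, ← nopE_add_left, neg_add_cancel, nopE_zero_left]

@[simp] lemma nopE_neg_right (h : ℤ) (e : ℂ) (A B : fields V) : nopE h e A (-B) = -nopE h e A B := by
  rw [eq_neg_iff_add_eq_zero, ← nopE_add_right, neg_add_cancel, nopE_zero_right]

@[simp] lemma nopE_sub_right (h : ℤ) (e : ℂ) (A B B' : fields V) :
    nopE h e A (B - B') = nopE h e A B - nopE h e A B' := by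
  rw [sub_eq_add_neg, nopE_add_right, nopE_neg_right, sub_eq_add_neg]

lemma nopE_sum_left {ι : Type*} (s : Finset ι) (h : ℤ) (e : ℂ) (A : ι → fields V)
    (B : fields V) : nopE h e (∑ i ∈ s, A i) B = ∑ i ∈ s, nopE h e (A i) B := by
  induction s using Finset.cons_induction with
  | empty => simp
  | cons a s ha ih => rw [Finset.sum_cons, Finset.sum_cons, nopE_add_left, ih]

lemma nopE_sum_right {ι : Type*} (s : Finset ι) (h : ℤ) (e : ℂ) (A : fields V)
    (B : ι → fields V) : nopE h e A (∑ i ∈ s, B i) = ∑ i ∈ s, nopE h e A (B i) := by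
  induction s using Finset.cons_induction with
  | empty => simp
  | cons a s ha ih => rw [Finset.sum_cons, Finset.sum_cons, nopE_add_right, ih]

/-- The identity field. -/
def oneF : fields V :=
  ⟨fun n => if n = 0 then 1 else 0, fun v => ⟨1, fun n hn => by
    simp [show n ≠ 0 by omega]⟩⟩

lemma mode_oneF (n : ℤ) : mode (oneF : fields V) n = if n = 0 then 1 else 0 := rfl

@[simp] lemma nopE_oneF_left (h : ℤ) (B : fields V) : nopE h 1 oneF B = B := by
  refine fields_ext fun n => LinearMap.ext fun v => ?_
  rw [mode_nopE_apply, finsum_eq_single _ (0 : ℤ)]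
  · simp [nopTerm, mode_oneF]
  · intro m hm
    simp [nopTerm, mode_oneF, hm]

@[simp] lemma nopE_oneF_right (h : ℤ) (A : fields V) : nopE h 1 A oneF = A := by
  refine fields_ext fun n => LinearMap.ext fun v => ?_
  rw [mode_nopE_apply, finsum_eq_single _ n]
  · simp [nopTerm, mode_oneF]
  · intro m hm
    simp [nopTerm, mode_oneF, sub_eq_zero, Ne.symm hm]

lemma finsum_step_finite (a b : ℤ) (w : V) : (fun l : ℤ =>
    ((if l ≤ b then 1 else 0) - (if l ≤ a then 1 else 0) : ℂ) • w).HasFiniteSupport := by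
  refine (Set.finite_Icc (min a b) (max a b)).subset fun l hl => ?_
  by_contra hc
  apply hl
  simp only [Set.mem_Icc, not_and_or, not_le] at hc
  dsimp only
  rcases le_or_gt l b with h1 | h1 <;> rcases le_or_gt l a with h2 | h2 <;>
    simp [h1, h2, not_le.2] <;> omega

/-- The sum is a signed count of the integers between a and b. All anomalous terms of the calculus
come from here: they compare two places at which creation and annihilation modes are separated. -/
lemma finsum_step (a b : ℤ) (w : V) : ∑ᶠ l : ℤ,
    ((if l ≤ b then 1 else 0) - (if l ≤ a then 1 else 0) : ℂ) • w = ((b : ℂ) - a) • w := by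
  wlog hab : a ≤ b generalizing a b
  · have := this b a (by omega)
    rw [← neg_inj, ← finsum_neg_distrib]
    rw [← neg_smul, neg_sub, ← this]
    refine finsum_congr fun l => ?_
    rw [← neg_smul, neg_sub]
  rw [finsum_eq_sum_of_support_subset (s := Finset.Ioc a b)]
  · rw [Finset.sum_congr rfl (g := fun _ => w), Finset.sum_const, Int.card_Ioc,
      ← Nat.cast_smul_eq_nsmul ℂ]
    · congr 1
      rw [← Int.cast_natCast, Int.toNat_of_nonneg (by omega), Int.cast_sub]
    · intro l hl
      rw [Finset.mem_Ioc] at hl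
      simp [hl.2, not_le.2 hl.1]
  · intro l hl
    by_contra hc
    apply hl
    simp only [Finset.coe_Ioc, Set.mem_Ioc, not_and_or, not_le, not_lt] at hc
    dsimp only
    rcases hc with hc | hc
    · simp [hc, hc.trans hab]
    · simp [not_le.2 hc, not_le.2 (lt_of_le_of_lt hab hc)]

/-- The Wick formula for the commutator of an operator with a normally ordered product. -/
theorem mul_mode_nopE (X : Module.End ℂ V) (h : ℤ) (e eA eB : ℂ) (A B C D E : fields V)
    (m n : ℤ) (he : eA * eA = 1)
    (hA : ∀ l, X * mode A l = eA • (mode A l * X) + mode C (l + m))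
    (hB : ∀ l, X * mode B l = eB • (mode B l * X) + mode D (l + m))
    (hE : ∀ p q, p + q = m + n →
      mode C p * mode B q = (e * eB) • (mode B q * mode C p) + mode E (m + n)) :
    X * mode (nopE h e A B) n = (eA * eB) • (mode (nopE h e A B) n * X)
      + mode (nopE h (e * eB) C B) (m + n) + eA • mode (nopE h (e * eA) A D) (m + n)
      + (m : ℂ) • mode E (m + n) := by
  refine LinearMap.ext fun v => ?_
  have hA' : ∀ l w, X (mode A l w) = eA • mode A l (X w) + mode C (l + m) w := fun l w =>
    LinearMap.congr_fun (hA l) w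
  have hB' : ∀ l w, X (mode B l w) = eB • mode B l (X w) + mode D (l + m) w := fun l w =>
    LinearMap.congr_fun (hB l) w
  simp only [LinearMap.add_apply, LinearMap.smul_apply, Module.End.mul_apply, mode_nopE_apply]
  rw [map_finsum X (nopTerm_hasFiniteSupport ..), smul_finsum, smul_finsum,
    ← finsum_comp_equiv (Equiv.addRight m) (f := fun l => nopTerm h (e * eB) C B (m + n) l v)]
  -- Reindexing the term with `C` by m moves the cut between creation and annihilation modes from -h
  -- to -h - m. Each mode between the two cuts contributes one double contraction `E`, m of them
  -- with sign.
  have hm : (m : ℂ) • mode E (m + n) v = ∑ᶠ l : ℤ, ((if l ≤ -h then 1 else 0)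
      - (if l ≤ -h - m then 1 else 0) : ℂ) • mode E (m + n) v := by
    rw [finsum_step]; push_cast; congr 1; ring
  have f1 : (fun l => (eA * eB) • nopTerm h e A B n l (X v)).HasFiniteSupport :=
    (nopTerm_finite h e A B n (X v)).subset (Function.support_const_smul_subset (eA * eB) _)
  have f3 : (fun l => eA • nopTerm h (e * eA) A D (m + n) l v).HasFiniteSupport :=
    (nopTerm_finite h (e * eA) A D (m + n) v).subset (Function.support_const_smul_subset eA _)
  have f2 : (fun l => nopTerm h (e * eB) C B (m + n) (Equiv.addRight m l) v).HasFiniteSupport :=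
    (nopTerm_finite h (e * eB) C B (m + n) v).preimage (Equiv.addRight m).injective.injOn
  have f12 := f1.fun_add f2
  have f123 := f12.fun_add f3
  rw [hm, ← finsum_add_distrib f1 f2, ← finsum_add_distrib f12 f3,
    ← finsum_add_distrib f123 (finsum_step_finite ..)]
  refine finsum_congr fun l => ?_
  have hE' : mode C (l + m) (mode B (n - l) v) = (e * eB) • mode B (n - l) (mode C (l + m) v)
      + mode E (m + n) v := by
    simpa using LinearMap.congr_fun (hE (l + m) (n - l) (by ring)) v
  have i1 : m + n - (l + m) = n - l := by ring
  have i2 : m + n - l = n - l + m := by ring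
  simp only [nopTerm, Equiv.coe_addRight, i1, i2]
  -- The identity now holds for each l separately; only the positions of l and l + m relative to the
  -- cut matter.
  obtain rfl | rfl := mul_self_eq_one_iff.1 he <;>
  by_cases h1 : l ≤ -h <;> by_cases h2 : l + m ≤ -h <;>
    simp only [h1, h2, if_true, if_false, show (l ≤ -h - m) = (l + m ≤ -h) from by
      rw [eq_iff_iff]; omega, hA', hB', map_add, map_smul, smul_add, smul_smul, hE'] <;> module

/-- The normally ordered products in the two orders differ by a multiple of the commutator. -/
theorem mode_nopE_comm (h h' : ℤ) (e : ℂ) (he : e * e = 1) (A B E : fields V) (n : ℤ)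
    (hE : ∀ p q, mode A p * mode B q = e • (mode B q * mode A p) + mode E (p + q)) :
    mode (nopE h e A B) n = e • mode (nopE h' e B A) n - ((n : ℂ) + h + h' - 1) • mode E n := by
  refine LinearMap.ext fun v => ?_
  simp only [LinearMap.sub_apply, LinearMap.smul_apply, mode_nopE_apply]
  rw [smul_finsum, ← finsum_comp_equiv (Equiv.subLeft n) (f := fun l =>
    e • nopTerm h' e B A n l v), sub_eq_add_neg]
  -- The reflection l ↦ n - l turns the cut of the opposite product into n + h' - 1. The modes
  -- between this cut and -h are ordered differently on the two sides.
  have hm : -(((n : ℂ) + h + h' - 1) • mode E n v) = ∑ᶠ l : ℤ, ((if l ≤ -h then 1 else 0)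
      - (if l ≤ n + h' - 1 then 1 else 0) : ℂ) • mode E n v := by
    rw [finsum_step, ← neg_smul]; push_cast; congr 1; ring
  have f2 : (fun l => e • nopTerm h' e B A n (Equiv.subLeft n l) v).HasFiniteSupport :=
      ((nopTerm_finite h' e B A n v).subset (Function.support_const_smul_subset e _)).preimage
        (Equiv.subLeft n).injective.injOn
  rw [hm, ← finsum_add_distrib f2 (finsum_step_finite ..)]
  refine finsum_congr fun l => ?_
  have hE' : mode A l (mode B (n - l) v) = e • mode B (n - l) (mode A l v) + mode E n v := by
    simpa using LinearMap.congr_fun (hE l (n - l)) v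
  have i1 : n - (n - l) = l := by ring
  have i3 : (n - l ≤ -h') = ¬ (l ≤ n + h' - 1) := by rw [eq_iff_iff]; omega
  simp only [nopTerm, Equiv.subLeft_apply, i1, i3]
  by_cases h1 : l ≤ -h <;> by_cases h2 : l ≤ n + h' - 1 <;>
    simp only [h1, h2, if_true, if_false, not_true_eq_false, not_false_eq_true, hE', smul_add,
      smul_smul, he] <;> module

lemma hasFiniteSupport_prod {M : Type*} [AddCommGroup M] {f : ℤ × ℤ → M} (h₁ : {r | ∃ t, f (r, t) ≠ 0}.Finite)
    (h₂ : ∀ r, {t | f (r, t) ≠ 0}.Finite) : f.HasFiniteSupport := by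
  refine (h₁.biUnion fun r _ => (h₂ r).image (Prod.mk r)).subset ?_
  rintro ⟨r, t⟩ h
  exact Set.mem_biUnion (x := r) ⟨t, h⟩ ⟨t, h, rfl⟩

/-- Quasi-associativity of the normally ordered product, for two fields `A` and `B` of weight `0`
that commute up to a sign. -/
theorem nopE_assoc (e₁ e₂ e₃ : ℂ) (h₁ : e₁ * e₁ = 1) (h₂ : e₂ * e₂ = 1) (h₃ : e₃ * e₃ = 1)
    (A B C E F : fields V)
    (hAB : ∀ p q, mode A p * mode B q = e₁ • (mode B q * mode A p))
    (hCB : ∀ p q, mode C p * mode B q = e₂ • (mode B q * mode C p) + mode E (p + q))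
    (hCA : ∀ p q, mode C p * mode A q = e₃ • (mode A q * mode C p) + mode F (p + q)) :
    nopE 0 (e₂ * e₃) (nopE 0 e₁ A B) C = nopE 0 (e₁ * e₃) A (nopE 0 e₂ B C)
      - e₂ • nopE 0 (e₁ * e₃) (deriv 0 A) E - (e₁ * e₃) • nopE 0 (e₁ * e₂) (deriv 0 B) F := by
  refine fields_ext fun n => LinearMap.ext fun v => ?_
  have hAB' : ∀ p q w, mode A p (mode B q w) = e₁ • mode B q (mode A p w) := fun p q w =>
    LinearMap.congr_fun (hAB p q) w
  have hCB' : ∀ p q w, mode C p (mode B q w) = e₂ • mode B q (mode C p w) + mode E (p + q) w :=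
    fun p q w => LinearMap.congr_fun (hCB p q) w
  have hCA' : ∀ p q w, mode C p (mode A q w) = e₃ • mode A q (mode C p w) + mode F (p + q) w :=
    fun p q w => LinearMap.congr_fun (hCA p q) w
  obtain ⟨NA, hNA⟩ := mode_eventually_zero A v
  obtain ⟨NB, hNB⟩ := mode_eventually_zero B v
  obtain ⟨NC, hNC⟩ := mode_eventually_zero C v
  choose L hL using fun t : ℤ => mode_eventually_zero C (mode B t v)
  -- Only finitely many positive modes of `B` act nontrivially on v, so one bound serves for the
  -- action of `C` on all the resulting vectors.
  obtain ⟨K, hK⟩ : ∃ K : ℤ, ∀ t ∈ Finset.Icc 0 NB, L t + t ≤ K := by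
    obtain ⟨K, hK⟩ := ((Finset.Icc 0 NB).image fun t => L t + t).bddAbove
    exact ⟨K, fun t ht => hK (Finset.mem_coe.2 (Finset.mem_image_of_mem _ ht))⟩
  -- Both triple products become sums over pairs of integers: `f` is indexed by the modes of A and
  -- B, and `g` by the mode of :AB: and the mode of A.
  let f : ℤ × ℤ → V := fun x => if x.1 ≤ 0 then mode A x.1 (nopTerm 0 e₂ B C (n - x.1) x.2 v)
    else (e₁ * e₃) • nopTerm 0 e₂ B C (n - x.1) x.2 (mode A x.1 v)
  let g : ℤ × ℤ → V := fun x => if x.1 ≤ 0 then mode A x.2 (mode B (x.1 - x.2) (mode C (n - x.1) v))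
    else (e₂ * e₃) • mode C (n - x.1) (mode A x.2 (mode B (x.1 - x.2) v))
  -- The factor -r in the mode r of the derivative is spread over a second index by `finsum_step`,
  -- so that the corrections are sums over pairs of integers as well.
  let fE : ℤ × ℤ → V := fun x => ((if x.2 ≤ -x.1 then 1 else 0) - (if x.2 ≤ 0 then 1 else 0) : ℂ) •
    nopTerm 0 (e₁ * e₃) A E n x.1 v
  let fF : ℤ × ℤ → V := fun x => ((if x.2 ≤ -x.1 then 1 else 0) - (if x.2 ≤ 0 then 1 else 0) : ℂ) •
    nopTerm 0 (e₁ * e₂) B F n x.1 v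
  have hf : f.HasFiniteSupport := by
    refine hasFiniteSupport_prod ((Set.finite_Icc (min 0 (min (n - NC) (n - K))) (max 0 NA)).subset ?_) ?_
    · rintro r ⟨t, ht⟩
      by_contra hc
      apply ht
      simp only [Set.mem_Icc, not_and_or, not_le] at hc
      dsimp only [f, nopTerm]
      by_cases hr : r ≤ 0
      · rw [if_pos hr]
        by_cases ht : t ≤ 0
        · rw [if_pos (by omega), hNC _ (by omega), map_zero, map_zero]
        · rw [if_neg (by omega)]
          by_cases htB : NB ≤ t
          · rw [hNB _ htB, map_zero, smul_zero, map_zero]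
          · have := hK t (Finset.mem_Icc.2 ⟨by omega, by omega⟩)
            rw [hL t _ (by omega), smul_zero, map_zero]
      · rw [if_neg hr, hNA r (by omega)]
        simp
    · intro r
      dsimp only [f]
      by_cases hr : r ≤ 0
      · simp only [hr, if_true]
        exact (nopTerm_finite 0 e₂ B C (n - r) v).subset fun t ht h0 => ht (by
          dsimp only at h0 ⊢; rw [h0, map_zero])
      · simp only [hr, if_false]
        exact (nopTerm_finite 0 e₂ B C (n - r) (mode A r v)).subset fun t ht h0 => ht (by
          dsimp only at h0 ⊢; rw [h0, smul_zero])
  have hAB0 : ∀ u w r, nopTerm 0 e₁ A B u r w = mode A r (mode B (u - r) w) := by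
    intro u w r
    simp only [nopTerm, hAB', ite_self]
  have hg : g.HasFiniteSupport := by
    refine hasFiniteSupport_prod ((Set.finite_Icc (min 0 (n - NC)) (max 0 (NA + NB))).subset ?_) ?_
    · rintro u ⟨r, hr⟩
      by_contra hc
      apply hr
      simp only [Set.mem_Icc, not_and_or, not_le] at hc
      dsimp only [g]
      by_cases hu : u ≤ 0
      · rw [if_pos hu]
        rw [hNC _ (by omega), map_zero, map_zero]
      · rw [if_neg hu]
        by_cases hb : NB ≤ u - r
        · rw [hNB _ hb, map_zero, map_zero, smul_zero]
        · rw [hAB', hNA r (by omega), map_zero, smul_zero, map_zero, smul_zero]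
    · intro u
      dsimp only [g]
      by_cases hu : u ≤ 0
      · simp only [hu, if_true, ← hAB0]
        exact nopTerm_finite ..
      · simp only [hu, if_false, ← hAB0]
        exact (nopTerm_finite 0 e₁ A B u v).subset fun t ht h0 => ht (by
          dsimp only at h0 ⊢; rw [h0, map_zero, smul_zero])
  have hfE : fE.HasFiniteSupport := by
    refine hasFiniteSupport_prod ((nopTerm_finite 0 (e₁ * e₃) A E n v).subset ?_) fun r => by
      exact finsum_step_finite 0 (-r) (nopTerm 0 (e₁ * e₃) A E n r v)
    rintro r ⟨t, ht⟩ h0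
    exact ht (by dsimp only [fE] at h0 ⊢; rw [h0, smul_zero])
  have hfF : fF.HasFiniteSupport := by
    refine hasFiniteSupport_prod ((nopTerm_finite 0 (e₁ * e₂) B F n v).subset ?_) fun r => by
      exact finsum_step_finite 0 (-r) (nopTerm 0 (e₁ * e₂) B F n r v)
    rintro r ⟨t, ht⟩ h0
    exact ht (by dsimp only [fF] at h0 ⊢; rw [h0, smul_zero])
  have sf : mode (nopE 0 (e₁ * e₃) A (nopE 0 e₂ B C)) n v = ∑ᶠ x, f x := by
    rw [finsum_curry f hf, mode_nopE_apply]
    refine finsum_congr fun r => ?_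
    change (if r ≤ -0 then mode A r (mode (nopE 0 e₂ B C) (n - r) v)
      else (e₁ * e₃) • mode (nopE 0 e₂ B C) (n - r) (mode A r v)) = _
    dsimp only [f]
    by_cases hr : r ≤ 0
    · simp only [hr, if_true, neg_zero]
      rw [mode_nopE_apply, map_finsum _ (nopTerm_hasFiniteSupport ..)]
    · simp only [hr, if_false, neg_zero]
      rw [mode_nopE_apply, smul_finsum]
  have sg : mode (nopE 0 (e₂ * e₃) (nopE 0 e₁ A B) C) n v = ∑ᶠ x, g x := by
    rw [finsum_curry g hg, mode_nopE_apply]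
    refine finsum_congr fun r => ?_
    change (if r ≤ -0 then mode (nopE 0 e₁ A B) r (mode C (n - r) v)
      else (e₂ * e₃) • mode C (n - r) (mode (nopE 0 e₁ A B) r v)) = _
    dsimp only [g]
    by_cases hr : r ≤ 0
    · simp only [hr, if_true, neg_zero]
      rw [mode_nopE_apply]
      simp only [hAB0]
    · simp only [hr, if_false, neg_zero]
      rw [mode_nopE_apply, map_finsum _ (nopTerm_hasFiniteSupport ..), smul_finsum]
      simp only [hAB0]
  have sE : mode (nopE 0 (e₁ * e₃) (deriv 0 A) E) n v = ∑ᶠ x, fE x := by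
    rw [finsum_curry fE hfE, mode_nopE_apply]
    refine finsum_congr fun r => ?_
    dsimp only [fE]
    rw [finsum_step]
    simp only [nopTerm, mode_deriv, LinearMap.smul_apply, map_smul]
    split_ifs
    · simp
    · rw [smul_comm]; simp
  have sF : mode (nopE 0 (e₁ * e₂) (deriv 0 B) F) n v = ∑ᶠ x, fF x := by
    rw [finsum_curry fF hfF, mode_nopE_apply]
    refine finsum_congr fun r => ?_
    dsimp only [fF]
    rw [finsum_step]
    simp only [nopTerm, mode_deriv, LinearMap.smul_apply, map_smul]
    split_ifs
    · simp
    · rw [smul_comm]; simp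
  -- This changes coordinates from (mode of A, mode of B) to (mode of :AB:, mode of A), after which
  -- both sides can be compared term by term.
  let σ : ℤ × ℤ ≃ ℤ × ℤ := ⟨fun x => (x.1 + x.2, x.1), fun x => (x.2, x.1 - x.2),
    fun x => by simp, fun x => by simp⟩
  rw [← finsum_comp_equiv σ] at sg
  rw [← finsum_comp_equiv (Equiv.prodComm ℤ ℤ)] at sF
  simp only [LinearMap.sub_apply, LinearMap.smul_apply, mode_sub, mode_smul]
  rw [sf, sg, sE, sF, smul_finsum, smul_finsum]
  have hfE' : (fun x => e₂ • fE x).HasFiniteSupport :=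
    hfE.subset (Function.support_const_smul_subset _ _)
  have hfF' : (fun x => (e₁ * e₃) • fF (Equiv.prodComm ℤ ℤ x)).HasFiniteSupport :=
    (hfF.preimage (Equiv.prodComm ℤ ℤ).injective.injOn).subset
      (Function.support_const_smul_subset _ _)
  rw [← finsum_sub_distrib hf hfE', ← finsum_sub_distrib (hf.fun_sub hfE') hfF']
  refine finsum_congr fun x => ?_
  obtain ⟨r, t⟩ := x
  have i1 : r + t - r = t := by ring
  have i2 : n - (r + t) = n - r - t := by ring
  have i3 : n - r - t + t = n - r := by ring
  have i4 : n - r - t + r = n - t := by ring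
  have q1 : (r ≤ -t) = (t ≤ -r) := by rw [eq_iff_iff]; omega
  have q2 : (r + t ≤ 0) = (t ≤ -r) := by rw [eq_iff_iff]; omega
  have q3 : (t + r ≤ 0) = (t ≤ -r) := by rw [eq_iff_iff]; omega
  simp only [f, g, fE, fF, σ, Equiv.coe_fn_mk, Equiv.prodComm_apply, Prod.swap_prod_mk, nopTerm,
    neg_zero, i1, i2, q1, q2]
  have k1 : mode C (n - r - t) (mode B t v) = e₂ • mode B t (mode C (n - r - t) v)
      + mode E (n - r) v := by rw [hCB', i3]
  have k2 : ∀ w, mode C (n - r - t) (mode A r w) = e₃ • mode A r (mode C (n - r - t) w)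
      + mode F (n - t) w := fun w => by rw [hCA', i4]
  have k3 : ∀ w, mode C (n - r - t) (mode B t w) = e₂ • mode B t (mode C (n - r - t) w)
      + mode E (n - r) w := fun w => by rw [hCB', i3]
  -- The ordering of a term depends only on the signs of r, t and r + t. Where the two sides order
  -- the modes differently, the commutators needed to reconcile them are the corrections `fE` and
  -- `fF`.
  obtain rfl | rfl := mul_self_eq_one_iff.1 h₁ <;> obtain rfl | rfl := mul_self_eq_one_iff.1 h₂ <;>
  obtain rfl | rfl := mul_self_eq_one_iff.1 h₃ <;>
  by_cases hr : r ≤ 0 <;> by_cases ht : t ≤ 0 <;> by_cases hs : t ≤ -r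
  all_goals first
    | (exfalso; omega)
    | simp only [hr, ht, hs, if_true, if_false]
  all_goals first
    | module
    | (simp only [k1, map_add, map_smul]; module)
    | (simp only [k2, map_add, map_smul]; module)
    | (simp only [hAB', k2, map_add, map_smul]; module)
    | (simp only [hAB', k3, map_smul]; module)

end Calculus

end AffineOsp

end

noncomputable section

namespace AffineOsp

/-! ### Commutators linear in the mode number -/

section Bracket

variable {V : Type*} [AddCommGroup V] [Module ℂ V]

@[simp] lemma fields_neg_smul (c : ℂ) (A : fields V) : (-c) • A = -(c • A) := neg_smul c A

/-- The relation `A_m B_n = e B_n A_m + C_{m+n} + m D_{m+n}` between fields. -/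
def LB (e : ℂ) (A B C D : fields V) : Prop := ∀ m n : ℤ,
  mode A m * mode B n = e • (mode B n * mode A m) + mode C (m + n) + (m : ℂ) • mode D (m + n)

lemma deriv_smul (h : ℤ) (c : ℂ) (A : fields V) : deriv h (c • A) = c • deriv h A :=
  fields_ext fun n => by simp [smul_smul, mul_comm]

lemma deriv_neg (h : ℤ) (A : fields V) : deriv h (-A) = -deriv h A :=
  fields_ext fun n => by simp

@[simp] lemma deriv_zero (h : ℤ) : deriv h (0 : fields V) = 0 :=
  fields_ext fun n => by simp

@[simp] lemma deriv_oneF : deriv 0 (oneF : fields V) = 0 :=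
  fields_ext fun n => by
    rw [mode_deriv, mode_oneF]
    split_ifs with h <;> simp [h]

namespace LB

variable {e eA eB e₁ : ℂ} {h : ℤ} {X A A' B B' C C' D D' E R R' J : fields V}

lemma congr (H : LB e A B C D) (hC : C = C') (hD : D = D') : LB e A B C' D' := hC ▸ hD ▸ H

/-- In the exchanged relation the coefficient m has to be written as (m + n) - n. The part m + n is
absorbed by the derivative of `D`, whose mode m + n carries the factor -(m + n). -/
lemma skew (H : LB e A B C D) (he : e * e = 1 := by norm_num) (hC : C' = -e • (C - deriv 0 D))
    (hD : D' = e • D) : LB e B A C' D' := by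
  intro n m
  have h1 := congrArg (fun T => e • T) (H m n)
  simp only [smul_add, smul_smul, he, one_smul] at h1
  subst hC hD
  rw [add_comm n m]
  simp only [mode_smul, mode_sub, mode_deriv, h1]
  push_cast
  module

lemma zero_left (e : ℂ) (B : fields V) : LB e 0 B 0 0 := fun m n => by simp
lemma zero_right (e : ℂ) (B : fields V) : LB e B 0 0 0 := fun m n => by simp

lemma one_left (B : fields V) : LB 1 oneF B 0 0 := fun m n => by
  rw [mode_oneF]; split_ifs <;> simp

lemma one_right (B : fields V) : LB 1 B oneF 0 0 := fun m n => by
  rw [mode_oneF]; split_ifs <;> simp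

lemma add_right (H : LB e A B C D) (H' : LB e A B' C' D') :
    LB e A (B + B') (C + C') (D + D') := fun m n => by
  simp only [mode_add, mul_add, add_mul, H m n, H' m n]; module

lemma add_left (H : LB e A B C D) (H' : LB e A' B C' D') :
    LB e (A + A') B (C + C') (D + D') := fun m n => by
  simp only [mode_add, mul_add, add_mul, H m n, H' m n]; module

lemma smul_right (c : ℂ) (H : LB e A B C D) : LB e A (c • B) (c • C) (c • D) := fun m n => by
  simp only [mode_smul, mul_smul_comm, smul_mul_assoc, H m n]; module

lemma smul_left (c : ℂ) (H : LB e A B C D) : LB e (c • A) B (c • C) (c • D) := fun m n => by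
  simp only [mode_smul, mul_smul_comm, smul_mul_assoc, H m n]; module

lemma neg_right (H : LB e A B C D) : LB e A (-B) (-C) (-D) := by
  simpa only [fields_neg_smul, one_smul] using H.smul_right (-1)

lemma neg_left (H : LB e A B C D) : LB e (-A) B (-C) (-D) := by
  simpa only [fields_neg_smul, one_smul] using H.smul_left (-1)

lemma neg_left₀ (H : LB e A B C 0) : LB e (-A) B (-C) 0 := H.neg_left.congr rfl neg_zero

lemma smul_left₀ (c : ℂ) (H : LB e A B C 0) : LB e (c • A) B (c • C) 0 :=
  (H.smul_left c).congr rfl (smul_zero c)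

lemma sub_right (H : LB e A B C D) (H' : LB e A B' C' D') :
    LB e A (B - B') (C - C') (D - D') := by
  simpa only [sub_eq_add_neg] using H.add_right H'.neg_right

lemma sum_right {ι : Type*} (s : Finset ι) {B C D : ι → fields V}
    (H : ∀ i ∈ s, LB e A (B i) (C i) (D i)) :
    LB e A (∑ i ∈ s, B i) (∑ i ∈ s, C i) (∑ i ∈ s, D i) := by
  induction s using Finset.cons_induction with
  | empty => exact zero_right e A
  | cons a s ha ih =>
    simp only [Finset.sum_cons]
    exact (H a (by simp)).add_right (ih fun i hi => H i (by simp [hi]))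

lemma sum_left {ι : Type*} (s : Finset ι) {A C D : ι → fields V}
    (H : ∀ i ∈ s, LB e (A i) B (C i) (D i)) :
    LB e (∑ i ∈ s, A i) B (∑ i ∈ s, C i) (∑ i ∈ s, D i) := by
  induction s using Finset.cons_induction with
  | empty => exact zero_left e B
  | cons a s ha ih =>
    simp only [Finset.sum_cons]
    exact (H a (by simp)).add_left (ih fun i hi => H i (by simp [hi]))

lemma deriv_right (H : LB e A B C 0) : LB e A (deriv h B) (deriv h C) C := fun m n => by
  have := H m n
  simp only [mode_zero, smul_zero, add_zero] at this
  simp only [mode_deriv, mul_smul_comm, smul_mul_assoc, this]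
  push_cast
  module

/-- The Wick formula. -/
theorem nop (hA : LB eA X A C C') (hB : LB eB X B D D') (hE : LB e₁ C B E 0)
    (hE' : LB e₁ C' B 0 0) {e₃ : ℂ} (h₀ : eA * eA = 1 := by norm_num)
    (h₁ : e * eB = e₁ := by norm_num) (h₃ : eA * eB = e₃ := by norm_num)
    (hR : R = nopE h e₁ C B + eA • nopE h (e * eA) A D)
    (hR' : R' = nopE h e₁ C' B + eA • nopE h (e * eA) A D' + E) :
    LB e₃ X (nopE h e A B) R R' := by
  intro m n
  subst h₁ h₃ hR hR'
  rw [mul_mode_nopE (mode X m) h e eA eB A B (C + (m : ℂ) • C') (D + (m : ℂ) • D') E m n h₀]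
  · simp only [nopE_add_left, nopE_add_right, nopE_smul_left, nopE_smul_right, mode_add, mode_smul]
    module
  · intro l
    rw [hA m l, add_comm m l]
    simp only [mode_add, mode_smul]
    module
  · intro l
    rw [hB m l, add_comm m l]
    simp only [mode_add, mode_smul]
    module
  · intro p q hpq
    have h1 := hE p q
    have h2 := hE' p q
    simp only [mode_zero, smul_zero, add_zero, hpq] at h1 h2
    simp only [mode_add, mode_smul, add_mul, mul_add, smul_mul_assoc, mul_smul_comm, h1, h2]
    module

/-- Two fields that both commute with `X` up to signs have a product which does so. -/
lemma nop_zero (hA : LB eA X A 0 0) (hB : LB eB X B 0 0) {e₃ : ℂ}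
    (h₀ : eA * eA = 1 := by norm_num) (h₃ : eA * eB = e₃ := by norm_num) :
    LB e₃ X (nopE h e A B) 0 0 :=
  hA.nop hB (zero_left (e * eB) B) (zero_left _ B) h₀ rfl h₃ (by simp) (by simp)

/-- The Jacobi identity. -/
theorem jacobi {c d : ℂ} (hc : c ≠ 0) (hJ : LB e A B (c • J) (d • oneF)) {U U' W W' P P' S S' :
    fields V} (hA : LB eA X A U U') (hB : LB eB X B W W') {e₂ e₃ : ℂ}
    (hP : LB e₁ U B P P') (hS : LB e₂ A W S S') (hU' : LB e₁ U' B 0 0) (hW' : LB e₂ A W' 0 0)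
    (h₁ : e * eB = e₁ := by norm_num) (h₂ : e * eA = e₂ := by norm_num)
    (h₀ : eA * eA = 1 := by norm_num)
    (h₃ : eA * eB = e₃ := by norm_num)
    (hR : R = c⁻¹ • (P + eA • S)) (hR' : R' = c⁻¹ • P') : LB e₃ X J R R' := by
  intro l s
  subst h₁ h₂ h₃ hR hR'
  -- Only the mode zero of `A` is used. The central term of its bracket is multiplied by the mode
  -- number 0, so every mode of `J` is a pure commutator.
  have j0 : mode J s = c⁻¹ • (mode A 0 * mode B s - e • (mode B s * mode A 0)) := by
    have := hJ 0 s
    rw [this]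
    simp [smul_smul, hc]
  have a0 := hA l 0
  have b0 := hB l s
  have p0 := hP l s
  have s0 := hS 0 (l + s)
  have u0 := hU' l s
  have w0 := hW' 0 (l + s)
  simp only [add_zero, Int.cast_zero, zero_smul, zero_add, mode_zero, smul_zero] at a0 b0 p0 s0 u0 w0
  have x1 : mode X l * (mode A 0 * mode B s) = (eA * eB) • (mode A 0 * mode B s * mode X l)
      + eA • (mode A 0 * mode W (l + s)) + (eA * l) • (mode A 0 * mode W' (l + s))
      + mode U l * mode B s + (l : ℂ) • (mode U' l * mode B s) := by
    rw [← mul_assoc, a0]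
    simp only [add_mul, smul_mul_assoc, mul_assoc, b0, mul_add, mul_smul_comm]
    module
  have x2 : mode X l * (mode B s * mode A 0) = (eA * eB) • (mode B s * mode A 0 * mode X l)
      + eB • (mode B s * mode U l) + (eB * l) • (mode B s * mode U' l)
      + mode W (l + s) * mode A 0 + (l : ℂ) • (mode W' (l + s) * mode A 0) := by
    rw [← mul_assoc, b0]
    simp only [add_mul, smul_mul_assoc, mul_assoc, a0, mul_add, mul_smul_comm]
    module
  rw [j0]
  simp only [mul_smul_comm, mul_sub, x1, x2, p0, s0, u0, w0, smul_mul_assoc, sub_mul, mode_smul,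
    mode_add]
  obtain rfl | rfl := mul_self_eq_one_iff.1 h₀ <;> module

end LB

/-- `T` commutes with all modes of `A` up to the sign `e`. -/
def OpComm (e : ℂ) (T : Module.End ℂ V) (A : fields V) : Prop :=
  ∀ n, T * mode A n = e • (mode A n * T)

namespace OpComm

variable {e eA eB e₁ : ℂ} {h : ℤ} {T : Module.End ℂ V} {A B : fields V}

lemma add (hA : OpComm e T A) (hB : OpComm e T B) : OpComm e T (A + B) := fun n => by
  rw [mode_add, mul_add, hA n, hB n, add_mul, smul_add]

lemma smul (c : ℂ) (hA : OpComm e T A) : OpComm e T (c • A) := fun n => by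
  rw [mode_smul, mul_smul_comm, hA n, smul_mul_assoc, smul_comm]

lemma neg (hA : OpComm e T A) : OpComm e T (-A) := fun n => by
  rw [mode_neg, mul_neg, hA n, neg_mul, smul_neg]

lemma sub (hA : OpComm e T A) (hB : OpComm e T B) : OpComm e T (A - B) := by
  rw [sub_eq_add_neg]; exact hA.add hB.neg

lemma nop (hA : OpComm eA T A) (hB : OpComm eB T B) {e₃ : ℂ} (h₀ : eA * eA = 1 := by norm_num)
    (h₃ : eA * eB = e₃ := by norm_num) : OpComm e₃ T (nopE h e A B) := fun n => by
  have := mul_mode_nopE T h e eA eB A B 0 0 0 0 n h₀ (by simpa [OpComm] using hA)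
    (by simpa [OpComm] using hB)
    (by simp)
  simpa [h₃] using this

end OpComm

/-- Products of two fields commuting up to a sign. -/
lemma nopE_comm {h h' : ℤ} {e : ℂ} {A B : fields V} (H : LB e A B 0 0)
    (he : e * e = 1 := by norm_num) : nopE h e A B = e • nopE h' e B A := by
  refine fields_ext fun n => ?_
  rw [mode_nopE_comm h h' e he A B 0 n fun p q => by simpa using H p q]
  simp

lemma nopE_assoc' {e₁ e₂ e₃ : ℂ} {A B C E F : fields V} (hAB : LB e₁ A B 0 0)
    (hCB : LB e₂ C B E 0) (hCA : LB e₃ C A F 0) (h₁ : e₁ * e₁ = 1 := by norm_num)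
    (h₂ : e₂ * e₂ = 1 := by norm_num) (h₃ : e₃ * e₃ = 1 := by norm_num) :
    nopE 0 (e₂ * e₃) (nopE 0 e₁ A B) C = nopE 0 (e₁ * e₃) A (nopE 0 e₂ B C)
      - e₂ • nopE 0 (e₁ * e₃) (deriv 0 A) E - (e₁ * e₃) • nopE 0 (e₁ * e₂) (deriv 0 B) F :=
  nopE_assoc e₁ e₂ e₃ h₁ h₂ h₃ A B C E F (fun p q => by simpa using hAB p q)
    (fun p q => by simpa using hCB p q) (fun p q => by simpa using hCA p q)

lemma nopE_self_eq_zero {A : fields V} (H : LB (-1) A A 0 0) {h : ℤ} : nopE h (-1) A A = 0 := by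
  have := nopE_comm (h := h) (h' := h) H
  rw [fields_neg_smul, one_smul, eq_neg_iff_add_eq_zero, ← two_smul ℂ] at this
  exact (smul_eq_zero.1 this).resolve_left two_ne_zero

end Bracket

end AffineOsp

end

noncomputable section

namespace AffineOsp

open Gen

/-! ### The Wakimoto realization -/

/-- The commutation relations of a system of free fields. -/
structure FreeFields {V : Type*} [AddCommGroup V] [Module ℂ V] (β γ p ψ φ : fields V) : Prop where
  ββ : LB 1 β β 0 0
  βγ : LB 1 β γ oneF 0
  γγ : LB 1 γ γ 0 0
  pp : LB (-1) p p 0 0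
  pψ : LB (-1) p ψ oneF 0
  ψψ : LB (-1) ψ ψ 0 0
  φφ : LB 1 φ φ 0 oneF
  βp : LB 1 β p 0 0
  βψ : LB 1 β ψ 0 0
  βφ : LB 1 β φ 0 0
  γp : LB 1 γ p 0 0
  γψ : LB 1 γ ψ 0 0
  γφ : LB 1 γ φ 0 0
  pφ : LB 1 p φ 0 0
  ψφ : LB 1 ψ φ 0 0

namespace FreeFields

variable {V : Type*} [AddCommGroup V] [Module ℂ V] {β γ p ψ φ : fields V} {k a : ℂ}

local notation "Jp" => p - nopE 1 1 β ψ
local notation "Jt" => -nopE 1 1 β γ + (a / 2) • φ - (1 / 2 : ℂ) • nopE 0 (-1) ψ p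
local notation "Jm" => nopE 0 1 γ (p - nopE 1 1 β ψ) + a • nopE 0 1 ψ φ + (2 * k + 1) • deriv 0 ψ
local notation "Jmm" => nopE 1 1 β (nopE 0 1 γ γ) - a • nopE 0 1 γ φ
  + nopE 0 1 γ (nopE 0 (-1) ψ p) - k • deriv 0 γ + (k + 1) • nopE 0 (-1) ψ (deriv 0 ψ)

variable (F : FreeFields β γ p ψ φ)
include F

lemma γβ : LB 1 γ β (-oneF) 0 := F.βγ.skew (hC := by simp) (hD := by simp)
lemma ψp : LB (-1) ψ p oneF 0 := F.pψ.skew (hC := by simp) (hD := by simp)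
lemma pβ : LB 1 p β 0 0 := F.βp.skew (hC := by simp) (hD := by simp)
lemma ψβ : LB 1 ψ β 0 0 := F.βψ.skew (hC := by simp) (hD := by simp)
lemma φβ : LB 1 φ β 0 0 := F.βφ.skew (hC := by simp) (hD := by simp)
lemma pγ : LB 1 p γ 0 0 := F.γp.skew (hC := by simp) (hD := by simp)
lemma ψγ : LB 1 ψ γ 0 0 := F.γψ.skew (hC := by simp) (hD := by simp)
lemma φγ : LB 1 φ γ 0 0 := F.γφ.skew (hC := by simp) (hD := by simp)
lemma φp : LB 1 φ p 0 0 := F.pφ.skew (hC := by simp) (hD := by simp)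
lemma φψ : LB 1 φ ψ 0 0 := F.ψφ.skew (hC := by simp) (hD := by simp)

/-! Brackets of `β`. -/

lemma β_Jp : LB 1 β Jp 0 0 :=
  (F.βp.sub_right (F.ββ.nop_zero (e₃ := 1) F.βψ)).congr (by simp) (by simp)

lemma β_βγ : LB 1 β (nopE 1 1 β γ) β 0 :=
  F.ββ.nop F.βγ (LB.zero_left 1 γ) (LB.zero_left 1 γ) (hR := by simp) (hR' := by simp)

lemma β_ψp : LB 1 β (nopE 0 (-1) ψ p) 0 0 := F.βψ.nop_zero F.βp

lemma β_Jt : LB 1 β Jt (-β) 0 :=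
  ((F.β_βγ.neg_right.add_right (F.βφ.smul_right _)).sub_right (F.β_ψp.smul_right _)).congr
    (by simp) (by simp)

lemma β_dψ : LB 1 β (deriv 0 ψ) 0 0 := F.βψ.deriv_right.congr (by simp) rfl

lemma β_Jm : LB 1 β Jm Jp 0 :=
  (((F.βγ.nop (e₃ := 1) F.β_Jp (LB.one_left _) (LB.zero_left 1 _) (hR := rfl) (hR' := rfl)).add_right
    ((F.βψ.nop_zero (e₃ := 1) F.βφ).smul_right _)).add_right (F.β_dψ.smul_right _)).congr
    (by simp) (by simp)

lemma β_γγ : LB 1 β (nopE 0 1 γ γ) ((2 : ℂ) • γ) 0 :=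
  F.βγ.nop F.βγ (LB.one_left _) (LB.zero_left 1 _) (hR := by simp [two_smul]) (hR' := by simp)

lemma β_Jmm : LB 1 β Jmm ((-2 : ℂ) • (Jt)) (-k • oneF) := by
  have h1 := F.ββ.nop (e₃ := 1) F.β_γγ (h := 1) (e := 1) (LB.zero_left 1 _) (LB.zero_left 1 _)
    (hR := rfl) (hR' := rfl)
  have h2 := F.βγ.nop (e₃ := 1) F.βφ (h := 0) (e := 1) (LB.one_left _) (LB.zero_left 1 _)
    (hR := rfl) (hR' := rfl)
  have h3 := F.βγ.nop (e₃ := 1) F.β_ψp (h := 0) (e := 1) (LB.one_left _) (LB.zero_left 1 _)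
    (hR := rfl) (hR' := rfl)
  have h4 := F.βψ.nop_zero (e₃ := 1) F.β_dψ (h := 0) (e := -1)
  have h5 := F.βγ.deriv_right (h := 0)
  refine ((((h1.sub_right (h2.smul_right a)).add_right h3).sub_right (h5.smul_right k)).add_right
    (h4.smul_right (k + 1))).congr ?_ ?_
  · simp; module
  · simp

/-! Brackets of `γ`. -/

lemma γ_Jp : LB 1 γ Jp ψ 0 :=
  (F.γp.sub_right (F.γβ.nop (e₃ := 1) F.γψ ((LB.one_left _).neg_left₀) (LB.zero_left 1 _) (hR := rfl)
    (hR' := rfl))).congr (by simp) (by simp)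

lemma γ_Jm : LB 1 γ Jm (nopE 0 1 γ ψ) 0 := by
  have h1 := F.γγ.nop (e₃ := 1) F.γ_Jp (h := 0) (e := 1) (LB.zero_left 1 _) (LB.zero_left 1 _)
    (hR := rfl) (hR' := rfl)
  have h2 := F.γψ.nop_zero (e₃ := 1) F.γφ (h := 0) (e := 1)
  have h3 := F.γψ.deriv_right (h := 0)
  refine ((h1.add_right (h2.smul_right a)).add_right (h3.smul_right (2 * k + 1))).congr ?_ ?_
  · simp
  · simp

lemma γ_Jmm : LB 1 γ Jmm (-nopE 0 1 γ γ) 0 := by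
  have h1 := F.γβ.nop (e₃ := 1) (F.γγ.nop_zero (e₃ := 1) F.γγ (h := 0) (e := 1)) (h := 1) (e := 1)
    ((LB.one_left _).neg_left₀) (LB.zero_left 1 _)
    (hR := rfl) (hR' := rfl)
  have h2 := F.γγ.nop_zero (e₃ := 1) F.γφ (h := 0) (e := 1)
  have h3 := F.γγ.nop_zero (e₃ := 1) (F.γψ.nop_zero (e₃ := 1) F.γp (h := 0) (e := -1)) (h := 0) (e := 1)
  have h4 := F.γψ.nop_zero (e₃ := 1) (F.γψ.deriv_right (h := 0) |>.congr (deriv_zero 0) rfl)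
    (h := 0) (e := -1)
  have h5 := F.γγ.deriv_right (h := 0)
  refine ((((h1.sub_right (h2.smul_right a)).add_right h3).sub_right (h5.smul_right k)).add_right
    (h4.smul_right (k + 1))).congr ?_ ?_
  · simp
  · simp

/-! Brackets of `ψ`. -/

lemma ψ_Jp : LB (-1) ψ Jp oneF 0 := by
  refine (F.ψp.sub_right (F.ψβ.nop_zero (e₃ := -1) F.ψψ)).congr ?_ ?_ <;> simp

lemma ψ_ψp : LB 1 ψ (nopE 0 (-1) ψ p) (-ψ) 0 :=
  F.ψψ.nop F.ψp (e := -1) (LB.zero_left 1 _) (LB.zero_left 1 _) (hR := by simp) (hR' := by simp)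

lemma ψ_Jm : LB (-1) ψ Jm γ 0 := by
  have h1 := F.ψγ.nop (e₃ := -1) F.ψ_Jp (h := 0) (e := 1) (LB.zero_left (-1) _) (LB.zero_left (-1) _)
    (hR := rfl) (hR' := rfl)
  have h2 := F.ψψ.nop_zero (e₃ := -1) F.ψφ (h := 0) (e := 1)
  have h3 := F.ψψ.deriv_right (h := 0)
  refine ((h1.add_right (h2.smul_right a)).add_right (h3.smul_right (2 * k + 1))).congr ?_ ?_
  · simp
  · simp

lemma ψ_Jmm : LB 1 ψ Jmm (-nopE 0 1 γ ψ) 0 := by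
  have h1 := F.ψβ.nop_zero (e₃ := 1) (F.ψγ.nop_zero (e₃ := 1) F.ψγ (h := 0) (e := 1)) (h := 1) (e := 1)
  have h2 := F.ψγ.nop_zero (e₃ := 1) F.ψφ (h := 0) (e := 1)
  have h3 := F.ψγ.nop (e₃ := 1) F.ψ_ψp (h := 0) (e := 1) (LB.zero_left 1 _) (LB.zero_left 1 _)
    (hR := rfl) (hR' := rfl)
  have h4 := F.ψψ.nop_zero (e₃ := 1) (F.ψψ.deriv_right (h := 0) |>.congr (deriv_zero 0) rfl)
    (h := 0) (e := -1)
  have h5 := F.ψγ.deriv_right (h := 0)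
  refine ((((h1.sub_right (h2.smul_right a)).add_right h3).sub_right (h5.smul_right k)).add_right
    (h4.smul_right (k + 1))).congr ?_ ?_
  · simp
  · simp

/-! Brackets of `φ`. -/

lemma φ_Jp : LB 1 φ Jp 0 0 := by
  refine (F.φp.sub_right (F.φβ.nop_zero (e₃ := 1) F.φψ)).congr ?_ ?_ <;> simp

lemma φ_Jm : LB 1 φ Jm 0 (a • ψ) := by
  have h1 := F.φγ.nop_zero (e₃ := 1) F.φ_Jp (h := 0) (e := 1)
  have h2 := F.φψ.nop (e₃ := 1) F.φφ (h := 0) (e := 1) (LB.zero_left 1 _) (LB.zero_left 1 _)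
    (hR := rfl) (hR' := rfl)
  have h3 := F.φψ.deriv_right (h := 0)
  refine ((h1.add_right (h2.smul_right a)).add_right (h3.smul_right (2 * k + 1))).congr ?_ ?_
  · simp
  · simp

lemma φ_Jmm : LB 1 φ Jmm 0 (-a • γ) := by
  have h1 := F.φβ.nop_zero (e₃ := 1) (F.φγ.nop_zero (e₃ := 1) F.φγ (h := 0) (e := 1)) (h := 1) (e := 1)
  have h2 := F.φγ.nop (e₃ := 1) F.φφ (h := 0) (e := 1) (LB.zero_left 1 _) (LB.zero_left 1 _)
    (hR := rfl) (hR' := rfl)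
  have h3 := F.φγ.nop_zero (e₃ := 1) (F.φψ.nop_zero (e₃ := 1) F.φp (h := 0) (e := -1)) (h := 0) (e := 1)
  have h4 := F.φψ.nop_zero (e₃ := 1) (F.φψ.deriv_right (h := 0) |>.congr (deriv_zero 0) rfl)
    (h := 0) (e := -1)
  have h5 := F.φγ.deriv_right (h := 0)
  refine ((((h1.sub_right (h2.smul_right a)).add_right h3).sub_right (h5.smul_right k)).add_right
    (h4.smul_right (k + 1))).congr ?_ ?_
  · simp
  · simp

/-! Brackets of `j⁺`. -/

lemma Jp_β : LB 1 Jp β 0 0 := F.β_Jp.skew (hC := by simp) (hD := by simp)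
lemma Jp_γ : LB 1 Jp γ (-ψ) 0 := F.γ_Jp.skew (hC := by simp) (hD := by simp)
lemma Jp_ψ : LB (-1) Jp ψ oneF 0 := F.ψ_Jp.skew (hC := by simp) (hD := by simp)
lemma Jp_φ : LB 1 Jp φ 0 0 := F.φ_Jp.skew (hC := by simp) (hD := by simp)

lemma p_βψ : LB (-1) p (nopE 1 1 β ψ) β 0 :=
  F.pβ.nop F.pψ (LB.zero_left (-1) _) (LB.zero_left (-1) _) (hR := by simp) (hR' := by simp)

lemma Jp_p : LB (-1) Jp p (-β) 0 :=
  ((F.pp.sub_right F.p_βψ).congr rfl rfl).skew (hC := by simp) (hD := by simp)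

lemma Jp_Jp : LB (-1) Jp Jp ((2 : ℂ) • (-β)) ((0 : ℂ) • oneF) := by
  have h1 := F.Jp_β.nop (e₃ := -1) F.Jp_ψ (h := 1) (e := 1) (LB.zero_left (-1) _) (LB.zero_left (-1) _)
    (hR := rfl) (hR' := rfl)
  refine (F.Jp_p.sub_right h1).congr ?_ ?_
  · simp; module
  · simp

/-! Brackets of `J³`. -/

lemma Jt_β : LB 1 Jt β β 0 := F.β_Jt.skew (hC := by simp) (hD := by simp)

lemma Jt_γ : LB 1 Jt γ (-γ) 0 := by
  have h1 := F.γβ.nop (e₃ := 1) F.γγ (h := 1) (e := 1) ((LB.one_left _).neg_left₀) (LB.zero_left 1 _)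
    (hR := rfl) (hR' := rfl)
  have h2 := F.γψ.nop_zero (e₃ := 1) F.γp (h := 0) (e := -1)
  exact ((h1.neg_right.add_right (F.γφ.smul_right (a / 2))).sub_right
    (h2.smul_right (1 / 2))).skew (hC := by simp) (hD := by simp)

lemma Jt_ψ : LB 1 Jt ψ (-(1 / 2 : ℂ) • ψ) 0 := by
  have h1 := F.ψβ.nop_zero (e₃ := 1) F.ψγ (h := 1) (e := 1)
  exact ((h1.neg_right.add_right (F.ψφ.smul_right (a / 2))).sub_right
    (F.ψ_ψp.smul_right (1 / 2))).skew (hC := by simp) (hD := by simp)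

lemma Jt_p : LB 1 Jt p ((1 / 2 : ℂ) • p) 0 := by
  have h1 := F.pβ.nop_zero (e₃ := 1) F.pγ (h := 1) (e := 1)
  have h2 := F.pψ.nop (e₃ := 1) F.pp (h := 0) (e := -1) (LB.one_left _) (LB.zero_left 1 _)
    (hR := rfl) (hR' := rfl)
  exact ((h1.neg_right.add_right (F.pφ.smul_right (a / 2))).sub_right
    (h2.smul_right (1 / 2))).skew (hC := by simp) (hD := by simp)

lemma Jt_φ : LB 1 Jt φ 0 ((a / 2) • oneF) := by
  have h1 := F.φβ.nop_zero (e₃ := 1) F.φγ (h := 1) (e := 1)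
  have h2 := F.φψ.nop_zero (e₃ := 1) F.φp (h := 0) (e := -1)
  exact ((h1.neg_right.add_right (F.φφ.smul_right (a / 2))).sub_right
    (h2.smul_right (1 / 2))).skew (hC := by simp [deriv_smul]) (hD := by simp)

lemma Jt_Jp : LB 1 Jt Jp ((1 / 2 : ℂ) • (Jp)) 0 := by
  have h1 := (F.Jt_β (a := a)).nop (e₃ := 1) F.Jt_ψ (h := 1) (e := 1) F.βψ (LB.zero_left 1 _)
    (hR := rfl) (hR' := rfl)
  refine (F.Jt_p.sub_right h1).congr ?_ ?_
  · simp; module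
  · simp

/-- The relation between a and k is forced here: the double contractions contribute -1, a²/2 and
-(2k+1)/2 times ψ, and these must cancel. -/
lemma Jt_Jm (ha : a ^ 2 = 2 * k + 3) : LB 1 Jt Jm (-(1 / 2 : ℂ) • (Jm)) 0 := by
  have h1 := (F.Jt_γ (a := a)).nop (e₃ := 1) F.Jt_Jp (h := 0) (e := 1) F.γ_Jp.neg_left₀ (LB.zero_left 1 _)
    (hR := rfl) (hR' := rfl)
  have h2 := (F.Jt_ψ (a := a)).nop (e₃ := 1) F.Jt_φ (h := 0) (e := 1) (F.ψφ.smul_left₀ _) (LB.zero_left 1 _)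
    (hR := rfl) (hR' := rfl)
  have h3 := (F.Jt_ψ (a := a)).deriv_right (h := 0)
  refine ((h1.add_right (h2.smul_right a)).add_right (h3.smul_right (2 * k + 1))).congr ?_ ?_
  · simp [deriv_smul, deriv_neg]; module
  · simp [smul_smul, show a * (a / 2) = a ^ 2 / 2 by ring, ha]; module

/-! Brackets of `j⁺` and `j⁻` with each other. -/

/-- Reassociation has no corrections, since ψ has no contraction with itself or with β, and the
product reduces to :ψψ: = 0. -/
lemma nopE_ψ_ψβ : nopE 0 (-1) ψ (nopE 1 1 β ψ) = 0 := by
  have h := nopE_assoc' F.ψψ F.βψ F.βψ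
  rw [nopE_self_eq_zero F.ψψ] at h
  rw [nopE_comm F.βψ (h := 1) (h' := 0), one_smul]
  simpa using h.symm

/-- The weights 0 and 1 add up to 1, so reordering costs n times the mode n of the identity field,
which is always zero. -/
lemma nopE_γ_β : nopE 0 1 γ β = nopE 1 1 β γ := by
  refine fields_ext fun n => ?_
  rw [mode_nopE_comm 0 1 1 (by norm_num) γ β (-oneF) n fun p q => by simpa using F.γβ p q]
  by_cases hn : n = 0 <;> simp [mode_oneF, hn]

/-- The level comes out as 2k = (2k + 1) - 1: the first part is due to ∂ψ, the second to the double
contraction with the cubic term of j⁻. -/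
lemma Jp_Jm : LB (-1) Jp Jm ((2 : ℂ) • (Jt)) ((2 * k) • oneF) := by
  have h1 := F.Jp_γ.nop (e₃ := -1) F.Jp_Jp (h := 0) (e := 1) F.ψ_Jp.neg_left₀ (LB.zero_left _ _)
    (hR := rfl) (hR' := rfl)
  have h2 := F.Jp_ψ.nop (e₃ := -1) F.Jp_φ (h := 0) (e := 1) (LB.one_left _) (LB.zero_left 1 _)
    (hR := rfl) (hR' := rfl)
  have h3 := F.Jp_ψ.deriv_right (h := 0)
  refine ((h1.add_right (h2.smul_right a)).add_right (h3.smul_right (2 * k + 1))).congr ?_ ?_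
  · simp [F.nopE_ψ_ψβ, F.nopE_γ_β]; module
  · simp; module

end FreeFields

end AffineOsp

end

noncomputable section

namespace AffineOsp

open Gen

namespace FreeFields

variable {V : Type*} [AddCommGroup V] [Module ℂ V] {β γ p ψ φ : fields V} {k a : ℂ}

local notation "Jp" => p - nopE 1 1 β ψ
local notation "Jt" => -nopE 1 1 β γ + (a / 2) • φ - (1 / 2 : ℂ) • nopE 0 (-1) ψ p
local notation "Jm" => nopE 0 1 γ (p - nopE 1 1 β ψ) + a • nopE 0 1 ψ φ + (2 * k + 1) • deriv 0 ψ
local notation "Jmm" => nopE 1 1 β (nopE 0 1 γ γ) - a • nopE 0 1 γ φ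
  + nopE 0 1 γ (nopE 0 (-1) ψ p) - k • deriv 0 γ + (k + 1) • nopE 0 (-1) ψ (deriv 0 ψ)

variable (F : FreeFields β γ p ψ φ)
include F

/-! Brackets of `j⁻`. -/

lemma Jm_β : LB 1 Jm β (-(Jp)) 0 := F.β_Jm.skew (hC := by simp) (hD := by simp)
lemma Jm_γ : LB 1 Jm γ (-nopE 0 1 γ ψ) 0 := F.γ_Jm.skew (hC := by simp) (hD := by simp)
lemma Jm_ψ : LB (-1) Jm ψ γ 0 := F.ψ_Jm.skew (hC := by simp) (hD := by simp)
lemma Jm_φ : LB 1 Jm φ (a • deriv 0 ψ) (a • ψ) :=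
  F.φ_Jm.skew (hC := by simp [deriv_smul]) (hD := by simp)
lemma Jm_Jp : LB (-1) Jm Jp ((2 : ℂ) • (Jt)) ((-(2 * k)) • oneF) :=
  F.Jp_Jm.skew (hC := by simp [deriv_smul]) (hD := by simp)
lemma Jm_Jt (ha : a ^ 2 = 2 * k + 3) : LB 1 Jm Jt ((1 / 2 : ℂ) • (Jm)) 0 :=
  (F.Jt_Jm ha).skew (hC := by simp) (hD := by simp)

lemma nopE_γψ_ψ : nopE 0 (-1) (nopE 0 1 γ ψ) ψ = 0 := by
  have h := nopE_assoc' F.γψ F.ψψ F.ψγ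
  rw [nopE_self_eq_zero F.ψψ] at h
  simpa using h

lemma Jp_γψ : LB (-1) Jp (nopE 0 1 γ ψ) γ 0 :=
  F.Jp_γ.nop F.Jp_ψ F.ψψ.neg_left₀ (LB.zero_left _ _)
    (hR := by simp [nopE_self_eq_zero F.ψψ]) (hR' := by simp)

lemma γψ_Jp : LB (-1) (nopE 0 1 γ ψ) Jp γ 0 := F.Jp_γψ.skew (hC := by simp) (hD := by simp)

lemma nopE_γψ_p : nopE 0 (-1) (nopE 0 1 γ ψ) p = nopE 0 1 γ (nopE 0 (-1) ψ p) + deriv 0 γ := by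
  have h := nopE_assoc' F.γψ F.pψ F.pγ
  simpa using h

/-- The regular part contains ψ twice and vanishes. What is left is the correction from the
contraction of β with γ. -/
lemma nopE_γψ_βψ : nopE 0 (-1) (nopE 0 1 γ ψ) (nopE 1 1 β ψ) = nopE 0 (-1) ψ (deriv 0 ψ) := by
  have h1 : LB 1 γ (nopE 1 1 β ψ) (-ψ) 0 :=
    F.γβ.nop F.γψ ((LB.one_left _).neg_left₀.congr neg_zero rfl) (LB.zero_left 1 _)
      (hR := by simp) (hR' := by simp)
  have h2 : LB 1 (nopE 1 1 β ψ) γ ψ 0 := h1.skew (hC := by simp) (hD := by simp)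
  have h3 : LB (-1) ψ (nopE 1 1 β ψ) 0 0 := F.ψβ.nop_zero F.ψψ
  have h4 : LB (-1) (nopE 1 1 β ψ) ψ 0 0 := h3.skew (hC := by simp) (hD := by simp)
  have h := nopE_assoc' F.γψ h4 h2
  have h5 : LB (-1) ψ (deriv 0 ψ) 0 0 := F.ψψ.deriv_right.congr (deriv_zero 0) rfl
  rw [F.nopE_ψ_ψβ, ] at h
  simp only [mul_one, one_mul, nopE_zero_right, smul_zero, sub_zero] at h
  rw [h, nopE_comm h5 (h := 0) (h' := 0)]
  simp

/-- Reassociating (γγ)β and moving β to the left each cost 2∂γ, and the two corrections cancel. -/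
lemma nopE_γ_βγ : nopE 0 1 γ (nopE 1 1 β γ) = nopE 1 1 β (nopE 0 1 γ γ) := by
  have h := nopE_assoc' F.γγ F.βγ F.βγ
  have h1 : LB 1 (nopE 0 1 γ γ) β ((-2 : ℂ) • γ) 0 :=
    F.β_γγ.skew (hC := by simp) (hD := by simp)
  simp only [mul_one, one_smul, nopE_oneF_right, F.nopE_γ_β] at h
  have h2 : nopE 0 1 (nopE 0 1 γ γ) β = nopE 1 1 β (nopE 0 1 γ γ) - (2 : ℂ) • deriv 0 γ := by
    refine fields_ext fun n => ?_
    rw [mode_nopE_comm 0 1 1 (by norm_num) _ β ((-2 : ℂ) • γ) n fun p q => by simpa using h1 p q]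
    simp only [mode_sub, mode_smul, mode_deriv, one_smul]
    push_cast
    module
  rw [h2, two_smul] at h
  calc _ = nopE 0 1 γ (nopE 1 1 β γ) - deriv 0 γ - deriv 0 γ + deriv 0 γ + deriv 0 γ := by abel
    _ = _ := by rw [← h]; abel

lemma Jm_Jm (ha : a ^ 2 = 2 * k + 3) : LB (-1) Jm Jm ((-2 : ℂ) • (Jmm)) ((0 : ℂ) • oneF) := by
  have h1 := (F.Jm_γ (a := a) (k := k)).nop (e₃ := -1) F.Jm_Jp (h := 0) (e := 1) F.γψ_Jp.neg_left₀
    (LB.zero_left _ _) (hR := rfl) (hR' := rfl)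
  have h2 := (F.Jm_ψ (a := a) (k := k)).nop (e₃ := -1) F.Jm_φ (h := 0) (e := 1) F.γφ
    (LB.zero_left 1 _) (hR := rfl) (hR' := rfl)
  have h3 := (F.Jm_ψ (a := a) (k := k)).deriv_right (h := 0)
  refine ((h1.add_right (h2.smul_right a)).add_right (h3.smul_right (2 * k + 1))).congr ?_ ?_
  · simp only [nopE_neg_left, nopE_sub_right, nopE_add_right, nopE_smul_right, nopE_neg_right,
      F.nopE_γψ_p, F.nopE_γψ_βψ, F.nopE_γ_βγ, one_mul, mul_one, smul_add, smul_sub,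
      smul_neg, smul_smul, mul_neg, neg_smul]
    -- With k eliminated, all coefficients are polynomials in a and are compared without a side
    -- condition.
    obtain rfl : k = (a ^ 2 - 3) / 2 := by linear_combination -(1 / 2) * ha
    module
  · simp only [nopE_zero_left, nopE_smul_right, nopE_oneF_right, mul_one, mul_neg,
      nopE_self_eq_zero F.ψψ, smul_zero]
    module

/-! The remaining brackets. -/

/-- J³ and J⁻ are multiples of the anticommutators {j⁺, j⁻} and {j⁻, j⁻}. Their remaining brackets
therefore follow from the Jacobi identity, without Wick expansions of two composite currents of
degree two or three. -/
lemma Jt_Jt (ha : a ^ 2 = 2 * k + 3) : LB 1 Jt Jt 0 ((k / 2) • oneF) :=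
  LB.jacobi (A := Jp) (B := Jm) (e := -1) two_ne_zero F.Jp_Jm F.Jt_Jp (F.Jt_Jm ha)
    (F.Jp_Jm.smul_left _) (F.Jp_Jm.smul_right _) (LB.zero_left _ _) (LB.zero_right _ _)
    (hR := by simp) (hR' := by simp only [smul_smul]; congr 1; ring)

lemma Jt_Jmm (ha : a ^ 2 = 2 * k + 3) : LB 1 Jt Jmm (-(Jmm)) 0 :=
  LB.jacobi (A := Jm) (B := Jm) (e := -1) (by norm_num) (F.Jm_Jm ha) (F.Jt_Jm ha) (F.Jt_Jm ha)
    ((F.Jm_Jm ha).smul_left _) ((F.Jm_Jm ha).smul_right _) (LB.zero_left _ _) (LB.zero_right _ _)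
    (hR := by module) (hR' := by simp)

lemma Jp_Jmm (ha : a ^ 2 = 2 * k + 3) : LB 1 Jp Jmm Jm 0 :=
  LB.jacobi (A := Jm) (B := Jm) (e := -1) (by norm_num) (F.Jm_Jm ha) F.Jp_Jm F.Jp_Jm
    ((F.Jt_Jm ha).smul_left₀ _) ((F.Jm_Jt ha).smul_right _) ((LB.one_left _).smul_left₀ _ |>.congr
      (smul_zero _) rfl) ((LB.one_right _).smul_right _ |>.congr (smul_zero _) (smul_zero _))
    (hR := by module) (hR' := by simp)

lemma Jmm_β : LB 1 Jmm β ((2 : ℂ) • (Jt)) (-k • oneF) :=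
  F.β_Jmm.skew (hC := by simp [deriv_smul, deriv_neg]) (hD := by simp)
lemma Jmm_γ : LB 1 Jmm γ (nopE 0 1 γ γ) 0 := F.γ_Jmm.skew (hC := by simp) (hD := by simp)
lemma Jmm_ψ : LB 1 Jmm ψ (nopE 0 1 γ ψ) 0 := F.ψ_Jmm.skew (hC := by simp) (hD := by simp)
lemma Jmm_φ : LB 1 Jmm φ (-a • deriv 0 γ) (-a • γ) :=
  F.φ_Jmm.skew (hC := by simp [deriv_smul, deriv_neg]) (hD := by simp)
lemma Jmm_Jp (ha : a ^ 2 = 2 * k + 3) : LB 1 Jmm Jp (-(Jm)) 0 :=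
  (F.Jp_Jmm ha).skew (hC := by simp; abel) (hD := by simp)
lemma Jmm_Jt (ha : a ^ 2 = 2 * k + 3) : LB 1 Jmm Jt (Jmm) 0 :=
  (F.Jt_Jmm ha).skew (hC := by simp; abel) (hD := by simp)

-- A Jacobi identity for single modes: the assumption `hS` compares the two iterated brackets of X
-- and Y with A, and their difference is the bracket of the commutator with A.
omit F in
lemma commutator_comm {e : ℂ} {X Y A U U' W W' : fields V}
    (hX : LB 1 X A U U') (hY : LB e Y A W W') (s q : ℤ)
    (hS : ∀ n, mode X s * (mode W (q + n) + (q : ℂ) • mode W' (q + n))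
      - (mode W (q + n) + (q : ℂ) • mode W' (q + n)) * mode X s
      = mode Y q * (mode U (s + n) + (s : ℂ) • mode U' (s + n))
      - e • ((mode U (s + n) + (s : ℂ) • mode U' (s + n)) * mode Y q)) :
    OpComm e (mode X s * mode Y q - mode Y q * mode X s) A := by
  intro n
  have h1 := hX s n
  have h2 := hY q n
  have h3 := hS n
  rw [one_smul, add_assoc] at h1
  rw [add_assoc] at h2
  generalize mode W (q + n) + (q : ℂ) • mode W' (q + n) = w at h2 h3
  generalize mode U (s + n) + (s : ℂ) • mode U' (s + n) = u at h1 h3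
  have h4 : mode X s * w = mode Y q * u - e • (u * mode Y q) + w * mode X s := by
    rw [← h3, sub_add_cancel]
  rw [sub_mul, mul_assoc, mul_assoc, h1, h2]
  simp only [mul_add, mul_smul_comm, ← mul_assoc, h1, h2, h4]
  simp only [add_mul, smul_mul_assoc, mul_sub, mul_assoc, smul_sub, smul_add]
  module

/-- The Jacobi identity for three copies of j⁻ would presuppose this bracket. Instead, the
commutator R of two modes is shown to commute up to signs with all free fields, hence with J³_0,
which is built from them. On the other hand R has isospin -1 - 1/2 = -3/2 under J³_0, so R = 0. -/
lemma Jmm_Jm (ha : a ^ 2 = 2 * k + 3) : LB 1 Jmm Jm 0 0 := by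
  intro s q
  set R := mode (Jmm) s * mode (Jm) q - mode (Jm) q * mode (Jmm) s with hR
  have rβ : OpComm 1 R β := by
    refine commutator_comm F.Jmm_β F.Jm_β s q fun n => ?_
    have h1 := F.Jmm_Jp ha s (q + n)
    have h2 := F.Jm_Jt ha q (s + n)
    have e1 : mode (oneF : fields V) (s + n) * mode (Jm) q
      = mode (Jm) q * mode (oneF : fields V) (s + n) := by
      rw [mode_oneF]; split_ifs <;> simp
    rw [show q + (s + n) = s + (q + n) by ring] at h2
    rw [mode_neg (Jp), mode_smul _ (Jt)]
    rw [mode_neg (Jm)] at h1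
    rw [mode_smul _ (Jm)] at h2
    clear_value R
    clear hR
    generalize mode (Jmm) s = x at *
    generalize mode (Jp) (q + n) = x1 at *
    generalize mode (Jt) (s + n) = x2 at *
    generalize mode (Jm) (s + (q + n)) = x3 at *
    generalize mode (Jm) q = x4 at *
    simp only [mode_neg, mode_zero, smul_zero, add_zero, mul_neg, neg_mul, mode_smul, mul_add,
      add_mul, mul_smul_comm, smul_mul_assoc, h1, h2, e1]
    module
  have rγ : OpComm 1 R γ := by
    refine commutator_comm F.Jmm_γ F.Jm_γ s q fun n => ?_
    have hγ2 : nopE 0 1 (nopE 0 1 γ γ) ψ = nopE 0 1 γ (nopE 0 1 γ ψ) := by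
      simpa using nopE_assoc' F.γγ F.ψγ F.ψγ
    have hγγ : LB 1 (nopE 0 1 γ γ) ψ 0 0 :=
      LB.skew (F.ψγ.nop_zero F.ψγ) (hC := by simp) (hD := by simp)
    have hγψ : LB 1 (nopE 0 1 γ ψ) γ 0 0 :=
      LB.skew (F.γγ.nop_zero F.γψ) (hC := by simp) (hD := by simp)
    have hγ3 : nopE 0 1 (nopE 0 1 γ ψ) γ = nopE 0 1 γ (nopE 0 1 γ ψ) := by
      simpa using nopE_comm (h := 0) (h' := 0) hγψ
    have h1 := ((F.Jmm_γ (a := a) (k := k)).nop (e₃ := 1) F.Jmm_ψ (h := 0) (e := 1) (R := 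
      (2 : ℂ) • nopE 0 1 γ (nopE 0 1 γ ψ)) (R' := 0)
      hγγ (LB.zero_left 1 _)
      (hR := by simp [hγ2, two_smul]) (hR' := by simp)) s (q + n)
    have h2 := ((F.Jm_γ (a := a) (k := k)).nop (e₃ := 1) F.Jm_γ (h := 0) (e := 1) (R := 
      (-2 : ℂ) • nopE 0 1 γ (nopE 0 1 γ ψ)) (R' := 0)
      hγψ.neg_left₀ (LB.zero_left 1 _)
      (hR := by simp [hγ3, two_smul]) (hR' := by simp)) q (s + n)
    rw [show q + (s + n) = s + (q + n) by ring] at h2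
    simp only [mode_neg, mode_zero, smul_zero, add_zero, mul_neg, neg_mul, mode_smul, mul_add,
      add_mul, mul_smul_comm, smul_mul_assoc, h1, h2]
    module
  have rψ : OpComm (-1) R ψ := by
    refine commutator_comm F.Jmm_ψ F.Jm_ψ s q fun n => ?_
    have hγψ : LB (-1) (nopE 0 1 γ ψ) ψ 0 0 :=
      LB.skew (F.ψγ.nop_zero F.ψψ (h := 0) (e := 1) (e₃ := -1)) (hC := by simp) (hD := by simp)
    have h1 := F.Jmm_γ (a := a) (k := k) s (q + n)
    have h2 := ((F.Jm_γ (a := a) (k := k)).nop (e₃ := -1) F.Jm_ψ (h := 0) (e := 1) (R := 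
      nopE 0 1 γ γ) (R' := 0)
      hγψ.neg_left₀ (LB.zero_left (-1) _)
      (hR := by simp [F.nopE_γψ_ψ]) (hR' := by simp)) q (s + n)
    rw [show q + (s + n) = s + (q + n) by ring] at h2
    simp only [mode_neg, mode_zero, smul_zero, add_zero, mul_neg, neg_mul, mode_smul, mul_add,
      add_mul, mul_smul_comm, smul_mul_assoc, h1, h2]
    module
  have rφ : OpComm 1 R φ := by
    refine commutator_comm F.Jmm_φ F.Jm_φ s q fun n => ?_
    have h1 := F.Jmm_ψ (a := a) (k := k) s (q + n)
    have h2 := F.Jm_γ (a := a) (k := k) q (s + n)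
    rw [show q + (s + n) = s + (q + n) by ring] at h2
    simp only [mode_neg, mode_zero, smul_zero, add_zero, mul_neg, neg_mul, mode_smul, mul_add,
      add_mul, mul_smul_comm, smul_mul_assoc, h1, h2, mode_deriv]
    push_cast
    module
  have rJp : OpComm (-1) R (Jp) := by
    refine commutator_comm (F.Jmm_Jp ha) F.Jm_Jp s q fun n => ?_
    have h1 := F.Jmm_Jt ha s (q + n)
    have h2 := F.Jm_Jm ha q (s + n)
    have e1 : mode (oneF : fields V) (q + n) * mode (Jmm) s
      = mode (Jmm) s * mode (oneF : fields V) (q + n) := by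
      rw [mode_oneF]; split_ifs <;> simp
    rw [show q + (s + n) = s + (q + n) by ring] at h2
    rw [mode_smul _ (Jt), mode_neg (Jm), mode_zero, smul_zero, add_zero, mode_smul _ oneF, mul_neg,
      h2, mul_add, mul_smul_comm, h1, mode_zero, smul_zero, add_zero, add_mul, smul_mul_assoc,
      neg_mul, mode_smul, zero_smul, mode_zero, smul_zero, add_zero, smul_mul_assoc,
      smul_mul_assoc, e1, mul_smul_comm, mul_smul_comm]
    module
  -- A direct treatment of ψ⁺ would need its brackets with j⁻ and J⁻. It is recovered from the
  -- current j⁺ = ψ⁺ - βψ instead.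
  have rp : OpComm (-1) R p := by
    have := rJp.add (rβ.nop rψ (h := 1) (e := 1) (e₃ := -1))
    rwa [sub_add_cancel] at this
  have rJt : OpComm 1 R (Jt) := ((rβ.nop rγ (h := 1) (e := 1) (e₃ := 1)).neg.add
    (rφ.smul (a / 2))).sub ((rψ.nop rp (h := 0) (e := -1) (e₃ := 1)).smul (1 / 2))
  -- The isospins of J⁻ and j⁻ under J³_0 add, which contradicts the commutation of R with J³_0
  -- unless R vanishes.
  have t1 := F.Jt_Jmm ha 0 s
  have t2 := F.Jt_Jm ha 0 q
  have t3 := rJt 0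
  have t4 : R = 0 := by
    simp only [mode_neg (Jmm), mode_smul _ (Jm), zero_add, mode_zero, smul_zero, add_zero,
      one_smul] at t1 t2 t3
    generalize mode (Jt) 0 = y at t1 t2 t3
    generalize mode (Jmm) s = x at *
    generalize mode (Jm) q = z at *
    have u1 : y * (x * z) = x * z * y - (3 / 2 : ℂ) • (x * z) := by
      rw [← mul_assoc, t1, add_mul, mul_assoc, t2]
      simp only [mul_add, neg_mul, mul_neg, mul_smul_comm, mul_assoc]
      module
    have u2 : y * (z * x) = z * x * y - (3 / 2 : ℂ) • (z * x) := by
      rw [← mul_assoc, t2, add_mul, mul_assoc, t1]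
      simp only [mul_add, neg_mul, mul_neg, smul_mul_assoc, mul_assoc]
      module
    rw [hR, mul_sub, u1, u2, sub_mul] at t3
    have u3 : (3 / 2 : ℂ) • R = 0 := by
      rw [hR, smul_sub, ← sub_eq_zero.2 t3]
      abel
    exact (smul_eq_zero.1 u3).resolve_left (by norm_num)
  have := sub_eq_zero.1 t4
  simp only [this, one_smul, mode_zero, smul_zero, add_zero]

lemma Jmm_Jmm (ha : a ^ 2 = 2 * k + 3) : LB 1 Jmm Jmm 0 0 :=
  LB.jacobi (A := Jm) (B := Jm) (e := -1) (e₁ := -1) (e₂ := -1) (by norm_num) (F.Jm_Jm ha) (F.Jmm_Jm ha) (F.Jmm_Jm ha)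
    (LB.zero_left _ _) (LB.zero_right _ _) (LB.zero_left _ _) (LB.zero_right _ _)
    (hR := by simp) (hR' := by simp)

end FreeFields

end AffineOsp

end

noncomputable section

namespace AffineOsp

open Gen

/-! ### Coefficient identities -/

lemma sum_gen {M : Type*} [AddCommMonoid M] (g : Gen → M) :
    ∑ z, g z = g plus + g half + g three + g mhalf + g minus := by
  change ∑ z ∈ {plus, half, three, mhalf, minus}, g z = _
  simp [add_assoc]

/-- Twice the structure constants. -/
def fInt : Gen → Gen → Gen → ℤ
  | plus, minus, three => 4
  | minus, plus, three => -4
  | three, plus, plus => 2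
  | plus, three, plus => -2
  | three, minus, minus => -2
  | minus, three, minus => 2
  | three, half, half => 1
  | half, three, half => -1
  | three, mhalf, mhalf => -1
  | mhalf, three, mhalf => 1
  | plus, mhalf, half => -2
  | mhalf, plus, half => 2
  | minus, half, mhalf => -2
  | half, minus, mhalf => 2
  | half, mhalf, three => 4
  | mhalf, half, three => 4
  | half, half, plus => 4
  | mhalf, mhalf, minus => -4
  | _, _, _ => 0

/-- After rescaling to integers the identities between structure constants, signs and the form
become decidable statements over a five-element type. -/
lemma f_eq (x y z : Gen) : f x y z = 2⁻¹ * (fInt x y z : ℂ) := by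
  cases x <;> cases y <;> cases z <;> norm_num [f, fInt]

/-- Four times the inverse of the invariant form. -/
def hInt : Gen → Gen → ℤ
  | three, three => 4
  | plus, minus => 2
  | minus, plus => 2
  | half, mhalf => -1
  | mhalf, half => 1
  | _, _ => 0

lemma hInv_eq (x y : Gen) : hInv x y = 4⁻¹ * (hInt x y : ℂ) := by
  cases x <;> cases y <;> norm_num [hInv, hInt]

/-- Twice the value of the cocycle of the affine algebra on a pair of generators. -/
def kappa : Gen → Gen → ℤ
  | three, three => 1
  | plus, minus => 2
  | minus, plus => 2
  | half, mhalf => 4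
  | mhalf, half => -4
  | _, _ => 0

/-- The value of the cocycle of the affine algebra on a pair of generators. -/
def central (x y : Gen) : ℂ := 2⁻¹ * kappa x y

/-- Sign of the exchange of two currents. -/
def sgnJ (x y : Gen) : ℤ := if isOdd x = true ∧ isOdd y = true then -1 else 1

/-- Sign of the exchange of two ghosts. -/
def sgnG (x y : Gen) : ℤ := if isOdd x = false ∧ isOdd y = false then -1 else 1

/-- Sign of the exchange of a current `x` and a ghost `v`. -/
def sgnM (x v : Gen) : ℤ := if isOdd x = true ∧ isOdd v = false then -1 else 1

/-- Sign of the exchange of a current and an odd bosonic operator. -/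
def sgnO (x : Gen) : ℤ := if isOdd x = true then -1 else 1

lemma sgnJ_sq (x y : Gen) : (sgnJ x y : ℂ) * sgnJ x y = 1 := by
  unfold sgnJ; split_ifs <;> norm_num
lemma sgnG_sq (x y : Gen) : (sgnG x y : ℂ) * sgnG x y = 1 := by
  unfold sgnG; split_ifs <;> norm_num
lemma sgnM_sq (x y : Gen) : (sgnM x y : ℂ) * sgnM x y = 1 := by
  unfold sgnM; split_ifs <;> norm_num
lemma sgnO_sq (x : Gen) : (sgnO x : ℂ) * sgnO x = 1 := by
  unfold sgnO; split_ifs <;> norm_num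
lemma sgnG_comm (x y : Gen) : sgnG x y = sgnG y x := by
  simp only [sgnG, and_comm]

lemma fInt_ne {x y z : Gen} (h : f x y z ≠ 0) : fInt x y z ≠ 0 := fun h0 => h (by simp [f_eq, h0])
lemma hInt_ne {x y : Gen} (h : hInv x y ≠ 0) : hInt x y ≠ 0 := fun h0 => h (by simp [hInv_eq, h0])

/-- A nonvanishing structure constant means that parities add. This and the following sign lemmas
express that the sign of an exchange is multiplicative in the parities; they fail without the
nonvanishing condition. -/
lemma sgnG_mul_sgnG {x y z : Gen} (h : f x y z ≠ 0) (w : Gen) :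
    (sgnG w z : ℂ) * sgnG w y = sgnM x w := by
  have : ∀ x y z w, fInt x y z ≠ 0 → sgnG w z * sgnG w y = sgnM x w := by decide
  exact_mod_cast this x y z w (fInt_ne h)

lemma sgnM_mul_sgnM {x y z : Gen} (h : f y x z ≠ 0) (w : Gen) :
    (sgnM w z : ℂ) * sgnM w x = sgnJ w y := by
  have : ∀ x y z w, fInt y x z ≠ 0 → sgnM w z * sgnM w x = sgnJ w y := by decide
  exact_mod_cast this x y z w (fInt_ne h)

/-- The Jacobi identity of `osp(1,2)`. -/
lemma f_jacobi (x y u w : Gen) :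
    ∑ z, f y u z * f x z w + ∑ v, f y v w * (sgnM x w * (-sgnM x v * f x u v))
      = ∑ t, f x y t * f t u w := by
  have : ∀ x y u w, ∑ z, fInt y u z * fInt x z w
      + ∑ v, fInt y v w * (sgnM x w * (-sgnM x v * fInt x u v))
      = ∑ t, fInt x y t * fInt t u w := by decide +kernel
  have h := congrArg (fun n : ℤ => (4⁻¹ : ℂ) * n) (this x y u w)
  push_cast at h
  simp only [f_eq]
  rw [mul_add, Finset.mul_sum, Finset.mul_sum, Finset.mul_sum] at h
  exact (congrArg₂ (· + ·) (Finset.sum_congr rfl fun _ _ => by ring)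
    (Finset.sum_congr rfl fun _ _ => by ring)).trans
    (h.trans (Finset.sum_congr rfl fun _ _ => by ring))

/-- The left side is the supertrace of ad x ad y, the factor -`sgnG` v v being the parity of v. That
the Killing form is three times the cocycle is the reason for the level 3 of the ghost currents. -/
lemma f_level (x y : Gen) :
    ∑ v, ∑ z, f y v z * (f x z v * -sgnG v v) = 3 * central x y := by
  have : ∀ x y, ∑ v, ∑ z, fInt y v z * (fInt x z v * -sgnG v v) = 6 * kappa x y := by
    decide +kernel
  have h := congrArg (fun n : ℤ => (4⁻¹ : ℂ) * n) (this x y)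
  push_cast at h
  simp only [f_eq, central]
  simp only [Finset.mul_sum] at h
  refine Eq.trans (Finset.sum_congr rfl fun v _ => Finset.sum_congr rfl fun z _ => ?_)
    (h.trans ?_) <;> ring

lemma hInv_sgn {x y : Gen} (h : hInv x y ≠ 0) (v : Gen) :
    (sgnG v y : ℂ) * sgnM x v = sgnG v v := by
  have : ∀ x y v, hInt x y ≠ 0 → sgnG v y * sgnM x v = sgnG v v := by decide
  exact_mod_cast this x y v (hInt_ne h)

lemma hInv_sgnM {x v : Gen} (h : hInv x v ≠ 0) : (sgnM x v : ℂ) = 1 := by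
  have : ∀ x v, hInt x v ≠ 0 → sgnM x v = 1 := by decide
  exact_mod_cast this x v (hInt_ne h)

lemma hInv_f_sgn {x y u v : Gen} (h : hInv x y ≠ 0) (h' : f x u v ≠ 0) : sgnG v y = sgnG y u := by
  have : ∀ x y u v, hInt x y ≠ 0 → fInt x u v ≠ 0 → sgnG v y = sgnG y u := by decide
  exact this x y u v (hInt_ne h) (fInt_ne h')

/-- This is invariance of the form. It makes the contraction of an antighost with the ghost current
inside the BRST current equal to its contraction with the explicit ghost, which compensates the
factor 1/2 there. -/
lemma hInv_f (y u v : Gen) :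
    ∑ x, hInv x y * (sgnG v y * f x u v) = ∑ x, hInv x v * f x u y := by
  have : ∀ y u v, ∑ x, hInt x y * (sgnG v y * fInt x u v) = ∑ x, hInt x v * fInt x u y := by
    decide +kernel
  have h := congrArg (fun n : ℤ => (8⁻¹ : ℂ) * n) (this y u v)
  push_cast at h
  simp only [f_eq, hInv_eq]
  rw [Finset.mul_sum, Finset.mul_sum] at h
  exact (Finset.sum_congr rfl fun _ _ => by ring).trans
    (h.trans (Finset.sum_congr rfl fun _ _ => by ring))

lemma sgnO_mul {x u v : Gen} (h : f x u v ≠ 0) : (sgnG u u : ℂ) * sgnO x = sgnG v v := by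
  have : ∀ x u v, fInt x u v ≠ 0 → sgnG u u * sgnO x = sgnG v v := by decide
  exact_mod_cast this x u v (fInt_ne h)

lemma sgnO_sgnM {w v : Gen} (h : hInv w v ≠ 0) (x : Gen) :
    (sgnO x : ℂ) * sgnM x v = sgnJ w x := by
  have : ∀ w v x, hInt w v ≠ 0 → sgnO x * sgnM x v = sgnJ w x := by decide
  exact_mod_cast this w v x (hInt_ne h)

lemma hInv_parity {w v : Gen} (h : hInv w v ≠ 0) : (sgnG v v : ℂ) * sgnO w = -1 := by
  have : ∀ w v, hInt w v ≠ 0 → sgnG v v * sgnO w = -1 := by decide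
  exact_mod_cast this w v (hInt_ne h)

/-- Invariance of the form again, arranged for the comparison of the bracket of two total currents
with the bracket of an antighost and a total current. -/
lemma hInv_f' (x v z : Gen) :
    ∑ w, hInv w v * f w x z = sgnO x * ∑ u, f x u v * hInv z u := by
  have : ∀ x v z, ∑ w, hInt w v * fInt w x z = sgnO x * ∑ u, fInt x u v * hInt z u := by
    decide +kernel
  have h := congrArg (fun n : ℤ => (8⁻¹ : ℂ) * n) (this x v z)
  push_cast at h
  simp only [f_eq, hInv_eq]
  rw [Finset.mul_sum, mul_left_comm, Finset.mul_sum] at h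
  exact (Finset.sum_congr rfl fun _ _ => by ring).trans
    (h.trans (congrArg _ (Finset.sum_congr rfl fun _ _ => by ring)))

/-! ### Affine currents -/

section

variable {V : Type*} [AddCommGroup V] [Module ℂ V]

/-- The currents `J` satisfy the relations of the affine superalgebra of `osp(1,2)` at level `k`. -/
def Affine (k : ℂ) (J : Gen → fields V) : Prop := ∀ x y,
  LB (sgnJ x y) (J x) (J y) (∑ z, f x y z • J z) ((k * central x y) • oneF)

lemma LB.smul_right_of {e : ℂ} {A B C D : fields V} (c : ℂ) (H : c ≠ 0 → LB e A B C D) :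
    LB e A (c • B) (c • C) (c • D) := by
  by_cases hc : c = 0
  · subst hc
    simpa only [zero_smul] using LB.zero_right e A
  · exact (H hc).smul_right c

lemma LB.smul_right_of₀ {e : ℂ} {A B C : fields V} (c : ℂ) (H : c ≠ 0 → LB e A B C 0) :
    LB e A (c • B) (c • C) 0 := (LB.smul_right_of c H).congr rfl (smul_zero c)

lemma LB.sum_right₀ {ι : Type*} (s : Finset ι) {e : ℂ} {A : fields V} {B C : ι → fields V}
    (H : ∀ i ∈ s, LB e A (B i) (C i) 0) : LB e A (∑ i ∈ s, B i) (∑ i ∈ s, C i) 0 :=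
  (LB.sum_right s H).congr rfl Finset.sum_const_zero

lemma LB.smul_left_of₀ {e : ℂ} {A B C : fields V} (c : ℂ) (H : c ≠ 0 → LB e A B C 0) :
    LB e (c • A) B (c • C) 0 := by
  by_cases hc : c = 0
  · subst hc
    simpa only [zero_smul] using LB.zero_left e B
  · exact (H hc).smul_left₀ c

lemma LB.sum_left₀ {ι : Type*} (s : Finset ι) {e : ℂ} {B : fields V} {A C : ι → fields V}
    (H : ∀ i ∈ s, LB e (A i) B (C i) 0) : LB e (∑ i ∈ s, A i) B (∑ i ∈ s, C i) 0 :=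
  (LB.sum_left s H).congr rfl Finset.sum_const_zero

end

end AffineOsp

end

/-! ### Affine relations of the Wakimoto, dual Wakimoto and ghost currents -/

noncomputable section

namespace AffineOsp

open Gen

section

variable {V : Type*} [AddCommGroup V] [Module ℂ V]

/-- With C and D existentially quantified, a bracket can be supplied in the shape in which it was
computed and rewritten as a combination of currents afterwards. -/
lemma Affine.mk' {k : ℂ} {J : Gen → fields V}
    (H : ∀ x y, ∃ C D, LB (sgnJ x y) (J x) (J y) C D ∧ C = ∑ z, f x y z • J z ∧
      D = (k * central x y) • oneF) : Affine k J := fun x y => by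
  obtain ⟨C, D, h, rfl, rfl⟩ := H x y
  exact h

lemma FreeFields.affine {β γ p ψ φ : fields V} {k a : ℂ} (F : FreeFields β γ p ψ φ)
    (ha : a ^ 2 = 2 * k + 3) : Affine k (wakimotoCurrent k a β γ p ψ φ) := by
  refine Affine.mk' fun x y => ?_
  have e1 : ((1 : ℤ) : ℂ) = 1 := Int.cast_one
  have e2 : ((-1 : ℤ) : ℂ) = -1 := by norm_num
  cases x <;> cases y <;>
    simp only [sgnJ, isOdd, Bool.false_eq_true, and_self, and_true, and_false, if_true, if_false,
      e1, e2, sum_gen, f, zero_smul, add_zero, zero_add, central, kappa, Int.cast_zero, mul_zero]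
  · exact ⟨_, _, F.ββ.neg_left₀.neg_right, by simp, by simp⟩
  · exact ⟨_, _, F.β_Jp.neg_left₀, by simp, by simp⟩
  · exact ⟨_, _, (F.β_Jt (a := a)).neg_left₀, by simp only [wakimotoCurrent]; module, by simp⟩
  · exact ⟨_, _, (F.β_Jm (a := a) (k := k)).neg_left₀,
      by simp only [wakimotoCurrent, nop_eq]; module, by simp⟩
  · exact ⟨_, _, (F.β_Jmm (a := a) (k := k)).neg_left,
      by simp only [wakimotoCurrent, nop_eq, nopF_eq]; module, by push_cast; module⟩
  · exact ⟨_, _, F.Jp_β.neg_right, by simp, by simp⟩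
  · exact ⟨_, _, F.Jp_Jp, rfl, by simp⟩
  · exact ⟨_, _, (F.Jt_Jp (a := a)).skew (by norm_num) rfl rfl,
      by simp only [wakimotoCurrent, nop_eq, deriv_zero]; module, by simp⟩
  · exact ⟨_, _, F.Jp_Jm, rfl, by push_cast; module⟩
  · exact ⟨_, _, F.Jp_Jmm ha, (one_smul _ _).symm, by simp⟩
  · exact ⟨_, _, (F.Jt_β (a := a)).neg_right, by simp only [wakimotoCurrent]; module, by simp⟩
  · exact ⟨_, _, F.Jt_Jp, rfl, by simp⟩
  · exact ⟨_, _, F.Jt_Jt ha, rfl, by module⟩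
  · exact ⟨_, _, F.Jt_Jm ha, rfl, by simp⟩
  · exact ⟨_, _, F.Jt_Jmm ha, by simp only [wakimotoCurrent, nop_eq, nopF_eq]; module, by simp⟩
  · exact ⟨_, _, (F.Jm_β (a := a) (k := k)).neg_right,
      by simp only [wakimotoCurrent, nop_eq]; module, by simp⟩
  · exact ⟨_, _, F.Jm_Jp, rfl, by push_cast; module⟩
  · exact ⟨_, _, F.Jm_Jt ha, rfl, by simp⟩
  · exact ⟨_, _, F.Jm_Jm ha, rfl, by simp⟩
  · exact ⟨_, _, (F.Jmm_Jm ha).skew (by norm_num) rfl rfl, by simp, by simp⟩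
  · exact ⟨_, _, (F.Jmm_β (a := a) (k := k)).neg_right,
      by simp only [wakimotoCurrent, nop_eq, nopF_eq]; module, by push_cast; module⟩
  · exact ⟨_, _, F.Jmm_Jp ha,
      by simp only [wakimotoCurrent, nop_eq, nopF_eq]; module, by simp⟩
  · exact ⟨_, _, F.Jmm_Jt ha, (one_smul _ _).symm, by simp⟩
  · exact ⟨_, _, F.Jmm_Jm ha, rfl, by simp⟩
  · exact ⟨_, _, F.Jmm_Jmm ha, rfl, by simp⟩

/-- The permutation of the labels in the automorphism exchanging the two realizations. -/
def flip : Gen → Gen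
  | plus => minus
  | half => mhalf
  | three => three
  | mhalf => half
  | minus => plus

/-- The signs in the automorphism exchanging the two realizations. -/
def flipSign : Gen → ℤ
  | mhalf => 1
  | _ => -1

/-- The dual realization is the Wakimoto realization composed with an automorphism of osp(1,2) that
exchanges raising and lowering generators. Its brackets need no separate computation. -/
lemma dualWakimotoCurrent_eq (k a : ℂ) (β γ p ψ φ : fields V) (x : Gen) :
    dualWakimotoCurrent k a β γ p ψ φ x
      = (flipSign x : ℂ) • wakimotoCurrent k a β γ p ψ φ (flip x) := by
  cases x <;> simp only [dualWakimotoCurrent, wakimotoCurrent, flip, flipSign] <;> push_cast <;>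
    module

/-- The equivalence of labels given by `flip`. -/
def flipEquiv : Gen ≃ Gen := ⟨flip, flip, by decide, by decide⟩

lemma Affine.flip {k : ℂ} {J : Gen → fields V} (H : Affine k J) :
    Affine k fun x => (flipSign x : ℂ) • J (flip x) := by
  refine Affine.mk' fun x y => ⟨_, _, (by decide : ∀ x y, sgnJ (AffineOsp.flip x)
    (AffineOsp.flip y) = sgnJ x y) x y ▸
    ((H (AffineOsp.flip x) (AffineOsp.flip y)).smul_left (flipSign x)).smul_right (flipSign y), ?_, ?_⟩
  · rw [← Equiv.sum_comp flipEquiv, Finset.smul_sum, Finset.smul_sum]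
    refine Finset.sum_congr rfl fun z _ => ?_
    simp only [smul_smul, f_eq]
    congr 1
    have : ∀ x y z, flipSign y * (flipSign x * fInt (AffineOsp.flip x) (AffineOsp.flip y)
        (AffineOsp.flip z)) = fInt x y z * flipSign z := by decide
    have h := this x y z
    change (flipSign y : ℂ) * (flipSign x * (2⁻¹ * (fInt (AffineOsp.flip x) (AffineOsp.flip y)
        (AffineOsp.flip z) : ℂ))) = 2⁻¹ * fInt x y z * flipSign z
    have h' := congrArg (fun n : ℤ => (2⁻¹ : ℂ) * n) h
    push_cast at h'
    linear_combination h'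
  · simp only [smul_smul, central]
    congr 1
    have : ∀ x y, flipSign y * (flipSign x * kappa (AffineOsp.flip x) (AffineOsp.flip y))
        = kappa x y := by decide
    have h' := congrArg (fun n : ℤ => k * 2⁻¹ * (n : ℂ)) (this x y)
    push_cast at h'
    linear_combination h'

lemma FreeFields.affine_dual {β γ p ψ φ : fields V} {k a : ℂ} (F : FreeFields β γ p ψ φ)
    (ha : a ^ 2 = 2 * k + 3) : Affine k (dualWakimotoCurrent k a β γ p ψ φ) := by
  have := (F.affine ha).flip
  rwa [show dualWakimotoCurrent k a β γ p ψ φ = _ from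
    funext (dualWakimotoCurrent_eq k a β γ p ψ φ)]

/-- The sign with which the current `x` and an operator commute, if the operator commutes with the
fermionic free fields up to `e` and with the bosonic ones. -/
def sgnE (e : ℂ) (x : Gen) : ℂ := if isOdd x then e else 1

/-- The currents are polynomial in the free fields, so it suffices that X commutes with the fermions
up to e and with the bosons. It is applied both to single free fields of another sector and to whole
currents X. -/
lemma wakimotoCurrent_comm {X β γ p ψ φ : fields V} {e : ℂ} (he : e * e = 1) (k a : ℂ)
    (hβ : LB 1 X β 0 0) (hγ : LB 1 X γ 0 0) (hp : LB e X p 0 0) (hψ : LB e X ψ 0 0)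
    (hφ : LB 1 X φ 0 0) (x : Gen) : LB (sgnE e x) X (wakimotoCurrent k a β γ p ψ φ x) 0 0 := by
  have h1 : LB 1 X (nopE 1 1 β γ) 0 0 := hβ.nop_zero hγ
  have h2 : LB 1 X (nopE 0 (-1) ψ p) 0 0 := hψ.nop_zero hp he he
  have h3 : LB e X (nopE 1 1 β ψ) 0 0 := hβ.nop_zero hψ (h₃ := one_mul e)
  have h4 : LB e X (p - nopE 1 1 β ψ) 0 0 := (hp.sub_right h3).congr (sub_zero 0) (sub_zero 0)
  have h5 : LB e X (nopE 0 1 γ (p - nopE 1 1 β ψ)) 0 0 := hγ.nop_zero h4 (h₃ := one_mul e)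
  have h6 : LB e X (nopE 0 1 ψ φ) 0 0 := hψ.nop_zero hφ he (mul_one e)
  have h7 : LB e X (deriv 0 ψ) 0 0 := hψ.deriv_right.congr (deriv_zero 0) rfl
  have h8 : LB 1 X (nopE 0 1 γ γ) 0 0 := hγ.nop_zero hγ
  have h9 : LB 1 X (nopE 1 1 β (nopE 0 1 γ γ)) 0 0 := hβ.nop_zero h8
  have h10 : LB 1 X (nopE 0 1 γ φ) 0 0 := hγ.nop_zero hφ
  have h11 : LB 1 X (nopE 0 1 γ (nopE 0 (-1) ψ p)) 0 0 := hγ.nop_zero h2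
  have h12 : LB 1 X (deriv 0 γ) 0 0 := hγ.deriv_right.congr (deriv_zero 0) rfl
  have h13 : LB 1 X (nopE 0 (-1) ψ (deriv 0 ψ)) 0 0 := hψ.nop_zero h7 he he
  cases x
  · exact hβ.neg_right.congr neg_zero neg_zero
  · exact h4
  · exact ((h1.neg_right.add_right (hφ.smul_right (a / 2))).sub_right
      (h2.smul_right (1 / 2))).congr (by simp) (by simp)
  · exact ((h5.add_right (h6.smul_right a)).add_right (h7.smul_right (2 * k + 1))).congr
      (by simp) (by simp)
  · exact ((((h9.sub_right (h10.smul_right a)).add_right h11).sub_right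
      (h12.smul_right k)).add_right (h13.smul_right (k + 1))).congr (by simp) (by simp)

lemma dualWakimotoCurrent_comm {X β γ p ψ φ : fields V} {e : ℂ} (he : e * e = 1) (k a : ℂ)
    (hβ : LB 1 X β 0 0) (hγ : LB 1 X γ 0 0) (hp : LB e X p 0 0) (hψ : LB e X ψ 0 0)
    (hφ : LB 1 X φ 0 0) (x : Gen) :
    LB (sgnE e x) X (dualWakimotoCurrent k a β γ p ψ φ x) 0 0 := by
  rw [dualWakimotoCurrent_eq, show sgnE e x = sgnE e (flip x) by cases x <;> rfl]
  exact ((wakimotoCurrent_comm he k a hβ hγ hp hψ hφ (flip x)).smul_right _).congr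
    (smul_zero _) (smul_zero _)

end

/-! ### The ghost system -/

section

variable {V : Type*} [AddCommGroup V] [Module ℂ V]

/-- The commutation relations of the ghosts. -/
structure GhostSystem (b c : Gen → fields V) : Prop where
  bb : ∀ x y, LB (sgnG x y) (b x) (b y) 0 0
  cc : ∀ x y, LB (sgnG x y) (c x) (c y) 0 0
  bc : ∀ x y, LB (sgnG x y) (b x) (c y) (if x = y then oneF else 0) 0

/-- The product `:c^z b_y:`. -/
def ghostN (b c : Gen → fields V) (z y : Gen) : fields V := nopE 0 (sgnG z y) (c z) (b y)

/-- The ghost currents. -/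
def ghostCurrent (b c : Gen → fields V) (x : Gen) : fields V :=
  ∑ y, ∑ z, f x y z • ghostN b c z y

namespace GhostSystem

variable {b c : Gen → fields V} (G : GhostSystem b c)
include G

lemma cb (x y : Gen) : LB (sgnG x y) (c x) (b y) ((if x = y then -sgnG x x else 0 : ℂ) • oneF) 0 := by
  rw [sgnG_comm]
  refine (G.bc y x).skew (sgnG_sq y x) ?_ (smul_zero _).symm
  by_cases h : x = y
  · subst h; simp
  · simp [h, Ne.symm h]

lemma b_current (v x : Gen) :
    LB (sgnM x v) (b v) (ghostCurrent b c x) (∑ y, f x y v • b y) 0 := by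
  refine LB.congr (C := ∑ y, ∑ z, f x y z • if v = z then b y else 0)
    (LB.sum_right₀ _ fun y _ => LB.sum_right₀ _ fun z _ => LB.smul_right_of₀ _ fun h => ?_) ?_ rfl
  · refine (G.bc v z).nop (G.bb v y) (e₁ := sgnG z y * sgnG v y) (E := 0) ?_ (LB.zero_left _ _)
      (sgnG_sq _ _) rfl (sgnG_mul_sgnG h v) ?_ (by simp)
    · split_ifs with hv
      · subst hv
        rw [sgnG_sq]
        exact LB.one_left _
      · exact LB.zero_left _ _
    · split_ifs with hv
      · subst hv
        rw [sgnG_sq]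
        simp
      · simp
  · simp

lemma c_current (w x : Gen) :
    LB (sgnM x w) (c w) (ghostCurrent b c x) (∑ z, (-sgnM x w * f x w z) • c z) 0 := by
  refine LB.congr (C := ∑ y, ∑ z, f x y z • (if w = y then (-sgnM x w : ℂ) • c z else 0))
    (LB.sum_right₀ _ fun y _ => LB.sum_right₀ _ fun z _ => LB.smul_right_of₀ _ fun h => ?_) ?_ rfl
  · refine (G.cc w z).nop (G.cb w y) (e₁ := sgnG z y * sgnG w y) (LB.zero_left _ _)
      (LB.zero_left _ _) (sgnG_sq _ _) rfl (sgnG_mul_sgnG h w) ?_ (by simp)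
    split_ifs with hv
    · subst hv
      rw [sgnG_comm z w, sgnG_sq, nopE_smul_right, nopE_oneF_right, smul_smul, mul_neg,
        sgnG_mul_sgnG h]
      simp
    · simp
  · rw [Finset.sum_comm]
    simp [smul_smul, mul_comm]

lemma current_b (x v : Gen) :
    LB (sgnM x v) (ghostCurrent b c x) (b v) (∑ y, (-sgnM x v * f x y v) • b y) 0 :=
  (G.b_current v x).skew (sgnM_sq x v) (by simp [Finset.smul_sum, smul_smul]) (by simp)

lemma current_c (x w : Gen) :
    LB (sgnM x w) (ghostCurrent b c x) (c w) (∑ z, f x w z • c z) 0 :=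
  (G.c_current w x).skew (sgnM_sq x w)
    (by simp [Finset.smul_sum, smul_smul, ← mul_assoc, sgnM_sq]) (by simp)

/-- Single contractions add up to a ghost current by the Jacobi identity `f_jacobi`. Double
contractions give the supertrace of the adjoint representation, evaluated by `f_level`. -/
lemma affine : Affine 3 (ghostCurrent b c) := by
  intro x y
  have key : LB (sgnJ x y) (ghostCurrent b c x) (ghostCurrent b c y)
      (∑ v, ∑ z, f y v z • (∑ w, f x z w • ghostN b c w v
        + (sgnM x z : ℂ) • ∑ u, (-sgnM x v * f x u v) • ghostN b c z u))
      (∑ v, ∑ z, f y v z • (f x z v * -sgnG v v : ℂ) • oneF) := by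
    refine LB.sum_right _ fun v _ => LB.sum_right _ fun z _ => LB.smul_right_of _ fun h => ?_
    have hs := sgnM_mul_sgnM h x
    refine (G.current_c x z).nop (G.current_b x v) (e₁ := sgnG z v * sgnM x v)
      (E := (f x z v * -sgnG v v : ℂ) • oneF) ?_ (LB.zero_left _ _) (sgnM_sq _ _) rfl
      hs ?_ (by simp)
    · refine LB.congr (LB.sum_left₀ Finset.univ (C := fun w => f x z w •
        ((if w = v then -sgnG w w else 0 : ℂ) • oneF)) fun w _ => LB.smul_left_of₀ _ fun hw => ?_)
        ?_ rfl
      · convert G.cb w v using 1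
        have := sgnG_mul_sgnG hw v
        rw [← this, sgnG_comm z v, sgnG_comm w v]
        rw [mul_comm (sgnG v w : ℂ), ← mul_assoc, sgnG_sq, one_mul]
      · simp [smul_smul]
    · congr 1
      · rw [nopE_sum_left]
        refine Finset.sum_congr rfl fun w _ => ?_
        rw [nopE_smul_left]
        by_cases hw : f x z w = 0
        · rw [hw, zero_smul, zero_smul]
        · congr 1
          rw [ghostN]
          congr 1
          have := sgnG_mul_sgnG hw v
          rw [← this, sgnG_comm z v, sgnG_comm w v]
          rw [mul_comm (sgnG v w : ℂ), ← mul_assoc, sgnG_sq, one_mul]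
      · congr 1
        rw [nopE_sum_right]
        refine Finset.sum_congr rfl fun u _ => ?_
        rw [nopE_smul_right]
        by_cases hu : f x u v = 0
        · rw [hu, mul_zero, zero_smul, zero_smul]
        · congr 1
          rw [ghostN]
          congr 1
          have := sgnG_mul_sgnG hu z
          rw [← this, ← mul_assoc, sgnG_sq, one_mul]
  refine key.congr ?_ ?_
  · have h1 : ∀ u w, (∑ z, f y u z * f x z w) • ghostN b c w u
        + (∑ v, f y v w * (sgnM x w * (-sgnM x v * f x u v))) • ghostN b c w u
        = ∑ t, f x y t • f t u w • ghostN b c w u := fun u w => by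
      rw [← add_smul, f_jacobi, Finset.sum_smul]
      simp only [smul_smul]
    have h2 := Finset.sum_congr rfl fun u (_ : u ∈ Finset.univ) =>
      Finset.sum_congr rfl fun w (_ : w ∈ Finset.univ) => h1 u w
    simp only [Finset.sum_add_distrib, Finset.sum_smul] at h2
    simp only [ghostCurrent, smul_add, Finset.sum_add_distrib, Finset.smul_sum, smul_smul]
    simp only [smul_smul] at h2
    rw [Finset.sum_comm (s := Finset.univ (α := Gen)) (t := Finset.univ) (f := fun t u => ∑ w, (f x y t * f t u w) • ghostN b c w u)]
    rw [Finset.sum_congr rfl fun u _ => Finset.sum_comm (f := fun t w => (f x y t * f t u w) • ghostN b c w u), ← h2]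
    congr 1
    · exact Finset.sum_congr rfl fun v _ => Finset.sum_comm
    · rw [Finset.sum_congr rfl fun v _ => Finset.sum_comm, Finset.sum_comm]
      exact Finset.sum_congr rfl fun u _ => Finset.sum_comm
  · simp only [smul_smul, ← Finset.sum_smul, f_level]

end GhostSystem

end

end AffineOsp

end

noncomputable section

namespace AffineOsp

open Gen

/-! ### The BRST operator -/

section

variable {V : Type*} [AddCommGroup V] [Module ℂ V]

/-- A ghost system together with matter currents of level `-3`. -/
structure BrstSystem (M b c : Gen → fields V) : Prop where
  ghost : GhostSystem b c
  matter : Affine (-3) M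
  bM : ∀ v x, LB (sgnM x v) (b v) (M x) 0 0
  cM : ∀ v x, LB (sgnM x v) (c v) (M x) 0 0

/-- The total currents. -/
def totalCurrent (M b c : Gen → fields V) (x : Gen) : fields V := M x + ghostCurrent b c x

/-- The BRST current. -/
def brstField (M b c : Gen → fields V) : fields V :=
  ∑ x, ∑ y, hInv x y • nopE 0 1 (c y) (M x + (1 / 2 : ℂ) • ghostCurrent b c x)

namespace BrstSystem

variable {M b c : Gen → fields V} (S : BrstSystem M b c)
include S

lemma matter_ghost (x y : Gen) : LB (sgnJ x y) (M x) (ghostCurrent b c y) 0 0 := by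
  refine (LB.sum_right₀ _ fun v _ => LB.sum_right₀ _ fun z _ => LB.smul_right_of₀ (C := 0) _
    fun h => ?_).congr (by simp) rfl
  refine LB.nop_zero (eA := sgnM x z) (eB := sgnM x v) ?_ ?_ (sgnM_sq x z) (sgnM_mul_sgnM h x)
  · exact (S.cM z x).skew (sgnM_sq x z) (by simp) (by simp)
  · exact (S.bM v x).skew (sgnM_sq x v) (by simp) (by simp)

lemma ghost_matter (x y : Gen) : LB (sgnJ x y) (ghostCurrent b c x) (M y) 0 0 := by
  have h := (S.matter_ghost y x).skew (C' := 0) (D' := 0) (sgnJ_sq y x) (by simp) (by simp)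
  rwa [show sgnJ y x = sgnJ x y by simp only [sgnJ, and_comm]] at h

lemma total (x y : Gen) : LB (sgnJ x y) (totalCurrent M b c x) (totalCurrent M b c y)
    (∑ z, f x y z • totalCurrent M b c z) 0 := by
  refine (((S.matter x y).add_right (S.matter_ghost x y)).add_left
    ((S.ghost_matter x y).add_right (S.ghost.affine x y))).congr ?_ ?_
  · simp only [totalCurrent, smul_add, Finset.sum_add_distrib, add_zero, zero_add]
  · module

lemma b_total (v x : Gen) :
    LB (sgnM x v) (b v) (totalCurrent M b c x) (∑ u, f x u v • b u) 0 :=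
  ((S.bM v x).add_right (S.ghost.b_current v x)).congr (zero_add _) (zero_add _)

/-- The matter part of the total current comes from contracting b with the ghost in front. The ghost
part comes in two halves, one from that ghost and one from the ghosts inside the ghost current, and
the halves agree by invariance of the form (`hInv_f`). -/
lemma b_brst (v : Gen) :
    LB (sgnG v v) (b v) (brstField M b c) (∑ x, hInv x v • totalCurrent M b c x) 0 := by
  have key : LB (sgnG v v) (b v) (brstField M b c)
      (∑ x, ∑ y, hInv x y • ((if v = y then M x else 0) + (1 / 2 : ℂ) •
        ((if v = y then ghostCurrent b c x else 0)
          + ∑ u, (sgnG v y * f x u v) • ghostN b c y u))) 0 := by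
    refine LB.sum_right₀ _ fun x _ => LB.sum_right₀ _ fun y _ => LB.smul_right_of₀ _ fun h => ?_
    rw [nopE_add_right, nopE_smul_right]
    refine LB.congr (LB.add_right ?_ (LB.smul_right_of₀ (1 / 2) fun _ => ?_)) rfl (add_zero 0)
    · refine (S.ghost.bc v y).nop (S.bM v x) (e₁ := sgnM x v) (E := 0) ?_ (LB.zero_left _ _)
        (sgnG_sq v y) (one_mul _) (hInv_sgn h v) ?_ (by simp)
      · split_ifs with hv
        · subst hv
          rw [hInv_sgnM h]
          exact LB.one_left _
        · exact LB.zero_left _ _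
      · split_ifs with hv
        · subst hv
          rw [hInv_sgnM h]
          simp
        · simp
    · refine (S.ghost.bc v y).nop (S.ghost.b_current v x) (e₁ := sgnM x v) (E := 0) ?_
        (LB.zero_left _ _) (sgnG_sq v y) (one_mul _) (hInv_sgn h v) ?_ (by simp)
      · split_ifs with hv
        · subst hv
          rw [hInv_sgnM h]
          exact LB.one_left _
        · exact LB.zero_left _ _
      · congr 1
        · split_ifs with hv
          · subst hv
            rw [hInv_sgnM h]
            simp
          · simp
        · rw [nopE_sum_right, Finset.smul_sum]
          refine Finset.sum_congr rfl fun u _ => ?_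
          rw [nopE_smul_right, smul_smul]
          by_cases hu : f x u v = 0
          · rw [hu, mul_zero, zero_smul, zero_smul]
          · rw [ghostN, one_mul, hInv_f_sgn h hu]
  refine key.congr ?_ rfl
  have h1 : ∑ x, ∑ y, hInv x y • ∑ u, (sgnG v y * f x u v : ℂ) • ghostN b c y u
      = ∑ x, hInv x v • ghostCurrent b c x := by
    simp only [ghostCurrent, Finset.smul_sum, smul_smul]
    have h2 := Finset.sum_congr rfl fun y (_ : y ∈ Finset.univ (α := Gen)) =>
      Finset.sum_congr rfl fun u (_ : u ∈ Finset.univ (α := Gen)) =>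
        congrArg (fun t : ℂ => t • ghostN b c y u) (hInv_f y u v)
    simp only [Finset.sum_smul] at h2
    rw [Finset.sum_comm, Finset.sum_congr rfl fun y _ => Finset.sum_comm, h2, Finset.sum_comm,
      Finset.sum_congr rfl fun y _ => Finset.sum_comm, Finset.sum_comm]
  simp only [smul_add, Finset.sum_add_distrib]
  have h3 : ∑ x, ∑ y, hInv x y • (1 / 2 : ℂ) • ∑ u, (sgnG v y * f x u v : ℂ) • ghostN b c y u
      = (1 / 2 : ℂ) • ∑ x, hInv x v • ghostCurrent b c x := by
    rw [← h1]
    simp only [Finset.smul_sum, smul_smul]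
    refine Finset.sum_congr rfl fun x _ => Finset.sum_congr rfl fun y _ =>
      Finset.sum_congr rfl fun u _ => ?_
    congr 1
    ring
  rw [h3]
  simp only [totalCurrent, smul_add, Finset.sum_add_distrib, Finset.smul_sum, smul_ite, smul_zero,
    Finset.sum_ite_eq, Finset.mem_univ, if_true]
  rw [← Finset.sum_add_distrib]
  congr 1
  refine Finset.sum_congr rfl fun x _ => ?_
  module

/-- The commutator of the BRST operator with a total current commutes with the antighosts. -/
lemma b_comm_current (x : Gen) (n : ℤ) (v : Gen) (m : ℤ) :
    mode (b v) m * (mode (brstField M b c) 0 * mode (totalCurrent M b c x) n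
      - (sgnO x : ℂ) • (mode (totalCurrent M b c x) n * mode (brstField M b c) 0))
    = (sgnG v v * sgnM x v : ℂ) • ((mode (brstField M b c) 0 * mode (totalCurrent M b c x) n
      - (sgnO x : ℂ) • (mode (totalCurrent M b c x) n * mode (brstField M b c) 0))
        * mode (b v) m) := by
  have hQ : ∀ w m, mode (b w) m * mode (brstField M b c) 0
      = (sgnG w w : ℂ) • (mode (brstField M b c) 0 * mode (b w) m)
        + ∑ y, hInv y w • mode (totalCurrent M b c y) m := fun w m => by
    have := S.b_brst w m 0
    simpa only [add_zero, mode_zero, smul_zero, mode_sum, mode_smul] using this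
  have hJ : mode (b v) m * mode (totalCurrent M b c x) n
      = (sgnM x v : ℂ) • (mode (totalCurrent M b c x) n * mode (b v) m)
        + ∑ u, f x u v • mode (b u) (m + n) := by
    have := S.b_total v x m n
    simpa only [add_zero, mode_zero, smul_zero, mode_sum, mode_smul] using this
  -- The total currents have no central term. Invariance of the form turns their bracket into the
  -- expression that `hB` produces with the opposite sign, so nothing is left of the commutators
  -- with b.
  have hL : (∑ y, hInv y v • mode (totalCurrent M b c y) m) * mode (totalCurrent M b c x) n
      - (sgnO x * sgnM x v : ℂ) • (mode (totalCurrent M b c x) n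
        * ∑ y, hInv y v • mode (totalCurrent M b c y) m)
      = (sgnO x : ℂ) • ∑ u, f x u v • ∑ y, hInv y u • mode (totalCurrent M b c y) (m + n) := by
    have h1 : ∀ w, (hInv w v • mode (totalCurrent M b c w) m) * mode (totalCurrent M b c x) n
        - (sgnO x * sgnM x v : ℂ) • (mode (totalCurrent M b c x) n
          * hInv w v • mode (totalCurrent M b c w) m)
        = ∑ z, (hInv w v * f w x z) • mode (totalCurrent M b c z) (m + n) := fun w => by
      by_cases h : hInv w v = 0
      · simp [h]
      · have := S.total w x m n
        simp only [add_zero, mode_zero, smul_zero, mode_sum, mode_smul] at this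
        rw [sgnO_sgnM h, smul_mul_assoc, mul_smul_comm, this, smul_add, Finset.smul_sum]
        simp only [smul_smul]
        module
    rw [Finset.sum_mul, Finset.mul_sum, Finset.smul_sum, ← Finset.sum_sub_distrib,
      Finset.sum_congr rfl fun w _ => h1 w, Finset.sum_comm]
    simp only [← Finset.sum_smul, hInv_f', Finset.smul_sum, smul_smul, Finset.mul_sum]
    rw [Finset.sum_comm]
    simp only [Finset.sum_smul, mul_assoc]
  have hB : (∑ u, f x u v • mode (b u) (m + n)) * mode (brstField M b c) 0
      = (sgnG v v * sgnO x : ℂ) • (mode (brstField M b c) 0 * ∑ u, f x u v • mode (b u) (m + n))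
        + ∑ u, f x u v • ∑ y, hInv y u • mode (totalCurrent M b c y) (m + n) := by
    rw [Finset.sum_mul, Finset.mul_sum, Finset.smul_sum, ← Finset.sum_add_distrib]
    refine Finset.sum_congr rfl fun u _ => ?_
    by_cases h : f x u v = 0
    · simp [h]
    · rw [smul_mul_assoc, hQ, ← sgnO_mul h, mul_assoc, sgnO_sq, mul_one, mul_smul_comm, smul_add]
      module
  rw [mul_sub, mul_smul_comm, ← mul_assoc, hQ, ← mul_assoc, hJ, add_mul, add_mul, smul_mul_assoc,
    smul_mul_assoc, mul_assoc _ (mode (b v) m), hJ, mul_assoc _ (mode (b v) m), hQ, hB]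
  have h0 := sgnO_sq x
  generalize (∑ u, f x u v • ∑ y, hInv y u • mode (totalCurrent M b c y) (m + n)) = R at *
  generalize (∑ y, hInv y v • mode (totalCurrent M b c y) m) = L at *
  generalize (∑ u, f x u v • mode (b u) (m + n)) = B at *
  generalize mode (brstField M b c) 0 = Q at *
  generalize mode (totalCurrent M b c x) n = J at *
  simp only [mul_add, sub_mul, mul_smul_comm, smul_mul_assoc, mul_assoc, smul_add, smul_sub,
    smul_smul]
  have hL' : L * J = (sgnO x * sgnM x v : ℂ) • (J * L) + (sgnO x : ℂ) • R := by
    rw [← hL]; abel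
  rw [hL', show (sgnO x : ℂ) * (sgnG v v * sgnO x) = sgnG v v by linear_combination (sgnG v v : ℂ) * h0]
  module

/-- If the BRST operator commutes with the total currents, then its square commutes with the
antighosts. -/
lemma b_comm_sq (H : ∀ x n, mode (brstField M b c) 0 * mode (totalCurrent M b c x) n
      = (sgnO x : ℂ) • (mode (totalCurrent M b c x) n * mode (brstField M b c) 0))
    (v : Gen) (m : ℤ) :
    mode (b v) m * (mode (brstField M b c) 0 * mode (brstField M b c) 0)
      = (mode (brstField M b c) 0 * mode (brstField M b c) 0) * mode (b v) m := by
  have hQ : mode (b v) m * mode (brstField M b c) 0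
      = (sgnG v v : ℂ) • (mode (brstField M b c) 0 * mode (b v) m)
        + ∑ y, hInv y v • mode (totalCurrent M b c y) m := by
    have := S.b_brst v m 0
    simpa only [add_zero, mode_zero, smul_zero, mode_sum, mode_smul] using this
  -- The bracket of b with Q is a combination of total currents, which commute with Q by assumption.
  -- The parities matched by the form make the two contributions to the bracket of b with Q² cancel.
  have hL : (sgnG v v : ℂ) • (mode (brstField M b c) 0 * ∑ y, hInv y v • mode (totalCurrent M b c y) m)
      = -((∑ y, hInv y v • mode (totalCurrent M b c y) m) * mode (brstField M b c) 0) := by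
    rw [Finset.mul_sum, Finset.sum_mul, Finset.smul_sum, ← Finset.sum_neg_distrib]
    refine Finset.sum_congr rfl fun w _ => ?_
    by_cases h : hInv w v = 0
    · simp [h]
    · rw [mul_smul_comm, H, smul_mul_assoc, smul_smul, smul_smul, mul_right_comm, hInv_parity h]
      module
  rw [← mul_assoc, hQ, add_mul, smul_mul_assoc, mul_assoc _ (mode (b v) m), hQ, mul_add, smul_add,
    hL, mul_smul_comm, smul_smul, sgnG_sq, mul_assoc]
  module

end BrstSystem

end

end AffineOsp

end

noncomputable section

namespace AffineOsp

open Gen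

/-! ### Oscillators on the Fock space -/

lemma bCre_tmul (i : BosIdx) (p : MvPolynomial BosIdx ℂ) (q : ExteriorAlgebra ℂ (FerIdx →₀ ℂ)) :
    bCre i (Fock.tmul p q) = Fock.tmul (MvPolynomial.X i * p) q := rfl

lemma fCre_tmul (i : FerIdx) (p : MvPolynomial BosIdx ℂ) (q : ExteriorAlgebra ℂ (FerIdx →₀ ℂ)) :
    fCre i (Fock.tmul p q)
      = Fock.tmul p (ExteriorAlgebra.ι ℂ (Finsupp.single i (1 : ℂ)) * q) := rfl

lemma Fock.tmul_add (p : MvPolynomial BosIdx ℂ) (q q' : ExteriorAlgebra ℂ (FerIdx →₀ ℂ)) :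
    Fock.tmul p (q + q') = Fock.tmul p q + Fock.tmul p q' := TensorProduct.tmul_add p q q'

lemma Fock.add_tmul (p p' : MvPolynomial BosIdx ℂ) (q : ExteriorAlgebra ℂ (FerIdx →₀ ℂ)) :
    Fock.tmul (p + p') q = Fock.tmul p q + Fock.tmul p' q := TensorProduct.add_tmul p p' q

lemma Fock.tmul_smul (c : ℂ) (p : MvPolynomial BosIdx ℂ) (q : ExteriorAlgebra ℂ (FerIdx →₀ ℂ)) :
    Fock.tmul p (c • q) = c • Fock.tmul p q := TensorProduct.tmul_smul c p q

lemma Fock.smul_tmul (c : ℂ) (p : MvPolynomial BosIdx ℂ) (q : ExteriorAlgebra ℂ (FerIdx →₀ ℂ)) :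
    Fock.tmul (c • p) q = c • Fock.tmul p q := rfl

lemma Fock.tmul_neg (p : MvPolynomial BosIdx ℂ) (q : ExteriorAlgebra ℂ (FerIdx →₀ ℂ)) :
    Fock.tmul p (-q) = -Fock.tmul p q := TensorProduct.tmul_neg p q

lemma Fock.tmul_zero (p : MvPolynomial BosIdx ℂ) : Fock.tmul p 0 = 0 := TensorProduct.tmul_zero _ p

lemma Fock.zero_tmul (q : ExteriorAlgebra ℂ (FerIdx →₀ ℂ)) : Fock.tmul 0 q = 0 :=
  TensorProduct.zero_tmul _ q

lemma Fock.ext {S T : Module.End ℂ Fock} (h : ∀ p q, S (Fock.tmul p q) = T (Fock.tmul p q)) :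
    S = T := by
  refine LinearMap.ext fun v => ?_
  induction v using Fock.induction with
  | zero => simp
  | tmul p q => exact h p q
  | add v w hv hw => rw [map_add, map_add, hv, hw]

lemma bCre_bCre (i j : BosIdx) : bCre i * bCre j = bCre j * bCre i :=
  Fock.ext fun p q => by
    simp only [Module.End.mul_apply, bCre_tmul]
    rw [mul_left_comm]

lemma bAnn_bAnn (i j : BosIdx) : bAnn i * bAnn j = bAnn j * bAnn i :=
  Fock.ext fun p q => by
    simp only [Module.End.mul_apply, bAnn_tmul]
    have h : ⁅MvPolynomial.pderiv (R := ℂ) i, MvPolynomial.pderiv (R := ℂ) j⁆ = 0 := by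
      classical
      refine MvPolynomial.derivation_ext fun k => ?_
      rw [Derivation.commutator_apply, MvPolynomial.pderiv_X, MvPolynomial.pderiv_X,
        Pi.single_apply, Pi.single_apply]
      split_ifs <;> simp
    have h' := congrArg (fun d : Derivation ℂ (MvPolynomial BosIdx ℂ) _ => d p) h
    simp only [Derivation.commutator_apply, Derivation.coe_zero, Pi.zero_apply] at h'
    rw [sub_eq_zero.1 h']

lemma bAnn_bCre_self (i : BosIdx) : bAnn i * bCre i = bCre i * bAnn i + 1 :=
  Fock.ext fun p q => by
    simp only [Module.End.mul_apply, bAnn_tmul, bCre_tmul, LinearMap.add_apply, Module.End.one_apply]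
    rw [Derivation.leibniz, MvPolynomial.pderiv_X_self, smul_eq_mul, smul_eq_mul, mul_one,
      Fock.add_tmul]

lemma bAnn_bCre_ne {i j : BosIdx} (h : i ≠ j) : bAnn i * bCre j = bCre j * bAnn i :=
  Fock.ext fun p q => by
    simp only [Module.End.mul_apply, bAnn_tmul, bCre_tmul]
    rw [Derivation.leibniz, MvPolynomial.pderiv_X_of_ne h.symm, smul_zero, add_zero, smul_eq_mul]

lemma fCre_fCre (i j : FerIdx) : fCre i * fCre j = -(fCre j * fCre i) :=
  Fock.ext fun p q => by
    simp only [Module.End.mul_apply, fCre_tmul, LinearMap.neg_apply]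
    rw [← Fock.tmul_neg, ← mul_assoc, ← mul_assoc,
      eq_neg_of_add_eq_zero_left (ExteriorAlgebra.ι_add_mul_swap _ _), neg_mul]

lemma fAnn_fAnn (i j : FerIdx) : fAnn i * fAnn j = -(fAnn j * fAnn i) :=
  Fock.ext fun p q => by
    simp only [Module.End.mul_apply, fAnn_tmul, LinearMap.neg_apply]
    rw [← Fock.tmul_neg, CliffordAlgebra.contractLeft_comm]

lemma fAnn_fCre_self (i : FerIdx) : fAnn i * fCre i = -(fCre i * fAnn i) + 1 :=
  Fock.ext fun p q => by
    simp only [Module.End.mul_apply, fAnn_tmul, fCre_tmul, LinearMap.neg_apply,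
      LinearMap.add_apply, Module.End.one_apply]
    rw [ExteriorAlgebra.ι, CliffordAlgebra.contractLeft_ι_mul, Finsupp.lapply_apply,
      Finsupp.single_eq_same, one_smul, sub_eq_add_neg, Fock.tmul_add, Fock.tmul_neg, add_comm]

lemma fAnn_fCre_ne {i j : FerIdx} (h : i ≠ j) : fAnn i * fCre j = -(fCre j * fAnn i) :=
  Fock.ext fun p q => by
    simp only [Module.End.mul_apply, fAnn_tmul, fCre_tmul, LinearMap.neg_apply]
    rw [ExteriorAlgebra.ι, CliffordAlgebra.contractLeft_ι_mul, Finsupp.lapply_apply,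
      Finsupp.single_eq_of_ne h, zero_smul, zero_sub, Fock.tmul_neg]

lemma bCre_fCre (i : BosIdx) (j : FerIdx) : bCre i * fCre j = fCre j * bCre i :=
  Fock.ext fun _ _ => rfl
lemma bCre_fAnn (i : BosIdx) (j : FerIdx) : bCre i * fAnn j = fAnn j * bCre i :=
  Fock.ext fun _ _ => rfl
lemma bAnn_fCre (i : BosIdx) (j : FerIdx) : bAnn i * fCre j = fCre j * bAnn i :=
  Fock.ext fun _ _ => rfl
lemma bAnn_fAnn (i : BosIdx) (j : FerIdx) : bAnn i * fAnn j = fAnn j * bAnn i :=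
  Fock.ext fun _ _ => rfl

lemma bAnn_vac (i : BosIdx) : bAnn i vac = 0 := by
  rw [vac, bAnn_tmul, MvPolynomial.pderiv_one, Fock.zero_tmul]

lemma fAnn_vac (i : FerIdx) : fAnn i vac = 0 := by
  rw [vac, fAnn_tmul, CliffordAlgebra.contractLeft_one, Fock.tmul_zero]

lemma vac_ne_zero : vac ≠ 0 := by
  intro h
  let ε : Fock →ₗ[ℂ] ℂ := TensorProduct.lift
    ((LinearMap.mul ℂ ℂ).compl₁₂ (MvPolynomial.aeval (fun _ : BosIdx => (0 : ℂ))).toLinearMap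
      (ExteriorAlgebra.algebraMapInv (R := ℂ) (M := FerIdx →₀ ℂ)).toLinearMap)
  have h1 : ε vac = 1 := by
    change (MvPolynomial.aeval (fun _ : BosIdx => (0 : ℂ)) 1)
      * ExteriorAlgebra.algebraMapInv (R := ℂ) (M := FerIdx →₀ ℂ) 1 = 1
    rw [map_one, map_one, one_mul]
  rw [h, map_zero] at h1
  exact zero_ne_one h1

/-- The Fock space is generated from the vacuum by the creation operators. -/
lemma Fock.eq_top {M : Submodule ℂ Fock} (h : vac ∈ M) (hb : ∀ i, ∀ v ∈ M, bCre i v ∈ M)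
    (hf : ∀ i, ∀ v ∈ M, fCre i v ∈ M) : M = ⊤ := by
  have h1 : ∀ q, Fock.tmul 1 q ∈ M := fun q => by
    induction q using CliffordAlgebra.left_induction with
    | algebraMap r =>
      rw [Algebra.algebraMap_eq_smul_one, Fock.tmul_smul]
      exact M.smul_mem _ h
    | add v w hv hw => rw [Fock.tmul_add]; exact M.add_mem hv hw
    | ι_mul x m hx =>
      induction m using Finsupp.induction_linear with
      | zero => rw [map_zero, zero_mul, Fock.tmul_zero]; exact M.zero_mem
      | add f g hf hg => rw [map_add, add_mul, Fock.tmul_add]; exact M.add_mem hf hg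
      | single i c =>
        rw [show Finsupp.single i c = c • Finsupp.single i (1 : ℂ) by simp, map_smul,
          Algebra.smul_mul_assoc, Fock.tmul_smul]
        exact M.smul_mem _ (hf i _ hx)
  refine Submodule.eq_top_iff'.2 fun v => ?_
  induction v using Fock.induction with
  | zero => exact M.zero_mem
  | add v w hv hw => exact M.add_mem hv hw
  | tmul p q =>
    induction p using MvPolynomial.induction_on with
    | C a =>
      rw [← mul_one (MvPolynomial.C a), ← MvPolynomial.smul_eq_C_mul, Fock.smul_tmul]
      exact M.smul_mem _ (h1 q)
    | add p p' hp hp' => rw [Fock.add_tmul]; exact M.add_mem (hp) (hp')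
    | mul_X p i hp => rw [mul_comm, ← bCre_tmul]; exact hb i _ (hp)

/-! ### Relations of the free fields -/

section

variable {s s' : BosPair} {r r' : FerPair} {t t' : ℤ}

lemma mode_bosFst (s : BosPair) (t n : ℤ) : mode (bosFst s t) n =
    if t ≤ n then bAnn (.inl (s, n)) else bCre (.inl (s, n)) := rfl
lemma mode_bosSnd (s : BosPair) (t n : ℤ) : mode (bosSnd s t) n =
    if t ≤ -n then bCre (.inl (s, -n)) else -bAnn (.inl (s, -n)) := rfl
lemma mode_ferFst (s : FerPair) (t n : ℤ) : mode (ferFst s t) n =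
    if t ≤ n then fAnn (s, n) else fCre (s, n) := rfl
lemma mode_ferSnd (s : FerPair) (t n : ℤ) : mode (ferSnd s t) n =
    if t ≤ -n then fCre (s, -n) else fAnn (s, -n) := rfl

lemma LB.of_comm {V : Type*} [AddCommGroup V] [Module ℂ V] {e : ℂ} {A B : fields V}
    (h : ∀ m n, mode A m * mode B n = e • (mode B n * mode A m)) : LB e A B 0 0 := fun m n => by
  rw [h m n]; simp

lemma inl_ne {s s' : BosPair} {m n : ℤ} (h : s ≠ s' ∨ m ≠ n) :
    (.inl (s, m) : BosIdx) ≠ .inl (s', n) := by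
  simp only [ne_eq, Sum.inl.injEq, Prod.mk.injEq]; tauto

lemma ferIdx_ne {s s' : FerPair} {m n : ℤ} (h : s ≠ s' ∨ m ≠ n) : ((s, m) : FerIdx) ≠ (s', n) := by
  simp only [ne_eq, Prod.mk.injEq]; tauto

/-- Within one pair the levels have to agree. Otherwise the same mode would be a creation operator
in one field and the conjugate annihilation operator in the other. -/
lemma bosFst_bosFst (ht : s = s' → t = t') : LB 1 (bosFst s t) (bosFst s' t') 0 0 :=
  .of_comm fun m n => by
    rw [one_smul]
    by_cases h : s ≠ s' ∨ m ≠ n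
    · rw [mode_bosFst, mode_bosFst]
      split_ifs
      · exact bAnn_bAnn _ _
      · exact bAnn_bCre_ne (inl_ne h)
      · exact (bAnn_bCre_ne (inl_ne h).symm).symm
      · exact bCre_bCre _ _
    · push Not at h
      obtain ⟨rfl, rfl⟩ := h
      rw [ht rfl]

lemma bosSnd_bosSnd (ht : s = s' → t = t') : LB 1 (bosSnd s t) (bosSnd s' t') 0 0 :=
  .of_comm fun m n => by
    rw [one_smul]
    by_cases h : s ≠ s' ∨ -m ≠ -n
    · rw [mode_bosSnd, mode_bosSnd]
      split_ifs
      · exact bCre_bCre _ _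
      · rw [mul_neg, neg_mul, bAnn_bCre_ne (inl_ne h).symm]
      · rw [mul_neg, neg_mul, bAnn_bCre_ne (inl_ne h)]
      · rw [neg_mul_neg, neg_mul_neg, bAnn_bAnn]
    · push Not at h
      obtain ⟨rfl, h⟩ := h
      obtain rfl := neg_inj.1 h
      rw [ht rfl]

lemma bosFst_bosSnd_ne (h : s ≠ s') : LB 1 (bosFst s t) (bosSnd s' t') 0 0 :=
  .of_comm fun m n => by
    rw [one_smul, mode_bosFst, mode_bosSnd]
    split_ifs
    · exact bAnn_bCre_ne (inl_ne (.inl h))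
    · rw [mul_neg, neg_mul, bAnn_bAnn]
    · exact bCre_bCre _ _
    · rw [mul_neg, neg_mul, bAnn_bCre_ne (inl_ne (.inl h.symm))]

lemma bosFst_bosSnd (s : BosPair) (t : ℤ) : LB 1 (bosFst s t) (bosSnd s t) oneF 0 := fun m n => by
  rw [one_smul, mode_zero, smul_zero, add_zero, mode_oneF, mode_bosFst, mode_bosSnd]
  by_cases h : m = -n
  · subst h
    rw [neg_add_cancel, if_pos rfl]
    split_ifs
    · exact bAnn_bCre_self _
    · rw [mul_neg, neg_mul, bAnn_bCre_self]; abel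
  · rw [if_neg (show ¬m + n = 0 by omega), add_zero]
    split_ifs
    · exact bAnn_bCre_ne (inl_ne (.inr h))
    · rw [mul_neg, neg_mul, bAnn_bAnn]
    · exact bCre_bCre _ _
    · rw [mul_neg, neg_mul, bAnn_bCre_ne (inl_ne (.inr (Ne.symm h)))]

lemma ferFst_ferFst (ht : r = r' → t = t') : LB (-1) (ferFst r t) (ferFst r' t') 0 0 :=
  .of_comm fun m n => by
    rw [neg_one_smul]
    by_cases h : r ≠ r' ∨ m ≠ n
    · rw [mode_ferFst, mode_ferFst]
      split_ifs
      · exact fAnn_fAnn _ _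
      · exact fAnn_fCre_ne (ferIdx_ne h)
      · rw [fAnn_fCre_ne (ferIdx_ne h).symm, neg_neg]
      · exact fCre_fCre _ _
    · push Not at h
      obtain ⟨rfl, rfl⟩ := h
      rw [ht rfl, mode_ferFst]
      split_ifs
      · exact fAnn_fAnn _ _
      · exact fCre_fCre _ _

lemma ferSnd_ferSnd (ht : r = r' → t = t') : LB (-1) (ferSnd r t) (ferSnd r' t') 0 0 :=
  .of_comm fun m n => by
    rw [neg_one_smul]
    by_cases h : r ≠ r' ∨ -m ≠ -n
    · rw [mode_ferSnd, mode_ferSnd]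
      split_ifs
      · exact fCre_fCre _ _
      · rw [fAnn_fCre_ne (ferIdx_ne h).symm, neg_neg]
      · exact fAnn_fCre_ne (ferIdx_ne h)
      · exact fAnn_fAnn _ _
    · push Not at h
      obtain ⟨rfl, h⟩ := h
      obtain rfl := neg_inj.1 h
      rw [ht rfl, mode_ferSnd]
      split_ifs
      · exact fCre_fCre _ _
      · exact fAnn_fAnn _ _

lemma ferFst_ferSnd_ne (h : r ≠ r') : LB (-1) (ferFst r t) (ferSnd r' t') 0 0 :=
  .of_comm fun m n => by
    rw [neg_one_smul, mode_ferFst, mode_ferSnd]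
    split_ifs
    · exact fAnn_fCre_ne (ferIdx_ne (.inl h))
    · exact fAnn_fAnn _ _
    · exact fCre_fCre _ _
    · rw [fAnn_fCre_ne (ferIdx_ne (.inl h.symm)), neg_neg]

lemma ferFst_ferSnd (r : FerPair) (t : ℤ) : LB (-1) (ferFst r t) (ferSnd r t) oneF 0 :=
  fun m n => by
    rw [neg_one_smul, mode_zero, smul_zero, add_zero, mode_oneF, mode_ferFst, mode_ferSnd]
    by_cases h : m = -n
    · subst h
      rw [neg_add_cancel, if_pos rfl]
      split_ifs
      · exact fAnn_fCre_self _
      · rw [fAnn_fCre_self]; abel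
    · rw [if_neg (show ¬m + n = 0 by omega), add_zero]
      split_ifs
      · exact fAnn_fCre_ne (ferIdx_ne (.inr h))
      · exact fAnn_fAnn _ _
      · exact fCre_fCre _ _
      · rw [fAnn_fCre_ne (ferIdx_ne (.inr (Ne.symm h))), neg_neg]

lemma bosFst_ferFst : LB 1 (bosFst s t) (ferFst r t') 0 0 := .of_comm fun m n => by
  rw [one_smul, mode_bosFst, mode_ferFst]; split_ifs <;> simp only [bCre_fCre, bCre_fAnn, bAnn_fCre, bAnn_fAnn]
lemma bosFst_ferSnd : LB 1 (bosFst s t) (ferSnd r t') 0 0 := .of_comm fun m n => by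
  rw [one_smul, mode_bosFst, mode_ferSnd]; split_ifs <;> simp only [bCre_fCre, bCre_fAnn, bAnn_fCre, bAnn_fAnn]
lemma bosSnd_ferFst : LB 1 (bosSnd s t) (ferFst r t') 0 0 := .of_comm fun m n => by
  rw [one_smul, mode_bosSnd, mode_ferFst]
  split_ifs <;> simp only [bCre_fCre, bCre_fAnn, bAnn_fCre, bAnn_fAnn, neg_mul, mul_neg]
lemma bosSnd_ferSnd : LB 1 (bosSnd s t) (ferSnd r t') 0 0 := .of_comm fun m n => by
  rw [one_smul, mode_bosSnd, mode_ferSnd]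
  split_ifs <;> simp only [bCre_fCre, bCre_fAnn, bAnn_fCre, bAnn_fAnn, neg_mul, mul_neg]

lemma mode_boson (u : Heis) (p : ℂ) (n : ℤ) : mode (boson u p) n =
    if n = 0 then p • 1
    else if 0 < n then (n : ℂ) • bAnn (.inr (u, (n - 1).toNat))
    else bCre (.inr (u, (-n - 1).toNat)) := rfl

lemma boson_comm_of {T : Module.End ℂ Fock} {u : Heis} {p : ℂ}
    (h : ∀ k, T * bCre (.inr (u, k)) = bCre (.inr (u, k)) * T)
    (h' : ∀ k, T * bAnn (.inr (u, k)) = bAnn (.inr (u, k)) * T) (n : ℤ) :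
    T * mode (boson u p) n = mode (boson u p) n * T := by
  rw [mode_boson]
  split_ifs
  · rw [mul_smul_comm, smul_mul_assoc, mul_one, one_mul]
  · rw [mul_smul_comm, smul_mul_assoc, h']
  · exact h _

lemma bosFst_boson (u : Heis) (p : ℂ) : LB 1 (bosFst s t) (boson u p) 0 0 := .of_comm fun m n => by
  rw [one_smul]
  refine boson_comm_of (fun k => ?_) (fun k => ?_) n <;> rw [mode_bosFst] <;> split_ifs
  · exact bAnn_bCre_ne (by simp)
  · exact bCre_bCre _ _
  · exact bAnn_bAnn _ _
  · exact (bAnn_bCre_ne (by simp)).symm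

lemma bosSnd_boson (u : Heis) (p : ℂ) : LB 1 (bosSnd s t) (boson u p) 0 0 := .of_comm fun m n => by
  rw [one_smul]
  refine boson_comm_of (fun k => ?_) (fun k => ?_) n <;> rw [mode_bosSnd] <;> split_ifs
  · exact bCre_bCre _ _
  · rw [mul_neg, neg_mul, bAnn_bCre_ne (by simp)]
  · exact (bAnn_bCre_ne (by simp)).symm
  · rw [mul_neg, neg_mul, bAnn_bAnn]

lemma ferFst_boson (u : Heis) (p : ℂ) : LB 1 (ferFst r t) (boson u p) 0 0 := .of_comm fun m n => by
  rw [one_smul]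
  refine boson_comm_of (fun k => ?_) (fun k => ?_) n <;> rw [mode_ferFst] <;> split_ifs <;>
    simp only [bCre_fCre, bCre_fAnn, bAnn_fCre, bAnn_fAnn]

lemma ferSnd_boson (u : Heis) (p : ℂ) : LB 1 (ferSnd r t) (boson u p) 0 0 := .of_comm fun m n => by
  rw [one_smul]
  refine boson_comm_of (fun k => ?_) (fun k => ?_) n <;> rw [mode_ferSnd] <;> split_ifs <;>
    simp only [bCre_fCre, bCre_fAnn, bAnn_fCre, bAnn_fAnn]

lemma boson_boson_ne {u u' : Heis} (h : u ≠ u') (p p' : ℂ) :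
    LB 1 (boson u p) (boson u' p') 0 0 := .of_comm fun m n => by
  rw [one_smul]
  refine boson_comm_of (fun k => ?_) (fun k => ?_) n <;> refine (boson_comm_of (fun l => ?_)
    (fun l => ?_) m).symm
  · exact bCre_bCre _ _
  · exact (bAnn_bCre_ne (by simp [h])).symm
  · exact bAnn_bCre_ne (by simp [h.symm])
  · exact bAnn_bAnn _ _

lemma boson_boson (u : Heis) (p : ℂ) : LB 1 (boson u p) (boson u p) 0 oneF := fun m n => by
  rw [one_smul, mode_zero, add_zero, mode_oneF, mode_boson, mode_boson]
  by_cases hm : m = 0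
  · simp only [hm, if_true, Int.cast_zero, zero_smul, add_zero, smul_mul_assoc, mul_smul_comm,
      one_mul, mul_one]
  by_cases hn : n = 0
  · simp only [hn, hm, add_zero, if_true, if_false, smul_zero, smul_mul_assoc, mul_smul_comm,
      one_mul, mul_one]
  simp only [hm, hn, if_false]
  by_cases h : m + n = 0
  · obtain rfl : n = -m := by omega
    simp only [h, if_true]
    rcases lt_or_gt_of_ne hm with hm' | hm'
    · have h1 : ¬ 0 < m := by omega
      have h2 : 0 < -m := by omega
      simp only [h1, h2, if_true, if_false, mul_smul_comm, smul_mul_assoc, bAnn_bCre_self]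
      push_cast
      module
    · have h1 : ¬ 0 < -m := by omega
      simp only [h1, hm', if_true, if_false, mul_smul_comm, smul_mul_assoc, neg_neg,
        bAnn_bCre_self]
      module
  · simp only [h, if_false, smul_zero, add_zero]
    split_ifs with h1 h2 h2
    · rw [smul_mul_smul_comm, smul_mul_smul_comm, mul_comm (m : ℂ), bAnn_bAnn]
    · rw [smul_mul_assoc, mul_smul_comm, bAnn_bCre_ne]
      simp only [ne_eq, Sum.inr.injEq, Prod.mk.injEq, true_and]
      omega
    · rw [smul_mul_assoc, mul_smul_comm, bAnn_bCre_ne]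
      simp only [ne_eq, Sum.inr.injEq, Prod.mk.injEq, true_and]
      omega
    · exact bCre_bCre _ _

end

end AffineOsp

end

noncomputable section

namespace AffineOsp

open Gen

/-! ### The free fields of the complex -/

/-- The conjugate pairs of free fields. -/
inductive Pair
  | matterB | matterF | liouvilleB | liouvilleF | ghost (x : Gen)
  deriving DecidableEq

open Pair

/-- Whether the fields of a pair are fermionic. -/
def isFer : Pair → Bool
  | matterB => false
  | liouvilleB => false
  | matterF => true
  | liouvilleF => true
  | ghost x => !isOdd x

/-- Sign of the exchange of two free fields. -/
def sgnP (s r : Pair) : ℂ := if isFer s = true ∧ isFer r = true then -1 else 1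

lemma sgnP_sq (s r : Pair) : sgnP s r * sgnP s r = 1 := by
  unfold sgnP; split_ifs <;> norm_num

lemma sgnP_comm (s r : Pair) : sgnP s r = sgnP r s := by
  simp only [sgnP, and_comm]

lemma sgnP_ghost (x y : Gen) : sgnP (ghost x) (ghost y) = sgnG x y := by
  cases x <;> cases y <;> simp [sgnP, sgnG, isFer, isOdd]

/-- The index of a pair of fields. -/
def Pair.code : Pair → BosPair ⊕ FerPair
  | matterB => .inl .matter
  | liouvilleB => .inl .liouville
  | ghost half => .inl .ghostHalf
  | ghost mhalf => .inl .ghostMHalf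
  | matterF => .inr .matter
  | liouvilleF => .inr .liouville
  | ghost plus => .inr .ghostPlus
  | ghost three => .inr .ghostThree
  | ghost minus => .inr .ghostMinus

lemma Pair.code_injective : Function.Injective Pair.code := by
  intro s r h
  cases s with
  | ghost x => cases r with
    | ghost y => cases x <;> cases y <;> simp_all [Pair.code]
    | _ => cases x <;> simp_all [Pair.code]
  | _ => cases r with
    | ghost y => cases y <;> simp_all [Pair.code]
    | _ => simp_all [Pair.code]

lemma Pair.code_surjective : Function.Surjective Pair.code := by
  rintro (s | s) <;> cases s
  exacts [⟨matterB, rfl⟩, ⟨liouvilleB, rfl⟩, ⟨ghost half, rfl⟩, ⟨ghost mhalf, rfl⟩,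
    ⟨matterF, rfl⟩, ⟨liouvilleF, rfl⟩, ⟨ghost plus, rfl⟩, ⟨ghost three, rfl⟩, ⟨ghost minus, rfl⟩]

lemma LB.of_eq {V : Type*} [AddCommGroup V] [Module ℂ V] {e e' : ℂ} {A B C C' E : fields V}
    (H : LB e A B C E) (he : e = e') (hC : C = C') : LB e' A B C' E := he ▸ hC ▸ H

/-- First field of a pair with a given index. -/
def codeFst (i : BosPair ⊕ FerPair) (t : ℤ) : fields Fock :=
  Sum.elim (fun s => bosFst s t) (fun s => ferFst s t) i

/-- Second field of a pair with a given index. -/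
def codeSnd (i : BosPair ⊕ FerPair) (t : ℤ) : fields Fock :=
  Sum.elim (fun s => bosSnd s t) (fun s => ferSnd s t) i

/-- Sign of the exchange of free fields with given indices. -/
def codeSgn (i j : BosPair ⊕ FerPair) : ℂ :=
  if i.isRight = true ∧ j.isRight = true then -1 else 1

lemma codeSgn_eq (s r : Pair) : codeSgn s.code r.code = sgnP s r := by
  have : ∀ s : Pair, s.code.isRight = isFer s := by
    intro s
    cases s with
    | ghost x => cases x <;> rfl
    | _ => rfl
  simp only [codeSgn, sgnP, this]

lemma codeFst_codeFst {i j : BosPair ⊕ FerPair} {t t' : ℤ} (h : i = j → t = t') :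
    LB (codeSgn i j) (codeFst i t) (codeFst j t') 0 0 := by
  rcases i with i | i <;> rcases j with j | j <;> simp only [codeSgn, codeFst, Sum.elim_inl,
    Sum.elim_inr, Sum.isRight_inl, Sum.isRight_inr, Bool.false_eq_true, and_false, false_and,
    and_self, if_true, if_false]
  · exact bosFst_bosFst fun e => h (by rw [e])
  · exact bosFst_ferFst
  · exact bosFst_ferFst.skew (hC := by simp) (hD := by simp)
  · exact ferFst_ferFst fun e => h (by rw [e])

lemma codeSnd_codeSnd {i j : BosPair ⊕ FerPair} {t t' : ℤ} (h : i = j → t = t') :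
    LB (codeSgn i j) (codeSnd i t) (codeSnd j t') 0 0 := by
  rcases i with i | i <;> rcases j with j | j <;> simp only [codeSgn, codeSnd, Sum.elim_inl,
    Sum.elim_inr, Sum.isRight_inl, Sum.isRight_inr, Bool.false_eq_true, and_false, false_and,
    and_self, if_true, if_false]
  · exact bosSnd_bosSnd fun e => h (by rw [e])
  · exact bosSnd_ferSnd
  · exact bosSnd_ferSnd.skew (hC := by simp) (hD := by simp)
  · exact ferSnd_ferSnd fun e => h (by rw [e])

lemma codeFst_codeSnd_ne {i j : BosPair ⊕ FerPair} {t t' : ℤ} (h : i ≠ j) :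
    LB (codeSgn i j) (codeFst i t) (codeSnd j t') 0 0 := by
  rcases i with i | i <;> rcases j with j | j <;> simp only [codeSgn, codeFst, codeSnd, Sum.elim_inl,
    Sum.elim_inr, Sum.isRight_inl, Sum.isRight_inr, Bool.false_eq_true, and_false, false_and,
    and_self, if_true, if_false]
  · exact bosFst_bosSnd_ne fun e => h (by rw [e])
  · exact bosFst_ferSnd
  · exact bosSnd_ferFst.skew (hC := by simp) (hD := by simp)
  · exact ferFst_ferSnd_ne fun e => h (by rw [e])

lemma codeFst_codeSnd (i : BosPair ⊕ FerPair) (t : ℤ) :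
    LB (codeSgn i i) (codeFst i t) (codeSnd i t) oneF 0 := by
  rcases i with i | i <;> simp only [codeSgn, codeFst, codeSnd, Sum.elim_inl,
    Sum.elim_inr, Sum.isRight_inl, Sum.isRight_inr, Bool.false_eq_true, and_self, if_true, if_false]
  · exact bosFst_bosSnd i t
  · exact ferFst_ferSnd i t

lemma codeFst_boson (i : BosPair ⊕ FerPair) (t : ℤ) (u : Heis) (p : ℂ) :
    LB 1 (codeFst i t) (boson u p) 0 0 := by
  rcases i with i | i
  · exact bosFst_boson u p
  · exact ferFst_boson u p

lemma codeSnd_boson (i : BosPair ⊕ FerPair) (t : ℤ) (u : Heis) (p : ℂ) :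
    LB 1 (codeSnd i t) (boson u p) 0 0 := by
  rcases i with i | i
  · exact bosSnd_boson u p
  · exact ferSnd_boson u p

lemma codeFst_vac (i : BosPair ⊕ FerPair) {t n : ℤ} (h : t ≤ n) : mode (codeFst i t) n vac = 0 := by
  rcases i with i | i <;> simp only [codeFst, Sum.elim_inl, Sum.elim_inr, mode_bosFst, mode_ferFst,
    h, if_true, bAnn_vac, fAnn_vac]

lemma codeSnd_vac (i : BosPair ⊕ FerPair) {t n : ℤ} (h : -t < n) : mode (codeSnd i t) n vac = 0 := by
  have h' : ¬ t ≤ -n := by omega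
  rcases i with i | i <;> simp only [codeSnd, Sum.elim_inl, Sum.elim_inr, mode_bosSnd, mode_ferSnd,
    h', if_false, bAnn_vac, fAnn_vac, LinearMap.neg_apply, neg_zero]

lemma boson_vac (u : Heis) (p : ℂ) {n : ℤ} (h : 0 < n) : mode (boson u p) n vac = 0 := by
  rw [mode_boson, if_neg h.ne', if_pos h, LinearMap.smul_apply, bAnn_vac, smul_zero]

lemma mode_boson_zero (u : Heis) (p : ℂ) : mode (boson u p) 0 = p • 1 := by
  rw [mode_boson, if_pos rfl]

lemma mode_boson_of_ne (u : Heis) (p p' : ℂ) {n : ℤ} (h : n ≠ 0) :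
    mode (boson u p) n = mode (boson u p') n := by
  rw [mode_boson, mode_boson, if_neg h, if_neg h]

/-- The Fock space is generated from the vacuum by the creation modes of the free fields. -/
lemma Fock.eq_top_of_code {M : Submodule ℂ Fock} (h : vac ∈ M) (t : BosPair ⊕ FerPair → ℤ)
    (p : Heis → ℂ)
    (h₁ : ∀ i n, n < t i → ∀ v ∈ M, mode (codeFst i (t i)) n v ∈ M)
    (h₂ : ∀ i n, n ≤ -t i → ∀ v ∈ M, mode (codeSnd i (t i)) n v ∈ M)
    (h₃ : ∀ u n, n < 0 → ∀ v ∈ M, mode (boson u (p u)) n v ∈ M) : M = ⊤ := by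
  refine Fock.eq_top h (fun i v hv => ?_) (fun i v hv => ?_)
  · rcases i with ⟨s, n⟩ | ⟨u, n⟩
    · by_cases hn : t (.inl s) ≤ n
      · have := h₂ (.inl s) (-n) (by omega) v hv
        simpa [codeSnd, mode_bosSnd, hn] using this
      · have := h₁ (.inl s) n (by omega) v hv
        simpa [codeFst, mode_bosFst, hn] using this
    · have := h₃ u (-(n + 1 : ℤ)) (by omega) v hv
      rw [mode_boson, if_neg (by omega), if_neg (by omega)] at this
      simpa using this
  · rcases i with ⟨s, n⟩
    by_cases hn : t (.inr s) ≤ n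
    · have := h₂ (.inr s) (-n) (by omega) v hv
      simpa [codeSnd, mode_ferSnd, hn] using this
    · have := h₁ (.inr s) n (by omega) v hv
      simpa [codeFst, mode_ferFst, hn] using this

namespace Datum

variable (D : Datum)

/-- The mode from which on the first field of a pair annihilates the vacuum. -/
def lev : Pair → ℤ
  | matterB => 0
  | matterF => 0
  | liouvilleB => 1
  | liouvilleF => 1
  | ghost x => D.gh.level x

/-- The first field of a pair. -/
def fst (s : Pair) : fields Fock := codeFst s.code (D.lev s)

/-- The second field of a pair. -/
def snd (s : Pair) : fields Fock := codeSnd s.code (D.lev s)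

/-- The zero modes of the two free bosons. -/
def mom : Heis → ℂ
  | .matter => 2 * D.j₁ / D.a
  | .liouville => -(2 * D.j₂ + 1) / D.a'

/-- The two free bosons. -/
def bos (u : Heis) : fields Fock := boson u (D.mom u)

lemma fst_ghost (x : Gen) : D.fst (ghost x) = D.b x := by cases x <;> rfl
lemma snd_ghost (x : Gen) : D.snd (ghost x) = D.c x := by cases x <;> rfl

lemma fst_fst (s r : Pair) : LB (sgnP s r) (D.fst s) (D.fst r) 0 0 :=
  codeSgn_eq s r ▸ codeFst_codeFst fun h => by rw [Pair.code_injective h]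

lemma snd_snd (s r : Pair) : LB (sgnP s r) (D.snd s) (D.snd r) 0 0 :=
  codeSgn_eq s r ▸ codeSnd_codeSnd fun h => by rw [Pair.code_injective h]

lemma fst_snd (s r : Pair) :
    LB (sgnP s r) (D.fst s) (D.snd r) (if s = r then oneF else 0) 0 := by
  by_cases h : s = r
  · subst h
    rw [if_pos rfl, ← codeSgn_eq]
    exact codeFst_codeSnd _ _
  · rw [if_neg h, ← codeSgn_eq]
    exact codeFst_codeSnd_ne fun h' => h (Pair.code_injective h')

lemma snd_fst (s r : Pair) :
    LB (sgnP s r) (D.snd s) (D.fst r) (if s = r then (-sgnP s r) • oneF else 0) 0 := by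
  rw [sgnP_comm]
  refine (D.fst_snd r s).skew (sgnP_sq _ _) ?_ (by simp)
  by_cases h : s = r
  · subst h; simp
  · simp [h, Ne.symm h]

lemma fst_bos (s : Pair) (u : Heis) : LB 1 (D.fst s) (D.bos u) 0 0 := codeFst_boson _ _ _ _
lemma snd_bos (s : Pair) (u : Heis) : LB 1 (D.snd s) (D.bos u) 0 0 := codeSnd_boson _ _ _ _
lemma bos_fst (s : Pair) (u : Heis) : LB 1 (D.bos u) (D.fst s) 0 0 :=
  (D.fst_bos s u).skew (hC := by simp) (hD := by simp)
lemma bos_snd (s : Pair) (u : Heis) : LB 1 (D.bos u) (D.snd s) 0 0 :=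
  (D.snd_bos s u).skew (hC := by simp) (hD := by simp)

lemma bos_bos (u : Heis) : LB 1 (D.bos u) (D.bos u) 0 oneF := boson_boson u _
lemma bos_bos_ne {u u' : Heis} (h : u ≠ u') : LB 1 (D.bos u) (D.bos u') 0 0 :=
  boson_boson_ne h _ _

lemma fst_vac (s : Pair) {n : ℤ} (h : D.lev s ≤ n) : mode (D.fst s) n vac = 0 := codeFst_vac _ h
lemma snd_vac (s : Pair) {n : ℤ} (h : -D.lev s < n) : mode (D.snd s) n vac = 0 := codeSnd_vac _ h
lemma bos_vac (u : Heis) {n : ℤ} (h : 0 < n) : mode (D.bos u) n vac = 0 := boson_vac _ _ h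
lemma bos_zero (u : Heis) : mode (D.bos u) 0 = D.mom u • 1 := mode_boson_zero _ _

lemma eq_top {M : Submodule ℂ Fock} (h : vac ∈ M)
    (h₁ : ∀ s n, n < D.lev s → ∀ v ∈ M, mode (D.fst s) n v ∈ M)
    (h₂ : ∀ s n, n ≤ -D.lev s → ∀ v ∈ M, mode (D.snd s) n v ∈ M)
    (h₃ : ∀ u n, n < 0 → ∀ v ∈ M, mode (D.bos u) n v ∈ M) : M = ⊤ := by
  let e : Pair ≃ BosPair ⊕ FerPair :=
    Equiv.ofBijective Pair.code ⟨Pair.code_injective, Pair.code_surjective⟩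
  have he : ∀ s, e.symm s.code = s := e.symm_apply_apply
  refine Fock.eq_top_of_code h (fun i => D.lev (e.symm i)) D.mom (fun i => ?_) (fun i => ?_) h₃
  · obtain ⟨s, rfl⟩ := Pair.code_surjective i
    rw [he]
    exact h₁ s
  · obtain ⟨s, rfl⟩ := Pair.code_surjective i
    rw [he]
    exact h₂ s

lemma freeFields_matter : FreeFields D.beta D.gamma D.psiP D.psi D.phi where
  ββ := (D.fst_fst matterB matterB).of_eq (by simp [sgnP, isFer]) (by simp)
  βγ := (D.fst_snd matterB matterB).of_eq (by simp [sgnP, isFer]) (by simp)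
  γγ := (D.snd_snd matterB matterB).of_eq (by simp [sgnP, isFer]) (by simp)
  pp := (D.fst_fst matterF matterF).of_eq (by simp [sgnP, isFer]) (by simp)
  pψ := (D.fst_snd matterF matterF).of_eq (by simp [sgnP, isFer]) (by simp)
  ψψ := (D.snd_snd matterF matterF).of_eq (by simp [sgnP, isFer]) (by simp)
  φφ := D.bos_bos .matter
  βp := (D.fst_fst matterB matterF).of_eq (by simp [sgnP, isFer]) (by simp)
  βψ := (D.fst_snd matterB matterF).of_eq (by simp [sgnP, isFer]) (by simp)
  βφ := D.fst_bos matterB .matter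
  γp := (D.snd_fst matterB matterF).of_eq (by simp [sgnP, isFer]) (by simp)
  γψ := (D.snd_snd matterB matterF).of_eq (by simp [sgnP, isFer]) (by simp)
  γφ := D.snd_bos matterB .matter
  pφ := D.fst_bos matterF .matter
  ψφ := D.snd_bos matterF .matter

lemma freeFields_liouville : FreeFields D.betaT D.gammaT D.psiPT D.psiT D.phiT where
  ββ := (D.fst_fst liouvilleB liouvilleB).of_eq (by simp [sgnP, isFer]) (by simp)
  βγ := (D.fst_snd liouvilleB liouvilleB).of_eq (by simp [sgnP, isFer]) (by simp)
  γγ := (D.snd_snd liouvilleB liouvilleB).of_eq (by simp [sgnP, isFer]) (by simp)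
  pp := (D.fst_fst liouvilleF liouvilleF).of_eq (by simp [sgnP, isFer]) (by simp)
  pψ := (D.fst_snd liouvilleF liouvilleF).of_eq (by simp [sgnP, isFer]) (by simp)
  ψψ := (D.snd_snd liouvilleF liouvilleF).of_eq (by simp [sgnP, isFer]) (by simp)
  φφ := D.bos_bos .liouville
  βp := (D.fst_fst liouvilleB liouvilleF).of_eq (by simp [sgnP, isFer]) (by simp)
  βψ := (D.fst_snd liouvilleB liouvilleF).of_eq (by simp [sgnP, isFer]) (by simp)
  βφ := D.fst_bos liouvilleB .liouville
  γp := (D.snd_fst liouvilleB liouvilleF).of_eq (by simp [sgnP, isFer]) (by simp)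
  γψ := (D.snd_snd liouvilleB liouvilleF).of_eq (by simp [sgnP, isFer]) (by simp)
  γφ := D.snd_bos liouvilleB .liouville
  pφ := D.fst_bos liouvilleF .liouville
  ψφ := D.snd_bos liouvilleF .liouville

lemma ghostSystem : GhostSystem D.b D.c where
  bb x y := by
    have := D.fst_fst (ghost x) (ghost y)
    rwa [sgnP_ghost, fst_ghost, fst_ghost] at this
  cc x y := by
    have := D.snd_snd (ghost x) (ghost y)
    rwa [sgnP_ghost, snd_ghost, snd_ghost] at this
  bc x y := by
    have := D.fst_snd (ghost x) (ghost y)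
    rw [sgnP_ghost, fst_ghost, snd_ghost] at this
    simpa only [Pair.ghost.injEq] using this

lemma fst_fst_ne {s r : Pair} {e : ℂ} (he : sgnP s r = e) : LB e (D.fst s) (D.fst r) 0 0 :=
  he ▸ D.fst_fst s r

lemma snd_snd_ne {s r : Pair} {e : ℂ} (he : sgnP s r = e) : LB e (D.snd s) (D.snd r) 0 0 :=
  he ▸ D.snd_snd s r

lemma fst_snd_ne {s r : Pair} (h : s ≠ r) {e : ℂ} (he : sgnP s r = e) :
    LB e (D.fst s) (D.snd r) 0 0 := (D.fst_snd s r).of_eq he (if_neg h)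

lemma snd_fst_ne {s r : Pair} (h : s ≠ r) {e : ℂ} (he : sgnP s r = e) :
    LB e (D.snd s) (D.fst r) 0 0 := (D.snd_fst s r).of_eq he (if_neg h)

lemma sgnP_matterB (s : Pair) : sgnP s matterB = 1 := by simp [sgnP, isFer]
lemma sgnP_liouvilleB (s : Pair) : sgnP s liouvilleB = 1 := by simp [sgnP, isFer]

lemma fst_J {s : Pair} (h : s ≠ matterB) (h' : s ≠ matterF) (x : Gen) :
    LB (sgnE (sgnP s matterF) x) (D.fst s) (D.J x) 0 0 :=
  wakimotoCurrent_comm (sgnP_sq _ _) _ _ (D.fst_fst_ne (r := matterB) (sgnP_matterB s))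
    (D.fst_snd_ne (r := matterB) h (sgnP_matterB s)) (D.fst_fst_ne (r := matterF) rfl)
    (D.fst_snd_ne (r := matterF) h' rfl) (D.fst_bos s .matter) x

lemma snd_J {s : Pair} (h : s ≠ matterB) (h' : s ≠ matterF) (x : Gen) :
    LB (sgnE (sgnP s matterF) x) (D.snd s) (D.J x) 0 0 :=
  wakimotoCurrent_comm (sgnP_sq _ _) _ _ (D.snd_fst_ne (r := matterB) h (sgnP_matterB s))
    (D.snd_snd_ne (r := matterB) (sgnP_matterB s)) (D.snd_fst_ne (r := matterF) h' rfl)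
    (D.snd_snd_ne (r := matterF) rfl) (D.snd_bos s .matter) x

lemma bos_J (x : Gen) : LB 1 (D.bos .liouville) (D.J x) 0 0 := by
  have := wakimotoCurrent_comm (X := D.bos .liouville) (e := 1) (one_mul 1) D.k D.a
    (D.bos_fst matterB _) (D.bos_snd matterB _) (D.bos_fst matterF _) (D.bos_snd matterF _)
    (D.bos_bos_ne (u' := .matter) (by simp)) x
  rwa [show sgnE 1 x = 1 by simp [sgnE]] at this

lemma fst_JT {s : Pair} (h : s ≠ liouvilleB) (h' : s ≠ liouvilleF) (x : Gen) :
    LB (sgnE (sgnP s liouvilleF) x) (D.fst s) (D.JT x) 0 0 :=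
  dualWakimotoCurrent_comm (sgnP_sq _ _) _ _ (D.fst_fst_ne (r := liouvilleB) (sgnP_liouvilleB s))
    (D.fst_snd_ne (r := liouvilleB) h (sgnP_liouvilleB s)) (D.fst_fst_ne (r := liouvilleF) rfl)
    (D.fst_snd_ne (r := liouvilleF) h' rfl) (D.fst_bos s .liouville) x

lemma snd_JT {s : Pair} (h : s ≠ liouvilleB) (h' : s ≠ liouvilleF) (x : Gen) :
    LB (sgnE (sgnP s liouvilleF) x) (D.snd s) (D.JT x) 0 0 :=
  dualWakimotoCurrent_comm (sgnP_sq _ _) _ _ (D.snd_fst_ne (r := liouvilleB) h (sgnP_liouvilleB s))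
    (D.snd_snd_ne (r := liouvilleB) (sgnP_liouvilleB s)) (D.snd_fst_ne (r := liouvilleF) h' rfl)
    (D.snd_snd_ne (r := liouvilleF) rfl) (D.snd_bos s .liouville) x

lemma sgnE_sq {e : ℂ} (he : e * e = 1) (x : Gen) : sgnE e x * sgnE e x = 1 := by
  unfold sgnE; split_ifs <;> simp [he]

/-- `wakimotoCurrent_comm` gives the signs between a matter current and the Liouville free fields;
its dual version is then applied with the whole matter current in the role of X. -/
lemma J_JT (x y : Gen) : LB (sgnJ x y) (D.J x) (D.JT y) 0 0 := by
  have h0 : ((sgnJ x y : ℤ) : ℂ) = sgnE (sgnE (-1) x) y := by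
    cases x <;> cases y <;> simp [sgnJ, sgnE, isOdd]
  have e1 : sgnP liouvilleB matterF = 1 := by simp [sgnP, isFer]
  have e2 : sgnP liouvilleF matterF = -1 := by simp [sgnP, isFer]
  have e3 : sgnE 1 x = 1 := by simp [sgnE]
  have b1 := D.fst_J (s := liouvilleB) (by simp) (by simp) x
  have b2 := D.snd_J (s := liouvilleB) (by simp) (by simp) x
  have b3 := D.fst_J (s := liouvilleF) (by simp) (by simp) x
  have b4 := D.snd_J (s := liouvilleF) (by simp) (by simp) x
  rw [e1, e3] at b1 b2
  rw [e2] at b3 b4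
  have hs := sgnE_sq (e := -1) (by norm_num) x
  rw [h0]
  exact dualWakimotoCurrent_comm hs _ _ (b1.skew (hC := by simp) (hD := by simp))
    (b2.skew (hC := by simp) (hD := by simp)) (b3.skew hs (by simp) (by simp))
    (b4.skew hs (by simp) (by simp)) ((D.bos_J x).skew (hC := by simp) (hD := by simp)) y

lemma JT_J (x y : Gen) : LB (sgnJ x y) (D.JT x) (D.J y) 0 0 := by
  have h := (D.J_JT y x).skew (C' := 0) (D' := 0) (sgnJ_sq y x) (by simp) (by simp)
  rwa [show sgnJ y x = sgnJ x y by simp only [sgnJ, and_comm]] at h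

/-- The levels k and -3-k add up to -3, the negative of the level of the ghosts. This is the
criticality that makes Q nilpotent. -/
lemma brstSystem (ha : D.a ^ 2 = 2 * D.k + 3) (ha' : D.a' ^ 2 = 2 * (-3 - D.k) + 3) :
    BrstSystem (fun x => D.J x + D.JT x) D.b D.c where
  ghost := D.ghostSystem
  matter x y := by
    refine ((((D.freeFields_matter.affine ha) x y).add_right (D.J_JT x y)).add_left
      ((D.JT_J x y).add_right (D.freeFields_liouville.affine_dual ha' x y))).congr ?_ ?_
    · simp only [smul_add, Finset.sum_add_distrib, add_zero, zero_add]; rfl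
    · module
  bM v x := by
    have e1 : sgnE (sgnP (ghost v) matterF) x = sgnM x v := by
      cases x <;> cases v <;> simp [sgnE, sgnP, sgnM, isFer, isOdd]
    have h1 := D.fst_J (s := ghost v) (by simp) (by simp) x
    have h2 := D.fst_JT (s := ghost v) (by simp) (by simp) x
    rw [show sgnP (ghost v) liouvilleF = sgnP (ghost v) matterF from rfl] at h2
    rw [e1, fst_ghost] at h1 h2
    exact (h1.add_right h2).congr (add_zero 0) (add_zero 0)
  cM v x := by
    have e1 : sgnE (sgnP (ghost v) matterF) x = sgnM x v := by
      cases x <;> cases v <;> simp [sgnE, sgnP, sgnM, isFer, isOdd]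
    have h1 := D.snd_J (s := ghost v) (by simp) (by simp) x
    have h2 := D.snd_JT (s := ghost v) (by simp) (by simp) x
    rw [show sgnP (ghost v) liouvilleF = sgnP (ghost v) matterF from rfl] at h2
    rw [e1, snd_ghost] at h1 h2
    exact (h1.add_right h2).congr (add_zero 0) (add_zero 0)

lemma ghostProd_eq (h : ℤ) (x : Gen) (A : fields Fock) (y : Gen) :
    D.ghostProd h x A y = nopE h (sgnG x y) A (D.b y) := by
  unfold ghostProd sgnG
  split_ifs
  · rw [nopF_eq, Int.cast_neg, Int.cast_one]
  · rw [nop_eq, Int.cast_one]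

lemma Jgh_eq (x : Gen) : D.Jgh x = ghostCurrent D.b D.c x := by
  simp only [Jgh, ghostCurrent, ghostProd_eq, ghostN]

lemma brstCurrent_eq : D.brstCurrent = brstField (fun x => D.J x + D.JT x) D.b D.c := by
  simp only [brstCurrent, brstField, nop_eq, Jgh_eq]

end Datum

end AffineOsp

end

noncomputable section

namespace AffineOsp

/-! ### Zero modes of quadratic expressions -/

section Quadratic

variable {V : Type*} [AddCommGroup V] [Module ℂ V]

/-- The field with modes `μ n • A n`. -/
def mulF (μ : ℤ → ℂ) (A : fields V) : fields V :=
  ⟨fun n => μ n • mode A n, fun v => by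
    obtain ⟨N, hN⟩ := mode_eventually_zero A v
    exact ⟨N, fun n hn => by rw [LinearMap.smul_apply, hN n hn, smul_zero]⟩⟩

@[simp] lemma mode_mulF (μ : ℤ → ℂ) (A : fields V) (n : ℤ) : mode (mulF μ A) n = μ n • mode A n :=
  rfl

lemma deriv_eq_mulF (h : ℤ) (A : fields V) : deriv h A = mulF (fun n => -((n : ℂ) + h)) A := rfl

lemma mulF_const (c : ℂ) (A : fields V) : mulF (fun _ => c) A = c • A := rfl

lemma mulF_one (A : fields V) : mulF (fun _ => 1) A = A := fields_ext fun n => by simp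

lemma mulF_zero (A : fields V) : mulF (fun _ => 0) A = 0 := fields_ext fun n => by simp

lemma mulF_add (μ ν : ℤ → ℂ) (A : fields V) :
    mulF (fun n => μ n + ν n) A = mulF μ A + mulF ν A := fields_ext fun n => by simp [add_smul]

/-- The relation `A_m B_n = e B_n A_m + α_m δ_{m+n,0}`. -/
def SB (e : ℂ) (A B : fields V) (α : ℤ → ℂ) : Prop := ∀ m n : ℤ,
  mode A m * mode B n = e • (mode B n * mode A m) + (if m + n = 0 then α m else 0) • 1

namespace SB

variable {e : ℂ} {A B B' : fields V} {α α' : ℤ → ℂ}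

lemma of_zero (H : LB e A B 0 0) : SB e A B fun _ => 0 := fun m n => by
  rw [H m n]; simp

lemma of_one (H : LB e A B oneF 0) : SB e A B fun _ => 1 := fun m n => by
  rw [H m n, mode_oneF]; split_ifs <;> simp

lemma of_smul {c : ℂ} (H : LB e A B (c • oneF) 0) : SB e A B fun _ => c := fun m n => by
  rw [H m n, mode_smul, mode_oneF]; split_ifs <;> simp

lemma of_lin {c : ℂ} (H : LB e A B 0 (c • oneF)) : SB e A B fun m => m * c := fun m n => by
  rw [H m n, mode_smul, mode_oneF]; split_ifs <;> simp [smul_smul]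

lemma congr (H : SB e A B α) (h : ∀ m, α m = α' m) : SB e A B α' := fun m n => by
  rw [H m n, h m]

lemma mulF_right (μ : ℤ → ℂ) (H : SB e A B α) : SB e A (mulF μ B) fun m => μ (-m) * α m :=
  fun m n => by
    rw [mode_mulF, mul_smul_comm, H m n, smul_mul_assoc]
    split_ifs with h
    · rw [show n = -m by omega]; module
    · module

lemma add_right (H : SB e A B α) (H' : SB e A B' α') : SB e A (B + B') fun m => α m + α' m :=
  fun m n => by
    rw [mode_add, mul_add, H m n, H' m n, add_mul]
    split_ifs <;> module

lemma smul_right (c : ℂ) (H : SB e A B α) : SB e A (c • B) fun m => c * α m := fun m n => by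
  rw [mode_smul, mul_smul_comm, H m n, smul_mul_assoc]
  split_ifs <;> module

lemma add_left (H : SB e B A α) (H' : SB e B' A α') : SB e (B + B') A fun m => α m + α' m :=
  fun m n => by
    rw [mode_add, add_mul, H m n, H' m n, mul_add]
    split_ifs <;> module

lemma smul_left (c : ℂ) (H : SB e B A α) : SB e (c • B) A fun m => c * α m := fun m n => by
  rw [mode_smul, mul_smul_comm, smul_mul_assoc, H m n]
  split_ifs <;> module

end SB

/-- The relation `A_n T = e T A_n + C_n` between an operator and two fields. -/
def OB (e : ℂ) (T : Module.End ℂ V) (A C : fields V) : Prop := ∀ n : ℤ,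
  mode A n * T = e • (T * mode A n) + mode C n

/-- The identity field is neutral for the normally ordered product only with exchange sign 1. The
sign is irrelevant when the coefficient vanishes, and this form avoids separating the cases later.
-/
lemma nopE_oneF_left' {h : ℤ} {e : ℂ} (c : ℂ) (he : c ≠ 0 → e = 1) (B : fields V) :
    nopE h e (c • oneF) B = c • B := by
  by_cases hc : c = 0
  · simp [hc]
  · rw [he hc, nopE_smul_left, nopE_oneF_left]

lemma nopE_oneF_right' {h : ℤ} {e : ℂ} (c : ℂ) (he : c ≠ 0 → e = 1) (A : fields V) :
    nopE h e A (c • oneF) = c • A := by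
  by_cases hc : c = 0
  · simp [hc]
  · rw [he hc, nopE_smul_right, nopE_oneF_right]

namespace OB

variable {e eA eB e₃ : ℂ} {T S : Module.End ℂ V} {Y Y' A B C C' R : fields V} {α β : ℤ → ℂ}

lemma congr (H : OB e T A C) (h : C = C') : OB e T A C' := h ▸ H

lemma add (H : OB e T A C) (H' : OB e S A C') : OB e (T + S) A (C + C') := fun n => by
  rw [mul_add, H n, H' n, add_mul, mode_add]; module

lemma smul (c : ℂ) (H : OB e T A C) : OB e (c • T) A (c • C) := fun n => by
  rw [mul_smul_comm, H n, smul_mul_assoc, mode_smul]; module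

lemma zero (e : ℂ) (A : fields V) : OB e 0 A 0 := fun n => by simp

lemma scalar (c : ℂ) (A : fields V) : OB 1 (c • 1) A 0 := fun n => by simp

lemma sum {ι : Type*} (s : Finset ι) {T : ι → Module.End ℂ V} {C : ι → fields V}
    (H : ∀ i ∈ s, OB e (T i) A (C i)) : OB e (∑ i ∈ s, T i) A (∑ i ∈ s, C i) := by
  induction s using Finset.cons_induction with
  | empty => exact zero e A
  | cons a s ha ih =>
    simp only [Finset.sum_cons]
    exact (H a (by simp)).add (ih fun i hi => H i (by simp [hi]))

lemma add_right (H : OB e T A C) (H' : OB e T B C') : OB e T (A + B) (C + C') := fun n => by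
  rw [mode_add, add_mul, H n, H' n, mul_add, mode_add]; module

lemma smul_right (c : ℂ) (H : OB e T A C) : OB e T (c • A) (c • C) := fun n => by
  rw [mode_smul, smul_mul_assoc, H n, mul_smul_comm, mode_smul]; module

lemma mulF_right (μ : ℤ → ℂ) (H : OB e T A C) : OB e T (mulF μ A) (mulF μ C) := fun n => by
  rw [mode_mulF, smul_mul_assoc, H n, mul_smul_comm, mode_mulF]; module

lemma zero_right (e : ℂ) (T : Module.End ℂ V) : OB e T 0 0 := fun n => by simp

/-- The zero mode of a normally ordered product of two free fields. -/
lemma nop {h : ℤ} (hA : SB eA Y A α) (hB : SB eB Y B β) (h₃ : eA * eB = e₃)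
    (hα : (∀ m, α m = 0) ∨ e * eB = 1) (hβ : (∀ m, β m = 0) ∨ e * eA = 1) (h₀ : eA * eA = 1)
    (hR : R = mulF α B + eA • mulF β A) : OB e₃ (mode (nopE h e A B) 0) Y R := by
  intro m
  have := mul_mode_nopE (mode Y m) h e eA eB A B (α m • oneF) (β m • oneF) 0 m 0 h₀
    (fun l => by
      rw [hA m l, mode_smul, mode_oneF, add_comm m l]
      split_ifs <;> simp)
    (fun l => by
      rw [hB m l, mode_smul, mode_oneF, add_comm m l]
      split_ifs <;> simp)
    (fun p q _ => by
      rw [mode_smul, mode_oneF, mode_zero, add_zero]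
      rcases hα with hα | hα
      · simp [hα]
      · rw [hα]; split_ifs <;> simp)
  rw [this, nopE_oneF_left' _ (fun h' => by
      rcases hα with hα | hα
      · exact absurd (hα m) h'
      · exact hα), nopE_oneF_right' _ (fun h' => by
      rcases hβ with hβ | hβ
      · exact absurd (hβ m) h'
      · exact hβ), h₃, hR]
  simp only [add_zero, mode_smul, mode_add, mode_mulF, mode_zero, smul_zero, add_assoc]

/-- The anticommutator of two odd operators. -/
lemma anticomm {Q K : Module.End ℂ V} {A₁ A₂ A₁₂ A₂₁ : fields V} (he : e * e = 1)
    (hQ : OB e Q A A₁) (hK : OB e K A A₂) (h₁ : OB (-e) K A₁ A₁₂) (h₂ : OB (-e) Q A₂ A₂₁) :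
    OB 1 (Q * K + K * Q) A (A₁₂ + A₂₁) := fun n => by
  have q := hQ n
  have k := hK n
  have k1 := h₁ n
  have q2 := h₂ n
  rw [mul_add, ← mul_assoc, ← mul_assoc, q, k, add_mul, add_mul, smul_mul_assoc, smul_mul_assoc,
    mul_assoc Q, mul_assoc K, q, k, k1, q2, mode_add]
  simp only [mul_add, add_mul, mul_smul_comm, smul_add, smul_smul, he, mul_assoc]
  module

/-- The square of an odd operator. -/
lemma sq {Q : Module.End ℂ V} {A₁ : fields V} (he : e * e = 1) (hQ : OB e Q A A₁)
    (h₁ : OB (-e) Q A₁ 0) : OB 1 (Q * Q) A 0 := fun n => by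
  have q := hQ n
  have q1 := h₁ n
  rw [mode_zero, add_zero] at q1
  rw [← mul_assoc, q, add_mul, smul_mul_assoc, mul_assoc Q, q, q1]
  simp only [mul_add, mul_smul_comm, smul_add, smul_smul, he, mul_assoc, mode_zero]
  module

lemma apply (H : OB 1 T A C) (n : ℤ) (v : V) :
    T (mode A n v) = mode A n (T v) - mode C n v := by
  have := LinearMap.congr_fun (H n) v
  simp only [Module.End.mul_apply, one_smul, LinearMap.add_apply] at this
  rw [this, add_sub_cancel_right]

/-- A mode of definite weight shifts the eigenvalues of an operator. -/
lemma eigen {w : ℤ → ℂ} (H : OB 1 T A (mulF w A)) (n : ℤ) {c : ℂ} {v : V} (hv : T v = c • v) :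
    T (mode A n v) = (c - w n) • mode A n v := by
  rw [H.apply, hv, map_smul, mode_mulF, LinearMap.smul_apply, sub_smul]

end OB

lemma nopE_apply_eq_zero {h : ℤ} {e : ℂ} {A B : fields V} {n : ℤ} {v : V}
    (h₁ : ∀ m, m ≤ -h → mode A m (mode B (n - m) v) = 0)
    (h₂ : ∀ m, -h < m → mode B (n - m) (mode A m v) = 0) : mode (nopE h e A B) n v = 0 := by
  rw [mode_nopE_apply]
  refine finsum_eq_zero_of_forall_eq_zero fun m => ?_
  simp only [nopTerm]
  split_ifs with hm
  · exact h₁ m hm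
  · rw [h₂ m (by omega), smul_zero]

/-- A normally ordered product only one of whose summands does not vanish on a vector. -/
lemma nopE_apply_eq_single {h : ℤ} {e : ℂ} {A B : fields V} {n : ℤ} {v : V} (k : ℤ)
    (h₁ : ∀ m, m ≤ -h → m ≠ k → mode A m (mode B (n - m) v) = 0)
    (h₂ : ∀ m, -h < m → m ≠ k → mode B (n - m) (mode A m v) = 0) :
    mode (nopE h e A B) n v = nopTerm h e A B n k v := by
  rw [mode_nopE_apply]
  refine finsum_eq_single _ k fun m hmk => ?_
  simp only [nopTerm]
  split_ifs with hm
  · exact h₁ m hm hmk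
  · rw [h₂ m (by omega) hmk, smul_zero]

/-! ### Gradings -/

/-- The modes `A n` map `E γ` to `E (γ + g + n s)`. -/
def Shifts {G : Type*} [AddCommGroup G] (E : G → Submodule ℂ V) (s g : G) (A : fields V) : Prop :=
  ∀ n γ, ∀ v ∈ E γ, mode A n v ∈ E (γ + g + n • s)

namespace Shifts

variable {G : Type*} [AddCommGroup G] {E : G → Submodule ℂ V} {s g g' : G} {A B : fields V}

lemma add (hA : Shifts E s g A) (hB : Shifts E s g B) : Shifts E s g (A + B) := fun n γ v hv =>
  (E _).add_mem (hA n γ v hv) (hB n γ v hv)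

lemma sub (hA : Shifts E s g A) (hB : Shifts E s g B) : Shifts E s g (A - B) := fun n γ v hv =>
  (E _).sub_mem (hA n γ v hv) (hB n γ v hv)

lemma neg (hA : Shifts E s g A) : Shifts E s g (-A) := fun n γ v hv =>
  (E _).neg_mem (hA n γ v hv)

lemma smul (c : ℂ) (hA : Shifts E s g A) : Shifts E s g (c • A) := fun n γ v hv =>
  (E _).smul_mem c (hA n γ v hv)

lemma mulF (μ : ℤ → ℂ) (hA : Shifts E s g A) : Shifts E s g (mulF μ A) := fun n γ v hv =>
  (E _).smul_mem (μ n) (hA n γ v hv)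

lemma deriv (h : ℤ) (hA : Shifts E s g A) : Shifts E s g (deriv h A) := hA.mulF _

lemma zero : Shifts E s g 0 := fun _ _ _ _ => (E _).zero_mem

lemma sum {ι : Type*} (t : Finset ι) {A : ι → fields V} (H : ∀ i ∈ t, Shifts E s g (A i)) :
    Shifts E s g (∑ i ∈ t, A i) := by
  induction t using Finset.cons_induction with
  | empty => exact zero
  | cons a t ha ih =>
    simp only [Finset.sum_cons]
    exact (H a (by simp)).add (ih fun i hi => H i (by simp [hi]))

lemma nop {h : ℤ} {e : ℂ} (hA : Shifts E s g A) (hB : Shifts E s g' B) {k : G}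
    (hk : g + g' = k) : Shifts E s k (nopE h e A B) := fun n γ v hv => by
  subst hk
  rw [mode_nopE_apply]
  refine finsum_induction (· ∈ E (γ + (g + g') + n • s)) (Submodule.zero_mem _)
    (fun _ _ => Submodule.add_mem _) fun m => ?_
  simp only [nopTerm]
  split_ifs
  · have := hA m _ _ (hB (n - m) γ v hv)
    rwa [show γ + g' + (n - m) • s + g + m • s = γ + (g + g') + n • s by
      rw [sub_smul]; abel] at this
  · have := hB (n - m) _ _ (hA m γ v hv)
    rw [show γ + g + m • s + g' + (n - m) • s = γ + (g + g') + n • s by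
      rw [sub_smul]; abel] at this
    exact Submodule.smul_mem _ _ this

lemma nop_zero {h : ℤ} {e : ℂ} (hA : Shifts E s 0 A) (hB : Shifts E s 0 B) :
    Shifts E s 0 (nopE h e A B) := hA.nop hB (add_zero 0)

lemma of_OB {T : Module.End ℂ V} {w : ℤ → ℂ} {A : fields V} {s g : ℂ}
    (H : OB 1 T A (AffineOsp.mulF w A)) (hw : ∀ n, w n = -(g + n * s)) :
    Shifts (Module.End.eigenspace T) s g A := fun n γ v hv => by
  rw [Module.End.mem_eigenspace_iff] at hv ⊢
  rw [H.eigen n hv, hw]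
  congr 1
  rw [zsmul_eq_mul]
  ring

lemma oneF {s : G} : Shifts E s 0 (AffineOsp.oneF : fields V) := fun n γ v hv => by
  rw [mode_oneF]
  split_ifs with h
  · simpa [h] using hv
  · exact Submodule.zero_mem _

end Shifts

/-! ### Eigenspaces -/

/-- Generalized eigenspaces for different eigenvalues are independent. The generalized version on
one side serves the next lemma, where only the square of T is known to kill the vector. -/
lemma eq_zero_of_mem_eigenspace {T : Module.End ℂ V} {c : ℂ} {S : Set ℂ} (hc : c ∉ S) {v : V}
    (hv : v ∈ Module.End.maxGenEigenspace T c) (h : v ∈ ⨆ d ∈ S, Module.End.eigenspace T d) :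
    v = 0 := by
  have h₁ : ∀ d, Module.End.eigenspace T d ≤ Module.End.maxGenEigenspace T d := fun d u hu => by
    rw [Module.End.mem_maxGenEigenspace]
    exact ⟨1, by rw [pow_one, LinearMap.sub_apply, Module.End.mem_eigenspace_iff.1 hu]; simp⟩
  have h' : ∀ d ∈ S, Module.End.eigenspace T d ≤
      ⨆ d, ⨆ (_ : d ≠ c), Module.End.maxGenEigenspace T d := fun d hd =>
    (h₁ d).trans (le_iSup₂ (f := fun d (_ : d ≠ c) => Module.End.maxGenEigenspace T d) d
        fun h => hc (h ▸ hd))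
  exact Submodule.disjoint_def.1 (Module.End.independent_maxGenEigenspace T c) v hv
    (iSup₂_le h' h)

/-- If the eigenvectors of `T` with nonzero eigenvalues span together with a subspace `A` of the
kernel, then `A` is the kernel of all powers of `T`. -/
lemma mem_of_iterate_eq_zero {T : Module.End ℂ V} {A : Submodule ℂ V} {S : Set ℂ}
    (hA : ∀ a ∈ A, T a = 0) (hS : (0 : ℂ) ∉ S)
    (htop : A ⊔ ⨆ d ∈ S, Module.End.eigenspace T d = ⊤) {v : V} (hv : T (T v) = 0) : v ∈ A := by
  obtain ⟨a, ha, u, hu, rfl⟩ := Submodule.mem_sup.1 (htop ▸ Submodule.mem_top : v ∈ A ⊔ _)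
  have : u = 0 := by
    refine eq_zero_of_mem_eigenspace hS ?_ hu
    rw [Module.End.mem_maxGenEigenspace]
    refine ⟨2, ?_⟩
    rw [map_add, hA a ha, zero_add] at hv
    simpa [pow_two] using hv
  rwa [this, add_zero]

end Quadratic

end AffineOsp

end

/-! ### Diagonalizable operators: invariant subspaces, functional calculus, spectra from creation
operators -/

noncomputable section

namespace AffineOsp

section Eigen

open Module.End Polynomial

variable {V : Type*} [AddCommGroup V] [Module ℂ V] {T : Module.End ℂ V}

lemma aeval_apply_of_mem_eigenspace {c : ℂ} {v : V} (hv : v ∈ eigenspace T c) (q : ℂ[X]) :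
    aeval T q v = q.eval c • v := by
  by_cases h : v = 0
  · simp [h]
  · exact aeval_apply_of_hasEigenvector ⟨hv, h⟩

lemma aeval_mem_of_invariant {U : Submodule ℂ V} (hU : ∀ u ∈ U, T u ∈ U) (q : ℂ[X]) {u : V}
    (hu : u ∈ U) : aeval T q u ∈ U := by
  induction q using Polynomial.induction_on' with
  | add p q hp hq => simpa using U.add_mem hp hq
  | monomial n c =>
    rw [aeval_monomial, Module.End.mul_apply, Module.algebraMap_end_apply]
    refine U.smul_mem c ?_
    induction n with
    | zero => simpa using hu
    | succ n ih => rw [pow_succ', Module.End.mul_apply]; exact hU _ ih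

lemma exists_eigen_decomposition (hT : ⨆ c, eigenspace T c = ⊤) (v : V) :
    ∃ g : ℂ →₀ V, (∀ c, g c ∈ eigenspace T c) ∧ (g.sum fun _ u => u) = v ∧
      ∀ q : ℂ[X], aeval T q v = g.sum fun c u => q.eval c • u := by
  obtain ⟨g, hg, hv⟩ := (Submodule.mem_iSup_iff_exists_finsupp _ v).1
    (hT ▸ Submodule.mem_top : v ∈ ⨆ c, eigenspace T c)
  refine ⟨g, hg, hv, fun q => ?_⟩
  rw [← hv, Finsupp.sum, map_sum, Finsupp.sum]
  exact Finset.sum_congr rfl fun c _ => aeval_apply_of_mem_eigenspace (hg c) q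

/-- An invariant subspace is spanned by the eigenvectors in it. -/
lemma le_of_inf_eigenspace_le (hT : ⨆ c, eigenspace T c = ⊤) {U M : Submodule ℂ V}
    (hU : ∀ u ∈ U, T u ∈ U) (h : ∀ c, ∀ u ∈ U, u ∈ eigenspace T c → u ∈ M) : U ≤ M := by
  intro v hv
  obtain ⟨g, hg, hv', hq⟩ := exists_eigen_decomposition hT v
  rw [← hv']
  refine Submodule.sum_mem _ fun c hc => h c _ ?_ (hg c)
  -- The Lagrange polynomial is 1 at c and 0 at the other eigenvalues that occur in v. The component
  -- of v is thus a polynomial in T applied to v and stays in the invariant subspace.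
  have := hq (Lagrange.basis g.support id c)
  rw [Finsupp.sum, Finset.sum_eq_single c (fun d hd hdc => by
    rw [show Polynomial.eval d (Lagrange.basis g.support id c) = 0 from
      Lagrange.eval_basis_of_ne (v := id) hdc.symm hd, zero_smul]) (fun h => absurd hc h)] at this
  rw [show Polynomial.eval c (Lagrange.basis g.support id c) = 1 from
    Lagrange.eval_basis_self (v := id) (Function.injective_id.injOn) hc, one_smul] at this
  rw [← this]
  exact aeval_mem_of_invariant hU _ hv

/-- Functions of a diagonalizable operator. -/
lemma exists_functional_calculus (hT : ⨆ c, eigenspace T c = ⊤) (φ : ℂ → ℂ) :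
    ∃ G : Module.End ℂ V, (∀ c, ∀ v ∈ eigenspace T c, G v = φ c • v) ∧
      ∀ U : Submodule ℂ V, (∀ u ∈ U, T u ∈ U) → ∀ u ∈ U, G u ∈ U := by
  classical
  have hI := DirectSum.isInternal_submodule_of_iSupIndep_of_iSup_eq_top
    (eigenspaces_iSupIndep T) hT
  let e := LinearEquiv.ofBijective (DirectSum.coeLinearMap fun c => eigenspace T c) hI
  let G : Module.End ℂ V := (DirectSum.toModule ℂ ℂ V fun c => φ c • (eigenspace T c).subtype) ∘ₗ
    e.symm.toLinearMap
  have hG : ∀ c, ∀ v ∈ eigenspace T c, G v = φ c • v := by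
    intro c v hv
    have : e.symm v = DirectSum.lof ℂ ℂ (fun c => eigenspace T c) c ⟨v, hv⟩ := by
      rw [LinearEquiv.symm_apply_eq]
      exact (DirectSum.coeLinearMap_lof (fun c => eigenspace T c) c ⟨v, hv⟩).symm
    simp only [G, LinearMap.comp_apply, LinearEquiv.coe_coe, this, DirectSum.toModule_lof]
    rfl
  refine ⟨G, hG, fun U hU => le_of_inf_eigenspace_le (M := U.comap G) hT hU fun c u hu hc => ?_⟩
  rw [Submodule.mem_comap, hG c u hc]
  exact U.smul_mem _ hu

/-- Operators that raise the eigenvalues of `T` by elements of `S - S` generate eigenvectors. -/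
lemma iSup_eigenspace_eq_top {ι : Type*} {X : ι → Module.End ℂ V} {w : ι → ℂ} {v₀ : V}
    {S : Set ℂ} {c₀ : ℂ} (hv₀ : T v₀ = c₀ • v₀) (hc₀ : c₀ ∈ S)
    (hX : ∀ i v, T (X i v) = X i (T v) + w i • X i v) (hS : ∀ i, ∀ c ∈ S, c + w i ∈ S)
    (htop : ∀ M : Submodule ℂ V, v₀ ∈ M → (∀ i, ∀ v ∈ M, X i v ∈ M) → M = ⊤) :
    ⨆ c ∈ S, eigenspace T c = ⊤ := by
  refine htop _ (Submodule.mem_iSup_of_mem c₀ (Submodule.mem_iSup_of_mem hc₀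
    (mem_eigenspace_iff.2 hv₀))) fun i v hv => ?_
  suffices (⨆ c ∈ S, eigenspace T c) ≤ (⨆ c ∈ S, eigenspace T c).comap (X i) from this hv
  refine iSup₂_le fun c hc v hv => ?_
  refine Submodule.mem_iSup_of_mem (c + w i) (Submodule.mem_iSup_of_mem (hS i c hc) ?_)
  rw [mem_eigenspace_iff] at hv ⊢
  rw [hX, hv, map_smul, add_smul]

lemma iSup_eigenspace_eq_top' {S : Set ℂ} (h : ⨆ c ∈ S, eigenspace T c = ⊤) :
    ⨆ c, eigenspace T c = ⊤ :=
  top_le_iff.1 (h ▸ iSup_mono fun _ => iSup_le fun _ => le_rfl)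

/-- An eigenvalue outside of the set `S` does not occur. -/
lemma eq_zero_of_notMem {S : Set ℂ} (h : ⨆ c ∈ S, eigenspace T c = ⊤) {c : ℂ} (hc : c ∉ S) {v : V}
    (hv : T v = c • v) : v = 0 := by
  refine eq_zero_of_mem_eigenspace hc ?_ (h ▸ Submodule.mem_top)
  rw [mem_maxGenEigenspace]
  exact ⟨1, by rw [pow_one, LinearMap.sub_apply, hv]; simp⟩

/-- If all operators that generate the space from `v₀` raise the eigenvalues of `T`, then the
eigenvectors with the eigenvalue of `v₀` are its multiples. -/
lemma mem_span_of_eigenvalue {ι : Type*} {X : ι → Module.End ℂ V} {w : ι → ℕ} {v₀ : V}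
    (hv₀ : T v₀ = 0) (hX : ∀ i v, T (X i v) = X i (T v) + (w i : ℂ) • X i v) (hw : ∀ i, w i ≠ 0)
    (htop : ∀ M : Submodule ℂ V, v₀ ∈ M → (∀ i, ∀ v ∈ M, X i v ∈ M) → M = ⊤) {v : V}
    (hv : T v = 0) : v ∈ Submodule.span ℂ {v₀} := by
  -- Creation operators have positive integral weights, so they map both the line of the starting
  -- vector and the eigenspaces of positive integers into the latter; the line remains alone in the
  -- kernel.
  let S : Set ℂ := {c | ∃ n : ℕ, n ≠ 0 ∧ c = n}
  have h0 : (0 : ℂ) ∉ S := by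
    rintro ⟨n, hn, h⟩
    exact hn (by exact_mod_cast h.symm)
  have hA : ∀ a ∈ Submodule.span ℂ {v₀}, T a = 0 := fun a ha => by
    obtain ⟨r, rfl⟩ := Submodule.mem_span_singleton.1 ha
    rw [map_smul, hv₀, smul_zero]
  refine mem_of_iterate_eq_zero hA h0 (htop _ (Submodule.mem_sup_left
    (Submodule.mem_span_singleton_self _)) fun i v hv => ?_) (by rw [hv, map_zero])
  have hE : ∀ (n : ℕ) (u : V), T u = (n : ℂ) • u →
      X i u ∈ ⨆ d ∈ S, eigenspace T d := fun n u hu => by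
    refine Submodule.mem_iSup_of_mem ((n + w i : ℕ) : ℂ) (Submodule.mem_iSup_of_mem
      ⟨n + w i, by have := hw i; omega, rfl⟩ ?_)
    rw [mem_eigenspace_iff, hX, hu, map_smul, ← add_smul, Nat.cast_add]
  suffices h : Submodule.span ℂ {v₀} ⊔ ⨆ d ∈ S, eigenspace T d ≤
      (⨆ d ∈ S, eigenspace T d).comap (X i) from Submodule.mem_sup_right (h hv)
  refine sup_le (fun a ha => hE 0 a (by rw [hA a ha]; simp)) (iSup₂_le fun d hd u hu => ?_)
  obtain ⟨n, -, rfl⟩ := hd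
  exact hE n u (mem_eigenspace_iff.1 hu)

end Eigen

end AffineOsp

end

noncomputable section

namespace AffineOsp

open Gen Pair

instance : Fintype Pair :=
  ⟨{matterB, matterF, liouvilleB, liouvilleF, ghost plus, ghost half, ghost three, ghost mhalf,
    ghost minus}, fun s => by
      rcases s with _ | _ | _ | _ | x <;> [decide; decide; decide; decide; (cases x <;> decide)]⟩

lemma sum_pair {M : Type*} [AddCommMonoid M] (g : Pair → M) :
    ∑ s, g s = g matterB + g matterF + g liouvilleB + g liouvilleF
      + ∑ x, g (ghost x) := by
  have : (Finset.univ : Finset Pair) = {matterB, matterF, liouvilleB, liouvilleF} ∪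
      (Finset.univ : Finset Gen).image ghost := by
    ext s; rcases s with _ | _ | _ | _ | x <;> simp
  rw [this, Finset.sum_union (by
    rw [Finset.disjoint_left]; intro s; rcases s with _ | _ | _ | _ | x <;> simp),
    Finset.sum_image (fun x _ y _ h => by simpa using h)]
  simp [add_assoc]

namespace Datum

variable (D : Datum)

/-! ### Number operators -/

lemma SB_fst_snd (μ : ℤ → ℂ) (r s : Pair) :
    SB (sgnP r s) (D.fst r) (mulF μ (D.snd s)) fun m => if r = s then μ (-m) else 0 := by
  by_cases h : r = s
  · subst h
    exact ((SB.of_one ((D.fst_snd r r).of_eq rfl (if_pos rfl))).mulF_right μ).congr fun m => by simp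
  · exact ((SB.of_zero (D.fst_snd_ne h rfl)).mulF_right μ).congr fun m => by simp [h]

lemma SB_snd_fst (r s : Pair) :
    SB (sgnP r s) (D.snd r) (D.fst s) fun _ => if r = s then -sgnP r r else 0 := by
  by_cases h : r = s
  · subst h
    exact (SB.of_smul ((D.snd_fst r r).of_eq rfl (if_pos rfl))).congr fun m => by simp
  · exact (SB.of_zero (D.snd_fst_ne h rfl)).congr fun m => by simp [h]

lemma SB_fst_fst (r s : Pair) : SB (sgnP r s) (D.fst r) (D.fst s) fun _ => 0 :=
  SB.of_zero (D.fst_fst r s)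

lemma SB_snd_snd (μ : ℤ → ℂ) (r s : Pair) :
    SB (sgnP r s) (D.snd r) (mulF μ (D.snd s)) fun _ => 0 :=
  ((SB.of_zero (D.snd_snd r s)).mulF_right μ).congr fun _ => by simp

lemma SB_bos_fst (u : Heis) (s : Pair) : SB 1 (D.bos u) (D.fst s) fun _ => 0 :=
  SB.of_zero (D.bos_fst s u)

lemma SB_bos_snd (μ : ℤ → ℂ) (u : Heis) (s : Pair) :
    SB 1 (D.bos u) (mulF μ (D.snd s)) fun _ => 0 :=
  ((SB.of_zero (D.bos_snd s u)).mulF_right μ).congr fun _ => by simp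

/-- The weights of an operator on the modes of the free fields. -/
structure Weights (T : Module.End ℂ Fock) (μ : Pair → ℤ → ℂ) (ν : ℤ → ℂ) : Prop where
  fst : ∀ s, OB 1 T (D.fst s) (mulF (fun n => μ s (-n)) (D.fst s))
  snd : ∀ s, OB 1 T (D.snd s) (mulF (fun n => -μ s n) (D.snd s))
  bos : ∀ u, OB 1 T (D.bos u) (mulF ν (D.bos u))

variable {D}

namespace Weights

variable {T S : Module.End ℂ Fock} {μ μ' : Pair → ℤ → ℂ} {ν ν' : ℤ → ℂ}

lemma congr (H : D.Weights T μ ν) (h : ∀ s n, μ s n = μ' s n) (h' : ∀ n, ν n = ν' n) :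
    D.Weights T μ' ν' := by
  obtain rfl : μ = μ' := funext fun s => funext (h s)
  obtain rfl : ν = ν' := funext h'
  exact H

lemma add (H : D.Weights T μ ν) (H' : D.Weights S μ' ν') :
    D.Weights (T + S) (fun s n => μ s n + μ' s n) (fun n => ν n + ν' n) where
  fst s := ((H.fst s).add (H'.fst s)).congr (mulF_add _ _ _).symm
  snd s := ((H.snd s).add (H'.snd s)).congr (by rw [← mulF_add]; congr 1; ext n; ring)
  bos u := ((H.bos u).add (H'.bos u)).congr (mulF_add _ _ _).symm

lemma smul (c : ℂ) (H : D.Weights T μ ν) :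
    D.Weights (c • T) (fun s n => c * μ s n) (fun n => c * ν n) where
  fst s := ((H.fst s).smul c).congr (fields_ext fun n => by simp [smul_smul])
  snd s := ((H.snd s).smul c).congr (fields_ext fun n => by simp [smul_smul])
  bos u := ((H.bos u).smul c).congr (fields_ext fun n => by simp [smul_smul])

lemma scalar (c : ℂ) : D.Weights (c • 1) (fun _ _ => 0) (fun _ => 0) where
  fst s := (OB.scalar c _).congr (mulF_zero _).symm
  snd s := (OB.scalar c _).congr (by simp only [neg_zero]; exact (mulF_zero _).symm)
  bos u := (OB.scalar c _).congr (mulF_zero _).symm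

/-- An operator without weights is determined by its value on the vacuum. -/
lemma eq_smul_one (H : D.Weights T (fun _ _ => 0) fun _ => 0) {c : ℂ} (h : T vac = c • vac) :
    T = c • 1 := by
  have hM := D.eq_top (M := LinearMap.ker (T - c • (1 : Module.End ℂ Fock)))
    (by simp [h]) ?_ ?_ ?_
  · rw [LinearMap.ker_eq_top, sub_eq_zero] at hM
    exact hM
  all_goals intro s n _ v hv
  all_goals simp only [LinearMap.mem_ker, LinearMap.sub_apply, LinearMap.smul_apply,
    Module.End.one_apply, sub_eq_zero] at hv ⊢
  · simpa [hv] using (H.fst s).apply n v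
  · simpa [hv] using (H.snd s).apply n v
  · simpa [hv] using (H.bos s).apply n v

/-- Operators with the same weights and vacuum values agree. -/
lemma ext (H : D.Weights T μ ν) (H' : D.Weights S μ ν) {c : ℂ} (h : T vac = c • vac)
    (h' : S vac = c • vac) : T = S := by
  have := ((H.add (H'.smul (-1))).congr (μ' := fun _ _ => 0) (ν' := fun _ => 0)
    (fun s n => by ring) (fun n => by ring)).eq_smul_one (c := 0) (by simp [h, h'])
  rw [zero_smul] at this
  rw [← sub_eq_zero, ← this]
  module

end Weights

variable (D)

/-- The operator with weights `μ` on a pair of fields that annihilates the vacuum. -/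
def number (s : Pair) (μ : ℤ → ℂ) : Module.End ℂ Fock :=
  mode (nopE (D.lev s) (sgnP s s) (mulF μ (D.snd s)) (D.fst s)) 0

lemma weights_snd_fst (h : ℤ) (s : Pair) (μ : ℤ → ℂ) :
    D.Weights (mode (nopE h (sgnP s s) (mulF μ (D.snd s)) (D.fst s)) 0)
      (fun r n => if r = s then μ n else 0) (fun _ => 0) where
  fst r := by
    refine OB.nop (D.SB_fst_snd μ r s) (D.SB_fst_fst r s) (sgnP_sq _ _) ?_ (Or.inl fun _ => rfl)
      (sgnP_sq _ _) ?_
    · by_cases h : r = s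
      · subst h; exact Or.inr (sgnP_sq _ _)
      · exact Or.inl fun m => if_neg h
    · by_cases h : r = s
      · subst h; simp [mulF_zero]
      · simp [h, mulF_zero]
  snd r := by
    refine OB.nop (D.SB_snd_snd μ r s) (D.SB_snd_fst r s) (sgnP_sq _ _) (Or.inl fun _ => rfl) ?_
      (sgnP_sq _ _) ?_
    · by_cases h : r = s
      · subst h; exact Or.inr (sgnP_sq _ _)
      · exact Or.inl fun m => if_neg h
    · by_cases h : r = s
      · subst h
        refine fields_ext fun n => ?_
        simp [smul_smul, ← mul_assoc, sgnP_sq, mulF_zero]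
      · simp [h, mulF_zero]
  bos u := OB.nop (D.SB_bos_snd μ u s) (D.SB_bos_fst u s) (one_mul 1) (Or.inl fun _ => rfl)
    (Or.inl fun _ => rfl) (one_mul 1) (by simp [mulF_zero])

lemma weights_fst_snd (h : ℤ) (s : Pair) (μ : ℤ → ℂ) :
    D.Weights (sgnP s s • mode (nopE h (sgnP s s) (D.fst s) (mulF μ (D.snd s))) 0)
      (fun r n => if r = s then μ n else 0) (fun _ => 0) where
  fst r := by
    refine (OB.smul _ (OB.nop (D.SB_fst_fst r s) (D.SB_fst_snd μ r s) (sgnP_sq _ _)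
      (Or.inl fun _ => rfl) ?_ (sgnP_sq _ _) rfl)).congr ?_
    · by_cases h : r = s
      · subst h; exact Or.inr (sgnP_sq _ _)
      · exact Or.inl fun m => if_neg h
    · by_cases h : r = s
      · subst h; simp [mulF_zero, smul_smul, sgnP_sq]
      · simp [h, mulF_zero]
  snd r := by
    refine (OB.smul _ (OB.nop (D.SB_snd_fst r s) (D.SB_snd_snd μ r s) (sgnP_sq _ _) ?_
      (Or.inl fun _ => rfl) (sgnP_sq _ _) rfl)).congr ?_
    · by_cases h : r = s
      · subst h; exact Or.inr (sgnP_sq _ _)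
      · exact Or.inl fun m => if_neg h
    · by_cases h : r = s
      · subst h
        refine fields_ext fun n => ?_
        simp [smul_smul, ← mul_assoc, sgnP_sq, mulF_zero]
      · simp [h, mulF_zero]
  bos u := (OB.smul _ (OB.nop (D.SB_bos_fst u s) (D.SB_bos_snd μ u s) (one_mul 1)
    (Or.inl fun _ => rfl) (Or.inl fun _ => rfl) (one_mul 1) rfl)).congr (by simp [mulF_zero])

lemma lev_eq (s : Pair) : D.lev s = 0 ∨ D.lev s = 1 := by
  rcases D with ⟨_, _, _, _, _, g⟩
  rcases s with _ | _ | _ | _ | x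
  all_goals try simp [lev]
  cases g <;> cases x <;> simp [GhostVac.level]

lemma snd_fst_apply {s : Pair} {n : ℤ} {v : Fock} (h : mode (D.snd s) (-n) v = 0) :
    mode (D.snd s) (-n) (mode (D.fst s) n v) = -sgnP s s • v := by
  have := LinearMap.congr_fun (D.SB_snd_fst s s (-n) n) v
  simpa [h] using this

lemma number_vac (s : Pair) (μ : ℤ → ℂ) : D.number s μ vac = 0 := by
  refine nopE_apply_eq_zero (fun m hm => ?_) fun m hm => ?_
  · rw [D.fst_vac s (by omega), map_zero]
  · rw [mode_mulF, LinearMap.smul_apply, D.snd_vac s (by omega), smul_zero, map_zero]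

lemma weights_number (s : Pair) (μ : ℤ → ℂ) :
    D.Weights (D.number s μ) (fun r n => if r = s then μ n else 0) (fun _ => 0) :=
  D.weights_snd_fst _ s μ

/-- The two operators have the same commutators with all free fields, so they differ by a scalar
that is read off on the vacuum. It comes from the pair of zero modes, which conventional ordering
and vacuum ordering treat differently if the level is 1. The other two comparisons of orderings
below work in the same way. -/
lemma snd_fst_zero_eq (s : Pair) (μ : ℤ → ℂ) :
    mode (nopE 0 (sgnP s s) (mulF μ (D.snd s)) (D.fst s)) 0
      = D.number s μ + (-(D.lev s * sgnP s s * μ 0)) • 1 := by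
  refine (D.weights_snd_fst 0 s μ).ext (c := -(D.lev s * sgnP s s * μ 0))
    (((D.weights_number s μ).add (Weights.scalar _)).congr (fun r n => add_zero _)
      fun n => add_zero _) ?_ (by simp [number_vac])
  rcases D.lev_eq s with hl | hl
  · have := D.number_vac s μ
    rw [number, hl] at this
    rw [this, hl]; simp
  · rw [nopE_apply_eq_single 0 (fun m hm h0 => by rw [D.fst_vac s (by omega), map_zero])
      (fun m hm h0 => by
        rw [mode_mulF, LinearMap.smul_apply, D.snd_vac s (by omega), smul_zero, map_zero])]
    have := D.snd_fst_apply (s := s) (n := 0) (v := vac) (D.snd_vac s (by omega))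
    rw [neg_zero] at this
    simp only [nopTerm, neg_zero, le_refl, if_true, sub_zero, mode_mulF, LinearMap.smul_apply, this,
      hl, smul_smul]
    congr 1
    push_cast
    ring

lemma snd_fst_one_eq (s : Pair) {μ : ℤ → ℂ} (hμ : μ 0 = 0) :
    mode (nopE 1 (sgnP s s) (mulF μ (D.snd s)) (D.fst s)) 0 = D.number s μ := by
  refine (D.weights_snd_fst 1 s μ).ext (c := 0) (D.weights_number s μ) ?_ (by simp [number_vac])
  rw [zero_smul]
  refine nopE_apply_eq_zero (fun m hm => ?_) fun m hm => ?_
  · rw [D.fst_vac s (by rcases D.lev_eq s with h | h <;> omega), map_zero]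
  · rw [mode_mulF, LinearMap.smul_apply]
    by_cases h0 : m = 0
    · rw [h0, hμ, zero_smul, map_zero]
    · rw [D.snd_vac s (by rcases D.lev_eq s with h | h <;> omega), smul_zero, map_zero]

lemma fst_snd_one_eq (s : Pair) (μ : ℤ → ℂ) :
    mode (nopE 1 (sgnP s s) (D.fst s) (mulF μ (D.snd s))) 0
      = sgnP s s • D.number s μ + (-(D.lev s * μ 0)) • 1 := by
  have key : sgnP s s • mode (nopE 1 (sgnP s s) (D.fst s) (mulF μ (D.snd s))) 0
      = D.number s μ + (-(sgnP s s * (D.lev s * μ 0))) • 1 := by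
    refine (D.weights_fst_snd 1 s μ).ext (c := -(sgnP s s * (D.lev s * μ 0)))
      (((D.weights_number s μ).add (Weights.scalar _)).congr (fun r n => add_zero _)
        fun n => add_zero _) ?_ (by simp [number_vac])
    rw [LinearMap.smul_apply]
    rcases D.lev_eq s with hl | hl
    · rw [nopE_apply_eq_zero (fun m hm => ?_) fun m hm => ?_]
      · simp [hl]
      · rw [mode_mulF, LinearMap.smul_apply, D.snd_vac s (by omega), smul_zero, map_zero]
      · rw [D.fst_vac s (by omega), map_zero]
    · rw [nopE_apply_eq_single 0 (fun m hm h0 => by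
          rw [mode_mulF, LinearMap.smul_apply, D.snd_vac s (by omega), smul_zero, map_zero])
        (fun m hm h0 => by rw [D.fst_vac s (by omega), map_zero])]
      have := D.snd_fst_apply (s := s) (n := 0) (v := vac) (D.snd_vac s (by omega))
      rw [neg_zero] at this
      simp only [nopTerm, show ¬ (0 : ℤ) ≤ -1 by omega, if_false, sub_zero, mode_mulF,
        LinearMap.smul_apply, this, hl, smul_smul]
      congr 1
      have := sgnP_sq s s
      push_cast
      linear_combination (-μ 0 * sgnP s s) * this
  have h2 := congrArg (fun t => sgnP s s • t) key
  simp only [smul_smul, sgnP_sq, one_smul, smul_add] at h2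
  rw [h2]
  congr 2
  have := sgnP_sq s s
  linear_combination (-(D.lev s * μ 0) : ℂ) * this

end Datum

end AffineOsp

end

noncomputable section

namespace AffineOsp

open Gen Pair

instance : DecidableEq Heis := fun u u' => by
  cases u <;> cases u' <;> first | exact isTrue rfl | exact isFalse (by simp)

namespace Datum

variable (D : Datum)

/-- The operator with weights `μ` on the pairs of fields that annihilates the vacuum. -/
def numOp (μ : Pair → ℤ → ℂ) : Module.End ℂ Fock := ∑ s, D.number s (μ s)

lemma weights_numOp (μ : Pair → ℤ → ℂ) : D.Weights (D.numOp μ) μ (fun _ => 0) where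
  fst r := (OB.sum _ fun s _ => (D.weights_number s (μ s)).fst r).congr (fields_ext fun n => by
    simp [mode_sum])
  snd r := (OB.sum _ fun s _ => (D.weights_number s (μ s)).snd r).congr (fields_ext fun n => by
    simp [mode_sum])
  bos u := (OB.sum _ fun s _ => (D.weights_number s (μ s)).bos u).congr (by simp [mulF_zero])

lemma numOp_vac (μ : Pair → ℤ → ℂ) : D.numOp μ vac = 0 := by
  simp [numOp, LinearMap.sum_apply, number_vac]

lemma number_smul (s : Pair) (c : ℂ) (μ : ℤ → ℂ) :
    D.number s (fun n => c * μ n) = c • D.number s μ := by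
  rw [number, show mulF (fun n => c * μ n) (D.snd s) = c • mulF μ (D.snd s) from
    fields_ext fun n => by simp [smul_smul], nopE_smul_left]
  rfl

/-- The charge of the second field of a pair. -/
def isospin : Pair → ℂ
  | matterB => -1
  | matterF => -(1 / 2)
  | liouvilleB => 1
  | liouvilleF => 1 / 2
  | ghost plus => 1
  | ghost half => 1 / 2
  | ghost three => 0
  | ghost mhalf => -(1 / 2)
  | ghost minus => -1

/-- The ghost number of the second field of a pair. -/
def ghostDegree : Pair → ℤ
  | ghost _ => 1
  | _ => 0

lemma ghost_zero_eq (x : Gen) : mode (D.ghostProd 0 x (D.c x) x) 0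
    = D.number (ghost x) (fun _ => 1) + (-(D.lev (ghost x) * sgnP (ghost x) (ghost x))) • 1 := by
  have := D.snd_fst_zero_eq (ghost x) fun _ => 1
  rw [mulF_one, snd_ghost, fst_ghost, sgnP_ghost] at this
  rw [ghostProd_eq, this, sgnP_ghost, mul_one]

/-- For the second ghost vacuum the ordering constants of the two shifted pairs are 1 (fermionic)
and -1 (bosonic), so both ghost vacua have ghost number zero. -/
lemma ghostNumber_eq : D.ghostNumber = D.numOp fun s _ => ghostDegree s := by
  rw [ghostNumber, mode_sum, Finset.sum_congr rfl fun x _ => D.ghost_zero_eq x]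
  rw [numOp, sum_pair, sum_gen, sum_gen]
  have h0 : ∀ s, D.number s (fun _ => 0) = 0 := fun s => by simp [number, mulF_zero]
  rcases D with ⟨k, a, a', j₁, j₂, g⟩
  cases g <;> simp [ghostDegree, lev, GhostVac.level, sgnP, isFer, isOdd, h0] <;> abel

lemma ghostNumber_vac : D.ghostNumber vac = 0 := by rw [ghostNumber_eq, numOp_vac]

lemma weights_ghostNumber : D.Weights D.ghostNumber (fun s _ => ghostDegree s) (fun _ => 0) := by
  rw [ghostNumber_eq]; exact D.weights_numOp _

/-- The isospin of the vacuum. -/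
def vacIsospin : ℂ := D.j₁ + D.j₂ + (match D.gh with
  | .zero => 0
  | .zeroHalf => 1 / 2)

lemma mode_J_three : mode (D.J three) 0 = -D.number matterB (fun _ => 1)
    - (1 / 2 : ℂ) • D.number matterF (fun _ => 1) + (D.a / 2 * D.mom .matter) • 1 := by
  have h1 := D.fst_snd_one_eq matterB fun _ => 1
  have h2 := D.snd_fst_zero_eq matterF fun _ => 1
  rw [mulF_one] at h1 h2
  have e1 : sgnP matterB matterB = 1 := by simp [sgnP, isFer]
  have e2 : sgnP matterF matterF = -1 := by simp [sgnP, isFer]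
  rw [e1] at h1
  rw [e2] at h2
  rw [J, wakimotoCurrent, mode_sub, mode_add, mode_neg, mode_smul, mode_smul, nop_eq, nopF_eq]
  rw [show mode (nopE 1 1 D.beta D.gamma) 0 = _ from h1, show mode (nopE 0 (-1) D.psi D.psiP) 0 = _
    from h2, show mode D.phi 0 = _ from D.bos_zero .matter]
  simp only [lev, Int.cast_zero]
  module

/-- Reordering the Liouville zero modes costs -1 for the bosonic pair and 1/2 for the fermionic one.
The summand 1 in the momentum -(2j₂ + 1)/α̃₊ compensates this, so that the vacuum has isospin j₂. -/
lemma mode_JT_three : mode (D.JT three) 0 = D.number liouvilleB (fun _ => 1)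
    + (1 / 2 : ℂ) • D.number liouvilleF (fun _ => 1)
      + (-(1 / 2) - D.a' / 2 * D.mom .liouville) • 1 := by
  have h1 := D.fst_snd_one_eq liouvilleB fun _ => 1
  have h2 := D.snd_fst_zero_eq liouvilleF fun _ => 1
  rw [mulF_one] at h1 h2
  have e1 : sgnP liouvilleB liouvilleB = 1 := by simp [sgnP, isFer]
  have e2 : sgnP liouvilleF liouvilleF = -1 := by simp [sgnP, isFer]
  rw [e1] at h1
  rw [e2] at h2
  rw [JT, dualWakimotoCurrent, mode_add, mode_sub, mode_smul, mode_smul, nop_eq, nopF_eq]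
  rw [show mode (nopE 1 1 D.betaT D.gammaT) 0 = _ from h1,
    show mode (nopE 0 (-1) D.psiT D.psiPT) 0 = _ from h2,
    show mode D.phiT 0 = _ from D.bos_zero .liouville]
  simp only [lev, Int.cast_one]
  module

/-- J³_gh is diagonal in the ghosts. For the second ghost vacuum the ordering constants of the pairs
+ and 1/2, weighted by their charges 1 and 1/2, give 1 - 1/2. -/
lemma totalIsospin_eq (ha : D.a ≠ 0) (ha' : D.a' ≠ 0) :
    D.totalIsospin = D.numOp (fun s _ => isospin s) + D.vacIsospin • 1 := by
  have h0 : ∀ s c, D.number s (fun _ => c) = c • D.number s (fun _ => 1) := fun s c => by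
    simpa using D.number_smul s c fun _ => 1
  have hg : mode (D.Jgh three) 0 = ∑ x, f three x x • mode (D.ghostProd 0 x (D.c x) x) 0 := by
    rw [Jgh]
    simp only [mode_sum, mode_smul]
    refine Finset.sum_congr rfl fun y _ => Finset.sum_eq_single y (fun z _ hz => ?_) (by simp)
    cases y <;> cases z <;> first | exact absurd rfl hz | simp [f]
  have hm : D.a / 2 * D.mom .matter = D.j₁ := by simp only [mom]; field_simp
  have hl : D.a' / 2 * D.mom .liouville = -(2 * D.j₂ + 1) / 2 := by simp only [mom]; field_simp
  rw [totalIsospin, mode_add, mode_add, mode_J_three, mode_JT_three, hg, hm, hl,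
    Finset.sum_congr rfl fun x _ => congrArg _ (D.ghost_zero_eq x), numOp, sum_pair, sum_gen,
    sum_gen]
  simp only [h0 _ (isospin _)]
  unfold vacIsospin
  rcases hgh : D.gh with _ | _ <;>
    simp only [lev, hgh, GhostVac.level, sgnP, isFer, isOdd, f, isospin] <;> norm_num <;> module

lemma weights_totalIsospin (ha : D.a ≠ 0) (ha' : D.a' ≠ 0) :
    D.Weights D.totalIsospin (fun s _ => isospin s) (fun _ => 0) := by
  rw [D.totalIsospin_eq ha ha']
  exact ((D.weights_numOp _).add (Weights.scalar _)).congr (fun _ _ => add_zero _)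
    fun _ => add_zero _

lemma totalIsospin_vac (ha : D.a ≠ 0) (ha' : D.a' ≠ 0) :
    D.totalIsospin vac = D.vacIsospin • vac := by
  rw [D.totalIsospin_eq ha ha']
  simp [numOp_vac]

/-! ### The energy -/

lemma SB_bos_bos (u u' : Heis) :
    SB 1 (D.bos u) (D.bos u') fun m => if u = u' then (m : ℂ) else 0 := by
  by_cases h : u = u'
  · subst h
    have := D.bos_bos u
    rw [← one_smul ℂ oneF] at this
    exact (SB.of_lin this).congr fun m => by simp
  · exact (SB.of_zero (D.bos_bos_ne h)).congr fun m => by simp [h]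

/-- The energy of the free bosons. -/
def bosEnergy : Module.End ℂ Fock :=
  (1 / 2 : ℂ) • mode (nopE 1 1 (D.bos .matter) (D.bos .matter)) 0
    + (1 / 2 : ℂ) • mode (nopE 1 1 (D.bos .liouville) (D.bos .liouville)) 0

lemma weights_bosEnergy : D.Weights D.bosEnergy (fun _ _ => 0) (fun n => n) where
  fst s := by
    have h : ∀ u, OB 1 (mode (nopE 1 1 (D.bos u) (D.bos u)) 0) (D.fst s) 0 := fun u =>
      OB.nop (SB.of_zero (D.fst_bos s u)) (SB.of_zero (D.fst_bos s u)) (one_mul 1)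
        (Or.inl fun _ => rfl) (Or.inl fun _ => rfl) (one_mul 1) (by simp [mulF_zero])
    exact (((h _).smul _).add ((h _).smul _)).congr (by simp [mulF_zero])
  snd s := by
    have h : ∀ u, OB 1 (mode (nopE 1 1 (D.bos u) (D.bos u)) 0) (D.snd s) 0 := fun u =>
      OB.nop (SB.of_zero (D.snd_bos s u)) (SB.of_zero (D.snd_bos s u)) (one_mul 1)
        (Or.inl fun _ => rfl) (Or.inl fun _ => rfl) (one_mul 1) (by simp [mulF_zero])
    exact (((h _).smul _).add ((h _).smul _)).congr (by simp [mulF_zero])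
  bos u := by
    have h : ∀ u', OB 1 (mode (nopE 1 1 (D.bos u') (D.bos u')) 0) (D.bos u)
        (mulF (fun m => if u = u' then (m : ℂ) else 0) (D.bos u')
          + (1 : ℂ) • mulF (fun m => if u = u' then (m : ℂ) else 0) (D.bos u')) := fun u' =>
      OB.nop (D.SB_bos_bos u u') (D.SB_bos_bos u u') (one_mul 1)
        (Or.inr (one_mul 1)) (Or.inr (one_mul 1)) (one_mul 1) rfl
    refine (((h _).smul _).add ((h _).smul _)).congr (fields_ext fun n => ?_)
    cases u <;> simp <;> module

lemma bosEnergy_vac : D.bosEnergy vac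
    = (1 / 2 * D.mom .matter ^ 2 + 1 / 2 * D.mom .liouville ^ 2) • vac := by
  have h : ∀ u, mode (nopE 1 1 (D.bos u) (D.bos u)) 0 vac = D.mom u ^ 2 • vac := fun u => by
    rw [nopE_apply_eq_single 0 (fun m hm h0 => by rw [D.bos_vac u (by omega), map_zero])
      (fun m hm h0 => by rw [D.bos_vac u (by omega), map_zero])]
    simp [nopTerm, bos_zero, smul_smul, pow_two]
  rw [bosEnergy, LinearMap.add_apply, LinearMap.smul_apply, LinearMap.smul_apply, h, h]
  module

/-- The energy of the vacuum. -/
def vacEnergy : ℂ := (D.j₁ * (2 * D.j₁ + 1) - D.j₂ * (2 * D.j₂ + 1)) / D.a ^ 2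

lemma mode_stressTensor {s r : Pair} (hs : isFer s = false) (hr : isFer r = true) (u : Heis)
    (a : ℂ) :
    mode (stressTensor a (D.fst s) (D.snd s) (D.fst r) (D.snd r) (D.bos u)) 0
      = D.number s (fun n => -n) + D.number r (fun n => -n)
        + (1 / 2 : ℂ) • mode (nopE 1 1 (D.bos u) (D.bos u)) 0 + (D.mom u / (2 * a)) • 1 := by
  have h1 := D.fst_snd_one_eq s fun n => -((n : ℂ) + (0 : ℤ))
  have h2 := D.fst_snd_one_eq r fun n => -((n : ℂ) + (0 : ℤ))
  rw [← deriv_eq_mulF] at h1 h2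
  rw [show sgnP s s = 1 by simp [sgnP, hs]] at h1
  rw [show sgnP r r = -1 by simp [sgnP, hr]] at h2
  rw [stressTensor, mode_sub, mode_add, mode_sub, nop_eq, nopF_eq, nop_eq, h1, h2, mode_smul,
    mode_smul, mode_deriv, bos_zero]
  simp only [Int.cast_zero, add_zero, neg_zero, mul_zero]
  rw [show D.mom u / (2 * a) = D.mom u * (1 / (2 * a)) by ring]
  push_cast
  module

/-- The derivatives give zero modes the weight 0, so reordering produces no constants. The only
scalar comes from the linear terms ∂²φ and ∂²φ̃. -/
lemma L₀_eq (ha : D.a ≠ 0) (haa : D.a ^ 2 + D.a' ^ 2 = 0) :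
    D.L₀ = D.numOp (fun _ n => -n) + D.bosEnergy
      + (D.mom .matter / (2 * D.a) + D.mom .liouville / (2 * D.a')) • 1 := by
  have hg : ∀ x, mode (D.ghostProd 1 x (deriv 0 (D.c x)) x) 0
      = D.number (ghost x) (fun n => -n) := fun x => by
    have := D.snd_fst_one_eq (ghost x) (μ := fun n => -((n : ℂ) + (0 : ℤ))) (by simp)
    rw [← deriv_eq_mulF, snd_ghost, fst_ghost, sgnP_ghost] at this
    rw [ghostProd_eq, this]
    simp
  have h1 := D.mode_stressTensor (s := matterB) (r := matterF) rfl rfl .matter D.a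
  have h2 := D.mode_stressTensor (s := liouvilleB) (r := liouvilleF) rfl rfl .liouville D.a'
  rw [L₀, mode_add, mode_add, mode_sum, Finset.sum_congr rfl fun x _ => hg x]
  rw [show mode (stressTensor D.a D.beta D.gamma D.psiP D.psi D.phi) 0 = _ from h1,
    show mode (stressTensor D.a' D.betaT D.gammaT D.psiPT D.psiT D.phiT) 0 = _ from h2,
    numOp, sum_pair, bosEnergy]
  module

lemma weights_L₀ (ha : D.a ≠ 0) (haa : D.a ^ 2 + D.a' ^ 2 = 0) :
    D.Weights D.L₀ (fun _ n => -n) (fun n => n) := by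
  rw [D.L₀_eq ha haa]
  exact (((D.weights_numOp _).add D.weights_bosEnergy).add (Weights.scalar _)).congr
    (fun _ _ => by simp) fun _ => by simp

lemma L₀_vac (ha : D.a ≠ 0) (haa : D.a ^ 2 + D.a' ^ 2 = 0) : D.L₀ vac = D.vacEnergy • vac := by
  have ha' : D.a' ≠ 0 := fun h => ha (by simpa [h] using haa)
  rw [D.L₀_eq ha haa]
  simp only [LinearMap.add_apply, numOp_vac, bosEnergy_vac, LinearMap.smul_apply,
    Module.End.one_apply, zero_add, ← add_smul, mom, vacEnergy]
  congr 1
  have h : D.a' ^ 2 = -D.a ^ 2 := by linear_combination haa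
  rw [div_pow, div_pow, h, div_div, div_div, show D.a * (2 * D.a) = 2 * D.a ^ 2 by ring,
    show D.a' * (2 * D.a') = 2 * D.a' ^ 2 by ring, h]
  field_simp
  ring

end Datum

end AffineOsp

end

noncomputable section

namespace AffineOsp

open Gen Pair

namespace OB

variable {V : Type*} [AddCommGroup V] [Module ℂ V] {T S : Module.End ℂ V} {A : fields V}

lemma commutator {w w' : ℤ → ℂ} (H : OB 1 T A (mulF w A)) (H' : OB 1 S A (mulF w' A)) :
    OB 1 (T * S - S * T) A 0 := fun n => by
  have h := H n
  have h' := H' n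
  rw [mode_mulF, one_smul] at h h'
  rw [mul_sub, ← mul_assoc, ← mul_assoc, h, h', add_mul, add_mul, smul_mul_assoc, smul_mul_assoc,
    mul_assoc T, mul_assoc S, h, h']
  simp only [mul_add, mul_smul_comm, smul_add, smul_smul, sub_mul, mul_assoc, mode_zero]
  module

end OB

namespace Datum

variable (D : Datum)

/-! ### Light-cone bosons -/

/-- The oscillator parts of `a φ - a' φ̃` and `a φ + a' φ̃`. -/
def lc (ε : Bool) : fields Fock :=
  D.a • boson .matter 0 + (if ε then -D.a' else D.a') • boson .liouville 0

lemma fst_boson (s : Pair) (u : Heis) (p : ℂ) : LB 1 (D.fst s) (boson u p) 0 0 := codeFst_boson _ _ _ _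
lemma snd_boson (s : Pair) (u : Heis) (p : ℂ) : LB 1 (D.snd s) (boson u p) 0 0 := codeSnd_boson _ _ _ _

lemma SB_fst_lc (s : Pair) (ε : Bool) : SB 1 (D.fst s) (D.lc ε) fun _ => 0 :=
  SB.of_zero ((((D.fst_boson s _ _).smul_right _).add_right
    ((D.fst_boson s _ _).smul_right _)).congr (by simp) (by simp))

lemma SB_snd_lc (s : Pair) (ε : Bool) : SB 1 (D.snd s) (D.lc ε) fun _ => 0 :=
  SB.of_zero ((((D.snd_boson s _ _).smul_right _).add_right
    ((D.snd_boson s _ _).smul_right _)).congr (by simp) (by simp))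

lemma SB_lc_fst (ε : Bool) (s : Pair) : SB 1 (D.lc ε) (D.fst s) fun _ => 0 :=
  SB.of_zero (((((D.fst_boson s _ _).smul_right _).add_right
    ((D.fst_boson s _ _).smul_right _)).congr (C' := 0) (D' := 0) (by simp) (by simp)).skew
      (hC := by simp) (hD := by simp))

lemma SB_lc_snd (ε : Bool) (s : Pair) : SB 1 (D.lc ε) (D.snd s) fun _ => 0 :=
  SB.of_zero (((((D.snd_boson s _ _).smul_right _).add_right
    ((D.snd_boson s _ _).smul_right _)).congr (C' := 0) (D' := 0) (by simp) (by simp)).skew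
      (hC := by simp) (hD := by simp))

lemma SB_boson (u u' : Heis) (p p' : ℂ) :
    SB 1 (boson u p) (boson u' p') fun m => if u = u' then (m : ℂ) else 0 := by
  by_cases h : u = u'
  · subst h
    intro m n
    have h0 : ∀ k, m ≠ 0 → n ≠ 0 → mode (boson u p) k * mode (boson u p') k
      = mode (boson u p) k * mode (boson u p') k := fun _ _ _ => rfl
    by_cases hm : m = 0
    · subst hm; rw [mode_boson_zero]; simp
    by_cases hn : n = 0
    · subst hn; rw [mode_boson_zero]; simp [hm]
    rw [mode_boson_of_ne u p' p hn]
    have := boson_boson u p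
    rw [← one_smul ℂ oneF] at this
    simpa using SB.of_lin this m n
  · exact (SB.of_zero (boson_boson_ne h _ _)).congr fun m => by simp [h]

variable {D}

/-- Because a² + a'² = 0, both combinations are null and are paired only with each other. This makes
the c³ part of the quadratic differential nilpotent and provides the conjugate variable for the
homotopy. -/
lemma SB_lc (haa : D.a ^ 2 + D.a' ^ 2 = 0) (ε ε' : Bool) :
    SB 1 (D.lc ε) (D.lc ε') fun m => if ε = ε' then 0 else m * (2 * D.a ^ 2) := by
  refine ((((SB_boson _ _ 0 0).smul_right _).add_right ((SB_boson _ _ 0 0).smul_right _)).smul_left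
    _ |>.add_left ((((SB_boson _ _ 0 0).smul_right _).add_right
      ((SB_boson _ _ 0 0).smul_right _)).smul_left _)).congr fun m => ?_
  cases ε <;> cases ε' <;> simp <;>
    first
    | linear_combination (m : ℂ) * haa
    | linear_combination (-m : ℂ) * haa

variable (D)

lemma lc_zero (ε : Bool) : mode (D.lc ε) 0 = 0 := by
  cases ε <;> simp [lc, mode_boson_zero]

lemma boson_matter_eq (ha : D.a ≠ 0) :
    boson .matter 0 = (1 / (2 * D.a)) • D.lc true + (1 / (2 * D.a)) • D.lc false := by
  refine fields_ext fun n => ?_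
  simp only [lc, mode_add, mode_smul, smul_add, smul_smul, if_true, Bool.false_eq_true, if_false]
  match_scalars <;> field_simp <;> ring

lemma boson_liouville_eq (ha' : D.a' ≠ 0) :
    boson .liouville 0 = (1 / (2 * D.a')) • D.lc false - (1 / (2 * D.a')) • D.lc true := by
  refine fields_ext fun n => ?_
  simp only [lc, mode_add, mode_sub, mode_smul, smul_add, smul_smul, if_true, Bool.false_eq_true,
    if_false]
  match_scalars <;> field_simp <;> ring

lemma bos_eq (u : Heis) : D.bos u = boson u 0 + D.mom u • oneF := by
  refine fields_ext fun n => ?_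
  rw [mode_add, mode_smul, mode_oneF, bos]
  by_cases h : n = 0
  · subst h; simp [mode_boson_zero]
  · rw [mode_boson_of_ne u _ 0 h, if_neg h, smul_zero, add_zero]

lemma lc_vac (ε : Bool) {n : ℤ} (h : 0 ≤ n) : mode (D.lc ε) n vac = 0 := by
  rcases h.eq_or_lt with rfl | h
  · rw [lc_zero]; rfl
  · cases ε <;> simp [lc, boson_vac _ _ h]

/-- The weights of an operator on the free fields in the light-cone basis. -/
structure LCWeights (T : Module.End ℂ Fock) (μ : Pair → ℤ → ℂ) (ν : Bool → ℤ → ℂ) : Prop where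
  fst : ∀ s, OB 1 T (D.fst s) (mulF (fun n => μ s (-n)) (D.fst s))
  snd : ∀ s, OB 1 T (D.snd s) (mulF (fun n => -μ s n) (D.snd s))
  lc : ∀ ε, OB 1 T (D.lc ε) (mulF (ν ε) (D.lc ε))

/-- Indices of the creation modes for a vacuum of given levels. -/
abbrev Creator (l : Pair → ℤ) : Type :=
  {p : Pair × ℤ // p.2 < l p.1} ⊕ {p : Pair × ℤ // p.2 ≤ -l p.1} ⊕ {p : Bool × ℤ // p.2 < 0}

/-- The creation modes. -/
def cre (l : Pair → ℤ) : Creator l → Module.End ℂ Fock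
  | .inl p => mode (D.fst p.1.1) p.1.2
  | .inr (.inl p) => mode (D.snd p.1.1) p.1.2
  | .inr (.inr p) => mode (D.lc p.1.1) p.1.2

/-- The weights of the creation modes. -/
def creWeight {l : Pair → ℤ} (μ : Pair → ℤ → ℂ) (ν : Bool → ℤ → ℂ) : Creator l → ℂ
  | .inl p => -μ p.1.1 (-p.1.2)
  | .inr (.inl p) => μ p.1.1 p.1.2
  | .inr (.inr p) => -ν p.1.1 p.1.2

variable {D}

lemma eq_top_of_cre (ha : D.a ≠ 0) (ha' : D.a' ≠ 0) (M : Submodule ℂ Fock) (h : vac ∈ M)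
    (hM : ∀ i, ∀ v ∈ M, D.cre D.lev i v ∈ M) : M = ⊤ := by
  refine D.eq_top h (fun s n hn => hM (.inl ⟨(s, n), hn⟩))
    (fun s n hn => hM (.inr (.inl ⟨(s, n), hn⟩))) fun u n hn v hv => ?_
  have h1 := hM (.inr (.inr ⟨(true, n), hn⟩)) v hv
  have h2 := hM (.inr (.inr ⟨(false, n), hn⟩)) v hv
  rw [bos, mode_boson_of_ne u _ 0 hn.ne]
  cases u
  · rw [D.boson_matter_eq ha]
    exact M.add_mem (M.smul_mem _ h1) (M.smul_mem _ h2)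
  · rw [D.boson_liouville_eq ha']
    exact M.sub_mem (M.smul_mem _ h2) (M.smul_mem _ h1)

lemma Weights.toLC {T : Module.End ℂ Fock} {μ : Pair → ℤ → ℂ} {ν : ℤ → ℂ} (H : D.Weights T μ ν)
    (hν : ν 0 = 0) : D.LCWeights T μ fun _ => ν where
  fst := H.fst
  snd := H.snd
  lc ε := by
    have h1 : OB 1 T (oneF : fields Fock) 0 := fun n => by
      rw [mode_oneF]; split_ifs <;> simp
    have h : ∀ u, OB 1 T (boson u 0) (mulF ν (boson u 0)) := fun u => by
      have := (H.bos u).add_right (h1.smul_right (-D.mom u))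
      have e : D.bos u + -D.mom u • oneF = boson u 0 := by rw [D.bos_eq]; module
      rw [e] at this
      refine this.congr (fields_ext fun n => ?_)
      rw [smul_zero, add_zero, mode_mulF, mode_mulF]
      by_cases hn : n = 0
      · rw [hn, hν, zero_smul, zero_smul]
      · rw [Datum.bos, mode_boson_of_ne u _ 0 hn]
    refine (((h .matter).smul_right _).add_right ((h .liouville).smul_right _)).congr
      (fields_ext fun n => ?_)
    simp only [Datum.lc, mode_add, mode_smul, mode_mulF]
    module

namespace LCWeights

variable {T S : Module.End ℂ Fock} {μ μ' : Pair → ℤ → ℂ} {ν ν' : Bool → ℤ → ℂ}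

lemma add (H : D.LCWeights T μ ν) (H' : D.LCWeights S μ' ν') :
    D.LCWeights (T + S) (fun s n => μ s n + μ' s n) (fun ε n => ν ε n + ν' ε n) where
  fst s := ((H.fst s).add (H'.fst s)).congr (mulF_add _ _ _).symm
  snd s := ((H.snd s).add (H'.snd s)).congr (by rw [← mulF_add]; congr 1; ext n; ring)
  lc u := ((H.lc u).add (H'.lc u)).congr (mulF_add _ _ _).symm

lemma smul (c : ℂ) (H : D.LCWeights T μ ν) :
    D.LCWeights (c • T) (fun s n => c * μ s n) (fun ε n => c * ν ε n) where
  fst s := ((H.fst s).smul c).congr (fields_ext fun n => by simp [smul_smul])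
  snd s := ((H.snd s).smul c).congr (fields_ext fun n => by simp [smul_smul])
  lc u := ((H.lc u).smul c).congr (fields_ext fun n => by simp [smul_smul])

lemma cre (H : D.LCWeights T μ ν) {l : Pair → ℤ} (i : Creator l) (v : Fock) :
    T (D.cre l i v) = D.cre l i (T v) + creWeight μ ν i • D.cre l i v := by
  rcases i with ⟨p, hp⟩ | ⟨p, hp⟩ | ⟨p, hp⟩
  · exact ((H.fst p.1).apply p.2 v).trans (by
      simp only [mode_mulF, Datum.cre, creWeight, LinearMap.smul_apply]; module)
  · exact ((H.snd p.1).apply p.2 v).trans (by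
      simp only [mode_mulF, Datum.cre, creWeight, LinearMap.smul_apply]; module)
  · exact ((H.lc p.1).apply p.2 v).trans (by
      simp only [mode_mulF, Datum.cre, creWeight, LinearMap.smul_apply]; module)

/-- An operator without weights is determined by its value on the vacuum. -/
lemma eq_smul_one (ha : D.a ≠ 0) (ha' : D.a' ≠ 0)
    (H : D.LCWeights T (fun _ _ => 0) fun _ _ => 0) {c : ℂ} (h : T vac = c • vac) : T = c • 1 := by
  have hM := eq_top_of_cre ha ha' (LinearMap.ker (T - c • (1 : Module.End ℂ Fock)))
    (by simp [h]) fun i v hv => by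
      simp only [LinearMap.mem_ker, LinearMap.sub_apply, LinearMap.smul_apply,
        Module.End.one_apply, sub_eq_zero] at hv ⊢
      have h0 : creWeight (fun _ _ => 0) (fun _ _ => 0) i = 0 := by
        rcases i with _ | _ | _ <;> simp [creWeight]
      rw [H.cre, hv, map_smul, h0, zero_smul, add_zero]
  rw [LinearMap.ker_eq_top, sub_eq_zero] at hM
  exact hM

lemma commute (ha : D.a ≠ 0) (ha' : D.a' ≠ 0) (H : D.LCWeights T μ ν) (H' : D.LCWeights S μ' ν')
    {c c' : ℂ} (h : T vac = c • vac) (h' : S vac = c' • vac) : T * S = S * T := by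
  have H₀ : D.LCWeights (T * S - S * T) (fun _ _ => 0) fun _ _ => 0 :=
    ⟨fun s => ((H.fst s).commutator (H'.fst s)).congr (mulF_zero _).symm,
      fun s => ((H.snd s).commutator (H'.snd s)).congr (by simp only [neg_zero, mulF_zero]),
      fun ε => ((H.lc ε).commutator (H'.lc ε)).congr (mulF_zero _).symm⟩
  have := H₀.eq_smul_one ha ha' (c := 0) (by simp [h, h', smul_smul, mul_comm])
  rwa [zero_smul, sub_eq_zero] at this

/-- The possible eigenvalues of an operator with given weights. -/
lemma iSup_eigenspace (ha : D.a ≠ 0) (ha' : D.a' ≠ 0) (H : D.LCWeights T μ ν) {c₀ : ℂ}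
    (h : T vac = c₀ • vac) {S : Set ℂ} (hc₀ : c₀ ∈ S)
    (hS : ∀ i : Creator D.lev, ∀ c ∈ S, c + creWeight μ ν i ∈ S) : ⨆ c ∈ S, Module.End.eigenspace T c = ⊤ :=
  iSup_eigenspace_eq_top h hc₀ H.cre hS (eq_top_of_cre ha ha')

end LCWeights

end Datum

end AffineOsp

end

/-! ### Gradings by ghost number and energy, and nilpotency of the BRST operator -/

noncomputable section

namespace AffineOsp

open Gen Pair

section Shifts

variable {V G : Type*} [AddCommGroup V] [Module ℂ V] [AddCommGroup G] {E : G → Submodule ℂ V}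
  {s : G} {β γ p ψ φ : fields V}

lemma Shifts.apply_zero {t : G} {A : fields V} (hA : Shifts E s t A) {g : G} {v : V} (hv : v ∈ E g) :
    mode A 0 v ∈ E (g + t) := by
  have := hA 0 g v hv
  rwa [zero_smul, add_zero] at this

lemma wakimotoCurrent_shifts (hβ : Shifts E s 0 β) (hγ : Shifts E s 0 γ) (hp : Shifts E s 0 p)
    (hψ : Shifts E s 0 ψ) (hφ : Shifts E s 0 φ) (k a : ℂ) (x : Gen) :
    Shifts E s 0 (wakimotoCurrent k a β γ p ψ φ x) := by
  cases x <;> simp only [wakimotoCurrent, nop_eq, nopF_eq]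
  · exact hβ.neg
  · exact hp.sub (hβ.nop_zero hψ)
  · exact ((hβ.nop_zero hγ).neg.add (hφ.smul _)).sub ((hψ.nop_zero hp).smul _)
  · exact ((hγ.nop_zero (hp.sub (hβ.nop_zero hψ))).add ((hψ.nop_zero hφ).smul _)).add
      ((hψ.deriv 0).smul _)
  · exact ((((hβ.nop_zero (hγ.nop_zero hγ)).sub ((hγ.nop_zero hφ).smul _)).add
      (hγ.nop_zero (hψ.nop_zero hp))).sub ((hγ.deriv 0).smul _)).add
      ((hψ.nop_zero (hψ.deriv 0)).smul _)

lemma dualWakimotoCurrent_shifts (hβ : Shifts E s 0 β) (hγ : Shifts E s 0 γ) (hp : Shifts E s 0 p)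
    (hψ : Shifts E s 0 ψ) (hφ : Shifts E s 0 φ) (k a : ℂ) (x : Gen) :
    Shifts E s 0 (dualWakimotoCurrent k a β γ p ψ φ x) := by
  cases x <;> simp only [dualWakimotoCurrent, nop_eq, nopF_eq]
  · exact ((((hβ.nop_zero (hγ.nop_zero hγ)).neg.add ((hγ.nop_zero hφ).smul _)).sub
      (hγ.nop_zero (hψ.nop_zero hp))).add ((hγ.deriv 0).smul _)).sub
      ((hψ.nop_zero (hψ.deriv 0)).smul _)
  · exact ((hγ.nop_zero (hp.sub (hβ.nop_zero hψ))).neg.sub ((hψ.nop_zero hφ).smul _)).sub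
      ((hψ.deriv 0).smul _)
  · exact ((hβ.nop_zero hγ).sub (hφ.smul _)).add ((hψ.nop_zero hp).smul _)
  · exact hp.sub (hβ.nop_zero hψ)
  · exact hβ

end Shifts

namespace Datum

variable (D : Datum)

variable {D} in
/-- A grading of the Fock space in which the matter fields have degree zero. -/
structure GhostGrading {G : Type*} [AddCommGroup G] (D : Datum) (E : G → Submodule ℂ Fock)
    (s t : G) : Prop where
  fst : ∀ r, Shifts E s (-(ghostDegree r • t)) (D.fst r)
  snd : ∀ r, Shifts E s (ghostDegree r • t) (D.snd r)
  bos : ∀ u, Shifts E s 0 (D.bos u)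

namespace GhostGrading

variable {D} {G : Type*} [AddCommGroup G] {E : G → Submodule ℂ Fock} {s t : G}

lemma J (H : D.GhostGrading E s t) (x : Gen) : Shifts E s 0 (D.J x) := by
  have h1 := H.fst matterB
  have h2 := H.snd matterB
  have h3 := H.fst matterF
  have h4 := H.snd matterF
  simp only [ghostDegree, zero_smul, neg_zero] at h1 h2 h3 h4
  exact wakimotoCurrent_shifts h1 h2 h3 h4 (H.bos .matter) _ _ x

lemma JT (H : D.GhostGrading E s t) (x : Gen) : Shifts E s 0 (D.JT x) := by
  have h1 := H.fst liouvilleB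
  have h2 := H.snd liouvilleB
  have h3 := H.fst liouvilleF
  have h4 := H.snd liouvilleF
  simp only [ghostDegree, zero_smul, neg_zero] at h1 h2 h3 h4
  exact dualWakimotoCurrent_shifts h1 h2 h3 h4 (H.bos .liouville) _ _ x

lemma b (H : D.GhostGrading E s t) (x : Gen) : Shifts E s (-t) (D.b x) := by
  have := H.fst (ghost x)
  rwa [fst_ghost, ghostDegree, one_smul] at this

lemma c (H : D.GhostGrading E s t) (x : Gen) : Shifts E s t (D.c x) := by
  have := H.snd (ghost x)
  rwa [snd_ghost, ghostDegree, one_smul] at this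

lemma Jgh (H : D.GhostGrading E s t) (x : Gen) : Shifts E s 0 (D.Jgh x) :=
  Shifts.sum _ fun y _ => Shifts.sum _ fun z _ => Shifts.smul _ (by
    rw [ghostProd_eq]
    exact (H.c z).nop (H.b y) (add_neg_cancel t))

lemma total (H : D.GhostGrading E s t) (x : Gen) :
    Shifts E s 0 (totalCurrent (fun x => D.J x + D.JT x) D.b D.c x) := by
  rw [totalCurrent, ← Jgh_eq]
  exact ((H.J x).add (H.JT x)).add (H.Jgh x)

lemma brst (H : D.GhostGrading E s t) : Shifts E s t D.brstCurrent :=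
  Shifts.sum _ fun x _ => Shifts.sum _ fun y _ => Shifts.smul _ ((H.c y).nop
    (((H.J x).add (H.JT x)).add ((H.Jgh x).smul _)) (add_zero t))

end GhostGrading

lemma ghostNumber_grading : D.GhostGrading (Module.End.eigenspace D.ghostNumber) 0 1 where
  fst r := Shifts.of_OB (D.weights_ghostNumber.fst r) fun n => by simp
  snd r := Shifts.of_OB (D.weights_ghostNumber.snd r) fun n => by simp
  bos u := Shifts.of_OB (D.weights_ghostNumber.bos u) fun n => by simp

lemma L₀_grading (ha : D.a ≠ 0) (haa : D.a ^ 2 + D.a' ^ 2 = 0) :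
    D.GhostGrading (Module.End.eigenspace D.L₀) (-1) 0 where
  fst r := Shifts.of_OB ((D.weights_L₀ ha haa).fst r) fun n => by simp
  snd r := Shifts.of_OB ((D.weights_L₀ ha haa).snd r) fun n => by simp
  bos u := Shifts.of_OB ((D.weights_L₀ ha haa).bos u) fun n => by simp

/-! ### Operators that commute with the antighosts -/

/-- The number of ghosts `c`. -/
def numC : Module.End ℂ Fock :=
  D.numOp fun s n => if ghostDegree s = 1 ∧ n ≤ -D.lev s then 1 else 0

/-- The number of antighosts `b`. -/
def numB : Module.End ℂ Fock :=
  D.numOp fun s n => if ghostDegree s = 1 ∧ -D.lev s < n then -1 else 0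

lemma ghostNumber_eq_sub : D.ghostNumber = D.numC - D.numB := by
  have h := ((D.weights_numOp fun s n => if ghostDegree s = 1 ∧ n ≤ -D.lev s then 1 else 0).add
    ((D.weights_numOp fun s n => if ghostDegree s = 1 ∧ -D.lev s < n then -1 else 0).smul (-1)))
  have := D.weights_ghostNumber.ext (c := 0) (h.congr (fun s n => ?_) fun n => by simp)
    (by simp [ghostNumber_vac]) (by simp [numOp_vac])
  · rw [this, numC, numB]; module
  · rcases s with _ | _ | _ | _ | x <;> simp [ghostDegree]
    split_ifs <;> first | (exfalso; omega) | simp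

lemma numC_nat (ha : D.a ≠ 0) (ha' : D.a' ≠ 0) :
    ⨆ c ∈ {c : ℂ | ∃ n : ℕ, c = n}, Module.End.eigenspace D.numC c = ⊤ := by
  refine ((D.weights_numOp _).toLC rfl).iSup_eigenspace ha ha' (c₀ := 0) (by simp [numOp_vac])
    ⟨0, by simp⟩ ?_
  rintro i _ ⟨n, rfl⟩
  rcases i with ⟨p, hp⟩ | ⟨p, hp⟩ | ⟨p, hp⟩ <;> simp only [creWeight]
  · exact ⟨n, by rw [if_neg (by omega)]; simp⟩
  · split_ifs
    · exact ⟨n + 1, by simp⟩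
    · exact ⟨n, by simp⟩
  · exact ⟨n, by simp⟩

lemma numB_nat (ha : D.a ≠ 0) (ha' : D.a' ≠ 0) :
    ⨆ c ∈ {c : ℂ | ∃ n : ℕ, c = n}, Module.End.eigenspace D.numB c = ⊤ := by
  refine ((D.weights_numOp _).toLC rfl).iSup_eigenspace ha ha' (c₀ := 0) (by simp [numOp_vac])
    ⟨0, by simp⟩ ?_
  rintro i _ ⟨n, rfl⟩
  rcases i with ⟨p, hp⟩ | ⟨p, hp⟩ | ⟨p, hp⟩ <;> simp only [creWeight]
  · split_ifs
    · exact ⟨n + 1, by simp⟩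
    · exact ⟨n, by simp⟩
  · exact ⟨n, by rw [if_neg (by omega)]; simp⟩
  · exact ⟨n, by simp⟩

lemma numOp_apply_mem {μ : Pair → ℤ → ℂ} {M : Submodule ℂ Fock} {v : Fock}
    (h₁ : ∀ s m, m ≤ -D.lev s → μ s m • mode (D.snd s) m (mode (D.fst s) (-m) v) ∈ M)
    (h₂ : ∀ s m, -D.lev s < m → μ s m • mode (D.fst s) (-m) (mode (D.snd s) m v) ∈ M) :
    D.numOp μ v ∈ M := by
  rw [numOp, LinearMap.sum_apply]
  refine Submodule.sum_mem _ fun s _ => ?_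
  rw [number, mode_nopE_apply]
  refine finsum_induction (· ∈ M) M.zero_mem (fun _ _ => M.add_mem) fun m => ?_
  simp only [nopTerm, zero_sub, mode_mulF, LinearMap.smul_apply]
  split_ifs with h
  · exact h₁ s m h
  · rw [map_smul]
    exact M.smul_mem _ (h₂ s m (by omega))

variable {D}

/-- An operator that raises the ghost number and commutes with the antighosts vanishes. -/
lemma eq_zero_of_comm_b (ha : D.a ≠ 0) (ha' : D.a' ≠ 0) {T : Module.End ℂ Fock} {e : Gen → ℂ}
    (hb : ∀ v m, mode (D.b v) m * T = e v • (T * mode (D.b v) m)) (he : ∀ v, e v ≠ 0)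
    {p : ℕ} (hp : p ≠ 0) (hT : ∀ c, ∀ v ∈ Module.End.eigenspace D.ghostNumber c,
      T v ∈ Module.End.eigenspace D.ghostNumber (c + p)) : T = 0 := by
  have hbv : ∀ v m u, mode (D.fst (ghost v)) m (T u) = e v • T (mode (D.fst (ghost v)) m u) :=
    fun v m u => by
      rw [fst_ghost]
      exact LinearMap.congr_fun (hb v m) u
  have wB := D.weights_numOp fun s n => if ghostDegree s = 1 ∧ -D.lev s < n then -1 else 0
  have wC := D.weights_numOp fun s n => if ghostDegree s = 1 ∧ n ≤ -D.lev s then 1 else 0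
  have hBC : D.numC * D.numB = D.numB * D.numC :=
    (wC.toLC rfl).commute ha ha' (wB.toLC rfl) (c := 0) (c' := 0)
      (by simp [numC, numOp_vac]) (by simp [numB, numOp_vac])
  have hB := D.numB_nat ha ha'
  have hC := D.numC_nat ha ha'
  -- Suppose u has n ghosts and no antighosts. An annihilation mode of b lowers n, so by induction T
  -- kills its image and the mode kills T u. Hence T u contains no ghosts and its ghost number is
  -- not positive, although it equals n + p.
  have step : ∀ n : ℕ, ∀ u, D.numB u = 0 → D.numC u = (n : ℂ) • u → T u = 0 := by
    intro n
    induction n using Nat.strong_induction_on with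
    | _ n ih =>
      intro u hu hu'
      have hann : ∀ v m, D.lev (ghost v) ≤ m → T (mode (D.fst (ghost v)) m u) = 0 := by
        intro v m hm
        have e1 := (wB.fst (ghost v)).eigen m (c := 0) (v := u) (by rw [zero_smul]; exact hu)
        have e2 := (wC.fst (ghost v)).eigen m hu'
        rw [if_neg (by omega), sub_zero, zero_smul] at e1
        rw [if_pos ⟨rfl, by omega⟩] at e2
        rcases n with _ | n
        · rw [eq_zero_of_notMem hC (c := -1) ?_ (e2.trans (by simp)), map_zero]
          rintro ⟨k, hk⟩
          have : ((k + 1 : ℕ) : ℂ) = 0 := by push_cast; rw [← hk]; ring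
          norm_cast at this
        · exact ih n (by omega) _ e1 (e2.trans (by simp))
      have hCT : D.numC (T u) = 0 := by
        refine (Submodule.mem_bot ℂ).1 (D.numOp_apply_mem (fun s m hm => ?_) fun s m hm => ?_)
        · rw [Submodule.mem_bot]
          rcases s with _ | _ | _ | _ | v <;> simp only [ghostDegree, zero_ne_one, false_and,
            if_false, zero_smul]
          rw [hbv, hann v (-m) (by omega), smul_zero, map_zero, smul_zero]
        · rw [if_neg (by omega), zero_smul]; exact Submodule.zero_mem _
      have hg : u ∈ Module.End.eigenspace D.ghostNumber n := by
        rw [Module.End.mem_eigenspace_iff, ghostNumber_eq_sub, LinearMap.sub_apply, hu, hu', sub_zero]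
      have := hT _ _ hg
      rw [Module.End.mem_eigenspace_iff, ghostNumber_eq_sub, LinearMap.sub_apply, hCT, zero_sub] at this
      refine eq_zero_of_notMem hB (c := -(n + p : ℂ)) ?_ (by rw [neg_smul, ← this, neg_neg])
      rintro ⟨k, hk⟩
      have : ((k + n + p : ℕ) : ℂ) = 0 := by push_cast; rw [← hk]; ring
      have := Nat.cast_eq_zero.1 this
      omega
  -- The two counting operators commute, so the kernel of `numB` is decomposed into eigenvectors of
  -- `numC`.
  have base : ∀ u, D.numB u = 0 → T u = 0 := by
    have := le_of_inf_eigenspace_le (iSup_eigenspace_eq_top' hC) (U := LinearMap.ker D.numB)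
      (M := LinearMap.ker T) (fun u hu => by
        rw [LinearMap.mem_ker] at hu ⊢
        rw [← Module.End.mul_apply, ← hBC, Module.End.mul_apply, hu, map_zero]) fun c u hu hc => by
      rw [Module.End.mem_eigenspace_iff] at hc
      by_cases h : c ∈ {c : ℂ | ∃ n : ℕ, c = n}
      · obtain ⟨n, rfl⟩ := h
        exact step n u hu hc
      · rw [eq_zero_of_notMem hC h hc]; exact Submodule.zero_mem _
    exact fun u hu => this hu
  -- `numB` is a sum of products of a creation mode of b and an annihilation mode of c. The latter
  -- reduces the number of antighosts, and the former can be moved past T; thus T kills `numB` u =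
  -- (n + 1) u.
  have all : ∀ n : ℕ, ∀ u, D.numB u = (n : ℂ) • u → T u = 0 := by
    intro n
    induction n with
    | zero => exact fun u hu => base u (by rw [hu]; simp)
    | succ n ih =>
      intro u hu
      have h : D.numB u ∈ LinearMap.ker T := by
        refine D.numOp_apply_mem (fun s m hm => ?_) fun s m hm => ?_
        · rw [if_neg (by omega), zero_smul]; exact Submodule.zero_mem _
        · rcases s with _ | _ | _ | _ | v <;> simp only [ghostDegree, zero_ne_one, false_and,
            if_false, zero_smul, Submodule.zero_mem]
          refine Submodule.smul_mem _ _ ?_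
          have e1 := (wB.snd (ghost v)).eigen m hu
          rw [if_pos ⟨rfl, hm⟩] at e1
          have := hbv v (-m) (mode (D.snd (ghost v)) m u)
          rw [ih _ (e1.trans (by push_cast; congr 1; ring)), map_zero] at this
          rw [LinearMap.mem_ker]
          exact (smul_eq_zero.1 this.symm).resolve_left (he v)
      rw [hu, LinearMap.mem_ker, map_smul] at h
      exact (smul_eq_zero.1 h).resolve_left (by exact_mod_cast n.succ_ne_zero)
  have htop : (⊤ : Submodule ℂ Fock) ≤ LinearMap.ker T := by
    rw [← hB]
    refine iSup₂_le fun c hc u hu => ?_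
    obtain ⟨n, rfl⟩ := hc
    exact all n u (Module.End.mem_eigenspace_iff.1 hu)
  exact LinearMap.ker_eq_top.1 (top_le_iff.1 htop)

/-- The graded commutator raises the ghost number by one and commutes up to signs with the
antighosts by `b_comm_current`; no term of it is ever computed. -/
lemma Q_current (ha : D.a ^ 2 = 2 * D.k + 3) (ha' : D.a' ^ 2 = 2 * (-3 - D.k) + 3)
    (h0 : D.a ≠ 0) (h0' : D.a' ≠ 0) (x : Gen) (n : ℤ) :
    D.Q * mode (totalCurrent (fun x => D.J x + D.JT x) D.b D.c x) n
      = (sgnO x : ℂ) • (mode (totalCurrent (fun x => D.J x + D.JT x) D.b D.c x) n * D.Q) := by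
  have hQ : D.Q = mode (brstField (fun x => D.J x + D.JT x) D.b D.c) 0 := by
    rw [Q, brstCurrent_eq]
  rw [← sub_eq_zero]
  refine eq_zero_of_comm_b h0 h0' (e := fun v => (sgnG v v * sgnM x v : ℂ)) (p := 1)
    (fun v m => ?_) (fun v => ?_) one_ne_zero fun c v hv => ?_
  · rw [hQ]
    exact (D.brstSystem ha ha').b_comm_current x n v m
  · exact mul_ne_zero (by cases v <;> simp [sgnG, isOdd])
      (by cases x <;> cases v <;> simp [sgnM, isOdd])
  · have G := D.ghostNumber_grading
    have h1 := fun u (hu : u ∈ Module.End.eigenspace D.ghostNumber c) => G.total x n c u hu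
    have h2 := fun c u (hu : u ∈ Module.End.eigenspace D.ghostNumber c) => G.brst.apply_zero hu
    have h3 := fun c u (hu : u ∈ Module.End.eigenspace D.ghostNumber c) => G.total x n c u hu
    simp only [smul_zero, add_zero] at h1 h3
    rw [Nat.cast_one, LinearMap.sub_apply, LinearMap.smul_apply, Module.End.mul_apply,
      Module.End.mul_apply]
    exact Submodule.sub_mem _ (h2 _ _ (h1 _ hv)) (Submodule.smul_mem _ _ (h3 _ _ (h2 _ _ hv)))

/-- Q² raises the ghost number by two, and it commutes with the antighosts because Q commutes up to
signs with the total currents. -/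
lemma Q_sq (ha : D.a ^ 2 = 2 * D.k + 3) (ha' : D.a' ^ 2 = 2 * (-3 - D.k) + 3)
    (h0 : D.a ≠ 0) (h0' : D.a' ≠ 0) : D.Q * D.Q = 0 := by
  have hQ : D.Q = mode (brstField (fun x => D.J x + D.JT x) D.b D.c) 0 := by
    rw [Q, brstCurrent_eq]
  refine eq_zero_of_comm_b h0 h0' (e := fun _ => 1) (fun v m => ?_) (fun v => one_ne_zero)
    (p := 2) two_ne_zero fun c v hv => ?_
  · rw [one_smul, hQ]
    exact (D.brstSystem ha ha').b_comm_sq (fun x n => by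
      rw [← hQ]; exact Q_current ha ha' h0 h0' x n) v m
  · have h := fun c u (hu : u ∈ Module.End.eigenspace D.ghostNumber c) =>
      D.ghostNumber_grading.brst.apply_zero hu
    have := h _ _ (h _ _ hv)
    rwa [show c + ((2 : ℕ) : ℂ) = c + 1 + 1 by push_cast; ring]

lemma totalIsospin_eq_current :
    D.totalIsospin = mode (totalCurrent (fun x => D.J x + D.JT x) D.b D.c three) 0 := by
  rw [totalIsospin, totalCurrent, ← Jgh_eq]

lemma Q_totalIsospin (ha : D.a ^ 2 = 2 * D.k + 3) (ha' : D.a' ^ 2 = 2 * (-3 - D.k) + 3)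
    (h0 : D.a ≠ 0) (h0' : D.a' ≠ 0) : D.Q * D.totalIsospin = D.totalIsospin * D.Q := by
  rw [totalIsospin_eq_current, Q_current ha ha' h0 h0']
  simp [sgnO, isOdd]

/-- This is why the relative conditions belong together: Q preserves the kernel of b_{3,0} on
vectors of total isospin zero. -/
lemma b_three_Q (ha : D.a ^ 2 = 2 * D.k + 3) (ha' : D.a' ^ 2 = 2 * (-3 - D.k) + 3) :
    mode (D.b three) 0 * D.Q = -(D.Q * mode (D.b three) 0) + D.totalIsospin := by
  have := (D.brstSystem ha ha').b_brst three 0 0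
  rw [← brstCurrent_eq] at this
  rw [Q, this, totalIsospin_eq_current, sum_gen]
  simp [sgnG, isOdd, hInv]

end Datum

end AffineOsp

end

noncomputable section

namespace AffineOsp

open Gen Pair

/-! ### The quadratic differential and its homotopy -/

/-- Labels of the quartets that are formed by a pair of matter fields and a pair of ghosts. -/
inductive Quartet
  | minus | mhalf | plus | half
  deriving DecidableEq

namespace Quartet

instance : Fintype Quartet := ⟨{minus, mhalf, plus, half}, fun t => by cases t <;> decide⟩

/-- The matter fields of a quartet. -/
def mat : Quartet → Pair
  | minus => matterB
  | mhalf => matterF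
  | plus => liouvilleB
  | half => liouvilleF

/-- The label of the ghosts of a quartet. -/
def gen : Quartet → Gen
  | minus => .minus
  | mhalf => .mhalf
  | plus => .plus
  | half => .half

/-- The ghosts of a quartet. -/
def gho (t : Quartet) : Pair := ghost t.gen

/-- The coefficient of a quartet in the quadratic differential. -/
def coef : Quartet → ℂ
  | minus => -(1 / 2)
  | mhalf => -(1 / 4)
  | plus => 1 / 2
  | half => 1 / 4

lemma coef_ne_zero (t : Quartet) : t.coef ≠ 0 := by cases t <;> simp [coef]

lemma mat_inj {t t' : Quartet} : t.mat = t'.mat ↔ t = t' := by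
  cases t <;> cases t' <;> simp [mat]

lemma gho_inj {t t' : Quartet} : t.gho = t'.gho ↔ t = t' := by
  cases t <;> cases t' <;> simp [gho, gen]

lemma mat_ne_gho (t t' : Quartet) : t.mat ≠ t'.gho := by
  cases t <;> simp [mat, gho]

lemma gho_ne_mat (t t' : Quartet) : t.gho ≠ t'.mat := (mat_ne_gho t' t).symm

lemma mat_ne_three (t : Quartet) : t.mat ≠ ghost three := by cases t <;> simp [mat]

lemma gho_ne_three (t : Quartet) : t.gho ≠ ghost three := by cases t <;> simp [gho, gen]

end Quartet

lemma pair_cases {P : Pair → Prop} (h₁ : ∀ t : Quartet, P t.mat) (h₂ : ∀ t : Quartet, P t.gho)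
    (h₃ : P (ghost three)) (s : Pair) : P s := by
  rcases s with _ | _ | _ | _ | x
  · exact h₁ .minus
  · exact h₁ .mhalf
  · exact h₁ .plus
  · exact h₁ .half
  · cases x
    · exact h₂ .plus
    · exact h₂ .half
    · exact h₃
    · exact h₂ .mhalf
    · exact h₂ .minus

/-- The parity of a pair of fields. -/
def par (s : Pair) : ℂ := if isFer s then -1 else 1

lemma par_sq (s : Pair) : par s * par s = 1 := by unfold par; split_ifs <;> norm_num

lemma sgnP_self (s : Pair) : sgnP s s = par s := by simp [sgnP, par]

lemma par_gho (t : Quartet) : par t.gho = -par t.mat := by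
  cases t <;> simp [par, Quartet.gho, Quartet.gen, Quartet.mat, isFer, isOdd]

lemma par_three : par (ghost three) = -1 := by simp [par, isFer, isOdd]

lemma sgnP_three (s : Pair) : sgnP s (ghost three) = par s := by
  simp [par, sgnP, show isFer (ghost three) = true from rfl]

/-- The two pairs of a quartet have opposite parities, so every term of the differential and of the
homotopy is odd and the sign depends on s alone. -/
lemma sgnP_gho_mul (s : Pair) (t : Quartet) : sgnP s t.gho * sgnP s t.mat = par s := by
  have h : isFer t.gho = !isFer t.mat := by cases t <;> rfl
  unfold sgnP par
  rw [h]
  cases isFer s <;> cases isFer t.mat <;> simp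

lemma sgnP_mat_gho (t : Quartet) : sgnP t.mat t.gho = 1 := by
  cases t <;> simp [sgnP, Quartet.gho, Quartet.gen, Quartet.mat, isFer, isOdd]

lemma sgnP_gho_mat (t : Quartet) : sgnP t.gho t.mat = 1 := by rw [sgnP_comm, sgnP_mat_gho]

namespace Datum

variable (D : Datum)

/-- The levels of the cyclic vector that the homotopy annihilates. -/
def lev' : Pair → ℤ
  | liouvilleB => 1
  | liouvilleF => D.gh.level half
  | ghost plus => 1
  | ghost half => D.gh.level half
  | _ => 0

/-- The matter and the ghost pair of a quartet must be polarized alike. The level of the bosonic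
member is the one of the given vacuum; the fermionic member has to follow, if necessary by filling a
zero mode. -/
lemma lev'_gho (t : Quartet) : D.lev' t.gho = D.lev' t.mat := by cases t <;> rfl

lemma lev'_nonneg (s : Pair) : 0 ≤ D.lev' s := by
  rcases D with ⟨_, _, _, _, _, g⟩
  rcases s with _ | _ | _ | _ | x
  all_goals try simp [lev']
  all_goals try cases x
  all_goals cases g <;> simp [GhostVac.level]

/-- The sign that distinguishes creation from annihilation modes. -/
def creSign (s : Pair) (n : ℤ) : ℂ := if n ≤ -D.lev' s then 1 else -1

lemma creSign_gho (t : Quartet) : D.creSign t.gho = D.creSign t.mat := by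
  funext n; rw [creSign, creSign, lev'_gho]

/-- The quadratic differential. -/
def Q₀' : Module.End ℂ Fock :=
  ∑ t : Quartet, t.coef • mode (nopE 0 1 (D.snd t.gho) (D.fst t.mat)) 0
    + (1 / 2 : ℂ) • mode (nopE 0 1 (D.snd (ghost three)) (D.lc true)) 0

/-- The homotopy. -/
def K : Module.End ℂ Fock :=
  ∑ t : Quartet, t.coef⁻¹ • mode (nopE (D.lev' t.mat) 1 (mulF (D.creSign t.mat) (D.snd t.mat))
      (D.fst t.gho)) 0
    -- The factor 1/|n| removes the size of the commutator of the null bosons and leaves the sign of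
    -- n. At n = 0 it is 1/0 = 0; the zero mode of `lc` vanishes anyway.
    + (D.a ^ 2)⁻¹ • mode (nopE 0 1 (mulF (fun n => 1 / ((|n| : ℤ) : ℂ)) (D.lc false))
      (D.fst (ghost three))) 0

lemma Q₀_eq : D.Q₀ = D.Q₀' := by
  have h : (Finset.univ : Finset Quartet) = {.minus, .mhalf, .plus, .half} := rfl
  have h3 : D.a • boson .matter 0 - D.a' • boson .liouville 0 = D.lc true := by
    simp only [lc, if_true]; module
  rw [Q₀, Q₀', h3, h, Finset.sum_insert (by simp), Finset.sum_insert (by simp),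
    Finset.sum_insert (by simp), Finset.sum_singleton]
  simp only [nop_eq, mode_add, mode_sub, mode_smul, mode_neg]
  change -(1 / 2 : ℂ) • mode (nopE 0 1 (D.snd Quartet.minus.gho) (D.fst Quartet.minus.mat)) 0
    + (1 / 2 : ℂ) • mode (nopE 0 1 (D.snd Quartet.plus.gho) (D.fst Quartet.plus.mat)) 0
    + (1 / 4 : ℂ) • mode (nopE 0 1 (D.snd Quartet.half.gho) (D.fst Quartet.half.mat)) 0
    - (1 / 4 : ℂ) • mode (nopE 0 1 (D.snd Quartet.mhalf.gho) (D.fst Quartet.mhalf.mat)) 0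
    + (1 / 2 : ℂ) • mode (nopE 0 1 (D.snd (ghost three)) (D.lc true)) 0 = _
  simp only [Quartet.coef]
  module

lemma SB_snd_snd' (r s : Pair) : SB (sgnP r s) (D.snd r) (D.snd s) fun _ => 0 :=
  SB.of_zero (D.snd_snd r s)

lemma SB_fst_snd' (r s : Pair) :
    SB (sgnP r s) (D.fst r) (D.snd s) fun _ => if r = s then 1 else 0 := by
  have := D.SB_fst_snd (fun _ => 1) r s
  rwa [mulF_one] at this

/-! The action of the quartet terms on the free fields. -/

lemma Q₀_quartet_fst (r : Pair) (t : Quartet) :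
    OB (par r) (mode (nopE 0 1 (D.snd t.gho) (D.fst t.mat)) 0) (D.fst r)
      (if r = t.gho then D.fst t.mat else 0) := by
  refine OB.nop (D.SB_fst_snd' r t.gho) (D.SB_fst_fst r t.mat) (sgnP_gho_mul r t) ?_
    (Or.inl fun _ => rfl) (sgnP_sq _ _) ?_
  · by_cases h : r = t.gho
    · subst h; exact Or.inr (by rw [sgnP_gho_mat, one_mul])
    · exact Or.inl fun _ => if_neg h
  · by_cases h : r = t.gho <;> simp [h, mulF_zero, mulF_one]

lemma Q₀_quartet_snd (r : Pair) (t : Quartet) :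
    OB (par r) (mode (nopE 0 1 (D.snd t.gho) (D.fst t.mat)) 0) (D.snd r)
      (if r = t.mat then -par r • D.snd t.gho else 0) := by
  refine OB.nop (D.SB_snd_snd' r t.gho) (D.SB_snd_fst r t.mat) (sgnP_gho_mul r t)
    (Or.inl fun _ => rfl) ?_ (sgnP_sq _ _) ?_
  · by_cases h : r = t.mat
    · subst h; exact Or.inr (by rw [sgnP_mat_gho, one_mul])
    · exact Or.inl fun _ => if_neg h
  · by_cases h : r = t.mat
    · subst h; simp [mulF_zero, mulF_const, sgnP_self, sgnP_mat_gho]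
    · simp [h, mulF_zero]

lemma K_quartet_fst (r : Pair) (t : Quartet) (l : ℤ) (σ : ℤ → ℂ) :
    OB (par r) (mode (nopE l 1 (mulF σ (D.snd t.mat)) (D.fst t.gho)) 0) (D.fst r)
      (if r = t.mat then mulF (fun n => σ (-n)) (D.fst t.gho) else 0) := by
  refine OB.nop (D.SB_fst_snd σ r t.mat) (D.SB_fst_fst r t.gho)
    (by rw [mul_comm, sgnP_gho_mul]) ?_ (Or.inl fun _ => rfl) (sgnP_sq _ _) ?_
  · by_cases h : r = t.mat
    · subst h; exact Or.inr (by rw [sgnP_mat_gho, one_mul])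
    · exact Or.inl fun _ => if_neg h
  · by_cases h : r = t.mat <;> simp [h, mulF_zero]

lemma K_quartet_snd (r : Pair) (t : Quartet) (l : ℤ) (σ : ℤ → ℂ) :
    OB (par r) (mode (nopE l 1 (mulF σ (D.snd t.mat)) (D.fst t.gho)) 0) (D.snd r)
      (if r = t.gho then -par r • mulF σ (D.snd t.mat) else 0) := by
  refine OB.nop (D.SB_snd_snd σ r t.mat) (D.SB_snd_fst r t.gho)
    (by rw [mul_comm, sgnP_gho_mul]) (Or.inl fun _ => rfl) ?_ (sgnP_sq _ _) ?_
  · by_cases h : r = t.gho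
    · subst h; exact Or.inr (by rw [sgnP_gho_mat, one_mul])
    · exact Or.inl fun _ => if_neg h
  · by_cases h : r = t.gho
    · subst h; simp [mulF_zero, mulF_const, sgnP_self, sgnP_gho_mat]
    · simp [h, mulF_zero]

lemma SB_mulF_lc {e : ℂ} {A : fields Fock} {ε : Bool} {α : ℤ → ℂ} (μ : ℤ → ℂ)
    (h : SB e A (D.lc ε) α) (hα : ∀ m, α m = 0) : SB e A (mulF μ (D.lc ε)) fun _ => 0 :=
  (h.mulF_right μ).congr fun m => by rw [hα, mul_zero]

lemma Q₀_three_fst (r : Pair) :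
    OB (par r) (mode (nopE 0 1 (D.snd (ghost three)) (D.lc true)) 0) (D.fst r)
      (if r = ghost three then D.lc true else 0) := by
  refine OB.nop (D.SB_fst_snd' r (ghost three)) (D.SB_fst_lc r true)
    (by rw [sgnP_three, mul_one]) (Or.inr (one_mul 1)) (Or.inl fun _ => rfl) (sgnP_sq _ _) ?_
  by_cases h : r = ghost three <;> simp [h, mulF_zero, mulF_one]

lemma Q₀_three_snd (r : Pair) :
    OB (par r) (mode (nopE 0 1 (D.snd (ghost three)) (D.lc true)) 0) (D.snd r) 0 :=
  OB.nop (D.SB_snd_snd' r (ghost three)) (D.SB_snd_lc r true)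
    (by rw [sgnP_three, mul_one]) (Or.inl fun _ => rfl) (Or.inl fun _ => rfl) (sgnP_sq _ _)
    (by simp [mulF_zero])

lemma K_three_fst (r : Pair) (ξ : ℤ → ℂ) :
    OB (par r) (mode (nopE 0 1 (mulF ξ (D.lc false)) (D.fst (ghost three))) 0) (D.fst r) 0 :=
  OB.nop (D.SB_mulF_lc ξ (D.SB_fst_lc r false) fun _ => rfl) (D.SB_fst_fst r (ghost three))
    (by rw [sgnP_three, one_mul]) (Or.inl fun _ => rfl) (Or.inl fun _ => rfl) (one_mul 1)
    (by simp [mulF_zero])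

lemma K_three_snd (r : Pair) (ξ : ℤ → ℂ) :
    OB (par r) (mode (nopE 0 1 (mulF ξ (D.lc false)) (D.fst (ghost three))) 0) (D.snd r)
      (if r = ghost three then mulF ξ (D.lc false) else 0) := by
  refine OB.nop (D.SB_mulF_lc ξ (D.SB_snd_lc r false) fun _ => rfl) (D.SB_snd_fst r (ghost three))
    (by rw [sgnP_three, one_mul]) (Or.inl fun _ => rfl) (Or.inr (one_mul 1)) (one_mul 1) ?_
  by_cases h : r = ghost three <;> simp [h, mulF_zero, mulF_one, sgnP_self, par_three]

variable {D} in
lemma SB_lc_mulF_lc (haa : D.a ^ 2 + D.a' ^ 2 = 0) (ε ε' : Bool) (ξ : ℤ → ℂ) :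
    SB 1 (D.lc ε) (mulF ξ (D.lc ε')) fun m => if ε = ε' then 0 else ξ (-m) * (m * (2 * D.a ^ 2)) :=
  ((SB_lc haa ε ε').mulF_right ξ).congr fun m => by split_ifs <;> simp

lemma Q₀_quartet_lc (ε : Bool) (t : Quartet) :
    OB 1 (mode (nopE 0 1 (D.snd t.gho) (D.fst t.mat)) 0) (D.lc ε) 0 :=
  OB.nop (D.SB_lc_snd ε _) (D.SB_lc_fst ε _) (one_mul 1) (Or.inl fun _ => rfl)
    (Or.inl fun _ => rfl) (one_mul 1) (by simp [mulF_zero])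

lemma K_quartet_lc (ε : Bool) (t : Quartet) (l : ℤ) (σ : ℤ → ℂ) :
    OB 1 (mode (nopE l 1 (mulF σ (D.snd t.mat)) (D.fst t.gho)) 0) (D.lc ε) 0 :=
  OB.nop (((D.SB_lc_snd ε _).mulF_right σ).congr (α' := fun _ => 0) fun _ => by simp)
    (D.SB_lc_fst ε _) (one_mul 1) (Or.inl fun _ => rfl)
    (Or.inl fun _ => rfl) (one_mul 1) (by simp [mulF_zero])

variable {D} in
lemma Q₀_three_lc (haa : D.a ^ 2 + D.a' ^ 2 = 0) (ε : Bool) :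
    OB 1 (mode (nopE 0 1 (D.snd (ghost three)) (D.lc true)) 0) (D.lc ε)
      (if ε = true then 0 else mulF (fun m => m * (2 * D.a ^ 2)) (D.snd (ghost three))) := by
  refine OB.nop (D.SB_lc_snd ε _) (SB_lc haa ε true) (one_mul 1) (Or.inl fun _ => rfl)
    (Or.inr (one_mul 1)) (one_mul 1) ?_
  cases ε <;> simp [mulF_zero]

variable {D} in
lemma K_three_lc (haa : D.a ^ 2 + D.a' ^ 2 = 0) (ε : Bool) (ξ : ℤ → ℂ) :
    OB 1 (mode (nopE 0 1 (mulF ξ (D.lc false)) (D.fst (ghost three))) 0) (D.lc ε)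
      (if ε = true then mulF (fun m => ξ (-m) * (m * (2 * D.a ^ 2))) (D.fst (ghost three)) else 0) := by
  refine OB.nop (SB_lc_mulF_lc haa ε false ξ) (D.SB_lc_fst ε _) (one_mul 1) (Or.inr (one_mul 1))
    (Or.inl fun _ => rfl) (one_mul 1) ?_
  cases ε <;> simp [mulF_zero]

/-! The action of the differential and the homotopy on the free fields. -/

lemma Q₀_fst_mat (t : Quartet) : OB (par t.mat) D.Q₀' (D.fst t.mat) 0 :=
  ((OB.sum _ fun t' _ => (D.Q₀_quartet_fst _ t').smul _).add ((D.Q₀_three_fst _).smul _)).congr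
    (by simp [Quartet.mat_ne_gho, Quartet.mat_ne_three])

lemma Q₀_fst_gho (t : Quartet) : OB (par t.gho) D.Q₀' (D.fst t.gho) (t.coef • D.fst t.mat) :=
  ((OB.sum _ fun t' _ => (D.Q₀_quartet_fst _ t').smul _).add ((D.Q₀_three_fst _).smul _)).congr
    (by simp [Quartet.gho_inj, Quartet.gho_ne_three])

lemma Q₀_fst_three : OB (-1) D.Q₀' (D.fst (ghost three)) ((1 / 2 : ℂ) • D.lc true) := by
  rw [← par_three]
  exact ((OB.sum _ fun t' _ => (D.Q₀_quartet_fst _ t').smul _).add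
    ((D.Q₀_three_fst _).smul _)).congr (by simp [(Quartet.gho_ne_three _).symm])

lemma Q₀_snd_mat (t : Quartet) :
    OB (par t.mat) D.Q₀' (D.snd t.mat) ((-par t.mat * t.coef) • D.snd t.gho) :=
  ((OB.sum _ fun t' _ => (D.Q₀_quartet_snd _ t').smul _).add ((D.Q₀_three_snd _).smul _)).congr
    (by simp [Quartet.mat_inj, smul_smul, mul_comm])

lemma Q₀_snd_gho (t : Quartet) : OB (par t.gho) D.Q₀' (D.snd t.gho) 0 :=
  ((OB.sum _ fun t' _ => (D.Q₀_quartet_snd _ t').smul _).add ((D.Q₀_three_snd _).smul _)).congr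
    (by simp [Quartet.gho_ne_mat])

lemma Q₀_snd_three : OB (-1) D.Q₀' (D.snd (ghost three)) 0 := by
  rw [← par_three]
  exact ((OB.sum _ fun t' _ => (D.Q₀_quartet_snd _ t').smul _).add
    ((D.Q₀_three_snd _).smul _)).congr (by simp [(Quartet.mat_ne_three _).symm])

lemma K_fst_mat (t : Quartet) : OB (par t.mat) D.K (D.fst t.mat)
    (t.coef⁻¹ • mulF (fun n => D.creSign t.mat (-n)) (D.fst t.gho)) :=
  ((OB.sum _ fun t' _ => (D.K_quartet_fst _ t' _ _).smul _).add ((D.K_three_fst _ _).smul _)).congr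
    (by simp [Quartet.mat_inj])

lemma K_fst_gho (t : Quartet) : OB (par t.gho) D.K (D.fst t.gho) 0 :=
  ((OB.sum _ fun t' _ => (D.K_quartet_fst _ t' _ _).smul _).add ((D.K_three_fst _ _).smul _)).congr
    (by simp [Quartet.gho_ne_mat])

lemma K_fst_three : OB (-1) D.K (D.fst (ghost three)) 0 := by
  rw [← par_three]
  exact ((OB.sum _ fun t' _ => (D.K_quartet_fst _ t' _ _).smul _).add
    ((D.K_three_fst _ _).smul _)).congr (by simp [(Quartet.mat_ne_three _).symm])

lemma K_snd_mat (t : Quartet) : OB (par t.mat) D.K (D.snd t.mat) 0 :=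
  ((OB.sum _ fun t' _ => (D.K_quartet_snd _ t' _ _).smul _).add ((D.K_three_snd _ _).smul _)).congr
    (by simp [Quartet.mat_ne_gho, Quartet.mat_ne_three])

lemma K_snd_gho (t : Quartet) : OB (par t.gho) D.K (D.snd t.gho)
    ((-par t.gho * t.coef⁻¹) • mulF (D.creSign t.mat) (D.snd t.mat)) :=
  ((OB.sum _ fun t' _ => (D.K_quartet_snd _ t' _ _).smul _).add ((D.K_three_snd _ _).smul _)).congr
    (by simp [Quartet.gho_inj, Quartet.gho_ne_three, smul_smul, mul_comm])

lemma K_snd_three : OB (-1) D.K (D.snd (ghost three))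
    ((D.a ^ 2)⁻¹ • mulF (fun n => 1 / ((|n| : ℤ) : ℂ)) (D.lc false)) := by
  rw [← par_three]
  exact ((OB.sum _ fun t' _ => (D.K_quartet_snd _ t' _ _).smul _).add
    ((D.K_three_snd _ _).smul _)).congr (by simp [(Quartet.gho_ne_three _).symm])

variable {D}

lemma Q₀_lc (haa : D.a ^ 2 + D.a' ^ 2 = 0) (ε : Bool) : OB 1 D.Q₀' (D.lc ε)
    (if ε = true then 0 else mulF (fun m => m * D.a ^ 2) (D.snd (ghost three))) :=
  ((OB.sum _ fun t' _ => (D.Q₀_quartet_lc _ t').smul _).add ((Q₀_three_lc haa _).smul _)).congr (by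
    cases ε
    · refine fields_ext fun n => ?_
      simp [smul_smul]; module
    · simp)

lemma K_lc (haa : D.a ^ 2 + D.a' ^ 2 = 0) (h0 : D.a ≠ 0) (ε : Bool) : OB 1 D.K (D.lc ε)
    (if ε = true then (2 : ℂ) • mulF (fun m => (m.sign : ℂ)) (D.fst (ghost three)) else 0) :=
  ((OB.sum _ fun t' _ => (D.K_quartet_lc _ t' _ _).smul _).add ((K_three_lc haa _ _).smul _)).congr
    (by
      cases ε
      · simp
      · refine fields_ext fun n => ?_
        simp only [smul_zero, Finset.sum_const_zero, zero_add, if_true, mode_smul, mode_mulF,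
          smul_smul, abs_neg]
        congr 1
        rcases lt_trichotomy n 0 with hn | rfl | hn
        · have : (n : ℂ) ≠ 0 := by exact_mod_cast hn.ne
          rw [abs_of_neg hn, Int.sign_eq_neg_one_of_neg hn]; push_cast; field_simp
        · simp
        · have : (n : ℂ) ≠ 0 := by exact_mod_cast hn.ne'
          rw [abs_of_pos hn, Int.sign_eq_one_of_pos hn]; push_cast; field_simp)

end Datum

end AffineOsp

end

/-! ### The Laplacian of the quadratic differential and its kernel -/

noncomputable section

namespace AffineOsp

open Gen Pair

lemma OB.of_eq {V : Type*} [AddCommGroup V] [Module ℂ V] {e e' : ℂ} {T : Module.End ℂ V}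
    {A C : fields V} (H : OB e T A C) (h : e = e') : OB e' T A C := h ▸ H

namespace Datum

variable (D : Datum)

/-- The Laplacian of the quadratic differential. -/
def lap : Module.End ℂ Fock := D.Q₀' * D.K + D.K * D.Q₀'

/-- The weights of the Laplacian. -/
def lapWeight (s : Pair) (n : ℤ) : ℂ := if s = ghost three then -(n.sign : ℂ) else D.creSign s n

variable {D}

/-- The differential and the homotopy exchange the two pairs of a quartet with inverse coefficients,
and likewise the null bosons and the pair (b_3, c³). Their anticommutator is therefore diagonal on
the free fields, with weight 1 on creation modes, -1 on annihilation modes and 0 on the zero modes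
of (b_3, c³). -/
lemma lapWeights (haa : D.a ^ 2 + D.a' ^ 2 = 0) (h0 : D.a ≠ 0) :
    D.LCWeights D.lap D.lapWeight fun _ n => (n.sign : ℂ) where
  fst := by
    refine pair_cases (fun t => ?_) (fun t => ?_) ?_
    · refine (OB.anticomm (par_sq _) (D.Q₀_fst_mat t) (D.K_fst_mat t) (OB.zero_right _ _)
        ((((D.Q₀_fst_gho t).of_eq (par_gho t)).mulF_right _).smul_right _)).congr
        (fields_ext fun n => ?_)
      simp [lapWeight, Quartet.mat_ne_three, smul_smul]
      congr 1
      field_simp [t.coef_ne_zero]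
    · refine (OB.anticomm (par_sq _) (D.Q₀_fst_gho t) (D.K_fst_gho t)
        (((D.K_fst_mat t).of_eq (by rw [par_gho, neg_neg])).smul_right _)
        (OB.zero_right _ _)).congr (fields_ext fun n => ?_)
      simp [lapWeight, Quartet.gho_ne_three, smul_smul, creSign_gho, t.coef_ne_zero]
    · refine (OB.anticomm (by norm_num) D.Q₀_fst_three D.K_fst_three
        (((K_lc haa h0 true).of_eq (by norm_num)).smul_right _)
        (OB.zero_right _ _)).congr (fields_ext fun n => ?_)
      simp [lapWeight, smul_smul]
  snd := by
    refine pair_cases (fun t => ?_) (fun t => ?_) ?_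
    · refine (OB.anticomm (par_sq _) (D.Q₀_snd_mat t) (D.K_snd_mat t)
        (((D.K_snd_gho t).of_eq (par_gho t)).smul_right _) (OB.zero_right _ _)).congr
        (fields_ext fun n => ?_)
      simp [lapWeight, Quartet.mat_ne_three, smul_smul, par_gho]
      congr 1
      have := par_sq t.mat
      field_simp [t.coef_ne_zero]
      linear_combination (D.creSign t.mat n) * this
    · refine (OB.anticomm (par_sq _) (D.Q₀_snd_gho t) (D.K_snd_gho t) (OB.zero_right _ _)
        ((((D.Q₀_snd_mat t).of_eq (by rw [par_gho, neg_neg])).mulF_right _).smul_right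
        _)).congr (fields_ext fun n => ?_)
      simp [lapWeight, Quartet.gho_ne_three, smul_smul, par_gho, creSign_gho]
      congr 1
      have := par_sq t.mat
      field_simp [t.coef_ne_zero]
      linear_combination (D.creSign t.mat n) * this
    · refine (OB.anticomm (by norm_num) D.Q₀_snd_three D.K_snd_three (OB.zero_right _ _)
        ((((Q₀_lc haa false).of_eq (by norm_num)).mulF_right _).smul_right _)).congr
        (fields_ext fun n => ?_)
      simp [lapWeight, smul_smul]
      congr 1
      rcases lt_trichotomy n 0 with hn | rfl | hn
      · have : (n : ℂ) ≠ 0 := by exact_mod_cast hn.ne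
        rw [abs_of_neg hn, Int.sign_eq_neg_one_of_neg hn]; push_cast; field_simp
      · simp
      · have : (n : ℂ) ≠ 0 := by exact_mod_cast hn.ne'
        rw [abs_of_pos hn, Int.sign_eq_one_of_pos hn]; push_cast; field_simp
  lc ε := by
    cases ε
    · refine (OB.anticomm (by norm_num) (Q₀_lc haa false) (K_lc haa h0 false)
        (D.K_snd_three.mulF_right _) (OB.zero_right _ _)).congr
        (fields_ext fun n => ?_)
      simp [smul_smul]
      congr 1
      rcases lt_trichotomy n 0 with hn | rfl | hn
      · have : (n : ℂ) ≠ 0 := by exact_mod_cast hn.ne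
        rw [abs_of_neg hn, Int.sign_eq_neg_one_of_neg hn]; push_cast; field_simp
      · simp
      · have : (n : ℂ) ≠ 0 := by exact_mod_cast hn.ne'
        rw [abs_of_pos hn, Int.sign_eq_one_of_pos hn]; push_cast; field_simp
    · refine (OB.anticomm (by norm_num) (Q₀_lc haa true) (K_lc haa h0 true)
        (OB.zero_right _ _) ((D.Q₀_fst_three.mulF_right _).smul_right _)).congr
        (fields_ext fun n => ?_)
      simp [smul_smul]
      congr 1
      ring

/-- Only commutators with the free fields are considered here. An operator commuting with all of
them is determined by its value on a cyclic vector, where the square vanishes because the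
differential does. -/
lemma Q₀_sq_weights (haa : D.a ^ 2 + D.a' ^ 2 = 0) :
    D.LCWeights (D.Q₀' * D.Q₀') (fun _ _ => 0) fun _ _ => 0 where
  fst := by
    refine pair_cases (fun t => ?_) (fun t => ?_) ?_
    · exact (OB.sq (par_sq _) (D.Q₀_fst_mat t) (OB.zero_right _ _)).congr (mulF_zero _).symm
    · exact (OB.sq (par_sq _) (D.Q₀_fst_gho t) ((((D.Q₀_fst_mat t).of_eq
        (by rw [par_gho, neg_neg])).smul_right _).congr (smul_zero _))).congr (mulF_zero _).symm
    · exact (OB.sq (by norm_num) D.Q₀_fst_three ((((Q₀_lc haa true).of_eq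
        (by norm_num)).smul_right _).congr (by simp))).congr (mulF_zero _).symm
  snd := by
    refine pair_cases (fun t => ?_) (fun t => ?_) ?_
    · exact (OB.sq (par_sq _) (D.Q₀_snd_mat t) ((((D.Q₀_snd_gho t).of_eq
        (par_gho t)).smul_right _).congr (smul_zero _))).congr (by simp [mulF_zero])
    · exact (OB.sq (par_sq _) (D.Q₀_snd_gho t) (OB.zero_right _ _)).congr (by simp [mulF_zero])
    · exact (OB.sq (by norm_num) D.Q₀_snd_three (OB.zero_right _ _)).congr (by simp [mulF_zero])
  lc ε := by
    cases ε
    · exact (OB.sq (by norm_num) (Q₀_lc haa false) ((D.Q₀_snd_three.mulF_right _).congr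
        (fields_ext fun n => by simp))).congr (mulF_zero _).symm
    · exact (OB.sq (by norm_num) (Q₀_lc haa true) (OB.zero_right _ _)).congr (mulF_zero _).symm

variable (D)

/-- A vacuum vector of given levels: `fst s n` for `n ≥ l s` and `snd s n` for `n > -l s` annihilate
it, and the other modes of the free fields generate the Fock space from it. -/
structure IsVacuum (l : Pair → ℤ) (h : Fock) : Prop where
  fst : ∀ s n, l s ≤ n → mode (D.fst s) n h = 0
  snd : ∀ s n, -l s < n → mode (D.snd s) n h = 0
  lc : ∀ ε n, 0 ≤ n → mode (D.lc ε) n h = 0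
  top : ∀ M : Submodule ℂ Fock, h ∈ M → (∀ i, ∀ v ∈ M, D.cre l i v ∈ M) → M = ⊤

/-- A vacuum vector for the polarization of the homotopy. -/
abbrev IsCyclic (h : Fock) : Prop := D.IsVacuum D.lev' h

variable {D}

namespace IsCyclic

variable {h : Fock}

lemma ne_zero (H : D.IsCyclic h) : h ≠ 0 := by
  rintro rfl
  have := H.top ⊥ (Submodule.zero_mem _) fun i v hv => by
    rw [(Submodule.mem_bot ℂ).1 hv, map_zero]; exact Submodule.zero_mem _
  exact vac_ne_zero ((Submodule.mem_bot ℂ).1 (this ▸ Submodule.mem_top))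

lemma eq_zero (H : D.IsCyclic h) {T : Module.End ℂ Fock}
    (hT : D.LCWeights T (fun _ _ => 0) fun _ _ => 0) (h0 : T h = 0) : T = 0 :=
  LinearMap.ker_eq_top.1 (H.top _ h0 fun i v hv => by
    rw [LinearMap.mem_ker] at hv ⊢
    rw [hT.cre, hv, map_zero, zero_add]
    have : creWeight (fun _ _ => 0) (fun _ _ => 0) i = 0 := by
      rcases i with _ | _ | _ <;> simp [creWeight]
    rw [this, zero_smul])

/-- Since both pairs of a quartet have the same level, each product c_m x_{-m} contains an
annihilation mode, and the two modes commute up to a sign because they belong to different pairs. -/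
lemma Q₀_apply (H : D.IsCyclic h) : D.Q₀' h = 0 := by
  rw [Q₀', LinearMap.add_apply, LinearMap.sum_apply, LinearMap.smul_apply,
    nopE_apply_eq_zero (A := D.snd (ghost three)) (fun m hm => ?_) fun m hm => ?_,
    smul_zero, add_zero]
  · refine Finset.sum_eq_zero fun t _ => ?_
    rw [LinearMap.smul_apply, nopE_apply_eq_zero (fun m hm => ?_) fun m hm => ?_, smul_zero]
    · by_cases hl : D.lev' t.mat ≤ 0 - m
      · rw [H.fst _ _ hl, map_zero]
      · have := LinearMap.congr_fun (D.SB_snd_fst t.gho t.mat m (0 - m)) h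
        simp only [Module.End.mul_apply, if_neg (Quartet.gho_ne_mat t t), ite_self, zero_smul,
          add_zero, LinearMap.smul_apply] at this
        rw [this, H.snd _ _ (by rw [lev'_gho]; omega), map_zero, smul_zero]
    · rw [H.snd _ _ (by have := D.lev'_nonneg t.gho; omega), map_zero]
  · rw [H.lc _ _ (by omega), map_zero]
  · rw [H.snd _ _ (by simp only [lev']; omega), map_zero]

/-- The products in `K` are ordered at the level `lev'`, so an annihilation mode of the cyclic
vector always stands on the right. -/
lemma K_apply (H : D.IsCyclic h) : D.K h = 0 := by
  rw [K, LinearMap.add_apply, LinearMap.sum_apply, LinearMap.smul_apply,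
    nopE_apply_eq_zero (B := D.fst (ghost three)) (fun m hm => ?_) fun m hm => ?_,
    smul_zero, add_zero]
  · refine Finset.sum_eq_zero fun t _ => ?_
    rw [LinearMap.smul_apply, nopE_apply_eq_zero (fun m hm => ?_) fun m hm => ?_, smul_zero]
    · rw [H.fst _ _ (by rw [lev'_gho]; omega), map_zero]
    · rw [mode_mulF, LinearMap.smul_apply, H.snd _ _ (by omega), smul_zero, map_zero]
  · rw [H.fst _ _ (by simp only [lev']; omega), map_zero]
  · rw [mode_mulF, LinearMap.smul_apply, H.lc _ _ (by omega), smul_zero, map_zero]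

lemma lap_apply (H : D.IsCyclic h) : D.lap h = 0 := by
  simp [lap, H.Q₀_apply, H.K_apply]

lemma Q₀_sq (H : D.IsCyclic h) (haa : D.a ^ 2 + D.a' ^ 2 = 0) : D.Q₀' * D.Q₀' = 0 :=
  H.eq_zero (Q₀_sq_weights haa) (by simp [H.Q₀_apply])

lemma lap_diagonalizable (H : D.IsCyclic h) (haa : D.a ^ 2 + D.a' ^ 2 = 0) (h0 : D.a ≠ 0) :
    ⨆ c, Module.End.eigenspace D.lap c = ⊤ :=
  iSup_eigenspace_eq_top' (iSup_eigenspace_eq_top (S := Set.univ) (c₀ := 0)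
    (H.lap_apply.trans (zero_smul _ _).symm)
    trivial (lapWeights haa h0).cre (fun _ _ _ => trivial) H.top)

/-- The relative vectors in the kernel of the Laplacian. -/
lemma mem_span_of_lap (H : D.IsCyclic h) (haa : D.a ^ 2 + D.a' ^ 2 = 0) (h0 : D.a ≠ 0) {v : Fock}
    (hv : D.lap v = 0) (hb : mode (D.b three) 0 v = 0) : v ∈ Submodule.span ℂ {h} := by
  have hl : D.lev (ghost three) = 0 := by rw [lev]; cases D.gh <;> rfl
  have hN := (lapWeights haa h0).add
    ((D.weights_number (ghost three) fun n => if n = 0 then 1 else 0).toLC rfl)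
  -- The Laplacian does not see c³_0. Adding the number operator of this mode gives weight 1 to
  -- every creation mode, and the added operator vanishes on v because b_{3,0} does.
  refine mem_span_of_eigenvalue (w := fun _ => 1) (v₀ := h) ?_ (fun i u => ?_)
    (fun _ => one_ne_zero) H.top (v := v) ?_ (T := D.lap + D.number (ghost three) fun n =>
      if n = 0 then 1 else 0)
  · rw [LinearMap.add_apply, H.lap_apply, zero_add]
    refine nopE_apply_eq_zero (fun m hm => ?_) fun m hm => ?_
    · rw [H.fst _ _ (by simp only [lev']; omega), map_zero]
    · rw [mode_mulF, LinearMap.smul_apply, H.snd _ _ (by simp only [lev']; omega), smul_zero,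
        map_zero]
  · rw [hN.cre]
    congr 2
    rcases i with ⟨⟨s, n⟩, hp⟩ | ⟨⟨s, n⟩, hp⟩ | ⟨⟨ε, n⟩, hp⟩ <;> simp only at hp
    · simp only [creWeight, lapWeight]
      by_cases hs : s = ghost three
      · subst hs
        simp only [lev'] at hp
        rw [if_pos rfl, if_pos rfl, if_neg (by omega), Int.sign_eq_one_of_pos (by omega)]
        simp
      · rw [if_neg hs, if_neg hs, creSign, if_neg (by omega)]; simp
    · simp only [creWeight, lapWeight]
      by_cases hs : s = ghost three
      · subst hs
        simp only [lev', neg_zero] at hp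
        rcases hp.eq_or_lt with rfl | hp
        · simp
        · rw [if_pos rfl, if_pos rfl, if_neg (by omega), Int.sign_eq_neg_one_of_neg hp]
          simp
      · rw [if_neg hs, if_neg hs, creSign, if_pos hp]; simp
    · simp only [creWeight]
      rw [Int.sign_eq_neg_one_of_neg hp]; simp
  · rw [LinearMap.add_apply, hv, zero_add]
    refine nopE_apply_eq_zero (fun m hm => ?_) fun m hm => ?_
    · rw [mode_mulF]
      by_cases h : m = 0
      · subst h
        rw [← fst_ghost] at hb
        rw [sub_zero, hb, map_zero]
      · rw [if_neg h, zero_smul]; rfl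
    · rw [mode_mulF, if_neg (by omega), zero_smul, LinearMap.zero_apply, map_zero]

end IsCyclic

end Datum

end AffineOsp

end

/-! ### Perturbation of a differential with diagonalizable Laplacian -/

noncomputable section

namespace AffineOsp

section Perturbation

open Module.End

variable {V : Type*} [AddCommGroup V] [Module ℂ V]

/-- A filtered complex whose differential `Q` has a leading part `Q₀` with a diagonalizable
Laplacian. -/
structure FilteredComplex (Q Q₀ K : Module.End ℂ V) (C F : ℤ → Submodule ℂ V) : Prop where
  sq : Q * Q = 0
  sq₀ : Q₀ * Q₀ = 0
  diag : ⨆ c, eigenspace (Q₀ * K + K * Q₀) c = ⊤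
  mapQ : ∀ m, ∀ v ∈ C m, Q v ∈ C (m + 1)
  mapQ₀ : ∀ m, ∀ v ∈ C m, Q₀ v ∈ C (m + 1)
  mapK : ∀ m, ∀ v ∈ C m, K v ∈ C (m - 1)
  filtQ₀ : ∀ p, ∀ v ∈ F p, Q₀ v ∈ F p
  filtK : ∀ p, ∀ v ∈ F p, K v ∈ F p
  filt_sub : ∀ p, ∀ v ∈ F p, Q v - Q₀ v ∈ F (p + 1)
  anti : Antitone F
  exhaust : ∀ v, ∃ p, v ∈ F p
  bounded : ∀ m, ∃ q, ∀ v ∈ C m, v ∈ F q → v = 0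

namespace FilteredComplex

variable {Q Q₀ K : Module.End ℂ V} {C F : ℤ → Submodule ℂ V}

/-- The Green operator of the Laplacian. -/
lemma exists_green (H : FilteredComplex Q Q₀ K C F) : ∃ G : Module.End ℂ V,
    (∀ U : Submodule ℂ V, (∀ u ∈ U, (Q₀ * K + K * Q₀) u ∈ U) → ∀ u ∈ U, G u ∈ U) ∧
      (∀ v, Q₀ (K (v - G (Q₀ (K v) + K (Q₀ v)))) + K (Q₀ (v - G (Q₀ (K v) + K (Q₀ v)))) = 0) ∧
      ∀ v, G (Q₀ v) = Q₀ (G v) := by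
  -- Since 0⁻¹ = 0, the operator G inverts the Laplacian off its kernel and is zero on the kernel;
  -- it preserves every subspace that the Laplacian preserves.
  obtain ⟨G, hG, hU⟩ := exists_functional_calculus H.diag fun c => c⁻¹
  have ext : ∀ A : Module.End ℂ V, (∀ c, ∀ v ∈ eigenspace (Q₀ * K + K * Q₀) c, A v = 0) →
      ∀ v, A v = 0 := fun A hA v => by
    have : (⊤ : Submodule ℂ V) ≤ LinearMap.ker A := H.diag ▸ iSup_le fun c v hv => hA c v hv
    exact this Submodule.mem_top
  refine ⟨G, hU, ext ((Q₀ * K + K * Q₀) * (1 - G * (Q₀ * K + K * Q₀))) fun c v hv => ?_,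
    fun v => ?_⟩
  · have hv' := mem_eigenspace_iff.1 hv
    rw [Module.End.mul_apply, LinearMap.sub_apply, Module.End.mul_apply, hv', map_smul, hG c v hv,
      smul_smul, Module.End.one_apply]
    by_cases hc : c = 0
    · subst hc; rw [zero_mul, zero_smul, sub_zero, hv', zero_smul]
    · rw [mul_inv_cancel₀ hc, one_smul, sub_self, map_zero]
  · have := ext (G * Q₀ - Q₀ * G) (fun c v hv => ?_) v
    · exact sub_eq_zero.1 this
    · have hv' : Q₀ v ∈ eigenspace (Q₀ * K + K * Q₀) c := by
        have e := mem_eigenspace_iff.1 hv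
        have e0 : ∀ u, Q₀ (Q₀ u) = 0 := fun u => LinearMap.congr_fun H.sq₀ u
        have := congrArg Q₀ e
        simp only [LinearMap.add_apply, Module.End.mul_apply, map_add, e0, map_smul, zero_add] at this
        rw [mem_eigenspace_iff]
        simpa [e0] using this
      rw [LinearMap.sub_apply, Module.End.mul_apply, Module.End.mul_apply, hG c _ hv', hG c v hv,
        map_smul, sub_self]

/-- The first step of the reduction of a vector whose boundary has a higher leading degree. -/
lemma reduce (H : FilteredComplex Q Q₀ K C F) {m p : ℤ} {w : V} (hw : w ∈ C m) (hp : w ∈ F p)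
    (hQ : Q w ∈ F (p + 1)) : ∃ k ∈ C m, ∃ u ∈ C (m - 1), k ∈ F p ∧ Q₀ (K k) + K (Q₀ k) = 0 ∧
      w - k - Q u ∈ F (p + 1) := by
  obtain ⟨G, hU, hG, hc⟩ := H.exists_green
  have GC : ∀ m, ∀ u ∈ C m, G u ∈ C m := fun m => hU _ fun u hu => by
    have h1 := H.mapQ₀ _ _ (H.mapK _ _ hu)
    have h2 := H.mapK _ _ (H.mapQ₀ _ _ hu)
    rw [sub_add_cancel] at h1
    rw [add_sub_cancel_right] at h2
    exact (C m).add_mem h1 h2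
  have GF : ∀ p, ∀ u ∈ F p, G u ∈ F p := fun p => hU _ fun u hu =>
    (F p).add_mem (H.filtQ₀ _ _ (H.filtK _ _ hu)) (H.filtK _ _ (H.filtQ₀ _ _ hu))
  have hQ₀ : Q₀ w ∈ F (p + 1) := by
    have := (F (p + 1)).sub_mem hQ (H.filt_sub p w hp)
    rwa [sub_sub_cancel] at this
  have e : G (Q₀ (K w) + K (Q₀ w)) = Q₀ (G (K w)) + G (K (Q₀ w)) := by rw [map_add, hc]
  -- The Hodge decomposition of w for Q₀: the vector k is the harmonic part of w and u = GKw. The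
  -- exact part is then removed with Q instead of Q₀, at the price of an error of higher degree.
  refine ⟨w - G (Q₀ (K w) + K (Q₀ w)), (C m).sub_mem hw (GC _ _ ?_), G (K w),
    GC _ _ (H.mapK _ _ hw), (F p).sub_mem hp (GF _ _ ?_), hG w, ?_⟩
  · have h1 := H.mapQ₀ _ _ (H.mapK _ _ hw)
    have h2 := H.mapK _ _ (H.mapQ₀ _ _ hw)
    rw [sub_add_cancel] at h1
    rw [add_sub_cancel_right] at h2
    exact (C m).add_mem h1 h2
  · exact (F p).add_mem (H.filtQ₀ _ _ (H.filtK _ _ hp)) (H.filtK _ _ (H.filtQ₀ _ _ hp))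
  · rw [sub_sub_cancel, e, show Q₀ (G (K w)) + G (K (Q₀ w)) - Q (G (K w))
      = G (K (Q₀ w)) - (Q (G (K w)) - Q₀ (G (K w))) by abel]
    exact (F _).sub_mem (GF _ _ (H.filtK _ _ hQ₀)) (H.filt_sub _ _ (GF _ _ (H.filtK _ _ hp)))

/-- If the harmonic vectors of degree `m` are, up to higher terms, multiples of a cocycle `h'`,
then its class spans the cohomology of degree `m`. -/
lemma exists_of_cocycle (H : FilteredComplex Q Q₀ K C F) {m : ℤ} {h' : V} (hC : h' ∈ C m)
    (hQ : Q h' = 0) (hk : ∀ p, ∀ k ∈ C m, k ∈ F p → Q₀ (K k) + K (Q₀ k) = 0 →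
      ∃ c : ℂ, k - c • h' ∈ F (p + 1)) {w : V} (hw : w ∈ C m) (hw' : Q w = 0) :
    ∃ c : ℂ, ∃ u ∈ C (m - 1), w = c • h' + Q u := by
  obtain ⟨q, hq⟩ := H.bounded m
  obtain ⟨p, hp⟩ := H.exhaust w
  have QQ : ∀ u, Q (Q u) = 0 := fun u => LinearMap.congr_fun H.sq u
  -- Each reduction raises the filtration degree of the remaining cocycle by one, and beyond q the
  -- complex of degree m is zero; the induction is on the distance to q.
  obtain ⟨n, hn⟩ : ∃ n : ℕ, q ≤ p + n := ⟨(q - p).toNat, by omega⟩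
  induction n generalizing p w with
  | zero =>
    refine ⟨0, 0, Submodule.zero_mem _, ?_⟩
    rw [hq w hw (H.anti (by simpa using hn) hp), zero_smul, map_zero, add_zero]
  | succ n ih =>
    obtain ⟨k, hkC, u, hu, hkF, hk0, hF⟩ := H.reduce hw hp (by rw [hw']; exact Submodule.zero_mem _)
    obtain ⟨c, hc⟩ := hk p k hkC hkF hk0
    have hQu := H.mapQ _ _ hu
    rw [sub_add_cancel] at hQu
    obtain ⟨c', u', hu', e⟩ := ih (w := w - c • h' - Q u)
      ((C m).sub_mem ((C m).sub_mem hw ((C m).smul_mem c hC)) hQu)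
      (by rw [map_sub, map_sub, map_smul, hw', hQ, QQ]; simp) (p + 1)
      (by
        have := (F (p + 1)).add_mem hF hc
        rwa [show w - k - Q u + (k - c • h') = w - c • h' - Q u by abel] at this)
      (by push_cast at hn; omega)
    refine ⟨c + c', u + u', (C _).add_mem hu hu', ?_⟩
    rw [map_add, add_smul, show w = (w - c • h' - Q u) + c • h' + Q u by abel, e]
    abel

/-- A cocycle with a harmonic leading term is not a coboundary. -/
lemma ne_coboundary (H : FilteredComplex Q Q₀ K C F) {m p₀ : ℤ} {h h' : V}
    (hk : ∀ k ∈ C (m - 1), Q₀ (K k) + K (Q₀ k) = 0 → k = 0) (hp : h ∈ F p₀)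
    (hp' : h ∉ F (p₀ + 1)) (hl : h' - h ∈ F (p₀ + 1)) (h0 : Q₀ (K h) + K (Q₀ h) = 0)
    {u : V} (hu : u ∈ C (m - 1)) : Q u ≠ h' := by
  intro e
  have hh' : h' ∈ F p₀ := by
    have := (F p₀).add_mem (H.anti (by omega : p₀ ≤ p₀ + 1) hl) hp
    rwa [sub_add_cancel] at this
  have QQ : ∀ u, Q (Q u) = 0 := fun u => LinearMap.congr_fun H.sq u
  -- A primitive of too low degree can be corrected by a coboundary, because there are no harmonic
  -- vectors of degree m - 1. So u may be taken in the filtration step of h.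
  obtain ⟨u, hu, hup, e⟩ : ∃ u ∈ C (m - 1), u ∈ F p₀ ∧ Q u = h' := by
    obtain ⟨p, hp⟩ := H.exhaust u
    obtain ⟨n, hn⟩ : ∃ n : ℕ, p₀ ≤ p + n := ⟨(p₀ - p).toNat, by omega⟩
    induction n generalizing p u with
    | zero => exact ⟨u, hu, H.anti (by simpa using hn) hp, e⟩
    | succ n ih =>
      by_cases hpp : p₀ ≤ p
      · exact ⟨u, hu, H.anti hpp hp, e⟩
      obtain ⟨k, hkC, y, hy, -, hk0, hF⟩ := H.reduce hu hp
        (by rw [e]; exact H.anti (by omega) hh')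
      rw [hk k hkC hk0, sub_zero] at hF
      have hQy := H.mapQ _ _ hy
      rw [sub_add_cancel] at hQy
      exact ih (u := u - Q y) ((C _).sub_mem hu hQy) (by rw [map_sub, QQ, sub_zero, e]) (p + 1) hF
        (by push_cast at hn; omega)
  obtain ⟨G, hU, hG, hc⟩ := H.exists_green
  have GF : ∀ p, ∀ u ∈ F p, G u ∈ F p := fun p => hU _ fun u hu =>
    (F p).add_mem (H.filtQ₀ _ _ (H.filtK _ _ hu)) (H.filtK _ _ (H.filtQ₀ _ _ hu))
  have hL : ∀ m, ∀ u ∈ C m, Q₀ (K u) + K (Q₀ u) ∈ C m := fun m u hu => by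
    have h1 := H.mapQ₀ _ _ (H.mapK _ _ hu)
    have h2 := H.mapK _ _ (H.mapQ₀ _ _ hu)
    rw [sub_add_cancel] at h1
    rw [add_sub_cancel_right] at h2
    exact (C m).add_mem h1 h2
  have Q₀Q₀ : ∀ u, Q₀ (Q₀ u) = 0 := fun u => LinearMap.congr_fun H.sq₀ u
  have hu0 : u - G (Q₀ (K u) + K (Q₀ u)) = 0 :=
    hk _ ((C _).sub_mem hu (hU _ (hL _) _ (hL _ _ hu))) (hG u)
  -- As u has no harmonic part, Q₀u is recovered by G from Q₀KQ₀u. Up to a sign the latter is the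
  -- Laplacian of h - Q₀u, which lies in the next filtration step; hence so do Q₀u and h.
  have hQu : Q₀ u = G (Q₀ (K (Q₀ u))) := by
    have := congrArg Q₀ hu0
    rw [map_sub, ← hc, map_add, Q₀Q₀, zero_add, map_zero, sub_eq_zero] at this
    exact this
  have hf : h - Q₀ u ∈ F (p₀ + 1) := by
    have := (F _).sub_mem (H.filt_sub _ _ hup) hl
    rwa [e, show h' - Q₀ u - (h' - h) = h - Q₀ u by abel] at this
  have h1 := GF _ _ ((F _).add_mem (H.filtQ₀ _ _ (H.filtK _ _ hf)) (H.filtK _ _ (H.filtQ₀ _ _ hf)))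
  apply hp'
  have h2 := (F _).sub_mem hf h1
  have h3 : Q₀ (K (h - Q₀ u)) + K (Q₀ (h - Q₀ u)) = -Q₀ (K (Q₀ u)) := by
    simp only [map_sub, Q₀Q₀, map_zero, sub_zero]
    rw [sub_add_eq_add_sub, h0, zero_sub]
  rw [h3, map_neg, ← hQu, sub_neg_eq_add, sub_add_cancel] at h2
  exact h2

end FilteredComplex

end Perturbation

end AffineOsp

end

noncomputable section

namespace AffineOsp

open Gen Pair

/-! ### Gradings of the quadratic differential and of the homotopy -/

namespace Datum

/-- A grading of the Fock space with respect to which the quadratic differential and the homotopy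
have degrees `δ` and `-δ`. -/
structure QuartetGrading {G : Type*} [AddCommGroup G] (D : Datum) (E : G → Submodule ℂ Fock)
    (s δ : G) (χ : Pair → G) (x y : G) : Prop where
  fst : ∀ r, Shifts E s (-χ r) (D.fst r)
  snd : ∀ r, Shifts E s (χ r) (D.snd r)
  pos : Shifts E s x (D.lc true)
  neg : Shifts E s y (D.lc false)
  quartet : ∀ t : Quartet, χ t.gho - χ t.mat = δ
  three_pos : χ (ghost three) + x = δ
  neg_three : y - χ (ghost three) = -δ

namespace QuartetGrading

variable {G : Type*} [AddCommGroup G] {D : Datum} {E : G → Submodule ℂ Fock} {s δ : G}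
  {χ : Pair → G} {x y : G}

lemma Q₀ (H : D.QuartetGrading E s δ χ x y) {g : G} {v : Fock} (hv : v ∈ E g) :
    D.Q₀' v ∈ E (g + δ) := by
  rw [Q₀', LinearMap.add_apply, LinearMap.sum_apply]
  refine Submodule.add_mem _ (Submodule.sum_mem _ fun t _ => Submodule.smul_mem _ _ ?_)
    (Submodule.smul_mem _ _ ?_)
  · exact ((H.snd _).nop (H.fst _) (by rw [← H.quartet t]; abel)).apply_zero hv
  · exact ((H.snd _).nop H.pos H.three_pos).apply_zero hv

lemma K (H : D.QuartetGrading E s δ χ x y) {g : G} {v : Fock} (hv : v ∈ E g) :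
    D.K v ∈ E (g - δ) := by
  rw [Datum.K, LinearMap.add_apply, LinearMap.sum_apply, sub_eq_add_neg]
  refine Submodule.add_mem _ (Submodule.sum_mem _ fun t _ => Submodule.smul_mem _ _ ?_)
    (Submodule.smul_mem _ _ ?_)
  · exact (((H.snd _).mulF _).nop (H.fst _) (by rw [← H.quartet t]; abel)).apply_zero hv
  · exact ((H.neg.mulF _).nop (H.fst _) (by rw [← H.neg_three]; abel)).apply_zero hv

end QuartetGrading

variable {D : Datum}

lemma LCWeights.quartetGrading {T : Module.End ℂ Fock} {μ : Pair → ℤ → ℂ} {ν : Bool → ℤ → ℂ}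
    (H : D.LCWeights T μ ν) {s δ x y : ℂ} {χ : Pair → ℂ} (hμ : ∀ r n, μ r n = χ r + n * s)
    (hx : ∀ n, ν true n = -(x + n * s)) (hy : ∀ n, ν false n = -(y + n * s))
    (hq : ∀ t : Quartet, χ t.gho - χ t.mat = δ) (h₁ : χ (ghost three) + x = δ)
    (h₂ : y - χ (ghost three) = -δ) :
    D.QuartetGrading (Module.End.eigenspace T) s δ χ x y where
  fst r := Shifts.of_OB (H.fst r) fun n => by rw [hμ]; push_cast; ring
  snd r := Shifts.of_OB (H.snd r) fun n => by rw [hμ]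
  pos := Shifts.of_OB (H.lc true) hx
  neg := Shifts.of_OB (H.lc false) hy
  quartet := hq
  three_pos := h₁
  neg_three := h₂

lemma isospin_grading (h0 : D.a ≠ 0) (h0' : D.a' ≠ 0) :
    D.QuartetGrading (Module.End.eigenspace D.totalIsospin) 0 0 isospin 0 0 :=
  ((D.weights_totalIsospin h0 h0').toLC rfl).quartetGrading (fun r n => by simp) (fun n => by simp)
    (fun n => by simp) (fun t => by cases t <;> simp [Quartet.gho, Quartet.mat, Quartet.gen, isospin])
    (by simp [isospin]) (by simp [isospin])

lemma energy_grading (h0 : D.a ≠ 0) (haa : D.a ^ 2 + D.a' ^ 2 = 0) :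
    D.QuartetGrading (Module.End.eigenspace D.L₀) (-1) 0 (fun _ => 0) 0 0 :=
  ((D.weights_L₀ h0 haa).toLC (by simp)).quartetGrading (fun r n => by simp) (fun n => by simp)
    (fun n => by simp) (fun t => by simp) (by simp) (by simp)

lemma ghost_grading :
    D.QuartetGrading (Module.End.eigenspace D.ghostNumber) 0 1 (fun s => ghostDegree s) 0 0 :=
  (D.weights_ghostNumber.toLC rfl).quartetGrading (fun r n => by simp) (fun n => by simp)
    (fun n => by simp)
    (fun t => by cases t <;> simp [Quartet.gho, Quartet.mat, ghostDegree])
    (by simp [ghostDegree]) (by simp [ghostDegree])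

/-! ### The filtration -/

/-- The filtration degree of the second field of a pair. -/
def degree : Pair → ℤ
  | matterB => 3
  | matterF => 2
  | liouvilleB => 3
  | liouvilleF => 2
  | ghost plus => 3
  | ghost half => 2
  | ghost three => 1
  | ghost mhalf => 2
  | ghost minus => 3

variable (D)

/-- The operator that defines the filtration. -/
def degOp : Module.End ℂ Fock := D.numOp (fun s _ => degree s)
  -- The coefficients are the inverses of the commutators of the null bosons, up to sign, so that
  -- each mode of the two bosons gets degree -1 and 1.
  + mode (nopE 1 1 (mulF (fun n => -1 / (2 * D.a ^ 2 * n)) (D.lc false)) (D.lc true)) 0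

lemma degOp_vac : D.degOp vac = 0 := by
  rw [degOp, LinearMap.add_apply, numOp_vac, zero_add]
  refine nopE_apply_eq_zero (fun m hm => ?_) fun m hm => ?_
  · rw [D.lc_vac _ (by omega), map_zero]
  · rw [mode_mulF, LinearMap.smul_apply, D.lc_vac _ (by omega), smul_zero, map_zero]

variable {D}

lemma degWeights (h0 : D.a ≠ 0) (haa : D.a ^ 2 + D.a' ^ 2 = 0) :
    D.LCWeights D.degOp (fun s _ => degree s) (fun ε _ => if ε = true then 1 else -1) := by
  have h := (D.weights_numOp fun s _ => (degree s : ℂ)).toLC rfl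
  refine ⟨fun s => ((h.fst s).add (OB.nop (D.SB_mulF_lc _ (D.SB_fst_lc s _) fun _ => rfl)
      (D.SB_fst_lc s _) (one_mul 1) (Or.inl fun _ => rfl) (Or.inl fun _ => rfl) (one_mul 1)
      rfl)).congr (by simp [mulF_zero]),
    fun s => ((h.snd s).add (OB.nop (D.SB_mulF_lc _ (D.SB_snd_lc s _) fun _ => rfl)
      (D.SB_snd_lc s _) (one_mul 1) (Or.inl fun _ => rfl) (Or.inl fun _ => rfl) (one_mul 1)
      rfl)).congr (by simp [mulF_zero]), fun ε => ?_⟩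
  refine ((h.lc ε).add (OB.nop (SB_lc_mulF_lc haa ε _ _) (SB_lc haa ε _) (one_mul 1)
    (Or.inr (one_mul 1)) (Or.inr (one_mul 1)) (one_mul 1) rfl)).congr (fields_ext fun n => ?_)
  by_cases hn : n = 0
  · subst hn
    cases ε <;> simp [lc_zero]
  · have hn' : (n : ℂ) ≠ 0 := by exact_mod_cast hn
    cases ε <;> simp [smul_smul]
    · rw [← neg_one_smul ℂ (mode (D.lc false) n)]
      congr 1
      field_simp
    · rw [← one_smul ℂ (mode (D.lc true) n), smul_smul]
      congr 1
      field_simp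

variable (D)

/-- The filtration of the Fock space. -/
def filt (p : ℤ) : Submodule ℂ Fock :=
  ⨆ d ∈ Set.Ici p, Module.End.eigenspace D.degOp (d : ℂ)

lemma filt_antitone : Antitone D.filt := fun p q h =>
  iSup₂_le fun d hd => le_iSup₂ (f := fun d (_ : d ∈ Set.Ici p) =>
    Module.End.eigenspace D.degOp (d : ℂ)) d (le_trans h hd)

lemma mem_filt {d : ℤ} {v : Fock} (h : D.degOp v = (d : ℂ) • v) : v ∈ D.filt d :=
  Submodule.mem_iSup_of_mem d (Submodule.mem_iSup_of_mem (le_refl d)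
    (Module.End.mem_eigenspace_iff.2 h))

lemma eq_zero_of_mem_filt {d p : ℤ} (hd : d < p) {v : Fock} (h : D.degOp v = (d : ℂ) • v)
    (hv : v ∈ D.filt p) : v = 0 := by
  refine eq_zero_of_mem_eigenspace (T := D.degOp) (c := d) (S := {c | ∃ e : ℤ, p ≤ e ∧ c = e}) ?_
    ?_ ?_
  · rintro ⟨e, he, h⟩
    have : d = e := by exact_mod_cast h
    omega
  · rw [Module.End.mem_maxGenEigenspace]
    exact ⟨1, by rw [pow_one, LinearMap.sub_apply, h]; simp⟩
  · suffices h : D.filt p ≤ _ from h hv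
    exact iSup₂_le fun e he => le_iSup₂ (f := fun c (_ : c ∈ {c : ℂ | ∃ e : ℤ, p ≤ e ∧ c = e}) =>
      Module.End.eigenspace D.degOp c) (e : ℂ) ⟨e, he, rfl⟩

variable {D}

lemma shifts_filt {g k : ℤ} {A : fields Fock} (hA : Shifts (Module.End.eigenspace D.degOp) 0 (g : ℂ) A)
    (hk : k ≤ g) : Shifts D.filt 0 k A := fun n p v hv => by
  suffices h : D.filt p ≤ (D.filt (p + k + n • 0)).comap (mode A n) from h hv
  refine iSup₂_le fun d hd v hv => ?_
  have := hA n _ v hv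
  simp only [smul_zero, add_zero] at this ⊢
  refine D.filt_antitone (show p + k ≤ d + g from add_le_add hd hk) (D.mem_filt ?_)
  rw [Module.End.mem_eigenspace_iff] at this
  rw [this]
  push_cast
  rfl

lemma shifts_mono {g k : ℤ} {A : fields Fock} (hA : Shifts D.filt 0 g A) (hk : k ≤ g) :
    Shifts D.filt 0 k A := fun n p v hv => by
  have := hA n p v hv
  simp only [smul_zero, add_zero] at this ⊢
  exact D.filt_antitone (by omega) this

lemma shifts_nop {g g' k h : ℤ} {e : ℂ} {A B : fields Fock} (hA : Shifts D.filt 0 g A)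
    (hB : Shifts D.filt 0 g' B) (hk : k ≤ g + g') : Shifts D.filt 0 k (nopE h e A B) :=
  shifts_mono (hA.nop hB rfl) hk

lemma filt_fst (h0 : D.a ≠ 0) (haa : D.a ^ 2 + D.a' ^ 2 = 0) (s : Pair) :
    Shifts D.filt 0 (-degree s) (D.fst s) :=
  shifts_filt (Shifts.of_OB ((degWeights h0 haa).fst s) fun n => by simp) le_rfl

lemma filt_snd (h0 : D.a ≠ 0) (haa : D.a ^ 2 + D.a' ^ 2 = 0) (s : Pair) :
    Shifts D.filt 0 (degree s) (D.snd s) :=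
  shifts_filt (Shifts.of_OB ((degWeights h0 haa).snd s) fun n => by simp) le_rfl

lemma filt_lc (h0 : D.a ≠ 0) (haa : D.a ^ 2 + D.a' ^ 2 = 0) (ε : Bool) :
    Shifts D.filt 0 (if ε = true then -1 else 1) (D.lc ε) :=
  shifts_filt (Shifts.of_OB ((degWeights h0 haa).lc ε) fun n => by cases ε <;> simp) le_rfl

lemma filt_bos (h0 : D.a ≠ 0) (haa : D.a ^ 2 + D.a' ^ 2 = 0) (u : Heis) :
    Shifts D.filt 0 (-1) (D.bos u) := by
  have ha' : D.a' ≠ 0 := fun h => h0 (by simpa [h] using haa)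
  have h1 : Shifts D.filt 0 (-1) (D.lc true) := filt_lc h0 haa true
  have h2 : Shifts D.filt 0 (-1) (D.lc false) := shifts_mono (filt_lc h0 haa false) (by simp)
  have h3 : Shifts D.filt 0 (-1) (oneF : fields Fock) := shifts_mono Shifts.oneF (by simp)
  rw [bos_eq]
  cases u
  · rw [D.boson_matter_eq h0]
    exact ((h1.smul _).add (h2.smul _)).add (h3.smul _)
  · rw [D.boson_liouville_eq ha']
    exact ((h2.smul _).sub (h1.smul _)).add (h3.smul _)

/-- The degrees are chosen such that the two pairs of a quartet have equal degree and the degree of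
c³ is opposite to that of its boson. Hence the quadratic differential and the homotopy preserve the
filtration. -/
lemma filt_grading (h0 : D.a ≠ 0) (haa : D.a ^ 2 + D.a' ^ 2 = 0) :
    D.QuartetGrading D.filt 0 0 degree (-1) 1 where
  fst := filt_fst h0 haa
  snd := filt_snd h0 haa
  pos := filt_lc h0 haa true
  neg := filt_lc h0 haa false
  quartet t := by cases t <;> rfl
  three_pos := rfl
  neg_three := rfl

lemma filt_exhaust (h0 : D.a ≠ 0) (haa : D.a ^ 2 + D.a' ^ 2 = 0) (v : Fock) :
    ∃ p, v ∈ D.filt p := by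
  have ha' : D.a' ≠ 0 := fun h => h0 (by simpa [h] using haa)
  have h := (degWeights h0 haa).iSup_eigenspace h0 ha' (c₀ := 0) (S := Set.range fun d : ℤ => (d : ℂ))
    (by rw [degOp_vac, zero_smul]) ⟨0, by simp⟩ (by
      rintro i _ ⟨d, rfl⟩
      rcases i with ⟨⟨s, n⟩, hp⟩ | ⟨⟨s, n⟩, hp⟩ | ⟨⟨ε, n⟩, hp⟩ <;> simp only [creWeight]
      · exact ⟨d - degree s, by push_cast; ring⟩
      · exact ⟨d + degree s, by push_cast; ring⟩
      · cases ε
        · exact ⟨d + 1, by simp⟩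
        · exact ⟨d - 1, by simp; ring⟩)
  have hd : Directed (· ≤ ·) D.filt := fun p q =>
    ⟨min p q, D.filt_antitone (min_le_left _ _), D.filt_antitone (min_le_right _ _)⟩
  rw [← Submodule.mem_iSup_of_directed _ hd]
  suffices h : (⊤ : Submodule ℂ Fock) ≤ ⨆ p, D.filt p from h Submodule.mem_top
  rw [← h]
  refine iSup₂_le ?_
  rintro _ ⟨d, rfl⟩ v hv
  exact Submodule.mem_iSup_of_mem d (D.mem_filt (Module.End.mem_eigenspace_iff.1 hv))

/-! ### The higher terms of the differential -/

section Higher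

variable {β γ p ψ φ : fields Fock}

/-- These four currents contain only the terms beyond the linear ones. The derivatives and the
products without β or ψ⁺ have positive degree, and β and ψ⁺ occur together with enough factors γ and
ψ. -/
lemma wakimotoCurrent_filt (hβ : Shifts D.filt 0 (-3) β) (hγ : Shifts D.filt 0 3 γ)
    (hp : Shifts D.filt 0 (-2) p) (hψ : Shifts D.filt 0 2 ψ) (hφ : Shifts D.filt 0 (-1) φ)
    (k a : ℂ) : Shifts D.filt 0 0 (wakimotoCurrent k a β γ p ψ φ mhalf) ∧
      Shifts D.filt 0 0 (wakimotoCurrent k a β γ p ψ φ minus) ∧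
      Shifts D.filt 0 0 (dualWakimotoCurrent k a β γ p ψ φ half) ∧
      Shifts D.filt 0 0 (dualWakimotoCurrent k a β γ p ψ φ plus) := by
  have e1 : Shifts D.filt 0 0 (nopE 0 1 γ (p - nopE 1 1 β ψ)) :=
    shifts_nop (g' := -2) hγ (hp.sub (shifts_nop hβ hψ (by simp))) (by simp)
  have e2 : Shifts D.filt 0 0 (nopE 0 1 ψ φ) := shifts_nop hψ hφ (by simp)
  have e3 : Shifts D.filt 0 0 (deriv 0 ψ) := shifts_mono (hψ.deriv 0) (by simp)
  have e4 : Shifts D.filt 0 0 (nopE 1 1 β (nopE 0 1 γ γ)) :=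
    shifts_nop (g' := 6) hβ (shifts_nop hγ hγ (by simp)) (by simp)
  have e5 : Shifts D.filt 0 0 (nopE 0 1 γ φ) := shifts_nop hγ hφ (by simp)
  have e6 : Shifts D.filt 0 0 (nopE 0 1 γ (nopE 0 (-1) ψ p)) :=
    shifts_nop (g' := 0) hγ (shifts_nop hψ hp (by simp)) (by simp)
  have e7 : Shifts D.filt 0 0 (deriv 0 γ) := shifts_mono (hγ.deriv 0) (by simp)
  have e8 : Shifts D.filt 0 0 (nopE 0 (-1) ψ (deriv 0 ψ)) :=
    shifts_nop hψ (hψ.deriv 0) (by simp)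
  simp only [wakimotoCurrent, dualWakimotoCurrent, nop_eq, nopF_eq]
  exact ⟨(e1.add (e2.smul _)).add (e3.smul _),
    (((e4.sub (e5.smul _)).add e6).sub (e7.smul _)).add (e8.smul _),
    (e1.neg.sub (e2.smul _)).sub (e3.smul _),
    (((e4.neg.add (e5.smul _)).sub e6).add (e7.smul _)).sub (e8.smul _)⟩

end Higher

/-- The least degree of the terms of a current beyond those in the quadratic differential. -/
def rank : Gen → ℤ
  | plus => -2
  | half => -1
  | three => 0
  | mhalf => -1
  | minus => -2

lemma Jgh_filt (h0 : D.a ≠ 0) (haa : D.a ^ 2 + D.a' ^ 2 = 0) (x : Gen) :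
    Shifts D.filt 0 (rank x) (D.Jgh x) :=
  Shifts.sum _ fun y _ => Shifts.sum _ fun z _ => by
    by_cases hf : f x y z = 0
    · rw [hf, zero_smul]; exact Shifts.zero
    · refine Shifts.smul _ ?_
      rw [ghostProd_eq, ← snd_ghost, ← fst_ghost]
      refine shifts_nop (filt_snd h0 haa _) (filt_fst h0 haa _) ?_
      cases x <;> cases y <;> cases z <;> first | exact absurd rfl hf | simp [rank, degree]

variable (D)

/-- The terms of a current beyond those in the quadratic differential. -/
def higher : Gen → fields Fock
  | plus => D.JT plus + (1 / 2 : ℂ) • D.Jgh plus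
  | half => -nopE 1 1 D.beta D.psi + D.JT half + (1 / 2 : ℂ) • D.Jgh half
  | three => -nopE 1 1 D.beta D.gamma - (1 / 2 : ℂ) • nopE 0 (-1) D.psi D.psiP
      + nopE 1 1 D.betaT D.gammaT + (1 / 2 : ℂ) • nopE 0 (-1) D.psiT D.psiPT
      + (D.a / 2 * D.mom .matter - D.a' / 2 * D.mom .liouville) • oneF + (1 / 2 : ℂ) • D.Jgh three
  | mhalf => D.J mhalf - nopE 1 1 D.betaT D.psiT + (1 / 2 : ℂ) • D.Jgh mhalf
  | minus => D.J minus + (1 / 2 : ℂ) • D.Jgh minus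

variable {D}

lemma higher_filt (h0 : D.a ≠ 0) (haa : D.a ^ 2 + D.a' ^ 2 = 0) (x : Gen) :
    Shifts D.filt 0 (rank x) (D.higher x) := by
  have hβ : Shifts D.filt 0 (-3) D.beta := filt_fst h0 haa matterB
  have hγ : Shifts D.filt 0 3 D.gamma := filt_snd h0 haa matterB
  have hp : Shifts D.filt 0 (-2) D.psiP := filt_fst h0 haa matterF
  have hψ : Shifts D.filt 0 2 D.psi := filt_snd h0 haa matterF
  have hβT : Shifts D.filt 0 (-3) D.betaT := filt_fst h0 haa liouvilleB
  have hγT : Shifts D.filt 0 3 D.gammaT := filt_snd h0 haa liouvilleB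
  have hpT : Shifts D.filt 0 (-2) D.psiPT := filt_fst h0 haa liouvilleF
  have hψT : Shifts D.filt 0 2 D.psiT := filt_snd h0 haa liouvilleF
  obtain ⟨w1, w2, -, -⟩ := wakimotoCurrent_filt hβ hγ hp hψ (filt_bos h0 haa .matter) D.k D.a
  obtain ⟨-, -, w3, w4⟩ := wakimotoCurrent_filt hβT hγT hpT hψT (filt_bos h0 haa .liouville)
    (-3 - D.k) D.a'
  have hJ := (Jgh_filt h0 haa x).smul (1 / 2 : ℂ)
  cases x <;> simp only [higher, rank]
  · exact (shifts_mono w4 (by simp)).add hJ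
  · exact ((shifts_nop hβ hψ (by simp)).neg.add (shifts_mono w3 (by simp))).add hJ
  · exact (((((shifts_nop hβ hγ (by simp)).neg.sub ((shifts_nop hψ hp (by simp)).smul _)).add
      (shifts_nop hβT hγT (by simp))).add ((shifts_nop hψT hpT (by simp)).smul _)).add
      (Shifts.oneF.smul _)).add hJ
  · exact ((shifts_mono w1 (by simp)).sub (shifts_nop hβT hψT (by simp))).add hJ
  · exact (shifts_mono w2 (by simp)).add hJ

lemma brstCurrent_sub : D.brstCurrent
    - (-(1 / 2 : ℂ) • nop 0 (D.c minus) D.beta + (1 / 2 : ℂ) • nop 0 (D.c plus) D.betaT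
      + (1 / 4 : ℂ) • nop 0 (D.c half) D.psiPT - (1 / 4 : ℂ) • nop 0 (D.c mhalf) D.psiP
      + (1 / 2 : ℂ) • nop 0 (D.c three) (D.a • boson .matter 0 - D.a' • boson .liouville 0))
    = ∑ x, ∑ y, hInv x y • nopE 0 1 (D.c y) (D.higher x) := by
  have e1 : D.J plus + D.JT plus + (1 / 2 : ℂ) • D.Jgh plus = -D.beta + D.higher plus := by
    rw [higher, J, wakimotoCurrent]; abel
  have e2 : D.J half + D.JT half + (1 / 2 : ℂ) • D.Jgh half = D.psiP + D.higher half := by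
    rw [higher, J, wakimotoCurrent, nop_eq]; abel
  have e3 : D.J three + D.JT three + (1 / 2 : ℂ) • D.Jgh three
      = (1 / 2 : ℂ) • (D.a • boson .matter 0 - D.a' • boson .liouville 0) + D.higher three := by
    rw [higher, J, JT, wakimotoCurrent, dualWakimotoCurrent]
    simp only [nop_eq, nopF_eq]
    rw [show D.phi = _ from D.bos_eq .matter, show D.phiT = _ from D.bos_eq .liouville]
    module
  have e4 : D.J mhalf + D.JT mhalf + (1 / 2 : ℂ) • D.Jgh mhalf = D.psiPT + D.higher mhalf := by
    rw [higher, JT, dualWakimotoCurrent, nop_eq]; abel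
  have e5 : D.J minus + D.JT minus + (1 / 2 : ℂ) • D.Jgh minus = D.betaT + D.higher minus := by
    rw [higher, JT, dualWakimotoCurrent]; abel
  simp only [brstCurrent, nop_eq, sum_gen, hInv, zero_smul, add_zero, zero_add]
  rw [e1, e2, e3, e4, e5]
  simp only [nopE_add_right, nopE_neg_right, nopE_smul_right]
  module

/-- The form pairs the current x with a ghost of degree 1 - `rank` x, so every term beyond the
quadratic part has degree at least one. -/
lemma Q_sub_Q₀ (h0 : D.a ≠ 0) (haa : D.a ^ 2 + D.a' ^ 2 = 0) {p : ℤ} {v : Fock}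
    (hv : v ∈ D.filt p) : D.Q v - D.Q₀' v ∈ D.filt (p + 1) := by
  rw [← Q₀_eq, Q, Q₀, ← LinearMap.sub_apply, ← mode_sub, brstCurrent_sub]
  refine Shifts.apply_zero (s := 0) (Shifts.sum _ fun x _ => Shifts.sum _ fun y _ => ?_) hv
  by_cases hh : hInv x y = 0
  · rw [hh, zero_smul]; exact Shifts.zero
  · refine Shifts.smul _ ?_
    rw [← snd_ghost]
    refine shifts_nop (filt_snd h0 haa _) (higher_filt h0 haa x) ?_
    cases x <;> cases y <;> first | exact absurd rfl hh | simp [rank, degree]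

end Datum

end AffineOsp

end

noncomputable section

namespace AffineOsp

open Gen Pair

namespace Datum

variable {D : Datum}

/-! ### The relative complex as a filtered complex -/

lemma mem_relComplex {n : ℤ} {v : Fock} : v ∈ D.relComplex n ↔ D.totalIsospin v = 0 ∧ D.L₀ v = 0 ∧
    mode (D.b three) 0 v = 0 ∧ D.ghostNumber v = (n : ℂ) • v := by
  simp [relComplex, sub_eq_zero, and_assoc]

lemma Q_mem (ha : D.a ^ 2 = 2 * D.k + 3) (ha' : D.a' ^ 2 = 2 * (-3 - D.k) + 3) (h0 : D.a ≠ 0)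
    (h0' : D.a' ≠ 0) {n : ℤ} {v : Fock} (hv : v ∈ D.relComplex n) : D.Q v ∈ D.relComplex (n + 1) := by
  have haa : D.a ^ 2 + D.a' ^ 2 = 0 := by rw [ha, ha']; ring
  rw [mem_relComplex] at hv ⊢
  obtain ⟨h1, h2, h3, h4⟩ := hv
  refine ⟨?_, ?_, ?_, ?_⟩
  · have := LinearMap.congr_fun (Q_totalIsospin ha ha' h0 h0') v
    rw [Module.End.mul_apply, Module.End.mul_apply, h1, map_zero] at this
    exact this.symm
  · have := (D.L₀_grading h0 haa).brst.apply_zero (g := 0) (v := v) (by simpa using h2)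
    simpa [Q] using this
  · have := LinearMap.congr_fun (b_three_Q ha ha') v
    simpa [h3, h1] using this
  · have := D.ghostNumber_grading.brst.apply_zero (Module.End.mem_eigenspace_iff.2 h4)
    rw [Module.End.mem_eigenspace_iff] at this
    push_cast
    exact this

lemma Q₀_mem (h0 : D.a ≠ 0) (haa : D.a ^ 2 + D.a' ^ 2 = 0) {n : ℤ} {v : Fock}
    (hv : v ∈ D.relComplex n) : D.Q₀' v ∈ D.relComplex (n + 1) := by
  have h0' : D.a' ≠ 0 := fun h => h0 (by simpa [h] using haa)
  rw [mem_relComplex] at hv ⊢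
  obtain ⟨h1, h2, h3, h4⟩ := hv
  refine ⟨?_, ?_, ?_, ?_⟩
  · simpa using (isospin_grading h0 h0').Q₀ (g := 0) (v := v) (by simpa using h1)
  · simpa using (energy_grading h0 haa).Q₀ (g := 0) (v := v) (by simpa using h2)
  · have := LinearMap.congr_fun (D.Q₀_fst_three 0) v
    rw [fst_ghost] at this
    simpa [h3, lc_zero] using this
  · have := ghost_grading.Q₀ (Module.End.mem_eigenspace_iff.2 h4)
    rw [Module.End.mem_eigenspace_iff] at this
    push_cast
    exact this

lemma K_mem (h0 : D.a ≠ 0) (haa : D.a ^ 2 + D.a' ^ 2 = 0) {n : ℤ} {v : Fock}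
    (hv : v ∈ D.relComplex n) : D.K v ∈ D.relComplex (n - 1) := by
  have h0' : D.a' ≠ 0 := fun h => h0 (by simpa [h] using haa)
  rw [mem_relComplex] at hv ⊢
  obtain ⟨h1, h2, h3, h4⟩ := hv
  refine ⟨?_, ?_, ?_, ?_⟩
  · simpa using (isospin_grading h0 h0').K (g := 0) (v := v) (by simpa using h1)
  · simpa using (energy_grading h0 haa).K (g := 0) (v := v) (by simpa using h2)
  · have := LinearMap.congr_fun (D.K_fst_three 0) v
    rw [fst_ghost] at this
    simpa [h3] using this
  · have := ghost_grading.K (Module.End.mem_eigenspace_iff.2 h4)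
    rw [Module.End.mem_eigenspace_iff] at this
    push_cast
    exact this

lemma degOp_diagonalizable (h0 : D.a ≠ 0) (haa : D.a ^ 2 + D.a' ^ 2 = 0) :
    ⨆ c, Module.End.eigenspace D.degOp c = ⊤ := by
  refine top_le_iff.1 fun v _ => ?_
  obtain ⟨p, hp⟩ := filt_exhaust h0 haa v
  suffices h : D.filt p ≤ _ from h hp
  exact iSup₂_le fun d _ => le_iSup (fun c => Module.End.eigenspace D.degOp c) (d : ℂ)

/-- The degree operator commutes with isospin, energy and ghost number, since all of them are
diagonal on the same free fields. The relative complex can thus be decomposed by degree. -/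
lemma degOp_mem (h0 : D.a ≠ 0) (haa : D.a ^ 2 + D.a' ^ 2 = 0) {n : ℤ} {v : Fock}
    (hv : v ∈ D.relComplex n) : D.degOp v ∈ D.relComplex n := by
  have h0' : D.a' ≠ 0 := fun h => h0 (by simpa [h] using haa)
  have hd := degWeights h0 haa
  have hd0 : D.degOp vac = (0 : ℂ) • vac := by rw [degOp_vac, zero_smul]
  have c1 := hd.commute h0 h0' ((D.weights_totalIsospin h0 h0').toLC rfl) hd0
    (D.totalIsospin_vac h0 h0')
  have c2 := hd.commute h0 h0' ((D.weights_L₀ h0 haa).toLC (by simp)) hd0 (D.L₀_vac h0 haa)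
  have c3 := hd.commute h0 h0' (D.weights_ghostNumber.toLC rfl) (c' := 0) hd0
    (by simp [ghostNumber_vac])
  rw [mem_relComplex] at hv ⊢
  obtain ⟨h1, h2, h3, h4⟩ := hv
  have e := fun {T : Module.End ℂ Fock} (h : D.degOp * T = T * D.degOp) =>
    LinearMap.congr_fun h v
  simp only [Module.End.mul_apply] at e
  refine ⟨by rw [← e c1, h1, map_zero], by rw [← e c2, h2, map_zero], ?_,
    by rw [← e c3, h4, map_smul]⟩
  have := LinearMap.congr_fun (hd.fst (ghost three) 0) v
  rw [fst_ghost] at this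
  simpa [h3] using this

/-- Four times the isospin. -/
def isospin4 : Pair → ℤ
  | matterB => -4
  | matterF => -2
  | liouvilleB => 4
  | liouvilleF => 2
  | ghost plus => 4
  | ghost half => 2
  | ghost three => 0
  | ghost mhalf => -2
  | ghost minus => -4

lemma isospin4_eq (s : Pair) : 4 * isospin s = isospin4 s := by
  rcases s with _ | _ | _ | _ | x
  all_goals try cases x
  all_goals norm_num [isospin, isospin4]

/-- The degree of the relative complex in a given ghost number is bounded. -/
lemma bounded (h0 : D.a ≠ 0) (haa : D.a ^ 2 + D.a' ^ 2 = 0) (m : ℤ) :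
    ∃ q, ∀ v ∈ D.relComplex m, v ∈ D.filt q → v = 0 := by
  have h0' : D.a' ≠ 0 := fun h => h0 (by simpa [h] using haa)
  -- Over the first ghost vacuum the creation mode c⁺_0 has weight B - 4 - 3 in `T`, which requires
  -- B ≥ 7. Over the second the creation mode b_{1/2,0} has weight 4 - B, which requires B ≤ 4.
  obtain ⟨B, hB⟩ : ∃ B : ℤ, B = match D.gh with | .zero => 7 | .zeroHalf => 4 := ⟨_, rfl⟩
  -- The combination has nonnegative integral weights on all creation modes of the free fields, so
  -- its spectrum is bounded below by its vacuum value. In the relative complex energy and isospin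
  -- drop out and only the ghost number and the degree remain.
  let T : Module.End ℂ Fock := ((10 : ℂ) • D.L₀ + (-4 : ℂ) • D.totalIsospin)
    + ((B : ℂ) • D.ghostNumber + (-1 : ℂ) • D.degOp)
  have hT := ((((D.weights_L₀ h0 haa).toLC (by simp)).smul 10).add
    (((D.weights_totalIsospin h0 h0').toLC rfl).smul (-4))).add
    (((D.weights_ghostNumber.toLC rfl).smul B).add ((degWeights h0 haa).smul (-1)))
  have hTv : T vac = (10 * D.vacEnergy - 4 * D.vacIsospin) • vac := by
    simp only [T, LinearMap.add_apply, LinearMap.smul_apply, D.L₀_vac h0 haa,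
      D.totalIsospin_vac h0 h0', ghostNumber_vac, degOp_vac]
    module
  set c₀ := 10 * D.vacEnergy - 4 * D.vacIsospin
  have htop := hT.iSup_eigenspace h0 h0' (S := {c | ∃ N : ℕ, c = c₀ + N}) hTv ⟨0, by simp⟩ (by
    suffices hw : ∀ i : Creator D.lev, ∃ k : ℤ, 0 ≤ k ∧ creWeight _ _ i = (k : ℂ) by
      rintro i _ ⟨N, rfl⟩
      obtain ⟨k, hk, e⟩ := hw i
      refine ⟨N + k.toNat, ?_⟩
      rw [e]
      have : ((k.toNat : ℤ) : ℂ) = k := by rw [Int.toNat_of_nonneg hk]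
      push_cast at this ⊢
      rw [this, add_assoc]
    have hlev : ∀ s, (-10 * (D.lev s - 1) + isospin4 s - B * ghostDegree s + degree s ≥ 0) ∧
        (10 * D.lev s - isospin4 s + B * ghostDegree s - degree s ≥ 0) := by
      intro s
      rw [hB]
      rcases hg : D.gh with _ | _ <;> rcases s with _ | _ | _ | _ | x
      all_goals try cases x
      all_goals simp [lev, hg, GhostVac.level, isospin4, ghostDegree, degree]
    rintro (⟨⟨s, n⟩, hp⟩ | ⟨⟨s, n⟩, hp⟩ | ⟨⟨ε, n⟩, hp⟩) <;> simp only at hp <;>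
      simp only [creWeight]
    · refine ⟨-10 * n + isospin4 s - B * ghostDegree s + degree s, ?_, ?_⟩
      · have := (hlev s).1
        omega
      · push_cast
        rw [← isospin4_eq]
        ring
    · refine ⟨-10 * n - isospin4 s + B * ghostDegree s - degree s, ?_, ?_⟩
      · have := (hlev s).2
        omega
      · push_cast
        rw [← isospin4_eq]
        ring
    · refine ⟨-10 * n + if ε = true then 1 else -1, ?_, ?_⟩
      · split_ifs <;> omega
      · cases ε <;> simp <;> ring)
  -- A relative vector of ghost number m and degree c has `T`-eigenvalue Bm - c in c₀ + ℕ, so the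
  -- real part of c is at most Bm - Re c₀.
  obtain ⟨q, hq⟩ := exists_int_gt ((B : ℝ) * m - c₀.re)
  refine ⟨q, fun v hv hvq => ?_⟩
  have key : D.relComplex m ⊓ D.filt q ≤ ⊥ := by
    refine le_of_inf_eigenspace_le (degOp_diagonalizable h0 haa) (fun u hu => ⟨degOp_mem h0 haa hu.1,
      ?_⟩) fun c u hu hc => ?_
    · suffices h : D.filt q ≤ (D.filt q).comap D.degOp from h hu.2
      refine iSup₂_le fun d hd w hw => ?_
      rw [Submodule.mem_comap, Module.End.mem_eigenspace_iff.1 hw]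
      exact Submodule.smul_mem _ _ (D.filt_antitone hd (D.mem_filt
        (Module.End.mem_eigenspace_iff.1 hw)))
    · rw [Submodule.mem_bot]
      have hu' := Module.End.mem_eigenspace_iff.1 hc
      obtain ⟨h1, h2, -, h4⟩ := mem_relComplex.1 hu.1
      have hTu : T u = (B * m - c) • u := by
        simp only [T, LinearMap.add_apply, LinearMap.smul_apply, h1, h2, h4, hu']
        module
      by_cases hN : ∃ N : ℕ, B * m - c = c₀ + N
      · refine eq_zero_of_mem_eigenspace (T := D.degOp) (c := c)
          (S := {c | ∃ e : ℤ, q ≤ e ∧ c = e}) ?_ ?_ ?_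
        · rintro ⟨e, he, rfl⟩
          obtain ⟨N, hN⟩ := hN
          have := congrArg Complex.re hN
          simp only [Complex.sub_re, Complex.mul_re, Complex.intCast_re, Complex.intCast_im,
            Complex.add_re, Complex.natCast_re, mul_zero, sub_zero] at this
          have hN0 : (0 : ℝ) ≤ N := Nat.cast_nonneg N
          have he' : (q : ℝ) ≤ e := by exact_mod_cast he
          linarith
        · rw [Module.End.mem_maxGenEigenspace]
          exact ⟨1, by rw [pow_one, LinearMap.sub_apply, hu']; simp⟩
        · suffices h : D.filt q ≤ _ from h hu.2
          exact iSup₂_le fun e he => le_iSup₂ (f := fun c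
            (_ : c ∈ {c : ℂ | ∃ e : ℤ, q ≤ e ∧ c = e}) => Module.End.eigenspace D.degOp c)
            (e : ℂ) ⟨e, he, rfl⟩
      · exact eq_zero_of_notMem htop hN hTu
  exact (Submodule.mem_bot ℂ).1 (key ⟨hv, hvq⟩)

lemma filteredComplex₀ {h : Fock} (H : D.IsCyclic h) (h0 : D.a ≠ 0) (haa : D.a ^ 2 + D.a' ^ 2 = 0) :
    FilteredComplex D.Q₀' D.Q₀' D.K D.relComplex D.filt where
  sq := H.Q₀_sq haa
  sq₀ := H.Q₀_sq haa
  diag := H.lap_diagonalizable haa h0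
  mapQ _ _ := Q₀_mem h0 haa
  mapQ₀ _ _ := Q₀_mem h0 haa
  mapK _ _ := K_mem h0 haa
  filtQ₀ p v hv := by simpa using (filt_grading h0 haa).Q₀ hv
  filtK p v hv := by simpa using (filt_grading h0 haa).K hv
  filt_sub p v hv := by rw [sub_self]; exact Submodule.zero_mem _
  anti := D.filt_antitone
  exhaust := filt_exhaust h0 haa
  bounded := bounded h0 haa

lemma filteredComplex {h : Fock} (H : D.IsCyclic h) (ha : D.a ^ 2 = 2 * D.k + 3)
    (ha' : D.a' ^ 2 = 2 * (-3 - D.k) + 3) (h0 : D.a ≠ 0) (haa : D.a ^ 2 + D.a' ^ 2 = 0) :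
    FilteredComplex D.Q D.Q₀' D.K D.relComplex D.filt :=
  have h0' : D.a' ≠ 0 := fun h => h0 (by simpa [h] using haa)
  { filteredComplex₀ H h0 haa with
    sq := Q_sq ha ha' h0 h0'
    mapQ := fun _ _ => Q_mem ha ha' h0 h0'
    filt_sub := fun _ _ => Q_sub_Q₀ h0 haa }

/-! ### The cohomology -/

/-- A cyclic vector of definite ghost number, isospin, energy and degree. -/
structure IsGround (D : Datum) (h : Fock) (n p : ℤ) : Prop where
  cyclic : D.IsCyclic h
  isospin : D.totalIsospin h = (D.j₁ + D.j₂ + 1 / 2) • h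
  energy : D.L₀ h = D.vacEnergy • h
  ghost : D.ghostNumber h = (n : ℂ) • h
  degree : D.degOp h = (p : ℂ) • h

namespace IsGround

variable {h : Fock} {n p : ℤ}

/-- The energy numerator factors as 2(j₁ - j₂)(j₁ + j₂ + 1/2), so vanishing of the isospin implies
vanishing of the energy. -/
lemma mem (H : D.IsGround h n p) (hj : D.j₁ + D.j₂ + 1 / 2 = 0) : h ∈ D.relComplex n := by
  rw [mem_relComplex]
  refine ⟨by rw [H.isospin, hj, zero_smul], ?_, ?_, H.ghost⟩
  · rw [H.energy, vacEnergy, show D.j₁ * (2 * D.j₁ + 1) - D.j₂ * (2 * D.j₂ + 1)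
      = 2 * (D.j₁ - D.j₂) * (D.j₁ + D.j₂ + 1 / 2) by ring, hj, mul_zero, zero_div, zero_smul]
  · rw [← fst_ghost]
    exact H.cyclic.fst (Pair.ghost three) 0 le_rfl

/-- The harmonic vectors of the relative complex. -/
lemma harmonic (H : D.IsGround h n p) (h0 : D.a ≠ 0) (haa : D.a ^ 2 + D.a' ^ 2 = 0) {m : ℤ}
    {k : Fock} (hk : k ∈ D.relComplex m) (hl : D.Q₀' (D.K k) + D.K (D.Q₀' k) = 0) :
    ∃ c : ℂ, k = c • h ∧ (c ≠ 0 → m = n ∧ D.j₁ + D.j₂ + 1 / 2 = 0) := by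
  obtain ⟨h1, -, h3, h4⟩ := mem_relComplex.1 hk
  obtain ⟨c, rfl⟩ := Submodule.mem_span_singleton.1 (H.cyclic.mem_span_of_lap haa h0
    (v := k) (by simpa [lap] using hl) h3)
  refine ⟨c, rfl, fun hc => ?_⟩
  rw [map_smul, H.ghost, smul_smul, smul_smul] at h4
  rw [map_smul, H.isospin, smul_smul] at h1
  have hh := H.cyclic.ne_zero
  constructor
  · have := smul_left_injective ℂ hh h4
    have : (m : ℂ) = n := mul_right_cancel₀ hc (by rw [← this]; ring)
    exact_mod_cast this
  · exact ((mul_eq_zero.1 ((smul_eq_zero.1 h1).resolve_right hh))).resolve_left hc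

lemma notMem (H : D.IsGround h n p) : h ∉ D.filt (p + 1) := fun hm =>
  H.cyclic.ne_zero (D.eq_zero_of_mem_filt (lt_add_one p) H.degree hm)

/-- Without nonzero harmonic vectors in degree m, the reduction with the zero cocycle as target
exhibits every cocycle as a coboundary. -/
lemma rank_eq_zero (H : D.IsGround h n p) (h0 : D.a ≠ 0) (haa : D.a ^ 2 + D.a' ^ 2 = 0)
    {d : Module.End ℂ Fock} (F : FilteredComplex d D.Q₀' D.K D.relComplex D.filt) {m : ℤ}
    (hm : ¬(m = n ∧ D.j₁ + D.j₂ + 1 / 2 = 0)) : Module.rank ℂ (D.cohomology d m) = 0 := by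
  have : Subsingleton (D.cohomology d m) := by
    rw [Submodule.Quotient.subsingleton_iff, Submodule.submoduleOf_eq_top]
    intro w hw
    obtain ⟨c, u, hu, e⟩ := F.exists_of_cocycle (h' := 0) (Submodule.zero_mem _) (map_zero _)
      (fun q k hk _ hl => by
        obtain ⟨c, rfl, hc⟩ := H.harmonic h0 haa hk hl
        have : c = 0 := by
          by_contra h
          exact hm (hc h)
        exact ⟨0, by rw [this]; simp⟩) hw.1 hw.2
    exact ⟨u, hu, by rw [e]; simp⟩
  exact rank_subsingleton' _ _

/-- The harmonic vectors of degree n are the multiples of h, which agree with the multiples of h' up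
to higher terms, so the class of h' spans. It is not zero because there are no harmonic vectors in
degree n - 1. -/
lemma generates (H : D.IsGround h n p) (h0 : D.a ≠ 0) (haa : D.a ^ 2 + D.a' ^ 2 = 0)
    {d : Module.End ℂ Fock} (F : FilteredComplex d D.Q₀' D.K D.relComplex D.filt)
    {h' : Fock} (hC : h' ∈ D.relComplex n) (hd : d h' = 0) (hl : h' - h ∈ D.filt (p + 1)) :
    D.Generates d n h' := by
  refine ⟨⟨hC, hd⟩, ?_, ?_⟩
  · rw [Ne, Submodule.Quotient.mk_eq_zero, Submodule.submoduleOf, Submodule.mem_comap]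
    rintro ⟨u, hu, e⟩
    refine F.ne_coboundary (fun k hk hl => ?_) (D.mem_filt H.degree) H.notMem hl
      (by simp [H.cyclic.K_apply, H.cyclic.Q₀_apply]) hu e
    obtain ⟨c, rfl, hc⟩ := H.harmonic h0 haa hk hl
    by_cases h : c = 0
    · rw [h, zero_smul]
    · have := (hc h).1
      omega
  · rw [eq_top_iff]
    rintro x -
    obtain ⟨⟨w, hw⟩, rfl⟩ := Submodule.Quotient.mk_surjective _ x
    obtain ⟨c, u, hu, e⟩ := F.exists_of_cocycle hC hd (fun q k hk hq hl' => by
      obtain ⟨c, rfl, hc⟩ := H.harmonic h0 haa hk hl'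
      -- The vector h has degree exactly p. For q = p the multiple of h is replaced by the same
      -- multiple of h'; for q < p it already lies in the next step; for q > p it would contradict
      -- `notMem`.
      by_cases h0 : c = 0
      · exact ⟨0, by rw [h0]; simp⟩
      by_cases hqp : q ≤ p
      · rcases hqp.eq_or_lt with rfl | hqp
        · refine ⟨c, ?_⟩
          rw [← smul_sub, ← neg_sub, smul_neg]
          exact Submodule.neg_mem _ (Submodule.smul_mem _ _ hl)
        · exact ⟨0, by
            rw [zero_smul, sub_zero]
            exact Submodule.smul_mem _ _ (D.filt_antitone (by omega) (D.mem_filt H.degree))⟩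
      · exact absurd (D.filt_antitone (by omega : p + 1 ≤ q)
          (by simpa [smul_smul, h0] using Submodule.smul_mem _ c⁻¹ hq)) H.notMem) hw.1 hw.2
    refine Submodule.mem_span_singleton.2 ⟨c, ?_⟩
    rw [← Submodule.Quotient.mk_smul, eq_comm, Submodule.Quotient.eq, Submodule.submoduleOf,
      Submodule.mem_comap]
    refine ⟨u, hu, ?_⟩
    simp [e]

end IsGround

lemma Generates.rank_eq_one {d : Module.End ℂ Fock} {n : ℤ} {w : Fock} (H : D.Generates d n w) :
    Module.rank ℂ (D.cohomology d n) = 1 := by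
  obtain ⟨hw, h1, h2⟩ := H
  refine _root_.rank_eq_one _ h1 fun x => ?_
  exact Submodule.mem_span_singleton.1 (h2 ▸ Submodule.mem_top)

end Datum

end AffineOsp

end

noncomputable section

namespace AffineOsp

open Gen Pair

namespace Datum

variable {D : Datum}

/-! ### Vacuum vectors -/

lemma fst_fst_apply (r s : Pair) (m n : ℤ) (v : Fock) :
    mode (D.fst r) m (mode (D.fst s) n v) = sgnP r s • mode (D.fst s) n (mode (D.fst r) m v) := by
  simpa using LinearMap.congr_fun (D.SB_fst_fst r s m n) v

lemma snd_snd_apply (r s : Pair) (m n : ℤ) (v : Fock) :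
    mode (D.snd r) m (mode (D.snd s) n v) = sgnP r s • mode (D.snd s) n (mode (D.snd r) m v) := by
  simpa using LinearMap.congr_fun (D.SB_snd_snd (fun _ => 1) r s m n) v

lemma fst_snd_comm (r s : Pair) (m n : ℤ) (v : Fock) :
    mode (D.fst r) m (mode (D.snd s) n v) = sgnP r s • mode (D.snd s) n (mode (D.fst r) m v)
      + (if m + n = 0 ∧ r = s then (1 : ℂ) else 0) • v := by
  have := LinearMap.congr_fun (D.SB_fst_snd (fun _ => 1) r s m n) v
  rw [mode_mulF, one_smul, ← ite_and] at this
  exact this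

lemma snd_fst_comm (r s : Pair) (m n : ℤ) (v : Fock) :
    mode (D.snd r) m (mode (D.fst s) n v) = sgnP r s • mode (D.fst s) n (mode (D.snd r) m v)
      + (if m + n = 0 ∧ r = s then -sgnP r r else 0) • v := by
  have := LinearMap.congr_fun (D.SB_snd_fst r s m n) v
  rw [← ite_and] at this
  exact this

lemma lc_fst_apply (ε : Bool) (s : Pair) (m n : ℤ) (v : Fock) :
    mode (D.lc ε) m (mode (D.fst s) n v) = mode (D.fst s) n (mode (D.lc ε) m v) := by
  simpa using LinearMap.congr_fun (D.SB_lc_fst ε s m n) v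

lemma lc_snd_apply (ε : Bool) (s : Pair) (m n : ℤ) (v : Fock) :
    mode (D.lc ε) m (mode (D.snd s) n v) = mode (D.snd s) n (mode (D.lc ε) m v) := by
  simpa using LinearMap.congr_fun (D.SB_lc_snd ε s m n) v

lemma eq_zero_of_eq_neg_smul {v : Fock} (h : v = (-1 : ℂ) • v) : v = 0 := by
  have : (2 : ℂ) • v = 0 := by
    nth_rewrite 1 [two_smul, h]
    module
  exact (smul_eq_zero.1 this).resolve_left two_ne_zero

lemma fst_sq {s : Pair} (hs : sgnP s s = -1) (n : ℤ) (v : Fock) :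
    mode (D.fst s) n (mode (D.fst s) n v) = 0 :=
  eq_zero_of_eq_neg_smul (by conv_lhs => rw [fst_fst_apply, hs])

lemma snd_sq {s : Pair} (hs : sgnP s s = -1) (n : ℤ) (v : Fock) :
    mode (D.snd s) n (mode (D.snd s) n v) = 0 :=
  eq_zero_of_eq_neg_smul (by conv_lhs => rw [snd_snd_apply, hs])

lemma isVacuum_vac (h0 : D.a ≠ 0) (h0' : D.a' ≠ 0) : D.IsVacuum D.lev vac where
  fst s _ := D.fst_vac s
  snd s _ := D.snd_vac s
  lc ε _ := D.lc_vac ε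
  top := eq_top_of_cre h0 h0'

namespace IsVacuum

variable {l : Pair → ℤ} {h : Fock} {s : Pair}

/-- Filling the lowest creation mode of the second field of a fermionic pair. -/
lemma fill_snd (H : D.IsVacuum l h) (hs : sgnP s s = -1) :
    D.IsVacuum (Function.update l s (l s + 1)) (mode (D.snd s) (-l s) h) where
  fst r n hn := by
    rw [fst_snd_comm]
    by_cases hr : r = s
    · subst hr
      rw [Function.update_self] at hn
      rw [if_neg (by omega), H.fst r n (by omega)]; simp
    · rw [Function.update_of_ne hr] at hn
      rw [if_neg (by tauto), H.fst r n hn]; simp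
  snd r n hn := by
    by_cases hr : r = s
    · subst hr
      rw [Function.update_self] at hn
      by_cases hn' : n = -l r
      · rw [hn', snd_sq hs]
      · rw [snd_snd_apply, H.snd r n (by omega)]; simp
    · rw [Function.update_of_ne hr] at hn
      rw [snd_snd_apply, H.snd r n hn]; simp
  lc ε n hn := by rw [lc_snd_apply, H.lc ε n hn, map_zero]
  top M hM hcre := by
    have hF : ∀ r n, n < l r → ∀ v ∈ M, mode (D.fst r) n v ∈ M := fun r n hn =>
      hcre (.inl ⟨(r, n), by
        change n < Function.update l s (l s + 1) r
        by_cases hr : r = s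
        · subst hr; rw [Function.update_self]; omega
        · rwa [Function.update_of_ne hr]⟩)
    have hS : ∀ r n, n ≤ -l r → ¬(r = s ∧ n = -l s) → ∀ v ∈ M, mode (D.snd r) n v ∈ M :=
      fun r n hn hne => hcre (.inr (.inl ⟨(r, n), by
        change n ≤ -Function.update l s (l s + 1) r
        by_cases hr : r = s
        · subst hr
          have : n ≠ -l r := fun e => hne ⟨rfl, e⟩
          rw [Function.update_self]
          omega
        · rwa [Function.update_of_ne hr]⟩))
    -- The conjugate mode is a creation mode for the new vacuum and empties the filled level again.
    have h1 : h ∈ M := by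
      have := hcre (.inl ⟨(s, l s), by simp⟩) _ hM
      change mode (D.fst s) (l s) _ ∈ M at this
      rw [fst_snd_comm, H.fst s _ le_rfl, if_pos (by simp)] at this
      simpa using this
    -- Over the old vacuum the filled mode is one of the creation modes, and M need not be stable
    -- under it. The subspace of vectors of M that this mode maps into M is stable, since the mode
    -- squares to zero and commutes with the others up to signs.
    have hN := H.top (M ⊓ M.comap (mode (D.snd s) (-l s))) ⟨h1, hM⟩ (by
      rintro (⟨⟨r, n⟩, hn⟩ | ⟨⟨r, n⟩, hn⟩ | ⟨⟨ε, n⟩, hn⟩) v ⟨hv, hv'⟩ <;> simp only at hn <;>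
        rw [SetLike.mem_coe, Submodule.mem_comap] at hv' <;> simp only [cre, Submodule.mem_inf, Submodule.mem_comap]
      · refine ⟨hF r n hn v hv, ?_⟩
        rw [snd_fst_comm]
        refine M.add_mem (M.smul_mem _ (hF r n hn _ hv')) ?_
        rw [if_neg]
        · simp
        · rintro ⟨e, rfl⟩; omega
      · by_cases hr : r = s ∧ n = -l s
        · rw [hr.1, hr.2, snd_sq hs]
          exact ⟨hv', M.zero_mem⟩
        · refine ⟨hS r n hn hr v hv, ?_⟩
          rw [snd_snd_apply]
          exact M.smul_mem _ (hS r n hn hr _ hv')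
      · have hL := hcre (.inr (.inr ⟨(ε, n), hn⟩))
        refine ⟨hL v hv, ?_⟩
        rw [← lc_snd_apply]
        exact hL _ hv')
    exact top_le_iff.1 (hN ▸ inf_le_left)

/-- Filling the lowest creation mode of the first field of a fermionic pair. -/
lemma fill_fst (H : D.IsVacuum l h) (hs : sgnP s s = -1) :
    D.IsVacuum (Function.update l s (l s - 1)) (mode (D.fst s) (l s - 1) h) where
  fst r n hn := by
    by_cases hr : r = s
    · subst hr
      rw [Function.update_self] at hn
      by_cases hn' : n = l r - 1
      · rw [hn', fst_sq hs]
      · rw [fst_fst_apply, H.fst r n (by omega)]; simp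
    · rw [Function.update_of_ne hr] at hn
      rw [fst_fst_apply, H.fst r n hn]; simp
  snd r n hn := by
    rw [snd_fst_comm]
    by_cases hr : r = s
    · subst hr
      rw [Function.update_self] at hn
      rw [if_neg (by omega), H.snd r n (by omega)]; simp
    · rw [Function.update_of_ne hr] at hn
      rw [if_neg (by tauto), H.snd r n hn]; simp
  lc ε n hn := by rw [lc_fst_apply, H.lc ε n hn, map_zero]
  top M hM hcre := by
    have hF : ∀ r n, n < l r → ¬(r = s ∧ n = l s - 1) → ∀ v ∈ M, mode (D.fst r) n v ∈ M :=
      fun r n hn hne => hcre (.inl ⟨(r, n), by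
        change n < Function.update l s (l s - 1) r
        by_cases hr : r = s
        · subst hr
          have : n ≠ l r - 1 := fun e => hne ⟨rfl, e⟩
          rw [Function.update_self]
          omega
        · rwa [Function.update_of_ne hr]⟩)
    have hS : ∀ r n, n ≤ -l r → ∀ v ∈ M, mode (D.snd r) n v ∈ M :=
      fun r n hn => hcre (.inr (.inl ⟨(r, n), by
        change n ≤ -Function.update l s (l s - 1) r
        by_cases hr : r = s
        · subst hr; rw [Function.update_self]; omega
        · rwa [Function.update_of_ne hr]⟩))
    have h1 : h ∈ M := by
      have := hcre (.inr (.inl ⟨(s, -(l s - 1)), by simp⟩)) _ hM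
      change mode (D.snd s) (-(l s - 1)) _ ∈ M at this
      rw [snd_fst_comm, H.snd s _ (by omega), if_pos (by simp), hs] at this
      simpa using this
    have hN := H.top (M ⊓ M.comap (mode (D.fst s) (l s - 1))) ⟨h1, hM⟩ (by
      rintro (⟨⟨r, n⟩, hn⟩ | ⟨⟨r, n⟩, hn⟩ | ⟨⟨ε, n⟩, hn⟩) v ⟨hv, hv'⟩ <;> simp only at hn <;>
        rw [SetLike.mem_coe, Submodule.mem_comap] at hv' <;> simp only [cre, Submodule.mem_inf, Submodule.mem_comap]
      · by_cases hr : r = s ∧ n = l s - 1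
        · rw [hr.1, hr.2, fst_sq hs]
          exact ⟨hv', M.zero_mem⟩
        · refine ⟨hF r n hn hr v hv, ?_⟩
          rw [fst_fst_apply]
          exact M.smul_mem _ (hF r n hn hr _ hv')
      · refine ⟨hS r n hn v hv, ?_⟩
        rw [fst_snd_comm]
        refine M.add_mem (M.smul_mem _ (hS r n hn _ hv')) ?_
        rw [if_neg]
        · simp
        · rintro ⟨e, rfl⟩; omega
      · have hL := hcre (.inr (.inr ⟨(ε, n), hn⟩))
        refine ⟨hL v hv, ?_⟩
        rw [← lc_fst_apply]
        exact hL _ hv')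
    exact top_le_iff.1 (hN ▸ inf_le_left)

end IsVacuum

/-- For this ghost vacuum the pairs + and 1/2 have level 1, so the given polarization is already the
one required by the quartets. -/
lemma isGround_zeroHalf (h0 : D.a ≠ 0) (haa : D.a ^ 2 + D.a' ^ 2 = 0) (hg : D.gh = .zeroHalf) :
    D.IsGround vac 0 0 where
  cyclic := by
    have h0' : D.a' ≠ 0 := fun h => h0 (by simpa [h] using haa)
    have : D.lev' = D.lev := funext fun s => by
      rcases s with _ | _ | _ | _ | x
      all_goals try cases x
      all_goals simp [lev', lev, hg, GhostVac.level]
    rw [IsCyclic, this]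
    exact isVacuum_vac h0 h0'
  isospin := by
    rw [D.totalIsospin_vac h0 fun h => h0 (by simpa [h] using haa), vacIsospin, hg]
  energy := D.L₀_vac h0 haa
  ghost := by rw [ghostNumber_vac]; simp
  degree := by rw [degOp_vac]; simp

lemma LCWeights.fst_eigen {T : Module.End ℂ Fock} {μ : Pair → ℤ → ℂ} {ν : Bool → ℤ → ℂ}
    (H : D.LCWeights T μ ν) (s : Pair) {c d : ℂ} {v : Fock} (hv : T v = c • v)
    (hd : d = c - μ s 0) : T (mode (D.fst s) 0 v) = d • mode (D.fst s) 0 v := by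
  rw [(H.fst s).eigen 0 hv, hd, neg_zero]

lemma LCWeights.snd_eigen {T : Module.End ℂ Fock} {μ : Pair → ℤ → ℂ} {ν : Bool → ℤ → ℂ}
    (H : D.LCWeights T μ ν) (s : Pair) {c d : ℂ} {v : Fock} (hv : T v = c • v)
    (hd : d = c + μ s 0) : T (mode (D.snd s) 0 v) = d • mode (D.snd s) 0 v := by
  rw [(H.snd s).eigen 0 hv, hd, sub_neg_eq_add]

/-- Here the bosonic ghosts c^{1/2} have level 0 and force level 0 on ψ̃⁺, while β̃ has level 1 and
forces level 1 on c⁺. Filling c⁺_0 and ψ̃⁺_0 achieves both, and c⁺_0 accounts for the ghost number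
1. The degree is 3 - 2 = 1. -/
lemma isGround_zero (h0 : D.a ≠ 0) (haa : D.a ^ 2 + D.a' ^ 2 = 0) (hg : D.gh = .zero) :
    D.IsGround (mode (D.fst liouvilleF) 0 (mode (D.snd (ghost plus)) 0 vac)) 1 1 where
  cyclic := by
    have h0' : D.a' ≠ 0 := fun h => h0 (by simpa [h] using haa)
    have h1 := ((isVacuum_vac h0 h0').fill_snd (s := ghost plus)
      (by simp [sgnP, isFer, isOdd])).fill_fst (s := liouvilleF) (by simp [sgnP, isFer])
    have e1 : D.lev (ghost plus) = 0 := by simp [lev, hg, GhostVac.level]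
    rw [Function.update_of_ne (by simp), e1, show D.lev liouvilleF = 1 from rfl] at h1
    convert h1 using 1
    funext s
    rcases s with _ | _ | _ | _ | x
    all_goals try cases x
    all_goals simp [lev', lev, hg, GhostVac.level, Function.update_apply]
  isospin := by
    have h0' : D.a' ≠ 0 := fun h => h0 (by simpa [h] using haa)
    have hw := (D.weights_totalIsospin h0 h0').toLC rfl
    refine hw.fst_eigen _ (hw.snd_eigen _ (D.totalIsospin_vac h0 h0') rfl) ?_
    rw [vacIsospin, hg]
    simp only [Datum.isospin]
    ring
  energy := by
    have hw := (D.weights_L₀ h0 haa).toLC (by simp)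
    exact hw.fst_eigen _ (hw.snd_eigen _ (D.L₀_vac h0 haa) rfl) (by simp)
  ghost := by
    have hw := D.weights_ghostNumber.toLC rfl
    exact hw.fst_eigen _ (hw.snd_eigen _ (c := 0) (by simp [ghostNumber_vac]) rfl)
      (by simp [ghostDegree])
  degree := by
    have hw := degWeights h0 haa
    refine hw.fst_eigen _ (hw.snd_eigen _ (c := 0) (by simp [degOp_vac]) rfl) ?_
    simp only [Datum.degree]
    norm_num

end Datum

end AffineOsp

end

noncomputable section

namespace AffineOsp

open Gen Pair

/-! ### The lowest energy level -/

section Lowest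

variable {V G : Type*} [AddCommGroup V] [Module ℂ V] [AddCommGroup G] {E : G → Submodule ℂ V}
  {s g : G} {A B β γ p ψ φ : fields V} {w : V}

lemma Shifts.lowest_eq_zero (hA : Shifts E s 0 A) (hE : ∀ n : ℤ, 0 < n → E (g + n • s) = ⊥)
    (hw : w ∈ E g) {n : ℤ} (hn : 0 < n) : mode A n w = 0 := by
  have := hA n g w hw
  rw [add_zero, hE n hn] at this
  exact (Submodule.mem_bot ℂ).1 this

lemma Shifts.lowest_mem (hA : Shifts E s 0 A) (hw : w ∈ E g) : mode A 0 w ∈ E g := by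
  simpa using hA.apply_zero hw

lemma nopE_zero_lowest {e : ℂ} (hE : ∀ n : ℤ, 0 < n → E (g + n • s) = ⊥) (hA : Shifts E s 0 A)
    (hB : Shifts E s 0 B) (hw : w ∈ E g) :
    mode (nopE 0 e A B) 0 w = mode A 0 (mode B 0 w) := by
  rw [nopE_apply_eq_single 0 (fun m hm h0 => by rw [hB.lowest_eq_zero hE hw (by omega), map_zero])
    (fun m hm h0 => by rw [hA.lowest_eq_zero hE hw (by omega), map_zero])]
  simp [nopTerm]

/-- If A has weight 1, its zero mode counts as an annihilation mode and stands on the right, in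
contrast to weight 0. -/
lemma nopE_one_lowest {e : ℂ} (hE : ∀ n : ℤ, 0 < n → E (g + n • s) = ⊥) (hA : Shifts E s 0 A)
    (hB : Shifts E s 0 B) (hw : w ∈ E g) :
    mode (nopE 1 e A B) 0 w = e • mode B 0 (mode A 0 w) := by
  rw [nopE_apply_eq_single 0 (fun m hm h0 => by rw [hB.lowest_eq_zero hE hw (by omega), map_zero])
    (fun m hm h0 => by rw [hA.lowest_eq_zero hE hw (by omega), map_zero])]
  simp [nopTerm]

/-- The zero modes of the Wakimoto currents on the lowest energy level. -/
def wakimotoZero (a : ℂ) (β γ p ψ φ : Module.End ℂ V) (w : V) : Gen → V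
  | plus => -β w
  | half => p w - ψ (β w)
  | three => -γ (β w) + (a / 2) • φ w - (1 / 2 : ℂ) • ψ (p w)
  | mhalf => γ (p w - ψ (β w)) + a • ψ (φ w)
  | minus => γ (γ (β w)) - a • γ (φ w) + γ (ψ (p w))

/-- The zero modes of the dual Wakimoto currents on the lowest energy level. -/
def dualWakimotoZero (a : ℂ) (β γ p ψ φ : Module.End ℂ V) (w : V) : Gen → V
  | plus => -γ (γ (β w)) + a • γ (φ w) - γ (ψ (p w))
  | half => -γ (p w - ψ (β w)) - a • ψ (φ w)
  | three => γ (β w) - (a / 2) • φ w + (1 / 2 : ℂ) • ψ (p w)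
  | mhalf => p w - ψ (β w)
  | minus => β w

lemma mode_deriv_zero (A : fields V) : mode (deriv 0 A) 0 = 0 := by simp [mode_deriv]

lemma wakimotoCurrent_lowest (hE : ∀ n : ℤ, 0 < n → E (g + n • s) = ⊥) (hβ : Shifts E s 0 β)
    (hγ : Shifts E s 0 γ) (hp : Shifts E s 0 p) (hψ : Shifts E s 0 ψ) (hφ : Shifts E s 0 φ)
    (k a : ℂ) (hw : w ∈ E g) (x : Gen) : mode (wakimotoCurrent k a β γ p ψ φ x) 0 w
      = wakimotoZero a (mode β 0) (mode γ 0) (mode p 0) (mode ψ 0) (mode φ 0) w x := by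
  cases x <;> simp only [wakimotoCurrent, wakimotoZero, nop_eq, nopF_eq, mode_add, mode_sub,
    mode_neg, mode_smul, mode_deriv_zero, LinearMap.add_apply, LinearMap.sub_apply,
    LinearMap.neg_apply, LinearMap.smul_apply, LinearMap.zero_apply, smul_zero, add_zero, sub_zero]
  · rw [nopE_one_lowest hE hβ hψ hw]; simp
  · rw [nopE_one_lowest hE hβ hγ hw, nopE_zero_lowest hE hψ hp hw]; simp
  · rw [nopE_zero_lowest hE hγ (hp.sub (hβ.nop_zero hψ)) hw, nopE_zero_lowest hE hψ hφ hw,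
      mode_sub, LinearMap.sub_apply, nopE_one_lowest hE hβ hψ hw]; simp
  · rw [nopE_one_lowest hE hβ (hγ.nop_zero hγ) hw,
      nopE_zero_lowest hE hγ hγ (hβ.lowest_mem hw), nopE_zero_lowest hE hγ hφ hw,
      nopE_zero_lowest hE hγ (hψ.nop_zero hp) hw, nopE_zero_lowest hE hψ hp hw,
      nopE_zero_lowest hE hψ (hψ.deriv 0) hw, mode_deriv_zero]
    simp

lemma dualWakimotoCurrent_lowest (hE : ∀ n : ℤ, 0 < n → E (g + n • s) = ⊥) (hβ : Shifts E s 0 β)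
    (hγ : Shifts E s 0 γ) (hp : Shifts E s 0 p) (hψ : Shifts E s 0 ψ) (hφ : Shifts E s 0 φ)
    (k a : ℂ) (hw : w ∈ E g) (x : Gen) : mode (dualWakimotoCurrent k a β γ p ψ φ x) 0 w
      = dualWakimotoZero a (mode β 0) (mode γ 0) (mode p 0) (mode ψ 0) (mode φ 0) w x := by
  cases x <;> simp only [dualWakimotoCurrent, dualWakimotoZero, nop_eq, nopF_eq, mode_add,
    mode_sub, mode_neg, mode_smul, mode_deriv_zero, LinearMap.add_apply, LinearMap.sub_apply,
    LinearMap.neg_apply, LinearMap.smul_apply, LinearMap.zero_apply, smul_zero, add_zero, sub_zero]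
  · rw [nopE_one_lowest hE hβ (hγ.nop_zero hγ) hw,
      nopE_zero_lowest hE hγ hγ (hβ.lowest_mem hw), nopE_zero_lowest hE hγ hφ hw,
      nopE_zero_lowest hE hγ (hψ.nop_zero hp) hw, nopE_zero_lowest hE hψ hp hw,
      nopE_zero_lowest hE hψ (hψ.deriv 0) hw, mode_deriv_zero]
    simp
  · rw [nopE_zero_lowest hE hγ (hp.sub (hβ.nop_zero hψ)) hw, nopE_zero_lowest hE hψ hφ hw,
      mode_sub, LinearMap.sub_apply, nopE_one_lowest hE hβ hψ hw]; simp
  · rw [nopE_one_lowest hE hβ hγ hw, nopE_zero_lowest hE hψ hp hw]; simp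
  · rw [nopE_one_lowest hE hβ hψ hw]; simp

end Lowest

namespace Datum

variable {D : Datum}

/-- No creation mode of the given vacuum lowers the energy, so positive modes of the composite
fields annihilate the lowest level. -/
lemma energy_lowest (h0 : D.a ≠ 0) (haa : D.a ^ 2 + D.a' ^ 2 = 0) {n : ℤ} (hn : 0 < n) :
    Module.End.eigenspace D.L₀ (D.vacEnergy + n • (-1 : ℂ)) = ⊥ := by
  have h0' : D.a' ≠ 0 := fun h => h0 (by simpa [h] using haa)
  have htop := ((D.weights_L₀ h0 haa).toLC (by simp)).iSup_eigenspace h0 h0'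
    (S := {c | ∃ N : ℕ, c = D.vacEnergy + N}) (D.L₀_vac h0 haa) ⟨0, by simp⟩ (by
      suffices hw : ∀ i : Creator D.lev, ∃ k : ℤ, 0 ≤ k ∧ creWeight _ _ i = (k : ℂ) by
        rintro i _ ⟨N, rfl⟩
        obtain ⟨k, hk, e⟩ := hw i
        refine ⟨N + k.toNat, ?_⟩
        rw [e]
        have : ((k.toNat : ℤ) : ℂ) = k := by rw [Int.toNat_of_nonneg hk]
        push_cast at this ⊢
        rw [this, add_assoc]
      rintro (⟨⟨s, n⟩, hp⟩ | ⟨⟨s, n⟩, hp⟩ | ⟨⟨ε, n⟩, hp⟩) <;> simp only at hp <;>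
        simp only [creWeight]
      · exact ⟨-n, by rcases D.lev_eq s with h | h <;> omega, by push_cast; ring⟩
      · exact ⟨-n, by rcases D.lev_eq s with h | h <;> omega, by push_cast; ring⟩
      · exact ⟨-n, by omega, by push_cast; ring⟩)
  refine (Submodule.eq_bot_iff _).2 fun v hv => eq_zero_of_notMem htop ?_
    (Module.End.mem_eigenspace_iff.1 hv)
  rintro ⟨N, hN⟩
  have : ((N + n : ℤ) : ℂ) = 0 := by
    rw [zsmul_eq_mul] at hN
    push_cast
    linear_combination -hN
  have := Int.cast_eq_zero.1 this
  omega

variable (D) in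
/-- The zero modes of the matter and Liouville currents on the lowest energy level. -/
def currentZero (w : Fock) (x : Gen) : Fock :=
  wakimotoZero D.a (mode (D.fst matterB) 0) (mode (D.snd matterB) 0) (mode (D.fst matterF) 0)
    (mode (D.snd matterF) 0) (D.mom .matter • 1) w x
  + dualWakimotoZero D.a' (mode (D.fst liouvilleB) 0) (mode (D.snd liouvilleB) 0)
    (mode (D.fst liouvilleF) 0) (mode (D.snd liouvilleF) 0) (D.mom .liouville • 1) w x

/-- The BRST operator on the lowest energy level. -/
lemma Q_lowest (h0 : D.a ≠ 0) (haa : D.a ^ 2 + D.a' ^ 2 = 0) {w : Fock}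
    (hw : D.L₀ w = D.vacEnergy • w) : D.Q w = ∑ x, ∑ y, hInv x y • mode (D.snd (ghost y)) 0
      (D.currentZero w x + (1 / 2 : ℂ) • ∑ y', ∑ z, f x y' z •
        mode (D.snd (ghost z)) 0 (mode (D.fst (ghost y')) 0 w)) := by
  have hE := fun n (hn : 0 < n) => energy_lowest h0 haa hn
  have hG := D.L₀_grading h0 haa
  have hw' := Module.End.mem_eigenspace_iff.2 hw
  have hf := fun r => hG.fst r
  have hs := fun r => hG.snd r
  simp only [smul_zero, neg_zero] at hf hs
  have hgh : ∀ y, Shifts (Module.End.eigenspace D.L₀) (-1) 0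
      (D.J y + D.JT y + (1 / 2 : ℂ) • D.Jgh y) := fun y =>
    ((hG.J y).add (hG.JT y)).add ((hG.Jgh y).smul _)
  rw [Q, brstCurrent, mode_sum, LinearMap.sum_apply]
  refine Finset.sum_congr rfl fun x _ => ?_
  rw [mode_sum, LinearMap.sum_apply]
  refine Finset.sum_congr rfl fun y _ => ?_
  rw [mode_smul, LinearMap.smul_apply, nop_eq, nopE_zero_lowest hE (hG.c y) (hgh x) hw']
  simp only [mode_add, mode_smul, LinearMap.add_apply, LinearMap.smul_apply, snd_ghost, fst_ghost]
  have h1 : mode (D.J x) 0 w + mode (D.JT x) 0 w = D.currentZero w x := by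
    rw [currentZero, ← bos_zero, ← bos_zero]
    exact congrArg₂ (· + ·)
      (wakimotoCurrent_lowest hE (hf matterB) (hs matterB) (hf matterF) (hs matterF)
        (hG.bos .matter) _ _ hw' x)
      (dualWakimotoCurrent_lowest hE (hf liouvilleB) (hs liouvilleB) (hf liouvilleF)
        (hs liouvilleF) (hG.bos .liouville) _ _ hw' x)
  have h2 : mode (D.Jgh x) 0 w
      = ∑ y', ∑ z, f x y' z • mode (D.c z) 0 (mode (D.b y') 0 w) := by
    rw [Jgh, mode_sum, LinearMap.sum_apply]
    refine Finset.sum_congr rfl fun y' _ => ?_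
    rw [mode_sum, LinearMap.sum_apply]
    refine Finset.sum_congr rfl fun z _ => ?_
    have hb := hG.b y'
    rw [neg_zero] at hb
    rw [mode_smul, LinearMap.smul_apply, ghostProd_eq, nopE_zero_lowest hE (hG.c z) hb hw']
  rw [h1, h2]

end Datum

end AffineOsp

end

noncomputable section

namespace AffineOsp

open Gen Pair

namespace Datum

variable (D : Datum)

/-! ### Zero modes -/

/-- The zero mode of a pair of fields that does not annihilate the vacuum. -/
def up (s : Pair) : Module.End ℂ Fock :=
  if D.lev s = 0 then mode (D.snd s) 0 else mode (D.fst s) 0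

/-- The zero mode of a pair of fields that annihilates the vacuum. -/
def down (s : Pair) : Module.End ℂ Fock :=
  if D.lev s = 0 then mode (D.fst s) 0 else mode (D.snd s) 0

lemma down_vac (s : Pair) : D.down s vac = 0 := by
  unfold down
  split_ifs with h
  · exact D.fst_vac s h.le
  · exact D.snd_vac s (by rcases D.lev_eq s with h' | h' <;> omega)

lemma down_up (s r : Pair) (v : Fock) : D.down s (D.up r v) = sgnP s r • D.up r (D.down s v)
    + (if s = r then if D.lev s = 0 then 1 else -sgnP s s else 0 : ℂ) • v := by
  unfold down up
  by_cases hs : D.lev s = 0 <;> by_cases hr : D.lev r = 0 <;> simp only [hs, hr, if_true, if_false]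
  · rw [fst_snd_comm]; simp
  · rw [fst_fst_apply, if_neg (by rintro rfl; exact hr hs)]; simp
  · rw [snd_snd_apply, if_neg (by rintro rfl; exact hs hr)]; simp
  · rw [snd_fst_comm]; simp

lemma up_up (s r : Pair) (v : Fock) : D.up s (D.up r v) = sgnP s r • D.up r (D.up s v) := by
  unfold up
  by_cases hs : D.lev s = 0 <;> by_cases hr : D.lev r = 0 <;> simp only [hs, hr, if_true, if_false]
  · rw [snd_snd_apply]
  · rw [snd_fst_comm, if_neg (by rintro ⟨-, rfl⟩; exact hr hs)]; simp
  · rw [fst_snd_comm, if_neg (by rintro ⟨-, rfl⟩; exact hs hr)]; simp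
  · rw [fst_fst_apply]

lemma up_sq {s : Pair} (hs : sgnP s s = -1) (v : Fock) : D.up s (D.up s v) = 0 :=
  eq_zero_of_eq_neg_smul (by conv_lhs => rw [up_up, hs])

lemma fst_zero (s : Pair) : mode (D.fst s) 0 = if D.lev s = 0 then D.down s else D.up s := by
  unfold down up; split_ifs <;> rfl

lemma snd_zero (s : Pair) : mode (D.snd s) 0 = if D.lev s = 0 then D.up s else D.down s := by
  unfold down up; split_ifs <;> rfl

variable {D}

/-- On the lowest level only zero modes act. Every contribution to Q on the vacuum is a multiple of
c³_0 applied to the vacuum, with the vanishing total isospin as the resulting coefficient. -/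
lemma Q_vac_zeroHalf (h0 : D.a ≠ 0) (haa : D.a ^ 2 + D.a' ^ 2 = 0) (hg : D.gh = .zeroHalf)
    (hj : D.j₁ + D.j₂ + 1 / 2 = 0) : D.Q vac = 0 := by
  have h0' : D.a' ≠ 0 := fun h => h0 (by simpa [h] using haa)
  have hj' : D.j₂ = -(1 / 2) - D.j₁ := by linear_combination hj
  rw [Q_lowest h0 haa (D.L₀_vac h0 haa)]
  simp [sum_gen, hInv, f, currentZero, wakimotoZero, dualWakimotoZero, fst_zero, snd_zero, lev, hg,
    GhostVac.level, down_vac, down_up, sgnP, isFer, isOdd, mom, hj']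
  match_scalars
  field_simp
  ring

/-- The image of the leading term under Q is not zero; the two corrections, of degrees 5 and 2,
cancel it. The check is linear algebra in the finitely many zero modes. -/
lemma Q_zero (h0 : D.a ≠ 0) (haa : D.a ^ 2 + D.a' ^ 2 = 0) (hg : D.gh = .zero)
    (hj : D.j₁ + D.j₂ + 1 / 2 = 0) :
    D.Q (D.up liouvilleF (D.up (ghost plus) vac)
      + (2 * D.j₁) • D.up matterF (D.up (ghost plus) vac)
      + (1 / 2 : ℂ) • D.up (ghost half) vac) = 0 := by
  have h0' : D.a' ≠ 0 := fun h => h0 (by simpa [h] using haa)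
  have hj' : D.j₂ = -(1 / 2) - D.j₁ := by linear_combination hj
  have hl : ∀ s v, D.L₀ v = D.vacEnergy • v → D.L₀ (D.up s v) = D.vacEnergy • D.up s v := by
    intro s v hv
    have hw := (D.weights_L₀ h0 haa).toLC (by simp)
    unfold up
    split_ifs
    · exact hw.snd_eigen s hv (by simp)
    · exact hw.fst_eigen s hv (by simp)
  rw [Q_lowest h0 haa (by
    simp only [map_add, map_smul, hl _ _ (hl _ _ (D.L₀_vac h0 haa)), hl _ _ (D.L₀_vac h0 haa)]
    module)]
  simp [sum_gen, hInv, f, currentZero, wakimotoZero, dualWakimotoZero, fst_zero, snd_zero, lev, hg,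
    GhostVac.level, down_vac, down_up, sgnP, isFer, isOdd]
  -- All annihilation modes are gone by now. The exchanges listed bring the products of creation
  -- modes to a common order, in which coefficients can be compared.
  simp [up_sq, sgnP, isFer, isOdd, D.up_up liouvilleF matterF, D.up_up (ghost plus) matterB,
    D.up_up (ghost plus) matterF, D.up_up (ghost plus) liouvilleB, D.up_up (ghost plus) liouvilleF,
    D.up_up (ghost half) matterB, D.up_up (ghost half) matterF, D.up_up (ghost half) liouvilleB,
    D.up_up (ghost half) liouvilleF, D.up_up (ghost half) (ghost plus),
    D.up_up (ghost three) matterF, D.up_up (ghost three) liouvilleF,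
    D.up_up (ghost three) (ghost plus), D.up_up (ghost three) (ghost half),
    D.up_up (ghost mhalf) (ghost plus)]
  simp only [mom, hj']
  match_scalars <;> field_simp <;> ring

end Datum

end AffineOsp

end

/-! ### The generating cocycle over the first ghost vacuum, and the theorem -/

noncomputable section

namespace AffineOsp

open Gen Pair

namespace Datum

variable {D : Datum}

/-- The BRST cocycle for the ghost vacuum `zero`. -/
lemma generates_zero (ha : D.a ^ 2 = 2 * D.k + 3) (ha' : D.a' ^ 2 = 2 * (-3 - D.k) + 3)
    (h0 : D.a ≠ 0) (haa : D.a ^ 2 + D.a' ^ 2 = 0) (hg : D.gh = .zero)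
    (hj : D.j₁ + D.j₂ + 1 / 2 = 0) :
    D.Generates D.Q 1 (mode D.psiPT 0 (mode (D.c plus) 0 vac)
      + (2 * D.j₁) • mode D.psi 0 (mode (D.c plus) 0 vac)
      + (1 / 2 : ℂ) • mode (D.c half) 0 vac) := by
  have h0' : D.a' ≠ 0 := fun h => h0 (by simpa [h] using haa)
  have G := isGround_zero h0 haa hg
  have hL : ∀ s, D.L₀ (mode (D.snd s) 0 vac) = D.vacEnergy • mode (D.snd s) 0 vac := fun s =>
    ((D.weights_L₀ h0 haa).toLC (by simp)).snd_eigen s (D.L₀_vac h0 haa) (by simp)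
  have hI : ∀ s, D.totalIsospin (mode (D.snd s) 0 vac)
      = (D.vacIsospin + isospin s) • mode (D.snd s) 0 vac := fun s =>
    ((D.weights_totalIsospin h0 h0').toLC rfl).snd_eigen s (D.totalIsospin_vac h0 h0') rfl
  have hN : ∀ s, D.ghostNumber (mode (D.snd s) 0 vac)
      = (ghostDegree s : ℂ) • mode (D.snd s) 0 vac := fun s =>
    (D.weights_ghostNumber.toLC rfl).snd_eigen s (c := 0) (by simp [ghostNumber_vac]) (by simp)
  have hP : ∀ s, D.degOp (mode (D.snd s) 0 vac) = (degree s : ℂ) • mode (D.snd s) 0 vac := fun s =>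
    (degWeights h0 haa).snd_eigen s (c := 0) (by simp [degOp_vac]) (by simp)
  have hE : D.vacEnergy = 0 := by
    rw [vacEnergy, show D.j₁ * (2 * D.j₁ + 1) - D.j₂ * (2 * D.j₂ + 1)
      = 2 * (D.j₁ - D.j₂) * (D.j₁ + D.j₂ + 1 / 2) by ring, hj, mul_zero, zero_div]
  have hI0 : D.vacIsospin = -(1 / 2) := by rw [vacIsospin, hg]; linear_combination hj
  have hb : ∀ s, s ≠ ghost three → mode (D.b three) 0 (mode (D.snd s) 0 vac) = 0 := fun s hs => by
    rw [← fst_ghost, fst_snd_comm, if_neg (by simpa using hs.symm),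
      D.fst_vac (ghost three) (by simp [lev, hg, GhostVac.level])]
    simp
  have m1 : mode (D.snd (ghost half)) 0 vac ∈ D.relComplex 1 := by
    rw [mem_relComplex]
    refine ⟨?_, by rw [hL, hE, zero_smul], hb _ (by simp), by rw [hN]; simp [ghostDegree]⟩
    rw [hI, hI0, isospin]; simp
  have m2 : mode (D.snd matterF) 0 (mode (D.snd (ghost plus)) 0 vac) ∈ D.relComplex 1 := by
    rw [mem_relComplex]
    refine ⟨?_, ?_, ?_, ?_⟩
    · rw [((D.weights_totalIsospin h0 h0').toLC rfl).snd_eigen _ (hI _) rfl, hI0]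
      simp only [isospin]
      rw [show (-(1 / 2) + 1 + -(1 / 2) : ℂ) = 0 by norm_num, zero_smul]
    · rw [((D.weights_L₀ h0 haa).toLC (by simp)).snd_eigen _ (hL _) rfl, hE]; simp
    · rw [← fst_ghost, fst_snd_comm, fst_ghost, hb _ (by simp)]; simp
    · rw [(D.weights_ghostNumber.toLC rfl).snd_eigen _ (hN _) rfl]; simp [ghostDegree]
  -- The leading term has degree 1. The corrections have degrees 2 and 2 + 3 = 5, hence lie in the
  -- next filtration step.
  have f1 : mode (D.snd (ghost half)) 0 vac ∈ D.filt 2 := D.mem_filt (hP _)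
  have f2 : mode (D.snd matterF) 0 (mode (D.snd (ghost plus)) 0 vac) ∈ D.filt 2 :=
    D.filt_antitone (by norm_num) (D.mem_filt (d := 5)
      ((degWeights h0 haa).snd_eigen _ (hP _) (by norm_num [degree])))
  rw [← snd_ghost, ← snd_ghost]
  change D.Generates D.Q 1 (mode (D.fst liouvilleF) 0 (mode (D.snd (ghost plus)) 0 vac)
    + (2 * D.j₁) • mode (D.snd matterF) 0 (mode (D.snd (ghost plus)) 0 vac)
    + (1 / 2 : ℂ) • mode (D.snd (ghost half)) 0 vac)
  refine G.generates h0 haa (filteredComplex G.cyclic ha ha' h0 haa)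
    (Submodule.add_mem _ (Submodule.add_mem _ (G.mem hj) (Submodule.smul_mem _ _ m2))
      (Submodule.smul_mem _ _ m1)) ?_ ?_
  · have := Q_zero h0 haa hg hj
    simpa [up, lev, hg, GhostVac.level] using this
  · rw [add_assoc, add_sub_cancel_left]
    exact Submodule.add_mem _ (Submodule.smul_mem _ _ f2) (Submodule.smul_mem _ _ f1)

end Datum

end AffineOsp

end

theorem theorem5 (D : AffineOsp.Datum) (hk : D.k ≠ -(3 / 2)) (ha : D.a ^ 2 = 2 * D.k + 3)
    (ha' : D.a' ^ 2 = 2 * (-3 - D.k) + 3) :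
    -- the ghost vacuum `|gh⟩_0`
    (D.gh = .zero →
      (∀ n : ℤ,
        (n = 0 ∧ D.j₁ + D.j₂ + 1 / 2 = 0 → Module.rank ℂ (D.cohomology D.Q (n + 1)) = 1) ∧
        (¬(n = 0 ∧ D.j₁ + D.j₂ + 1 / 2 = 0) → Module.rank ℂ (D.cohomology D.Q (n + 1)) = 0)) ∧
      (D.j₁ + D.j₂ + 1 / 2 = 0 →
        D.Generates D.Q₀ 1
          (AffineOsp.mode D.psiPT 0 (AffineOsp.mode (D.c .plus) 0 AffineOsp.vac)) ∧
        D.Generates D.Q 1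
          (AffineOsp.mode D.psiPT 0 (AffineOsp.mode (D.c .plus) 0 AffineOsp.vac)
            + (2 * D.j₁) • AffineOsp.mode D.psi 0 (AffineOsp.mode (D.c .plus) 0 AffineOsp.vac)
            + (1 / 2 : ℂ) • AffineOsp.mode (D.c .half) 0 AffineOsp.vac))) ∧
    -- the ghost vacuum `|gh⟩_{0,1/2}`
    (D.gh = .zeroHalf →
      (∀ n : ℤ,
        (n = 0 ∧ D.j₁ + D.j₂ + 1 / 2 = 0 → Module.rank ℂ (D.cohomology D.Q n) = 1) ∧
        (¬(n = 0 ∧ D.j₁ + D.j₂ + 1 / 2 = 0) → Module.rank ℂ (D.cohomology D.Q n) = 0)) ∧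
      (D.j₁ + D.j₂ + 1 / 2 = 0 →
        D.Generates D.Q₀ 0 AffineOsp.vac ∧ D.Generates D.Q 0 AffineOsp.vac)) := by
  have h0 : D.a ≠ 0 := by
    intro h
    rw [h] at ha
    exact hk (by linear_combination (-(1 / 2) : ℂ) * ha)
  -- The levels k and -3-k make the squares of the two background charges opposite, which is the
  -- null condition for the light-cone bosons.
  have haa : D.a ^ 2 + D.a' ^ 2 = 0 := by rw [ha, ha']; ring
  constructor
  · intro hg
    have G := AffineOsp.Datum.isGround_zero h0 haa hg
    refine ⟨fun n => ⟨?_, fun h => ?_⟩, fun hj => ⟨?_, ?_⟩⟩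
    · rintro ⟨rfl, hj⟩
      exact (AffineOsp.Datum.generates_zero ha ha' h0 haa hg hj).rank_eq_one
    · exact G.rank_eq_zero h0 haa
        (AffineOsp.Datum.filteredComplex G.cyclic ha ha' h0 haa) (by simpa using h)
    · rw [AffineOsp.Datum.Q₀_eq, ← AffineOsp.Datum.snd_ghost]
      change D.Generates D.Q₀' 1 (AffineOsp.mode (D.fst .liouvilleF) 0 _)
      exact G.generates h0 haa (AffineOsp.Datum.filteredComplex₀ G.cyclic h0 haa) (G.mem hj)
        G.cyclic.Q₀_apply (by rw [sub_self]; exact Submodule.zero_mem _)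
    · exact AffineOsp.Datum.generates_zero ha ha' h0 haa hg hj
  · intro hg
    have G := AffineOsp.Datum.isGround_zeroHalf h0 haa hg
    have hQ : D.j₁ + D.j₂ + 1 / 2 = 0 → D.Generates D.Q 0 AffineOsp.vac := fun hj =>
      G.generates h0 haa (AffineOsp.Datum.filteredComplex G.cyclic ha ha' h0 haa) (G.mem hj)
        (AffineOsp.Datum.Q_vac_zeroHalf h0 haa hg hj) (by rw [sub_self]; exact Submodule.zero_mem _)
    refine ⟨fun n => ⟨?_, fun h => ?_⟩, fun hj => ⟨?_, hQ hj⟩⟩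
    · rintro ⟨rfl, hj⟩
      exact (hQ hj).rank_eq_one
    · exact G.rank_eq_zero h0 haa (AffineOsp.Datum.filteredComplex G.cyclic ha ha' h0 haa) h
    · rw [AffineOsp.Datum.Q₀_eq]
      exact G.generates h0 haa (AffineOsp.Datum.filteredComplex₀ G.cyclic h0 haa) (G.mem hj)
        G.cyclic.Q₀_apply (by rw [sub_self]; exact Submodule.zero_mem _)
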